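/- **Setting.** Let $M\subset\mathbb R^n$ be open and let $\Sigma\subset M$ be a smooth normal crossings variety: a finite union of smooth hypersurfaces, closed in $M$, such that near each point $p\in M$ there are smooth coordinates centred at $p$ in which $\Sigma=\{x_1\cdots x_c=0\}$ for some $0\le c\le n$; call $p$ a smooth point of $\Sigma$ if $c=1$. Let $X$ be a piecewise smooth vector field on $(M,\Sigma)$, i.e. for each connected component $W$ of $M\setminus\Sigma$ the restriction $X|_W$ extends to a smooth vector field on $M$. Let $m\in C^\infty(\mathbb R^n)$ be a mollifier ($m\ge 0$, $\int m=1$, compact support), $m_\varepsilon(x)=\varepsilon^{-n}m(x/\varepsilon)$, and $$(m_\varepsilon * X)(x)=\int_{\mathbb R^n} m_\varepsilon(y)\,X(x-y)\,dy\qquad(\varepsilon>0),$$ where $X$ is extended by $0$ outside $M$. A *sewing-type periodic orbit* of $X$ is a simple closed curve $\gamma\subset M$ which either is a periodic orbit of $X|_{M\setminus\Sigma}$, or is a cyclic concatenation $\gamma=\gamma_1\cup\dots\cup\gamma_k$, $k\ge1$, of arcs $\gamma_i$ from $p_i$ to $p_{i+1}$ (indices modulo $k$), where each $p_i$ is a smooth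 point of $\Sigma$, the interior of $\gamma_i$ is an orbit of $X|_{W_i}$ for a connected component $W_i$ of $M\setminus\Sigma$, traversed in the direction of the flow, and the smooth extension $X_i$ of $X|_{W_i}$ is transverse to $\Sigma$ (in particular non-zero) at $p_i$ and at $p_{i+1}$. In the second case let $P=P_k\circ\dots\circ P_1:(\Sigma,p_1)\to(\Sigma,p_1)$, where $P_i:(\Sigma,p_i)\to(\Sigma,p_{i+1})$ is the germ of the transition map obtained by following the flow of $X_i$ through $W_i$. In the first case, and for a periodic orbit of a smooth vector field in general, let $P$ be the Poincaré first return map on a local transverse section at a point of the orbit. The orbit is *$(s:u)$-hyperbolic*, for integers $s,u\ge0$ with $s+u=n-1$, if the differential of $P$ at its base point has $s$ eigenvalues with $|z|<1$ and $u$ eigenvalues with $|z|>1$, counted with multiplicity. **Corollary (hyperbolic sewing orbits persist).** Suppose that $\gamma$ is an $(s:u)$-hyperbolic periodic orbit of sewing type of $X$. Then there are an open neighborhood $U\subset M$ of $\gamma$ and a neighborhood $E$ of $0$ in $\mathbb R_{\ge0}$ such that, for each $\varepsilon\in E\setminus\{0\}$, the vector field $m_\varepsilon*X$ is smooth on $U$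 and has a unique $(s:u)$-hyperbolic periodic orbit $\gamma_\varepsilon$ contained in $U$. Moreover $\gamma_\varepsilon\to\gamma$ in the Hausdorff distance as $\varepsilon\to0$. -/

import Mathlib

open Set Filter Topology MeasureTheory
open scoped ContDiff NNReal

noncomputable section

/-- Euclidean space `ℝⁿ`. -/
abbrev Space (n : ℕ) : Type := EuclideanSpace ℝ (Fin n)

/-- At `p` there is a smooth chart `φ`, defined near `p` and centred at `p`, in which the set `S`
is `{x₁ ⋯ x_c = 0}`: the set `S` has `c` local components at `p`. -/
def HasLocalComponents {n : ℕ} (S : Set (Space n)) (p : Space n) (c : ℕ) : Prop :=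
  c ≤ n ∧ ∃ φ : OpenPartialHomeomorph (Space n) (Space n),
    p ∈ φ.source ∧ φ p = 0 ∧
    ContDiffOn ℝ ∞ φ φ.source ∧ ContDiffOn ℝ ∞ φ.symm φ.target ∧
    ∀ x ∈ φ.source, (x ∈ S ↔ ∃ i : Fin n, (i : ℕ) < c ∧ φ x i = 0)

/-- A smooth submanifold of codimension one of `M`, closed in `M`. -/
def IsClosedHypersurface {n : ℕ} (M S : Set (Space n)) : Prop :=
  S ⊆ M ∧ closure S ∩ M ⊆ S ∧ ∀ p ∈ S, HasLocalComponents S p 1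

/-- A smooth normal crossings variety in the open set `M`: a finite union of closed
smooth hypersurfaces which, near each point of `M`, is a union of coordinate hyperplanes
in suitable coordinates. -/
def IsNormalCrossings {n : ℕ} (M S : Set (Space n)) : Prop :=
  (∃ (N : ℕ) (H : Fin N → Set (Space n)),
    (∀ i, IsClosedHypersurface M (H i)) ∧ S = ⋃ i, H i) ∧
  ∀ p ∈ M, ∃ c : ℕ, HasLocalComponents S p c

/-- `W` is a connected component of `A`. -/
def IsComponentOf {n : ℕ} (A W : Set (Space n)) : Prop :=
  ∃ x ∈ A, W = connectedComponentIn A x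

/-- Piecewise smooth vector fields on `(M, S)`: the restriction of `X` to each connected component
of `M \ S` extends to a smooth vector field on `M`. The values of `X` on `S` and outside `M` are
irrelevant. -/
def IsPiecewiseSmooth {n : ℕ} (M S : Set (Space n)) (X : Space n → Space n) : Prop :=
  ∀ W, IsComponentOf (M \ S) W → ∃ Y : Space n → Space n, ContDiffOn ℝ ∞ Y M ∧ EqOn Y X W

/-- Mollifiers: smooth, non-negative, compactly supported functions of integral one. -/
structure IsMollifier {n : ℕ} (m : Space n → ℝ) : Prop where
  smooth : ContDiff ℝ ∞ m
  nonneg : ∀ x, 0 ≤ m x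
  integral_eq_one : ∫ x, m x = 1
  hasCompactSupport : HasCompactSupport m

/-- The rescaled mollifier `m_ε(x) = ε⁻ⁿ m(x / ε)`. -/
def rescale {n : ℕ} (m : Space n → ℝ) (ε : ℝ) (x : Space n) : ℝ :=
  (ε ^ n)⁻¹ * m (ε⁻¹ • x)

/-- The regularization by convolution
`(m_ε ∗ X)(x) = ∫ m_ε(y) X(x - y) dy` of a vector field `X` on `M`. The field is extended by zero
outside `M`; at points whose distance to the complement of `M` is large with respect to `ε` this
extension plays no role. -/
def regularize {n : ℕ} (M : Set (Space n)) (m : Space n → ℝ) (X : Space n → Space n) (ε : ℝ) :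
    Space n → Space n :=
  convolution (rescale m ε) (M.indicator X) (ContinuousLinearMap.lsmul ℝ ℝ) volume

/-- The tangent space at `p` of a smooth hypersurface `S`, as a subspace of `ℝⁿ`. -/
def tangentSubspace {n : ℕ} (S : Set (Space n)) (p : Space n) : Submodule ℝ (Space n) :=
  Submodule.span ℝ (tangentConeAt ℝ S p)

/-- The endomorphism `f` has `s` eigenvalues in `{|z| < 1}` and `u` eigenvalues in `{|z| > 1}`,
counted with (algebraic) multiplicity, and no other eigenvalue. -/
def HasHyperbolicType {V : Type*} [AddCommGroup V] [Module ℝ V] [FiniteDimensional ℝ V]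
    (f : V →ₗ[ℝ] V) (s u : ℕ) : Prop :=
  s + u = Module.finrank ℝ V ∧
  ((f.charpoly.map (algebraMap ℝ ℂ)).roots.filter fun z => ‖z‖ < 1).card = s ∧
  ((f.charpoly.map (algebraMap ℝ ℂ)).roots.filter fun z => 1 < ‖z‖).card = u

/-- `p` is an `(s:u)`-hyperbolic fixed point of (the germ at `p` of) the map `P : (S, p) → (S, p)`
of the hypersurface `S`: the differential `dP(p) : T_p S → T_p S` has hyperbolic type `(s:u)`. -/
def IsHyperbolicFixedPoint {n : ℕ} (S : Set (Space n)) (P : Space n → Space n) (p : Space n)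
    (s u : ℕ) : Prop :=
  P p = p ∧ ∃ (L : Space n →L[ℝ] Space n)
    (hL : ∀ v ∈ tangentSubspace S p, (L : Space n →ₗ[ℝ] Space n) v ∈ tangentSubspace S p),
    HasFDerivWithinAt P L S p ∧
    HasHyperbolicType ((L : Space n →ₗ[ℝ] Space n).restrict hL) s u

/-- `c`, restricted to `[0, τ]`, is an integral curve of `X`. -/
def IsIntegralArc {n : ℕ} (X : Space n → Space n) (c : ℝ → Space n) (τ : ℝ) : Prop :=
  0 < τ ∧ ∀ t ∈ Icc 0 τ, HasDerivWithinAt c (X (c t)) (Icc 0 τ) t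

/-- `c` is a (non-constant) periodic solution of `X` with minimal period `T`. -/
structure IsPeriodicSolution {n : ℕ} (X : Space n → Space n) (c : ℝ → Space n) (T : ℝ) :
    Prop where
  period_pos : 0 < T
  hasDerivAt : ∀ t, HasDerivAt c (X (c t)) t
  periodic : Function.Periodic c T
  injOn : InjOn c (Ico 0 T)

/-- `P` represents the germ at `p` of the Poincaré first return map on the section `S` of the
periodic orbit of `X` through `p` with minimal period `T`: each `x ∈ S` close to `p` flows under `X`
to `P x ∈ S` in a time `τ x` which is close to `T`. -/
def IsReturnMap {n : ℕ} (X : Space n → Space n) (S : Set (Space n)) (p : Space n) (T : ℝ)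
    (P : Space n → Space n) : Prop :=
  ∃ τ : Space n → ℝ, τ p = T ∧ ContinuousWithinAt τ S p ∧
    ∀ᶠ x in 𝓝[S] p, P x ∈ S ∧
      ∃ c : ℝ → Space n, IsIntegralArc X c (τ x) ∧ c 0 = x ∧ c (τ x) = P x

/-- `γ` is an `(s:u)`-hyperbolic periodic orbit of the vector field `X` (which is to be smooth
near `γ`): the Poincaré map of `γ` on a transverse section has hyperbolic type `(s:u)`. -/
def IsHyperbolicPeriodicOrbit {n : ℕ} (X : Space n → Space n) (s u : ℕ) (γ : Set (Space n)) :
    Prop :=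
  ∃ (c : ℝ → Space n) (T : ℝ), IsPeriodicSolution X c T ∧ γ = range c ∧
    ∃ S : Set (Space n), c 0 ∈ S ∧ HasLocalComponents S (c 0) 1 ∧
      X (c 0) ∉ tangentSubspace S (c 0) ∧
      ∃ P : Space n → Space n, IsReturnMap X S (c 0) T P ∧
        IsHyperbolicFixedPoint S P (c 0) s u

/-- A decomposition `γ = γ₀ ∪ ⋯ ∪ γ_k` of a simple closed curve into orbit segments of `X`
which exhibits `γ` as a sewing-type periodic orbit meeting `S` in the `k + 1` points `p i`.
Indices are taken modulo `k + 1`. -/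
structure SewingDecomposition {n : ℕ} (M S : Set (Space n)) (X : Space n → Space n)
    (γ : Set (Space n)) where
  k : ℕ
  /-- the component of `M \ S` that contains the interior of `γ i` -/
  W : Fin (k + 1) → Set (Space n)
  isComponent : ∀ i, IsComponentOf (M \ S) (W i)
  /-- the smooth extension to `M` of the restriction of `X` to `W i`; on the closure of `W i` it is
  determined by `X` -/
  Y : Fin (k + 1) → Space n → Space n
  smooth : ∀ i, ContDiffOn ℝ ∞ (Y i) M
  eqOn : ∀ i, EqOn (Y i) X (W i)
  /-- the initial point of `γ i`, which is the end point of the preceding segment -/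
  p : Fin (k + 1) → Space n
  /-- the travel time along `γ i` -/
  T : Fin (k + 1) → ℝ
  /-- the parametrization by time of `γ i` -/
  c : Fin (k + 1) → ℝ → Space n
  isIntegralArc : ∀ i, IsIntegralArc (Y i) (c i) (T i)
  mem_component : ∀ i, ∀ t ∈ Ioo 0 (T i), c i t ∈ W i
  start : ∀ i, c i 0 = p i
  finish : ∀ i, c i (T i) = p (i + 1)
  mem_locus : ∀ i, p i ∈ M ∩ S
  /-- the `p i` are smooth points of `S` -/
  regular : ∀ i, HasLocalComponents S (p i) 1
  transverse_start : ∀ i, Y i (p i) ∉ tangentSubspace S (p i)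
  transverse_finish : ∀ i, Y i (p (i + 1)) ∉ tangentSubspace S (p (i + 1))
  /-- the closed curve is simple -/
  simple : ∀ i j, ∀ a ∈ Ico 0 (T i), ∀ b ∈ Ico 0 (T j), c i a = c j b → i = j ∧ a = b
  eq_union : γ = ⋃ i, c i '' Icc 0 (T i)

/-- `Q` represents the germ at `p i` of the transition map `(S, p i) → (S, p (i + 1))`: each `x ∈ S`
close to `p i` flows through `W i` to `Q x ∈ S`. -/
def SewingDecomposition.IsTransitionMap {n : ℕ} {M S : Set (Space n)} {X : Space n → Space n}
    {γ : Set (Space n)} (D : SewingDecomposition M S X γ) (i : Fin (D.k + 1))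
    (Q : Space n → Space n) : Prop :=
  Q (D.p i) = D.p (i + 1) ∧
  ∀ᶠ x in 𝓝[S] (D.p i), Q x ∈ S ∧
    ∃ (τ : ℝ) (c : ℝ → Space n), IsIntegralArc (D.Y i) c τ ∧
      (∀ t ∈ Ioo 0 τ, c t ∈ D.W i) ∧ c 0 = x ∧ c τ = Q x

/-- The composition `Q k ∘ ⋯ ∘ Q 1 ∘ Q 0`. -/
def composeAll {n k : ℕ} (Q : Fin (k + 1) → Space n → Space n) : Space n → Space n :=
  (List.ofFn Q).foldl (fun g f => f ∘ g) id

/-- `γ` is an `(s:u)`-hyperbolic periodic orbit of sewing type of the piecewise smooth vector field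
`X` on `(M, S)`. Either `γ` is a periodic orbit in `M \ S`, or it crosses `S` and the sewing Poincaré
map, the composition of the transition maps, is considered. -/
def IsHyperbolicSewingOrbit {n : ℕ} (M S : Set (Space n)) (X : Space n → Space n) (s u : ℕ)
    (γ : Set (Space n)) : Prop :=
  (γ ⊆ M \ S ∧ IsHyperbolicPeriodicOrbit X s u γ) ∨
  ∃ (D : SewingDecomposition M S X γ) (Q : Fin (D.k + 1) → Space n → Space n),
    (∀ i, D.IsTransitionMap i (Q i)) ∧
    IsHyperbolicFixedPoint S (composeAll Q) (D.p 0) s u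

end

/-! ### Global solutions of Lipschitz and of linear differential equations. -/

section GlobalFlow

variable {F : Type*} [NormedAddCommGroup F] [NormedSpace ℝ F]

/-! Write `X_ε` for the regularized field. Replacing `X` by a bounded, compactly supported
truncation which agrees with it near `γ` off the locus does not change `X_ε` near `γ` for small `ε`,
and it gives `X_ε` a global flow `Φ_ε` with spatial derivative `W_ε`.

The analytic core is that `Φ_ε` converges along `γ` together with first derivatives, although `DX_ε`
blows up like `1/ε` at the locus. Away from the locus `X_ε` tends to the smooth pieces of `X` with
first derivatives, and so do the flows (`c1Reach_of_fieldTendsto`). Near a crossing point let the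
locus be `{h = 0}` with `ν = dh`, and let `a`, `b` be the incoming and outgoing values of the field,
both with `ν > 0`. Averaging preserves a positive lower bound for `ν`, so orbits of `X_ε` traverse
the layer `|h| ≲ ε` in time `O(ε)`, the integral of `‖DX_ε‖` stays bounded, and so does `W_ε`. In
directions tangent to the locus `DX_ε` is only `o(1/ε)`, because a step function is constant in
these directions (`IsMollifier.eventually_fderiv_moll_tangent_le`); hence `W_ε` is nearly the
identity on `ker ν`. Moreover `W_ε` transports the field along its own orbits, so it nearly maps `a`
to `b`. These two facts determine the limit, the saltation matrix (`CrossingField.window`,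
`CrossingField.c1Reach`).

Composing along `γ`, the derivative of the time `T` map tends to a monodromy `L` which fixes the
flow direction `v`. Modulo the flow direction `L` induces the differential of the sewing Poincaré
map, so the characteristic polynomial of `L` is that of `dP` times `X - 1`
(`hasHyperbolicType_iff_hasFlowType`, `hasFlowType_monodromy`). This allows all limits to be taken
in the full space, without sections.

What remains is a perturbation statement about a `LimitCycle`. Existence: the equations `Φ_ε(T + t,
x) = x`, `ℓ (x - c 0) = 0` have an invertible linearization and are uniformly close to it on a fixed
ball, so they are solvable near `(0, c 0)`. Uniqueness: the successive hits of the hyperplane by any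
closed orbit near `γ` form a bounded approximate orbit of a linear map without eigenvalues on the
unit circle; the distances to the periodic point are then summable
(`Module.End.exists_sum_norm_le`), so the hits converge to it, and it lies on the orbit since the
orbit is closed. Type: the numbers of eigenvalues inside and outside the unit circle are lower
semicontinuous, and the persistent eigenvalue `1` leaves no room for them to grow. -/

theorem hasDerivAt_comp_neg_time {α α' : ℝ → F} (h : ∀ t, HasDerivAt α (α' t) t) (s : ℝ) :
    HasDerivAt (fun s => α (-s)) (-α' (-s)) s := by
  simpa [Function.comp_def] using (h (-s)).scomp s (hasDerivAt_neg s)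

/-- Uniqueness makes the local solutions agree wherever two of them are defined, so the value at `t`
can be taken from the one with index `⌈|t|⌉₊`. -/
theorem exists_global_solution_of_forall_nat {f : ℝ → F → F} {K : ℝ≥0}
    (hL : ∀ t, LipschitzWith K (f t)) (x₀ : F)
    (h : ∀ N : ℕ, ∃ α : ℝ → F, α 0 = x₀ ∧
      ∀ t ∈ Ioo (-(N + 1 : ℝ)) (N + 1), HasDerivAt α (f t (α t)) t) :
    ∃ α : ℝ → F, α 0 = x₀ ∧ ∀ t, HasDerivAt α (f t (α t)) t := by
  choose α h0 hα using h
  have key : ∀ N M : ℕ, N ≤ M → ∀ t ∈ Ioo (-(N + 1 : ℝ)) (N + 1), α N t = α M t := by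
    intro N M hNM
    have hNM' : (N : ℝ) ≤ M := by exact_mod_cast hNM
    have hN : (0 : ℝ) ≤ N := Nat.cast_nonneg N
    refine ODE_solution_unique_of_mem_Ioo (v := f) (s := fun _ => univ) (t₀ := 0) (K := K)
      (fun t _ => (hL t).lipschitzOnWith) ⟨by linarith, by linarith⟩
      (fun t ht => ⟨hα N t ht, trivial⟩)
      (fun t ht => ⟨hα M t ⟨by linarith [ht.1], by linarith [ht.2]⟩, trivial⟩) ?_
    rw [h0, h0]
  have key' : ∀ N M : ℕ, ∀ t ∈ Ioo (-(N + 1 : ℝ)) (N + 1), t ∈ Ioo (-(M + 1 : ℝ)) (M + 1) →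
      α N t = α M t := by
    intro N M t h1 h2
    rcases le_total N M with h | h
    · exact key N M h t h1
    · exact (key M N h t h2).symm
  have hmem : ∀ t : ℝ, t ∈ Ioo (-((⌈|t|⌉₊ : ℕ) + 1 : ℝ)) ((⌈|t|⌉₊ : ℕ) + 1) := by
    intro t
    have := Nat.le_ceil |t|
    rw [mem_Ioo, ← abs_lt]
    linarith
  refine ⟨fun t => α ⌈|t|⌉₊ t, h0 _, fun t => ?_⟩
  have ht := hmem t
  have hev : (fun t => α ⌈|t|⌉₊ t) =ᶠ[𝓝 t] α ⌈|t|⌉₊ := by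
    filter_upwards [Ioo_mem_nhds ht.1 ht.2] with s hs
    exact key' _ _ s (hmem s) hs
  exact (hα _ t ht).congr_of_eventuallyEq hev

/-- At speed at most `C` the solution stays within `C * (N + 1)` of `x₀` up to time `N + 1`; since
all bounds are global, Picard–Lindelöf applies on that ball for every `N`. -/
theorem exists_global_solution_of_bounded [CompleteSpace F] {f : ℝ → F → F} {K C : ℝ≥0}
    (hL : ∀ t, LipschitzWith K (f t)) (hb : ∀ t x, ‖f t x‖ ≤ C)
    (hc : ∀ x, Continuous fun t => f t x) (x₀ : F) :
    ∃ α : ℝ → F, α 0 = x₀ ∧ ∀ t, HasDerivAt α (f t (α t)) t := by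
  refine exists_global_solution_of_forall_nat hL x₀ fun N => ?_
  have hN : (0 : ℝ) ≤ N := Nat.cast_nonneg N
  have hPL : IsPicardLindelof f (tmin := -(N + 1 : ℝ)) (tmax := N + 1)
      ⟨0, by constructor <;> linarith⟩ x₀ (C * (N + 1)) 0 C K :=
    { lipschitzOnWith := fun t _ => (hL t).lipschitzOnWith
      continuousOn := fun x _ => (hc x).continuousOn
      norm_le := fun t _ x _ => hb t x
      mul_max_le := by simp }
  obtain ⟨α, h0, hα⟩ := hPL.exists_eq_forall_mem_Icc_hasDerivWithinAt₀
  exact ⟨α, h0, fun t ht => (hα t (Ioo_subset_Icc_self ht)).hasDerivAt (Icc_mem_nhds ht.1 ht.2)⟩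

/-- A linear, time-dependent differential equation has global solutions. -/
theorem exists_global_solution_linear [FiniteDimensional ℝ F] {A : ℝ → F →L[ℝ] F}
    (hA : Continuous A) {K : ℝ≥0} (hK : ∀ t, ‖A t‖ ≤ K) (x₀ : F) :
    ∃ α : ℝ → F, α 0 = x₀ ∧ ∀ t, HasDerivAt α (A t (α t)) t := by
  have : CompleteSpace F := FiniteDimensional.complete ℝ F
  refine exists_global_solution_of_forall_nat (K := K)
    (fun t => (A t).lipschitz.weaken (show ‖A t‖₊ ≤ K from hK t)) x₀ fun N => ?_
  have hN : (0 : ℝ) ≤ N := Nat.cast_nonneg N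
  -- Grönwall bounds solutions on this time interval by less than `R`. The field is cut off beyond
  -- radius `R` to become bounded; the cut-off still obeys the same linear growth, so the solution
  -- never notices it.
  set R : ℝ := ‖x₀‖ * Real.exp (K * (N + 1)) + 1 with hR
  have hRpos : 0 < R := by positivity
  let χ : ContDiffBump (0 : F) := ⟨R, R + 1, hRpos, by linarith⟩
  have hcl : ContDiff ℝ ∞ (fun w : F => χ w • w) := χ.contDiff.smul contDiff_id
  have hcs : HasCompactSupport (fun w : F => χ w • w) := χ.hasCompactSupport.smul_right
  obtain ⟨C₁, hC₁⟩ := hcl.lipschitzWith_of_hasCompactSupport hcs (by simp)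
  obtain ⟨C₂, hC₂⟩ := hcs.exists_bound_of_continuous hcl.continuous
  obtain ⟨α, h0, hα⟩ := exists_global_solution_of_bounded (f := fun t w => A t (χ w • w))
    (K := K * C₁) (C := K * C₂.toNNReal) (fun t => by
      have := ((A t).lipschitz.weaken (show ‖A t‖₊ ≤ K from hK t)).comp hC₁
      exact this) (fun t w => by
      refine ((A t).le_opNorm _).trans ?_
      push_cast
      exact mul_le_mul (hK t) ((hC₂ w).trans (Real.le_coe_toNNReal _)) (norm_nonneg _) K.2)
    (fun w => hA.clm_apply continuous_const) x₀
  have hχ : ∀ w, ‖χ w • w‖ ≤ ‖w‖ := fun w => by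
    rw [norm_smul, Real.norm_of_nonneg χ.nonneg]
    exact mul_le_of_le_one_left (norm_nonneg _) χ.le_one
  have hbd : ∀ t, ‖A t (χ (α t) • α t)‖ ≤ K * ‖α t‖ + 0 := fun t => by
    rw [add_zero]
    exact ((A t).le_opNorm _).trans (mul_le_mul (hK t) (hχ _) (norm_nonneg _) K.2)
  have hpos : ∀ t, 0 ≤ t → ‖α t‖ ≤ ‖x₀‖ * Real.exp (K * t) := fun t ht => by
    have := norm_le_gronwallBound_of_norm_deriv_right_le (f := α) (a := 0) (b := t)
      (f' := fun s => A s (χ (α s) • α s)) (δ := ‖x₀‖) (K := K) (ε := 0)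
      (HasDerivAt.continuousOn fun s _ => hα s)
      (fun s _ => (hα s).hasDerivWithinAt) (by rw [h0]) (fun s _ => hbd s) t ⟨ht, le_rfl⟩
    rwa [gronwallBound_ε0, sub_zero] at this
  have hneg : ∀ t, 0 ≤ t → ‖α (-t)‖ ≤ ‖x₀‖ * Real.exp (K * t) := fun t ht => by
    have hd : ∀ s : ℝ, HasDerivAt (fun s => α (-s)) (-(A (-s) (χ (α (-s)) • α (-s)))) s := fun s =>
      hasDerivAt_comp_neg_time hα s
    have := norm_le_gronwallBound_of_norm_deriv_right_le (f := fun s => α (-s)) (a := 0) (b := t)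
      (f' := fun s => -(A (-s) (χ (α (-s)) • α (-s)))) (δ := ‖x₀‖) (K := K) (ε := 0)
      (HasDerivAt.continuousOn fun s _ => hd s)
      (fun s _ => (hd s).hasDerivWithinAt) (by simp [h0])
      (fun s _ => by rw [norm_neg]; exact hbd _) t ⟨ht, le_rfl⟩
    rwa [gronwallBound_ε0, sub_zero] at this
  refine ⟨α, h0, fun t ht => ?_⟩
  have hle : ‖α t‖ ≤ R := by
    have h1 : ‖α t‖ ≤ ‖x₀‖ * Real.exp (K * |t|) := by
      rcases le_total 0 t with h | h
      · rw [abs_of_nonneg h]; exact hpos t h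
      · rw [abs_of_nonpos h]
        simpa using hneg (-t) (by linarith)
    have h2 : Real.exp (K * |t|) ≤ Real.exp (K * (N + 1)) := by
      apply Real.exp_le_exp.2
      exact mul_le_mul_of_nonneg_left (abs_lt.2 ht).le K.2
    have := mul_le_mul_of_nonneg_left h2 (norm_nonneg x₀)
    linarith
  have h1 : χ (α t) = 1 := χ.one_of_mem_closedBall (by simpa using hle)
  simpa [h1] using hα t

end GlobalFlow

/-! ### Flows of compactly supported fields and the variational equation. -/

section Flow

variable {E : Type*} [NormedAddCommGroup E] [NormedSpace ℝ E]

/-- `Φ` is the global flow of the smooth Lipschitz vector field `X`, and `W t x` is the derivative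
of the time `t` map at `x`. -/
structure IsFlow (X : E → E) (Φ : ℝ → E → E) (W : ℝ → E → E →L[ℝ] E) : Prop where
  smooth : ContDiff ℝ ∞ X
  lipschitz : ∃ K, LipschitzWith K X
  zero : ∀ x, Φ 0 x = x
  hasDerivAt : ∀ t x, HasDerivAt (fun s => Φ s x) (X (Φ t x)) t
  linear_zero : ∀ x, W 0 x = 1
  hasDerivAt_linear : ∀ t x, HasDerivAt (fun s => W s x) ((fderiv ℝ X (Φ t x)) ∘L (W t x)) t
  hasFDerivAt : ∀ t x, HasFDerivAt (Φ t) (W t x) x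

/-- The defect on the left solves the linearized equation along `c` up to the Taylor remainder `C *
‖d - c‖ ^ 2`, and `‖d - c‖` grows at most by the factor `exp (K t)`; Grönwall makes the defect
quadratic in the initial distance. -/
theorem flow_linearization_estimate {X : E → E} {A : E → E →L[ℝ] E} {K : ℝ≥0} {C : ℝ}
    (hK1 : 1 ≤ K) (hC : 0 ≤ C)
    (hX : LipschitzWith K X) (hA : ∀ x, ‖A x‖ ≤ K)
    (hXA : ∀ x y, ‖X y - X x - A x (y - x)‖ ≤ C * ‖y - x‖ ^ 2) {c d : ℝ → E} {W : ℝ → E →L[ℝ] E}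
    (hc : ∀ t, HasDerivAt c (X (c t)) t) (hd : ∀ t, HasDerivAt d (X (d t)) t) (hW0 : W 0 = 1)
    (hW : ∀ t, HasDerivAt W ((A (c t)) ∘L (W t)) t) {t : ℝ} (ht : 0 ≤ t) :
    ‖d t - c t - W t (d 0 - c 0)‖ ≤
      C * Real.exp (K * t) ^ 2 / K * (Real.exp (K * t) - 1) * ‖d 0 - c 0‖ ^ 2 := by
  have hK0 : (0 : ℝ) < K := lt_of_lt_of_le one_pos (by exact_mod_cast hK1)
  have h1 : ∀ s ∈ Icc 0 t, ‖d s - c s‖ ≤ ‖d 0 - c 0‖ * Real.exp (K * t) := fun s hs => by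
    have := dist_le_of_trajectories_ODE (v := fun _ => X) (K := K) (f := d) (g := c) (a := 0) (b := t)
      (δ := dist (d 0) (c 0)) (fun _ => hX) (HasDerivAt.continuousOn fun s _ => hd s)
      (fun s _ => (hd s).hasDerivWithinAt) (HasDerivAt.continuousOn fun s _ => hc s)
      (fun s _ => (hc s).hasDerivWithinAt) le_rfl s hs
    rw [dist_eq_norm, dist_eq_norm, sub_zero] at this
    refine this.trans (mul_le_mul_of_nonneg_left (Real.exp_le_exp.2 ?_) (norm_nonneg _))
    exact mul_le_mul_of_nonneg_left hs.2 hK0.le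
  set v := d 0 - c 0 with hv
  have hdw : ∀ s, HasDerivAt (fun s => d s - c s - W s v)
      (X (d s) - X (c s) - A (c s) (W s v)) s := fun s =>
    ((hd s).sub (hc s)).sub ((hW s).clm_apply (hasDerivAt_const s v) |>.congr_deriv (by simp))
  have := norm_le_gronwallBound_of_norm_deriv_right_le (f := fun s => d s - c s - W s v)
    (f' := fun s => X (d s) - X (c s) - A (c s) (W s v)) (a := 0) (b := t) (δ := 0) (K := K)
    (ε := C * (‖v‖ * Real.exp (K * t)) ^ 2) (HasDerivAt.continuousOn fun s _ => hdw s)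
    (fun s _ => (hdw s).hasDerivWithinAt) (by simp [hW0, hv]) (fun s hs => ?_) t ⟨ht, le_rfl⟩
  · rw [gronwallBound_of_K_ne_0 hK0.ne'] at this
    simp only [sub_zero, zero_mul, zero_add] at this
    refine this.trans (le_of_eq ?_)
    ring
  · have e : X (d s) - X (c s) - A (c s) (W s v) =
        (X (d s) - X (c s) - A (c s) (d s - c s)) + A (c s) (d s - c s - W s v) := by
      simp only [map_sub]; abel
    rw [e]
    refine (norm_add_le _ _).trans ?_
    rw [add_comm]
    refine add_le_add (((A (c s)).le_opNorm _).trans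
      (mul_le_mul_of_nonneg_right (hA _) (norm_nonneg _))) ((hXA _ _).trans ?_)
    have := h1 s ⟨hs.1, hs.2.le⟩
    gcongr

/-- Differentiability of the time maps in the initial point is the quadratic bound of
`flow_linearization_estimate`; negative times are positive times of `-X`. -/
theorem exists_isFlow [FiniteDimensional ℝ E] {X : E → E} (hX : ContDiff ℝ ∞ X)
    (hc : HasCompactSupport X) :
    ∃ (Φ : ℝ → E → E) (W : ℝ → E → E →L[ℝ] E), IsFlow X Φ W := by
  have : CompleteSpace E := FiniteDimensional.complete ℝ E
  obtain ⟨K₀, hK₀⟩ := hX.lipschitzWith_of_hasCompactSupport hc (by simp)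
  set K : ℝ≥0 := K₀ + 1
  have hK : LipschitzWith K X := hK₀.weaken (by simp [K])
  obtain ⟨C₀, hC₀⟩ := hc.exists_bound_of_continuous hX.continuous
  have hDX : ContDiff ℝ ∞ (fderiv ℝ X) := hX.fderiv_right (by simp)
  obtain ⟨C, hC⟩ := hDX.lipschitzWith_of_hasCompactSupport (hc.fderiv ℝ) (by simp)
  have hA : ∀ x, ‖fderiv ℝ X x‖ ≤ K := fun x => norm_fderiv_le_of_lipschitz ℝ hK
  have hquad : ∀ x y, ‖X y - X x - fderiv ℝ X x (y - x)‖ ≤ C * ‖y - x‖ ^ 2 := fun x y => by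
    have := (convex_segment x y).norm_image_sub_le_of_norm_hasFDerivWithin_le' (f := X)
      (f' := fderiv ℝ X) (φ := fderiv ℝ X x) (C := C * ‖y - x‖)
      (fun z _ => (hX.differentiable (by simp) z).hasFDerivAt.hasFDerivWithinAt) (fun z hz => ?_)
      (left_mem_segment ℝ x y) (right_mem_segment ℝ x y)
    · refine this.trans (le_of_eq (by ring))
    · rw [← dist_eq_norm]
      refine (hC.dist_le_mul z x).trans (mul_le_mul_of_nonneg_left ?_ C.2)
      rw [dist_eq_norm]
      exact norm_sub_le_of_mem_segment hz
  have hΦ : ∀ x, ∃ α : ℝ → E, α 0 = x ∧ ∀ t, HasDerivAt α (X (α t)) t := fun x =>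
    exists_global_solution_of_bounded (f := fun _ => X) (K := K) (C := C₀.toNNReal)
      (fun _ => hK) (fun _ x => (hC₀ x).trans (Real.le_coe_toNNReal _)) (fun _ => continuous_const) x
  choose φ h0 hφ using hΦ
  have hW : ∀ x, ∃ w : ℝ → E →L[ℝ] E, w 0 = 1 ∧
      ∀ t, HasDerivAt w ((fderiv ℝ X (φ x t)) ∘L (w t)) t := fun x => by
    have hcont : Continuous (φ x) := continuous_iff_continuousAt.2 fun t => (hφ x t).continuousAt
    obtain ⟨w, hw0, hw⟩ := exists_global_solution_linear
      (A := fun t => ContinuousLinearMap.compL ℝ E E E (fderiv ℝ X (φ x t))) (K := K)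
      ((ContinuousLinearMap.compL ℝ E E E).continuous.comp (hDX.continuous.comp hcont))
      (fun t => by
        refine (ContinuousLinearMap.le_opNorm _ _).trans ?_
        have := ContinuousLinearMap.norm_compL_le ℝ E E E
        calc _ ≤ 1 * ‖fderiv ℝ X (φ x t)‖ := mul_le_mul_of_nonneg_right this (norm_nonneg _)
          _ ≤ K := by rw [one_mul]; exact hA _) 1
    exact ⟨w, hw0, hw⟩
  choose w hw0 hw using hW
  refine ⟨fun t x => φ x t, fun t x => w x t, hX, ⟨K, hK⟩, h0, fun t x => hφ x t, hw0,
    fun t x => hw x t, fun t x => ?_⟩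
  have hbound : ∀ t : ℝ, ∃ B : ℝ, ∀ y, ‖φ y t - φ x t - w x t (y - x)‖ ≤ B * ‖y - x‖ ^ 2 := by
    intro t
    rcases le_total 0 t with ht | ht
    · refine ⟨C * Real.exp (K * t) ^ 2 / K * (Real.exp (K * t) - 1), fun y => ?_⟩
      have := flow_linearization_estimate (by simp [K]) C.2 hK hA hquad (hφ x) (hφ y) (hw0 x) (hw x) ht
      rwa [h0, h0] at this
    · refine ⟨C * Real.exp (K * -t) ^ 2 / K * (Real.exp (K * -t) - 1), fun y => ?_⟩
      have hrev : ∀ y (s : ℝ), HasDerivAt (fun s => φ y (-s)) (-X (φ y (-s))) s := fun y s =>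
        hasDerivAt_comp_neg_time (hφ y) s
      have hwrev : ∀ s : ℝ, HasDerivAt (fun s => w x (-s))
          ((-fderiv ℝ X (φ x (-s))) ∘L (w x (-s))) s := fun s => by
        simpa using hasDerivAt_comp_neg_time (hw x) s
      have := flow_linearization_estimate (X := fun x => -X x) (A := fun x => -fderiv ℝ X x) (K := K)
        (C := C) (t := -t) (by simp [K]) C.2 hK.neg (fun x => by rw [norm_neg]; exact hA x)
        (fun x y => by
          have := hquad x y
          rw [← norm_neg] at this
          refine le_trans (le_of_eq ?_) this
          congr 1; simp; abel) (hrev x) (hrev y) (by simp [hw0]) hwrev (by linarith)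
      simpa only [neg_neg, neg_zero, h0] using this
  obtain ⟨B, hB⟩ := hbound t
  refine .of_isLittleO ?_
  have : (fun y => φ y t - φ x t - w x t (y - x)) =O[𝓝 x] fun y => ‖y - x‖ ^ 2 :=
    Asymptotics.IsBigO.of_bound B (Eventually.of_forall fun y => by
      rw [norm_pow, norm_norm]; exact hB y)
  refine this.trans_isLittleO ?_
  have h2 : Tendsto (fun y => y - x) (𝓝 x) (𝓝 0) := by
    have : Continuous fun y => y - x := by fun_prop
    simpa using this.tendsto x
  refine Asymptotics.IsLittleO.comp_tendsto (g := fun y : E => y)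
    (f := fun y : E => ‖y‖ ^ 2) ?_ h2
  exact Asymptotics.isLittleO_norm_pow_id one_lt_two

namespace IsFlow

variable {X : E → E} {Φ : ℝ → E → E} {W : ℝ → E → E →L[ℝ] E}

theorem continuous_time (h : IsFlow X Φ W) (x : E) : Continuous fun t => Φ t x :=
  continuous_iff_continuousAt.2 fun t => (h.hasDerivAt t x).continuousAt

theorem eq_of_hasDerivAt (h : IsFlow X Φ W) {c : ℝ → E} (hc : ∀ t, HasDerivAt c (X (c t)) t)
    (t : ℝ) : c t = Φ t (c 0) := by
  obtain ⟨K, hK⟩ := h.lipschitz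
  have := ODE_solution_unique_univ (v := fun _ => X) (s := fun _ => univ) (K := K) (t₀ := 0)
    (f := c) (g := fun t => Φ t (c 0)) (fun _ => hK.lipschitzOnWith) (fun t => ⟨hc t, trivial⟩)
    (fun t => ⟨h.hasDerivAt t _, trivial⟩) (h.zero _).symm
  exact congrFun this t

theorem hasDerivAt_shift (h : IsFlow X Φ W) (s t : ℝ) (x : E) :
    HasDerivAt (fun r => Φ (r + t) x) (X (Φ (s + t) x)) s :=
  (h.hasDerivAt (s + t) x).comp_add_const s t

theorem add (h : IsFlow X Φ W) (s t : ℝ) (x : E) : Φ (s + t) x = Φ s (Φ t x) := by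
  have := h.eq_of_hasDerivAt (c := fun r => Φ (r + t) x) (fun r => h.hasDerivAt_shift r t x) s
  simpa using this

theorem neg_apply (h : IsFlow X Φ W) (t : ℝ) (x : E) : Φ (-t) (Φ t x) = x := by
  rw [← h.add, neg_add_cancel, h.zero]

theorem injective (h : IsFlow X Φ W) (t : ℝ) : Function.Injective (Φ t) := fun x y hxy => by
  rw [← h.neg_apply t x, hxy, h.neg_apply]

theorem linear_add (h : IsFlow X Φ W) (s t : ℝ) (x : E) :
    W (s + t) x = (W s (Φ t x)) ∘L (W t x) := by
  have h1 := h.hasFDerivAt (s + t) x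
  have h2 := (h.hasFDerivAt s (Φ t x)).comp x (h.hasFDerivAt t x)
  refine h1.unique (h2.congr_of_eventuallyEq (Eventually.of_forall fun y => ?_))
  exact h.add s t y

/-- Both sides are the derivative at `s = 0` of `Φ (t + s) x`. This invariance of the flow direction
fixes the linearized flow transversally to a discontinuity. -/
theorem linear_field (h : IsFlow X Φ W) (t : ℝ) (x : E) : W t x (X x) = X (Φ t x) := by
  have h1 : HasDerivAt (fun s => Φ t (Φ s x)) (W t x (X x)) 0 := by
    have := h.hasFDerivAt t x
    have h0 := h.hasDerivAt 0 x
    rw [h.zero] at h0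
    exact HasFDerivAt.comp_hasDerivAt_of_eq (f := fun s => Φ s x) 0 this h0 (h.zero x).symm
  have h2 : HasDerivAt (fun s => Φ t (Φ s x)) (X (Φ t x)) 0 := by
    have := h.hasDerivAt_shift 0 t x
    rw [zero_add] at this
    refine this.congr_of_eventuallyEq (Eventually.of_forall fun s => ?_)
    change Φ t (Φ s x) = Φ (s + t) x
    rw [← h.add, add_comm]
  exact h1.unique h2

end IsFlow

end Flow

/-! ### Continuous dependence on the field and on the initial value. -/

section Comparison

variable {ι κ F : Type*}

/-- Statements along `l ×ˢ 𝓝 y` express locally uniform convergence throughout; compactness turns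
them into uniform ones. -/
theorem IsCompact.eventually_forall_of_prod_nhds [TopologicalSpace F] {l : Filter ι} {K : Set F} (hK : IsCompact K)
    {P : ι → F → Prop} (h : ∀ y ∈ K, ∀ᶠ q in l ×ˢ 𝓝 y, P q.1 q.2) :
    ∀ᶠ i in l, ∀ y ∈ K, P i y := by
  have h1 : ∀ᶠ q in l ×ˢ 𝓝ˢ K, P q.1 q.2 := by
    rw [hK.prod_nhdsSet_eq_biSup]
    simpa only [eventually_iSup] using h
  obtain ⟨p, hp, r, hr, hpr⟩ := eventually_prod_iff.1 h1
  filter_upwards [hp] with i hi y hy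
  exact hpr hi (subset_of_mem_nhdsSet hr hy)

variable [NormedAddCommGroup F] [NormedSpace ℝ F]

/-- Solutions of differential equations depend continuously on the equation and on the initial
value, uniformly on compact intervals of time. -/
theorem eventually_norm_sub_le_of_tendsto_field [FiniteDimensional ℝ F] {l : Filter ι}
    {l' : Filter κ} {Z : ι → F → F} {Z₀ : F → F} (hZ₀ : ContDiff ℝ 1 Z₀) {U : Set F} (hU : IsOpen U)
    (hconv : ∀ y ∈ U, Tendsto (fun q : ι × F => Z q.1 q.2) (l ×ˢ 𝓝 y) (𝓝 (Z₀ y)))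
    {z₀ : ℝ → F} {τ : ℝ} (hz₀ : ∀ t, HasDerivAt z₀ (Z₀ (z₀ t)) t) (hz₀U : ∀ t ∈ Icc 0 τ, z₀ t ∈ U)
    {i : κ → ι} (hi : Tendsto i l' l) {ζ : κ → ℝ → F} {σ : κ → ℝ} (hσ : ∀ k, σ k ≤ τ)
    (hζc : ∀ᶠ k in l', ContinuousOn (ζ k) (Icc 0 (σ k)))
    (hζ : ∀ᶠ k in l', ∀ t ∈ Ico 0 (σ k), HasDerivWithinAt (ζ k) (Z (i k) (ζ k t)) (Ici t) t)
    (h0 : Tendsto (fun k => ζ k 0) l' (𝓝 (z₀ 0))) {η : ℝ} (hη : 0 < η) :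
    ∀ᶠ k in l', ∀ t ∈ Icc 0 (σ k), ‖ζ k t - z₀ t‖ ≤ η := by
  have : ProperSpace F := FiniteDimensional.proper ℝ F
  have hz₀c : Continuous z₀ := continuous_iff_continuousAt.2 fun t => (hz₀ t).continuousAt
  have hcomp : IsCompact (z₀ '' Icc 0 τ) := isCompact_Icc.image hz₀c
  obtain ⟨ρ, hρ, hρU⟩ := hcomp.exists_cthickening_subset_open hU (by rintro _ ⟨t, ht, rfl⟩; exact hz₀U t ht)
  set T := Metric.cthickening ρ (z₀ '' Icc 0 τ)
  have hT : IsCompact T := hcomp.cthickening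
  obtain ⟨R, hR⟩ := hT.isBounded.subset_closedBall 0
  obtain ⟨K₀, hK₀⟩ := (isCompact_closedBall (0 : F) R).exists_bound_of_continuousOn
    (hZ₀.continuous_fderiv (by simp)).continuousOn
  set K := max K₀ 0
  have hLip : ∀ y ∈ T, ∀ z ∈ T, ‖Z₀ z - Z₀ y‖ ≤ K * ‖z - y‖ := fun y hy z hz =>
    (convex_closedBall (0 : F) R).norm_image_sub_le_of_norm_fderiv_le
      (fun x _ => hZ₀.differentiable (by simp) x) (fun x hx => (hK₀ x hx).trans (le_max_left _ _))
      (hR hy) (hR hz)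
  -- The barrier `κ₁ * exp ((K + 1) t)` then stays below `min η ρ` up to time `τ`, so a solution
  -- under it is within `η` of `z₀` and inside `T`, where the estimates hold.
  set κ₁ : ℝ := min η ρ * Real.exp (-(K + 1) * |τ|) with hκ₁
  have hκpos : 0 < κ₁ := by positivity
  have hcl : ∀ᶠ j in l, ∀ y ∈ T, ‖Z j y - Z₀ y‖ < κ₁ := by
    refine hT.eventually_forall_of_prod_nhds fun y hy => ?_
    have h1 := hconv y (hρU hy)
    have h2 : Tendsto (fun q : ι × F => Z₀ q.2) (l ×ˢ 𝓝 y) (𝓝 (Z₀ y)) :=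
      (hZ₀.continuous.tendsto y).comp tendsto_snd
    have h3 := (h1.sub h2).norm
    rw [sub_self, norm_zero] at h3
    exact h3.eventually_lt_const hκpos
  have h0' : ∀ᶠ k in l', ‖ζ k 0 - z₀ 0‖ < κ₁ := by
    have := (h0.sub_const (z₀ 0)).norm
    rw [sub_self, norm_zero] at this
    exact this.eventually_lt_const hκpos
  filter_upwards [hi.eventually hcl, h0', hζc, hζ] with k hk hk0 hkc hkd
  have hB : ∀ t, HasDerivAt (fun t => κ₁ * Real.exp ((K + 1) * t))
      ((K + 1) * (κ₁ * Real.exp ((K + 1) * t))) t := fun t => by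
    have := (((hasDerivAt_id t).const_mul (K + 1)).exp).const_mul κ₁
    refine this.congr_deriv ?_
    simp only [id]; ring
  have hBle : ∀ t ∈ Icc 0 τ, κ₁ * Real.exp ((K + 1) * t) ≤ min η ρ := fun t ht => by
    rw [hκ₁, mul_assoc, ← Real.exp_add]
    refine mul_le_of_le_one_right (by positivity) (Real.exp_le_one_iff.2 ?_)
    have : t ≤ |τ| := ht.2.trans (le_abs_self τ)
    have hK : 0 ≤ K := le_max_right _ _
    nlinarith
  have hle : ∀ t ∈ Icc 0 (σ k), t ∈ Icc 0 τ := fun t ht => ⟨ht.1, ht.2.trans (hσ k)⟩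
  intro t ht
  -- The differential inequality is only needed where the distance equals the barrier, and there `ζ
  -- k t` lies in `T`. The rate `K + 1` exceeds `K` because the barrier is at least `κ₁` and absorbs
  -- the error of the field.
  have := image_norm_le_of_norm_deriv_right_lt_deriv_boundary (f := fun t => ζ k t - z₀ t)
    (f' := fun t => Z (i k) (ζ k t) - Z₀ (z₀ t)) (a := 0) (b := σ k)
    (hkc.sub hz₀c.continuousOn) (fun t ht => (hkd t ht).sub (hz₀ t).hasDerivWithinAt)
    (B := fun t => κ₁ * Real.exp ((K + 1) * t)) (by simpa using hk0.le) hB (fun t ht hB' => ?_) ht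
  · exact this.trans ((hBle t (hle t ht)).trans (min_le_left _ _))
  · have ht' := hle t (Ico_subset_Icc_self ht)
    have hzT : z₀ t ∈ T := Metric.self_subset_cthickening _ ⟨t, ht', rfl⟩
    have hζT : ζ k t ∈ T := by
      refine Metric.mem_cthickening_of_dist_le _ (z₀ t) _ _ ⟨t, ht', rfl⟩ ?_
      rw [dist_eq_norm, hB']
      exact (hBle t ht').trans (min_le_right _ _)
    calc ‖Z (i k) (ζ k t) - Z₀ (z₀ t)‖ = ‖(Z (i k) (ζ k t) - Z₀ (ζ k t)) + (Z₀ (ζ k t) - Z₀ (z₀ t))‖ := by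
            congr 1; abel
      _ ≤ ‖Z (i k) (ζ k t) - Z₀ (ζ k t)‖ + ‖Z₀ (ζ k t) - Z₀ (z₀ t)‖ := norm_add_le _ _
      _ < κ₁ + K * ‖ζ k t - z₀ t‖ := add_lt_add_of_lt_of_le (hk _ hζT) (hLip _ hzT _ hζT)
      _ ≤ (K + 1) * (κ₁ * Real.exp ((K + 1) * t)) := by
        have hK : 0 ≤ K := le_max_right _ _
        have : 1 ≤ Real.exp ((K + 1) * t) := Real.one_le_exp (mul_nonneg (by linarith) ht.1)
        have h3 := mul_le_mul_of_nonneg_left this hκpos.le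
        rw [hB']
        generalize κ₁ * Real.exp ((K + 1) * t) = B at h3 ⊢
        linarith

end Comparison

/-! ### Convergence of flows and of their derivatives. -/

section Reach

variable {ι E : Type*} [NormedAddCommGroup E] [NormedSpace ℝ E]

/-- The time `t` maps `Φ i t`, near `x`, converge along `l` to `y`. -/
def C0Reach (l : Filter ι) (Φ : ι → ℝ → E → E) (x : E) (t : ℝ) (y : E) : Prop :=
  Tendsto (fun q : ι × E => Φ q.1 t q.2) (l ×ˢ 𝓝 x) (𝓝 y)

/-- The time `t` maps `Φ i t` and their derivatives, near `x`, converge along `l` to `y` and `L`. -/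
def C1Reach (l : Filter ι) (Φ : ι → ℝ → E → E) (W : ι → ℝ → E → E →L[ℝ] E) (x : E) (t : ℝ) (y : E)
    (L : E →L[ℝ] E) : Prop :=
  C0Reach l Φ x t y ∧ Tendsto (fun q : ι × E => W q.1 t q.2) (l ×ˢ 𝓝 x) (𝓝 L)

/-- The vector fields `X i` converge at `y` to `Y`, together with their derivatives. -/
def FieldTendsto (l : Filter ι) (X : ι → E → E) (Y : E → E) (y : E) : Prop :=
  Tendsto (fun q : ι × E => X q.1 q.2) (l ×ˢ 𝓝 y) (𝓝 (Y y)) ∧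
  Tendsto (fun q : ι × E => fderiv ℝ (X q.1) q.2) (l ×ˢ 𝓝 y) (𝓝 (fderiv ℝ Y y))

theorem fieldTendsto_const (l : Filter ι) {X : E → E} (hX : ContDiff ℝ ∞ X) (y : E) :
    FieldTendsto l (fun _ => X) X y :=
  ⟨(hX.continuous.tendsto y).comp tendsto_snd,
    ((hX.continuous_fderiv (by simp)).tendsto y).comp tendsto_snd⟩

variable {l : Filter ι} {X : ι → E → E} {Φ : ι → ℝ → E → E} {W : ι → ℝ → E → E →L[ℝ] E}

theorem C0Reach.prod {x y : E} {t : ℝ} (h : C0Reach l Φ x t y) :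
    Tendsto (fun q : ι × E => (q.1, Φ q.1 t q.2)) (l ×ˢ 𝓝 x) (l ×ˢ 𝓝 y) :=
  tendsto_fst.prodMk h

theorem C0Reach.trans (hF : ∀ i, IsFlow (X i) (Φ i) (W i)) {x y z : E} {t s : ℝ}
    (h₁ : C0Reach l Φ x t y) (h₂ : C0Reach l Φ y s z) : C0Reach l Φ x (t + s) z := by
  refine (h₂.comp h₁.prod).congr fun q => ?_
  rw [add_comm, (hF q.1).add]; rfl

theorem C1Reach.trans (hF : ∀ i, IsFlow (X i) (Φ i) (W i)) {x y z : E} {t s : ℝ}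
    {L M : E →L[ℝ] E} (h₁ : C1Reach l Φ W x t y L) (h₂ : C1Reach l Φ W y s z M) :
    C1Reach l Φ W x (t + s) z (M ∘L L) := by
  refine ⟨h₁.1.trans hF h₂.1, ?_⟩
  have h3 := h₂.2.comp h₁.1.prod
  have : Tendsto (fun p : (E →L[ℝ] E) × (E →L[ℝ] E) => p.1 ∘L p.2) (𝓝 (M, L)) (𝓝 (M ∘L L)) :=
    (isBoundedBilinearMap_comp (𝕜 := ℝ) (E := E) (F := E) (G := E)).continuous.tendsto _
  refine (this.comp (h3.prodMk_nhds h₁.2)).congr fun q => ?_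
  rw [add_comm t s, (hF q.1).linear_add]; rfl

theorem c0Reach_zero (hF : ∀ i, IsFlow (X i) (Φ i) (W i)) (x : E) : C0Reach l Φ x 0 x :=
  tendsto_snd.congr fun q => ((hF q.1).zero q.2).symm

theorem c1Reach_zero (hF : ∀ i, IsFlow (X i) (Φ i) (W i)) (x : E) : C1Reach l Φ W x 0 x 1 :=
  ⟨c0Reach_zero hF x, tendsto_const_nhds.congr fun q => ((hF q.1).linear_zero q.2).symm⟩

theorem IsFlow.hasDerivAt_prod {X : E → E} {Φ : ℝ → E → E} {W : ℝ → E → E →L[ℝ] E}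
    (h : IsFlow X Φ W) (x : E) (t : ℝ) :
    HasDerivAt (fun t => (Φ t x, W t x))
      ((fun p : E × (E →L[ℝ] E) => (X p.1, (fderiv ℝ X p.1) ∘L p.2)) (Φ t x, W t x)) t :=
  (h.hasDerivAt t x).prodMk (h.hasDerivAt_linear t x)

/-- Convergence of vector fields, with first derivatives, near an orbit segment of the limit implies
convergence of the flows, with first derivatives, uniformly in time. -/
theorem eventually_flow_close [FiniteDimensional ℝ E] (hF : ∀ i, IsFlow (X i) (Φ i) (W i))
    {Y : E → E} {φ : ℝ → E → E} {w : ℝ → E → E →L[ℝ] E} (hY : IsFlow Y φ w) {U : Set E}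
    (hU : IsOpen U) (hconv : ∀ y ∈ U, FieldTendsto l X Y y) {x₀ : E} {τ : ℝ}
    (hx₀ : ∀ t ∈ Icc 0 τ, φ t x₀ ∈ U) {η : ℝ} (hη : 0 < η) :
    ∀ᶠ q in l ×ˢ 𝓝 x₀, ∀ t ∈ Icc 0 τ, ‖(Φ q.1 t q.2, W q.1 t q.2) - (φ t x₀, w t x₀)‖ ≤ η := by
  have hDY : ContDiff ℝ ∞ (fderiv ℝ Y) := hY.smooth.fderiv_right (by simp)
  have hcomp : Continuous (fun p : (E →L[ℝ] E) × (E →L[ℝ] E) => p.1 ∘L p.2) :=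
    (isBoundedBilinearMap_comp (𝕜 := ℝ) (E := E) (F := E) (G := E)).continuous
  -- Flow and linearized flow together solve one equation on `E × (E →L[ℝ] E)`, so convergence with
  -- derivatives reduces to continuous dependence for the extended system.
  refine eventually_norm_sub_le_of_tendsto_field (ι := ι) (κ := ι × E) (F := E × (E →L[ℝ] E)) (l := l)
    (Z := fun i p => (X i p.1, (fderiv ℝ (X i) p.1) ∘L p.2))
    (Z₀ := fun p => (Y p.1, (fderiv ℝ Y p.1) ∘L p.2)) ?_ (hU.prod isOpen_univ) ?_
    (z₀ := fun t => (φ t x₀, w t x₀)) (τ := τ) (fun t => hY.hasDerivAt_prod x₀ t)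
    (fun t ht => ⟨hx₀ t ht, trivial⟩) (i := fun q => q.1) tendsto_fst
    (ζ := fun q t => (Φ q.1 t q.2, W q.1 t q.2)) (σ := fun _ => τ) (fun _ => le_rfl) ?_ ?_ ?_ hη
  · refine ((hY.smooth.of_le (by simp)).comp contDiff_fst).prodMk (ContDiff.clm_comp ?_ contDiff_snd)
    exact (hDY.of_le (by simp)).comp contDiff_fst
  · rintro ⟨y, A⟩ ⟨hy, -⟩
    obtain ⟨h1, h2⟩ := hconv y hy
    have hq : Tendsto (fun q : ι × (E × (E →L[ℝ] E)) => (q.1, q.2.1)) (l ×ˢ 𝓝 (y, A)) (l ×ˢ 𝓝 y) :=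
      tendsto_fst.prodMk ((continuous_fst.tendsto (y, A)).comp tendsto_snd)
    have hq2 : Tendsto (fun q : ι × (E × (E →L[ℝ] E)) => q.2.2) (l ×ˢ 𝓝 (y, A)) (𝓝 A) :=
      (continuous_snd.tendsto (y, A)).comp tendsto_snd
    refine (h1.comp hq).prodMk_nhds ?_
    exact (hcomp.tendsto (fderiv ℝ Y y, A)).comp ((h2.comp hq).prodMk_nhds hq2)
  · exact Eventually.of_forall fun q => HasDerivAt.continuousOn fun t _ => (hF q.1).hasDerivAt_prod q.2 t
  · exact Eventually.of_forall fun q t _ => ((hF q.1).hasDerivAt_prod q.2 t).hasDerivWithinAt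
  · simp only [(hF _).zero, (hF _).linear_zero, hY.zero, hY.linear_zero]
    exact (tendsto_snd (f := l) (g := 𝓝 x₀)).prodMk_nhds tendsto_const_nhds

theorem c1Reach_of_fieldTendsto [FiniteDimensional ℝ E] (hF : ∀ i, IsFlow (X i) (Φ i) (W i))
    {Y : E → E} {φ : ℝ → E → E} {w : ℝ → E → E →L[ℝ] E} (hY : IsFlow Y φ w) {U : Set E}
    (hU : IsOpen U) (hconv : ∀ y ∈ U, FieldTendsto l X Y y) {x₀ : E} {τ : ℝ} (hτ : 0 ≤ τ)
    (hx₀ : ∀ t ∈ Icc 0 τ, φ t x₀ ∈ U) : C1Reach l Φ W x₀ τ (φ τ x₀) (w τ x₀) := by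
  have key : Tendsto (fun q : ι × E => (Φ q.1 τ q.2, W q.1 τ q.2)) (l ×ˢ 𝓝 x₀)
      (𝓝 (φ τ x₀, w τ x₀)) := by
    refine Metric.tendsto_nhds.2 fun η hη => ?_
    filter_upwards [eventually_flow_close hF hY hU hconv hx₀ (half_pos hη)] with q hq
    rw [dist_eq_norm]
    exact (hq τ ⟨hτ, le_rfl⟩).trans_lt (half_lt_self hη)
  exact ⟨(continuous_fst.tendsto _).comp key, (continuous_snd.tendsto _).comp key⟩

theorem IsFlow.c1Reach [FiniteDimensional ℝ E] {Y : E → E} {φ : ℝ → E → E}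
    {w : ℝ → E → E →L[ℝ] E} (hY : IsFlow Y φ w) (l : Filter ι) (x : E) {t : ℝ} (ht : 0 ≤ t) :
    C1Reach l (fun _ => φ) (fun _ => w) x t (φ t x) (w t x) :=
  c1Reach_of_fieldTendsto (fun _ => hY) hY isOpen_univ
    (fun y _ => fieldTendsto_const l hY.smooth y) ht fun _ _ => trivial

end Reach

/-! ### The measure of thin slabs. -/

section Slab

variable {E : Type*} [NormedAddCommGroup E] [NormedSpace ℝ E] [FiniteDimensional ℝ E]
  [MeasurableSpace E] [BorelSpace E]

/-- Thin slabs have small measure inside a ball, uniformly in their position. -/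
theorem exists_volume_slab_le (μ : Measure E) [μ.IsAddHaarMeasure] {ν : E →L[ℝ] ℝ} (hν : ν ≠ 0)
    (R : ℝ) {η : ℝ} (hη : 0 < η) :
    ∃ κ > 0, ∀ c : ℝ, μ.real (Metric.closedBall 0 R ∩ {w | |c - ν w| ≤ κ}) ≤ η := by
  have : ProperSpace E := FiniteDimensional.proper ℝ E
  obtain ⟨e₀, he₀⟩ : ∃ e, ν e ≠ 0 := by
    by_contra! h
    exact hν (ContinuousLinearMap.ext h)
  set e := (ν e₀)⁻¹ • e₀
  have he : ν e = 1 := by simp [e, he₀]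
  set V := μ.real (Metric.closedBall (0 : E) (R + ‖e‖))
  obtain ⟨N, hN⟩ := exists_nat_gt (V / η)
  have hV : 0 ≤ V := measureReal_nonneg
  have hN0 : (0 : ℝ) < N := lt_of_le_of_lt (by positivity) hN
  refine ⟨1 / (3 * N), by positivity, fun c => ?_⟩
  set A := Metric.closedBall (0 : E) R ∩ {w | |c - ν w| ≤ 1 / (3 * N)}
  have hAm : MeasurableSet A := by
    refine (Metric.isClosed_closedBall.inter ?_).measurableSet
    exact isClosed_le (by fun_prop) continuous_const
  -- The translates of `A` by `(j / N) • e` for `j < N` are disjoint, as `ν` varies by at most `2 /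
  -- (3 N) < 1 / N` on each. They have equal measure and fit into one ball of measure `V`, so `N * μ
  -- A ≤ V`, and `N > V / η`.
  have hdisj : (↑(Finset.range N) : Set ℕ).PairwiseDisjoint
      fun j : ℕ => (fun w => w + (-((j : ℝ) / N) • e)) ⁻¹' A := by
    intro i _ j _ hij
    refine Set.disjoint_left.2 fun w hi hj => hij ?_
    have h1 := abs_le.1 (show |c - ν (w + (-((i : ℝ) / N) • e))| ≤ _ from hi.2)
    have h2 := abs_le.1 (show |c - ν (w + (-((j : ℝ) / N) • e))| ≤ _ from hj.2)
    simp only [map_add, map_smul, he, smul_eq_mul, mul_one] at h1 h2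
    have h3 : |(i : ℝ) / N - j / N| < 1 / N := by
      have : 1 / (3 * N : ℝ) + 1 / (3 * N) < 1 / N := by
        rw [← sub_pos]; field_simp; norm_num
      rw [abs_lt]; constructor <;> linarith [h1.1, h1.2, h2.1, h2.2]
    rw [← sub_div, abs_div, abs_of_pos hN0, div_lt_div_iff_of_pos_right hN0] at h3
    have h4 : |(i : ℤ) - j| < 1 := by exact_mod_cast h3
    have := Int.abs_lt_one_iff.1 h4
    omega
  have hsub : (⋃ j ∈ Finset.range N, (fun w => w + (-((j : ℝ) / N) • e)) ⁻¹' A) ⊆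
      Metric.closedBall (0 : E) (R + ‖e‖) := by
    refine iUnion₂_subset fun j hj w hw => ?_
    have h1 : ‖w + (-((j : ℝ) / N) • e)‖ ≤ R := by simpa using hw.1
    rw [mem_closedBall_zero_iff]
    have h2 : ‖-((j : ℝ) / N) • e‖ ≤ ‖e‖ := by
      rw [norm_smul, norm_neg, Real.norm_of_nonneg (by positivity)]
      refine mul_le_of_le_one_left (norm_nonneg _) (div_le_one_of_le₀ ?_ hN0.le)
      exact_mod_cast (Finset.mem_range.1 hj).le
    calc ‖w‖ = ‖(w + (-((j : ℝ) / N) • e)) - (-((j : ℝ) / N) • e)‖ := by congr 1; abel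
      _ ≤ _ := (norm_sub_le _ _).trans (add_le_add h1 h2)
  have hfin : μ (Metric.closedBall (0 : E) (R + ‖e‖)) ≠ ⊤ := (isCompact_closedBall _ _).measure_ne_top
  have h1 := measureReal_mono (μ := μ) hsub hfin
  rw [measureReal_biUnion_finset hdisj (fun j _ => (measurable_add_const _) hAm)
    (fun j _ => ne_top_of_le_ne_top hfin (measure_mono (Set.subset_biUnion_of_mem
      (u := fun j : ℕ => (fun w => w + (-((j : ℝ) / N) • e)) ⁻¹' A) ‹_› |>.trans hsub)))] at h1
  have h2 : ∀ j : ℕ, μ.real ((fun w => w + (-((j : ℝ) / N) • e)) ⁻¹' A) = μ.real A := fun j => by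
    simp only [measureReal_def, measure_preimage_add_right]
  simp only [h2, Finset.sum_const, Finset.card_range, nsmul_eq_mul] at h1
  rw [div_lt_iff₀ hη] at hN
  by_contra! hcon
  have := mul_lt_mul_of_pos_left hcon hN0
  linarith

end Slab

/-! ### Mollification: convergence, and bounds for derivatives at a discontinuity. -/

section Mollify

variable {n : ℕ} {G : Type*} [NormedAddCommGroup G] [NormedSpace ℝ G] [CompleteSpace G]

/-- The derivative falls on the smooth factor, so `g` may jump. -/
theorem hasFDerivAt_convolution_smul {f : Space n → ℝ} {g : Space n → G} (hf : ContDiff ℝ 1 f)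
    (hfc : HasCompactSupport f) (hg : LocallyIntegrable g) (x : Space n) :
    ∃ L : Space n →L[ℝ] G,
      HasFDerivAt (convolution f g (ContinuousLinearMap.lsmul ℝ ℝ) volume) L x ∧
      ∀ v, L v = ∫ y, (fderiv ℝ f y v) • g (x - y) := by
  refine ⟨_, hfc.hasFDerivAt_convolution_left (ContinuousLinearMap.lsmul ℝ ℝ) hf hg x, fun v => ?_⟩
  have hex := (hfc.fderiv ℝ).convolutionExists_left
    ((ContinuousLinearMap.lsmul ℝ ℝ : ℝ →L[ℝ] G →L[ℝ] G).precompL (Space n))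
    (hf.continuous_fderiv (by simp)) hg x
  have := (ContinuousLinearMap.apply ℝ G v).integral_comp_comm hex
  simp only [convolution]
  simpa using this.symm

/-- The convolution of `g` with the rescaled mollifier. -/
noncomputable def moll (m : Space n → ℝ) (ε : ℝ) (g : Space n → G) : Space n → G :=
  convolution (rescale m ε) g (ContinuousLinearMap.lsmul ℝ ℝ) volume

theorem IsMollifier.exists_radius {m : Space n → ℝ} (hm : IsMollifier m) :
    ∃ R > 0, Function.support m ⊆ Metric.ball 0 R := by
  obtain ⟨R, hR⟩ := hm.hasCompactSupport.isBounded.subset_ball 0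
  exact ⟨max R 1, by positivity,
    (subset_tsupport m).trans (hR.trans (Metric.ball_subset_ball (le_max_left _ _)))⟩

section Rescale

variable {m : Space n → ℝ} (hm : IsMollifier m) {ε : ℝ}

include hm

theorem IsMollifier.contDiff_rescale : ContDiff ℝ ∞ (rescale m ε) :=
  contDiff_const.mul (hm.smooth.comp (contDiff_const_smul _))

theorem IsMollifier.rescale_nonneg (hε : 0 < ε) (x : Space n) : 0 ≤ rescale m ε x :=
  mul_nonneg (by positivity) (hm.nonneg _)

theorem IsMollifier.hasCompactSupport_rescale (hε : 0 < ε) : HasCompactSupport (rescale m ε) :=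
  (hm.hasCompactSupport.comp_smul (inv_ne_zero hε.ne')).mul_left

theorem IsMollifier.integral_rescale (hε : 0 < ε) : ∫ x, rescale m ε x = 1 := by
  simp only [rescale]
  rw [integral_const_mul, Measure.integral_comp_inv_smul_of_nonneg _ _ hε.le, hm.integral_eq_one]
  have : ε ^ n ≠ 0 := by positivity
  simp [this]

theorem IsMollifier.fderiv_rescale (y v : Space n) :
    fderiv ℝ (rescale m ε) y v = (ε ^ n)⁻¹ * ε⁻¹ * fderiv ℝ m (ε⁻¹ • y) v := by
  have h1 : HasFDerivAt m (fderiv ℝ m (ε⁻¹ • y)) (ε⁻¹ • y) :=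
    (hm.smooth.differentiable (by simp) _).hasFDerivAt
  have h2 := (h1.comp y ((hasFDerivAt_id y).const_smul ε⁻¹)).const_mul (ε ^ n)⁻¹
  have h3 : fderiv ℝ (rescale m ε) y = _ := h2.fderiv
  rw [h3]
  simp [mul_assoc]

omit hm in
theorem support_rescale_subset {R : ℝ} (hR : Function.support m ⊆ Metric.ball 0 R) (hε : 0 < ε) :
    Function.support (rescale m ε) ⊆ Metric.ball 0 (R * ε) := by
  intro x hx
  have h1 : ε⁻¹ • x ∈ Metric.ball (0 : Space n) R := by
    apply hR
    intro h
    exact hx (by simp [rescale, h])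
  rw [mem_ball_zero_iff] at h1 ⊢
  rwa [norm_smul, norm_inv, Real.norm_of_nonneg hε.le, inv_mul_lt_iff₀ hε, mul_comm] at h1

theorem IsMollifier.contDiff_moll (hε : 0 < ε) {g : Space n → G} (hg : LocallyIntegrable g) :
    ContDiff ℝ ∞ (moll m ε g) :=
  (hm.hasCompactSupport_rescale hε).contDiff_convolution_left _ (n := (⊤ : ℕ∞)) hm.contDiff_rescale hg

theorem IsMollifier.hasCompactSupport_moll (hε : 0 < ε) {g : Space n → G}
    (hg : HasCompactSupport g) : HasCompactSupport (moll m ε g) :=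
  (hm.hasCompactSupport_rescale hε).convolution _ hg

-- Only values almost everywhere within distance `R * ε` enter, so those on the null set of
-- discontinuities are irrelevant.
omit hm in
theorem moll_congr {R : ℝ} (hR : Function.support m ⊆ Metric.ball 0 R) (hε : 0 < ε)
    {g g' : Space n → G} {x : Space n} (h : ∀ᵐ y, dist y x < R * ε → g y = g' y) :
    moll m ε g x = moll m ε g' x := by
  refine integral_congr_ae ?_
  have h2 : ∀ᵐ y, dist (x - y) x < R * ε → g (x - y) = g' (x - y) :=
    (quasiMeasurePreserving_sub_left volume x).ae h
  filter_upwards [h2] with y hy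
  by_cases h0 : y ∈ Function.support (rescale m ε)
  · have := support_rescale_subset hR hε h0
    rw [hy (by simpa [dist_eq_norm] using this)]
  · rw [Function.notMem_support] at h0
    simp [h0]

omit hm in
theorem moll_eventuallyEq {R : ℝ} (hR : Function.support m ⊆ Metric.ball 0 R) (hε : 0 < ε)
    {g g' : Space n → G} {x : Space n} {r : ℝ} (hr : R * ε < r)
    (h : ∀ᵐ y, dist y x < r → g y = g' y) : moll m ε g =ᶠ[𝓝 x] moll m ε g' := by
  filter_upwards [Metric.ball_mem_nhds x (sub_pos.2 hr)] with z hz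
  refine moll_congr hR hε ?_
  filter_upwards [h] with y hy hd
  exact hy ((dist_triangle y z x).trans_lt (by linarith [Metric.mem_ball.1 hz]))

theorem IsMollifier.tendsto_support_rescale :
    Tendsto (fun ε => Function.support (rescale m ε)) (𝓝[>] 0) (𝓝 0).smallSets := by
  obtain ⟨R, hR0, hR⟩ := hm.exists_radius
  rw [tendsto_smallSets_iff]
  intro t ht
  obtain ⟨δ, hδ, hδt⟩ := Metric.mem_nhds_iff.1 ht
  filter_upwards [Ioo_mem_nhdsGT (show 0 < δ / R by positivity)] with ε hε
  refine (support_rescale_subset hR hε.1).trans (Subset.trans (Metric.ball_subset_ball ?_) hδt)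
  have := (lt_div_iff₀ hR0).1 hε.2
  linarith

theorem IsMollifier.tendsto_moll {g : Space n → G} (hg : Continuous g) (x₀ : Space n) :
    Tendsto (fun q : ℝ × Space n => moll m q.1 g q.2) (𝓝[>] 0 ×ˢ 𝓝 x₀) (𝓝 (g x₀)) := by
  have hpos : ∀ᶠ q : ℝ × Space n in 𝓝[>] 0 ×ˢ 𝓝 x₀, 0 < q.1 :=
    tendsto_fst.eventually self_mem_nhdsWithin
  refine convolution_tendsto_right (x₀ := x₀) (φ := fun q : ℝ × Space n => rescale m q.1)
    (g := fun _ => g) (k := fun q => q.2)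
    (hpos.mono fun q hq x => hm.rescale_nonneg hq x) (hpos.mono fun q hq => hm.integral_rescale hq)
    (hm.tendsto_support_rescale.comp tendsto_fst)
    (Eventually.of_forall fun _ => hg.aestronglyMeasurable) ?_ tendsto_snd
  exact (hg.tendsto x₀).comp tendsto_snd

theorem IsMollifier.norm_moll_le (hε : 0 < ε) {g : Space n → G} (hg : AEStronglyMeasurable g)
    {K : ℝ} (hK : ∀ x, ‖g x‖ ≤ K) (x : Space n) : ‖moll m ε g x‖ ≤ K := by
  obtain ⟨R, -, hR⟩ := hm.exists_radius
  rw [← dist_zero_right]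
  exact dist_convolution_le ((norm_nonneg _).trans (hK 0)) (support_rescale_subset hR hε)
    (hm.rescale_nonneg hε) (hm.integral_rescale hε) hg fun y _ => by rw [dist_zero_right]; exact hK y

theorem IsMollifier.fderiv_moll_of_contDiff {Y : Space n → G} (hY : ContDiff ℝ 1 Y)
    (hYc : HasCompactSupport Y) (x : Space n) :
    fderiv ℝ (moll m ε Y) x = moll m ε (fderiv ℝ Y) x := by
  have hr : Continuous (rescale m ε) := hm.contDiff_rescale.continuous
  have := (hYc.hasFDerivAt_convolution_right (ContinuousLinearMap.lsmul ℝ ℝ)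
    hr.locallyIntegrable (μ := volume) hY x).fderiv
  refine this.trans ?_
  simp only [moll, convolution]
  refine integral_congr_ae (Eventually.of_forall fun y => ?_)
  ext v
  simp

theorem IsMollifier.fieldTendsto {Y : Space n → Space n} (hY : ContDiff ℝ ∞ Y)
    (hYc : HasCompactSupport Y) (x₀ : Space n) :
    FieldTendsto (𝓝[>] 0) (fun ε => moll m ε Y) Y x₀ := by
  refine ⟨hm.tendsto_moll hY.continuous x₀, ?_⟩
  refine (hm.tendsto_moll (hY.continuous_fderiv (by simp)) x₀).congr' ?_
  have hpos : ∀ᶠ q : ℝ × Space n in 𝓝[>] 0 ×ˢ 𝓝 x₀, 0 < q.1 :=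
    tendsto_fst.eventually self_mem_nhdsWithin
  filter_upwards [hpos] with q _
  exact (hm.fderiv_moll_of_contDiff (hY.of_le (by simp)) hYc q.2).symm

theorem IsMollifier.fieldTendsto_of_ae {g Y : Space n → Space n} (hY : ContDiff ℝ ∞ Y)
    (hYc : HasCompactSupport Y) {x₀ : Space n} {r : ℝ} (hr : 0 < r)
    (h : ∀ᵐ y, dist y x₀ < r → g y = Y y) :
    FieldTendsto (𝓝[>] 0) (fun ε => moll m ε g) Y x₀ := by
  obtain ⟨R, hR0, hR⟩ := hm.exists_radius
  obtain ⟨h1, h2⟩ := hm.fieldTendsto hY hYc x₀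
  have hev : ∀ᶠ q : ℝ × Space n in 𝓝[>] 0 ×ˢ 𝓝 x₀,
      moll m q.1 Y =ᶠ[𝓝 q.2] moll m q.1 g := by
    have hs : ∀ᶠ ε : ℝ in 𝓝[>] 0, ε ∈ Ioo 0 (r / 2 / R) := Ioo_mem_nhdsGT (by positivity)
    filter_upwards [hs.prod_mk (Metric.ball_mem_nhds x₀ (half_pos hr))] with q hq
    refine moll_eventuallyEq hR hq.1.1 (r := r / 2) ?_ ?_
    · have := (lt_div_iff₀ hR0).1 hq.1.2
      linarith
    · filter_upwards [h] with y hy hd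
      refine (hy ?_).symm
      have h3 : dist q.2 x₀ < r / 2 := hq.2
      linarith [dist_triangle y q.2 x₀]
  exact ⟨h1.congr' (hev.mono fun q hq => hq.eq_of_nhds),
    h2.congr' (hev.mono fun q hq => hq.fderiv_eq)⟩

/-- An average stays in a half-space containing the averaged values. This gives the regularizations
a definite crossing speed when both sides of a discontinuity have one. -/
theorem IsMollifier.le_apply_moll {R : ℝ} (hR : Function.support m ⊆ Metric.ball 0 R) (hε : 0 < ε)
    {g : Space n → G} (hg : LocallyIntegrable g) (ν : G →L[ℝ] ℝ) {a : ℝ} {x : Space n}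
    (h : ∀ᵐ y, dist y x < R * ε → a ≤ ν (g y)) : a ≤ ν (moll m ε g x) := by
  have hex := (hm.hasCompactSupport_rescale hε).convolutionExists_left
    (ContinuousLinearMap.lsmul ℝ ℝ : ℝ →L[ℝ] G →L[ℝ] G) hm.contDiff_rescale.continuous hg x
  have h1 : ν (moll m ε g x) = ∫ y, rescale m ε y * ν (g (x - y)) := by
    have := ν.integral_comp_comm hex
    simpa [moll, convolution] using this.symm
  have hint : Integrable (fun y => rescale m ε y * ν (g (x - y))) := by
    have := ν.integrable_comp hex
    simpa using this
  have hint2 : Integrable (rescale m ε) :=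
    hm.contDiff_rescale.continuous.integrable_of_hasCompactSupport (hm.hasCompactSupport_rescale hε)
  rw [h1]
  calc a = ∫ y, rescale m ε y * a := by
        rw [integral_mul_const, hm.integral_rescale hε, one_mul]
    _ ≤ _ := by
      refine integral_mono_ae (hint2.mul_const a) hint ?_
      have h2 : ∀ᵐ y, dist (x - y) x < R * ε → a ≤ ν (g (x - y)) :=
        (quasiMeasurePreserving_sub_left volume x).ae h
      filter_upwards [h2] with y hy
      by_cases h0 : y ∈ Function.support (rescale m ε)
      · have := support_rescale_subset hR hε h0
        exact mul_le_mul_of_nonneg_left (hy (by simpa [dist_eq_norm] using this))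
          (hm.rescale_nonneg hε y)
      · rw [Function.notMem_support] at h0
        simp [h0]

/-- Substituting `y = ε • w` isolates the factor `ε⁻¹`; what remains is an integral over a support
independent of `ε`. -/
theorem IsMollifier.fderiv_moll_apply (hε : 0 < ε) {g : Space n → G} (hg : LocallyIntegrable g)
    (x v : Space n) :
    fderiv ℝ (moll m ε g) x v = ε⁻¹ • ∫ w, (fderiv ℝ m w v) • g (x - ε • w) := by
  obtain ⟨L, hL, hLv⟩ := hasFDerivAt_convolution_smul (hm.contDiff_rescale.of_le (by simp))
    (hm.hasCompactSupport_rescale hε) hg x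
  have h1 : fderiv ℝ (moll m ε g) x = L := hL.fderiv
  rw [h1, hLv]
  have h2 := Measure.integral_comp_inv_smul_of_nonneg (volume : Measure (Space n))
    (fun w => (fderiv ℝ m w v) • g (x - ε • w)) hε.le
  simp only [smul_smul, mul_inv_cancel₀ hε.ne', one_smul, finrank_euclideanSpace, Fintype.card_fin] at h2
  simp only [hm.fderiv_rescale, mul_smul]
  rw [integral_smul, integral_smul]
  have h3 : ε ^ n ≠ 0 := by positivity
  rw [h2, smul_smul, smul_smul]
  congr 1
  field_simp

theorem IsMollifier.integrable_fderiv_smul (hε : 0 < ε) {g : Space n → G}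
    (hg : LocallyIntegrable g) (x v : Space n) :
    Integrable fun w => (fderiv ℝ m w v) • g (x - ε • w) := by
  have hc : Continuous fun w => fderiv ℝ m w v :=
    (hm.smooth.continuous_fderiv (by simp)).clm_apply continuous_const
  have hcs : HasCompactSupport fun w => fderiv ℝ m w v := hm.hasCompactSupport.fderiv_apply ℝ v
  have hex := (hcs.comp_smul (inv_ne_zero hε.ne')).convolutionExists_left
    (ContinuousLinearMap.lsmul ℝ ℝ : ℝ →L[ℝ] G →L[ℝ] G) (hc.comp (continuous_const_smul ε⁻¹)) hg x
  have := (integrable_comp_smul_iff (volume : Measure (Space n)) _ hε.ne').2 hex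
  simpa [smul_smul, inv_mul_cancel₀ hε.ne'] using this

theorem IsMollifier.exists_norm_fderiv_moll_le {g : Space n → G} (hg : LocallyIntegrable g)
    {K : ℝ} (hK : ∀ x, ‖g x‖ ≤ K) :
    ∃ C ≥ 0, ∀ ε > 0, ∀ x, ‖fderiv ℝ (moll m ε g) x‖ ≤ C / ε := by
  have hK0 : 0 ≤ K := (norm_nonneg _).trans (hK 0)
  have hint : Integrable fun w => ‖fderiv ℝ m w‖ :=
    ((hm.smooth.continuous_fderiv (by simp)).integrable_of_hasCompactSupport
      (hm.hasCompactSupport.fderiv ℝ)).norm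
  have hI : 0 ≤ ∫ w, ‖fderiv ℝ m w‖ := integral_nonneg fun _ => norm_nonneg _
  refine ⟨(∫ w, ‖fderiv ℝ m w‖) * K, by positivity, fun ε hε x => ?_⟩
  refine ContinuousLinearMap.opNorm_le_bound _ (by positivity) fun v => ?_
  rw [hm.fderiv_moll_apply hε hg, norm_smul, norm_inv, Real.norm_of_nonneg hε.le]
  have : ‖∫ w, (fderiv ℝ m w v) • g (x - ε • w)‖ ≤ ∫ w, ‖fderiv ℝ m w‖ * (‖v‖ * K) := by
    refine norm_integral_le_of_norm_le (hint.mul_const _) (Eventually.of_forall fun w => ?_)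
    rw [norm_smul, ← mul_assoc]
    exact mul_le_mul ((fderiv ℝ m w).le_opNorm v) (hK _) (norm_nonneg _) (by positivity)
  rw [integral_mul_const] at this
  calc _ ≤ ε⁻¹ * ((∫ w, ‖fderiv ℝ m w‖) * (‖v‖ * K)) := by gcongr
    _ = _ := by ring

/-- The integral is the derivative in direction `v` of the convolution of `m` with a step function
which is invariant under translation by `v`. -/
theorem IsMollifier.integral_fderiv_halfSpace (ν : Space n →L[ℝ] ℝ) (c : ℝ) (a b : G)
    {v : Space n} (hv : ν v = 0) :
    ∫ w, (fderiv ℝ m w v) • (if 0 < c - ν w then a else b) = 0 := by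
  set g : Space n → G := fun y => if 0 < c + ν y then a else b with hg
  have hms : MeasurableSet {y : Space n | 0 < c + ν y} :=
    (isOpen_lt continuous_const (by fun_prop)).measurableSet
  have hgint : LocallyIntegrable g := by
    have : g = {y | 0 < c + ν y}.indicator (fun _ => a) + {y | 0 < c + ν y}ᶜ.indicator (fun _ => b) := by
      ext y
      by_cases h : 0 < c + ν y <;> simp [hg, h]
    rw [this]
    exact ((locallyIntegrable_const a).indicator hms).add
      ((locallyIntegrable_const b).indicator hms.compl)
  obtain ⟨L, hL, hLv⟩ := hasFDerivAt_convolution_smul (hm.smooth.of_le (by simp))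
    hm.hasCompactSupport hgint 0
  have h1 := hLv v
  simp only [zero_sub, hg, map_neg, ← sub_eq_add_neg] at h1
  rw [← h1]
  have hline : HasDerivAt (fun t : ℝ => t • v) v 0 := by
    simpa using (hasDerivAt_id (0 : ℝ)).smul_const v
  have h2 := HasFDerivAt.comp_hasDerivAt_of_eq (f := fun t : ℝ => t • v) 0 hL hline (by simp)
  refine h2.unique ((hasDerivAt_const (0 : ℝ)
    (convolution m g (ContinuousLinearMap.lsmul ℝ ℝ) volume 0)).congr_of_eventuallyEq
      (Eventually.of_forall fun t => ?_))
  simp only [Function.comp, convolution]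
  congr 1
  ext y
  simp [hg, hv]

-- At distance at most `ε * R` the linearization of `h` errs by at most `ε * κ / 2`, so it gives the
-- correct sign wherever its value exceeds `ε * κ` in absolute value.
omit hm in
theorem eq_halfSpace_of_approx {h : Space n → ℝ} {ν : Space n →L[ℝ] ℝ} {x w : Space n} {κ R : ℝ}
    (hε : 0 < ε) (hR : 0 < R) (hκ : 0 < κ) (hw : ‖w‖ ≤ R)
    (happ : ‖h (x - ε • w) - h x - ν ((x - ε • w) - x)‖ ≤ κ / (2 * R) * ‖(x - ε • w) - x‖)
    (hslab : κ < |h x / ε - ν w|) : 0 < h (x - ε • w) ↔ 0 < h x / ε - ν w := by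
  have e1 : (x - ε • w) - x = -(ε • w) := by abel
  have e2 : h x = ε * (h x / ε) := by field_simp
  rw [e1, norm_neg, norm_smul, Real.norm_of_nonneg hε.le, map_neg, map_smul, smul_eq_mul,
    Real.norm_eq_abs] at happ
  have h1 : κ / (2 * R) * (ε * ‖w‖) ≤ ε * κ / 2 := by
    calc κ / (2 * R) * (ε * ‖w‖) ≤ κ / (2 * R) * (ε * R) := by gcongr
      _ = ε * κ / 2 := by field_simp
  obtain ⟨h2, h3⟩ := abs_le.1 (happ.trans h1)
  have h4 : 0 < ε * κ := by positivity
  set c := h x / ε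
  rw [e2] at h2 h3
  rcases lt_abs.1 hslab with h5 | h5
  · have h6 := mul_lt_mul_of_pos_left h5 hε
    constructor <;> intro <;> nlinarith
  · have h6 := mul_lt_mul_of_pos_left h5 hε
    constructor <;> intro <;> nlinarith

/-- In directions tangent to the discontinuity the derivative of the regularization is of lower order. -/
theorem IsMollifier.eventually_fderiv_moll_tangent_le {g A B : Space n → G}
    (hg : LocallyIntegrable g) {h : Space n → ℝ} {ν : Space n →L[ℝ] ℝ} {p : Space n}
    (hh : HasStrictFDerivAt h ν p) (hν : ν ≠ 0) (hA : ContinuousAt A p) (hB : ContinuousAt B p)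
    {r : ℝ} (hr : 0 < r) (hgAB : ∀ y, dist y p < r → g y = if 0 < h y then A y else B y)
    {η : ℝ} (hη : 0 < η) :
    ∀ᶠ q : ℝ × Space n in 𝓝[>] 0 ×ˢ 𝓝 p, ∀ v, ν v = 0 →
      ‖fderiv ℝ (moll m q.1 g) q.2 v‖ ≤ η / q.1 * ‖v‖ := by
  obtain ⟨R, hR0, hR⟩ := hm.exists_radius
  obtain ⟨D₀, hD₀⟩ := (hm.hasCompactSupport.fderiv ℝ).exists_bound_of_continuous
    (hm.smooth.continuous_fderiv (by simp))
  set D := max D₀ 1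
  have hD : ∀ w, ‖fderiv ℝ m w‖ ≤ D := fun w => (hD₀ w).trans (le_max_left _ _)
  have hD1 : 0 < D := lt_of_lt_of_le one_pos (le_max_right _ _)
  set V := (volume : Measure (Space n)).real (Metric.closedBall 0 R)
  have hV : 0 ≤ V := measureReal_nonneg
  set Q := 2 * (‖A p‖ + ‖B p‖) + 1 with hQ
  have hQ0 : 0 < Q := by positivity
  set η₁ := min 1 (η / (D * (V + Q)))
  have hη₁ : 0 < η₁ := lt_min one_pos (by positivity)
  obtain ⟨κ, hκ, hslab⟩ := exists_volume_slab_le (volume : Measure (Space n)) hν R hη₁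
  have hstrict : ∀ᶠ z : Space n × Space n in 𝓝 (p, p),
      ‖h z.1 - h z.2 - ν (z.1 - z.2)‖ ≤ κ / (2 * R) * ‖z.1 - z.2‖ :=
    hh.isLittleO.bound (by positivity)
  obtain ⟨δ₁, hδ₁, hst⟩ := Metric.eventually_nhds_iff.1 hstrict
  obtain ⟨δ₂, hδ₂, hA'⟩ := Metric.eventually_nhds_iff.1 (hA.eventually (Metric.ball_mem_nhds _ hη₁))
  obtain ⟨δ₃, hδ₃, hB'⟩ := Metric.eventually_nhds_iff.1 (hB.eventually (Metric.ball_mem_nhds _ hη₁))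
  set δ := min (min δ₁ r) (min δ₂ δ₃)
  have hδ : 0 < δ := lt_min (lt_min hδ₁ hr) (lt_min hδ₂ hδ₃)
  have hs : ∀ᶠ ε : ℝ in 𝓝[>] 0, ε ∈ Ioo 0 (δ / 2 / R) := Ioo_mem_nhdsGT (by positivity)
  filter_upwards [hs.prod_mk (Metric.ball_mem_nhds p (half_pos hδ))] with q hq v hv
  obtain ⟨⟨hε, hεδ⟩, hx⟩ := hq
  obtain ⟨ε, x⟩ := q
  simp only at hε hεδ hx
  rw [lt_div_iff₀ hR0] at hεδ

  -- Seen at scale `ε`, `g` is nearly the step function `Gc`, which contributes nothing by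
  -- `integral_fderiv_halfSpace`. The difference is at most `η₁` outside the slab around the
  -- interface and at most `η₁ + Q` inside it, and the slab has measure at most `η₁`.
  set Gc : Space n → G := fun w => if 0 < h x / ε - ν w then A p else B p
  have hz : ∀ w, ‖w‖ ≤ R → dist (x - ε • w) p < δ := fun w hw => by
    have : dist (x - ε • w) x ≤ ε * R := by
      rw [dist_eq_norm, sub_sub_cancel_left, norm_neg, norm_smul, Real.norm_of_nonneg hε.le]
      gcongr
    linarith [dist_triangle (x - ε • w) x p]
  have hxδ : dist x p < δ := by linarith
  have hval : ∀ w, ‖w‖ ≤ R → ‖g (x - ε • w) - Gc w‖ ≤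
      η₁ + ({w | |h x / ε - ν w| ≤ κ}).indicator (fun _ => Q) w := fun w hw => by
    have hzw := hz w hw
    have hzr : dist (x - ε • w) p < r := hzw.trans_le ((min_le_left _ _).trans (min_le_right _ _))
    have hAz : ‖A (x - ε • w) - A p‖ < η₁ := by
      rw [← dist_eq_norm]
      exact hA' (hzw.trans_le ((min_le_right _ _).trans (min_le_left _ _)))
    have hBz : ‖B (x - ε • w) - B p‖ < η₁ := by
      rw [← dist_eq_norm]
      exact hB' (hzw.trans_le ((min_le_right _ _).trans (min_le_right _ _)))
    rw [hgAB _ hzr]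
    by_cases hsl : |h x / ε - ν w| ≤ κ
    · rw [Set.indicator_of_mem (show w ∈ {w | |h x / ε - ν w| ≤ κ} from hsl)]
      have hη1 : η₁ ≤ 1 := min_le_left _ _
      have a1 := norm_le_norm_add_norm_sub' (A (x - ε • w)) (A p)
      have b1 := norm_le_norm_add_norm_sub' (B (x - ε • w)) (B p)
      refine (norm_sub_le _ _).trans ?_
      have a2 := norm_nonneg (A p)
      have b2 := norm_nonneg (B p)
      simp only [Gc]
      split_ifs <;> linarith
    · rw [Set.indicator_of_notMem (show w ∉ {w | |h x / ε - ν w| ≤ κ} from hsl), add_zero]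
      have hiff := eq_halfSpace_of_approx hε hR0 hκ hw
        (hst (y := (x - ε • w, x)) (by
          rw [Prod.dist_eq]
          exact max_lt (hzw.trans_le ((min_le_left _ _).trans (min_le_left _ _)))
            (hxδ.trans_le ((min_le_left _ _).trans (min_le_left _ _))))) (not_le.1 hsl)
      simp only [Gc, hiff]
      split_ifs
      · exact hAz.le
      · exact hBz.le
  have hGcm : StronglyMeasurable Gc := by
    refine StronglyMeasurable.ite ?_ stronglyMeasurable_const stronglyMeasurable_const
    exact (isOpen_lt continuous_const (by fun_prop)).measurableSet
  have hc : Continuous fun w => fderiv ℝ m w v :=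
    (hm.smooth.continuous_fderiv (by simp)).clm_apply continuous_const
  have hcs : HasCompactSupport fun w => fderiv ℝ m w v := hm.hasCompactSupport.fderiv_apply ℝ v
  have hi1 := hm.integrable_fderiv_smul hε hg x v
  have hi2 : Integrable fun w => (fderiv ℝ m w v) • Gc w := by
    refine Integrable.mono ((hc.integrable_of_hasCompactSupport hcs).mul_const (‖A p‖ + ‖B p‖))
      (hc.stronglyMeasurable.smul hGcm).aestronglyMeasurable (Eventually.of_forall fun w => ?_)
    rw [norm_smul, norm_mul, Real.norm_of_nonneg (by positivity : 0 ≤ ‖A p‖ + ‖B p‖)]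
    gcongr
    simp only [Gc]
    split_ifs
    · linarith [norm_nonneg (B p)]
    · linarith [norm_nonneg (A p)]
  have hzero : ∫ w, (fderiv ℝ m w v) • Gc w = 0 := hm.integral_fderiv_halfSpace ν _ _ _ hv
  have hslabm : MeasurableSet (Metric.closedBall (0 : Space n) R ∩ {w | |h x / ε - ν w| ≤ κ}) :=
    (Metric.isClosed_closedBall.inter (isClosed_le (by fun_prop) continuous_const)).measurableSet
  have hfin : (volume : Measure (Space n)) (Metric.closedBall 0 R) ≠ ⊤ :=
    (isCompact_closedBall _ _).measure_ne_top
  have hb1 : Integrable ((Metric.closedBall (0 : Space n) R).indicator fun _ => η₁) :=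
    (integrableOn_const hfin).integrable_indicator Metric.isClosed_closedBall.measurableSet
  have hb2 : Integrable ((Metric.closedBall (0 : Space n) R ∩
      {w | |h x / ε - ν w| ≤ κ}).indicator fun _ => Q) :=
    (integrableOn_const (ne_top_of_le_ne_top hfin
      (measure_mono inter_subset_left))).integrable_indicator hslabm
  rw [hm.fderiv_moll_apply hε hg, norm_smul, norm_inv, Real.norm_of_nonneg hε.le]
  have hsub : ∫ w, (fderiv ℝ m w v) • g (x - ε • w) =
      ∫ w, (fderiv ℝ m w v) • (g (x - ε • w) - Gc w) := by
    simp only [smul_sub]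
    rw [integral_sub hi1 hi2, hzero, sub_zero]
  have hest : ‖∫ w, (fderiv ℝ m w v) • (g (x - ε • w) - Gc w)‖ ≤
      ∫ w, D * ‖v‖ * ((Metric.closedBall (0 : Space n) R).indicator (fun _ => η₁) w +
        (Metric.closedBall (0 : Space n) R ∩ {w | |h x / ε - ν w| ≤ κ}).indicator (fun _ => Q) w) := by
    refine norm_integral_le_of_norm_le ((hb1.add hb2).const_mul _) (Eventually.of_forall fun w => ?_)
    by_cases hw : w ∈ Metric.closedBall (0 : Space n) R
    · rw [norm_smul, ← Set.indicator_indicator, Set.indicator_of_mem hw, Set.indicator_of_mem hw]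
      exact mul_le_mul (((fderiv ℝ m w).le_opNorm v).trans (by gcongr; exact hD w))
        (hval w (by simpa using hw)) (norm_nonneg _) (by positivity)
    · have h0 : fderiv ℝ m w = 0 := by
        by_contra hne
        refine hw ?_
        have h1 := support_fderiv_subset ℝ (f := m) hne
        have h2 := closure_mono hR h1
        exact Metric.closure_ball_subset_closedBall h2
      rw [Set.indicator_of_notMem hw, Set.indicator_of_notMem (fun h => hw h.1), h0]
      simp
  rw [integral_const_mul, integral_add hb1 hb2,
    integral_indicator_const _ Metric.isClosed_closedBall.measurableSet,
    integral_indicator_const _ hslabm] at hest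
  simp only [smul_eq_mul] at hest
  have hfinal : D * (V * η₁ + η₁ * Q) ≤ η := by
    have h1 : η₁ ≤ η / (D * (V + Q)) := min_le_right _ _
    have h2 : η₁ * (D * (V + Q)) ≤ η := (le_div_iff₀ (by positivity)).1 h1
    linarith
  rw [hsub]
  calc ε⁻¹ * ‖∫ w, (fderiv ℝ m w v) • (g (x - ε • w) - Gc w)‖
      ≤ ε⁻¹ * (D * ‖v‖ * (V * η₁ + η₁ * Q)) := by
        gcongr
        refine hest.trans ?_
        have := hslab (h x / ε)
        gcongr
    _ = ε⁻¹ * ‖v‖ * (D * (V * η₁ + η₁ * Q)) := by ring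
    _ ≤ ε⁻¹ * ‖v‖ * η := by gcongr
    _ = η / ε * ‖v‖ := by ring

end Rescale

end Mollify

/-! ### Estimates for orbits crossing a thin layer. -/

section Basic

variable {E : Type*} [NormedAddCommGroup E] [NormedSpace ℝ E]

theorem eventually_nhdsGT_prod_nhds_iff {E : Type*} [PseudoMetricSpace E] {p : E} {P : ℝ × E → Prop} :
    (∀ᶠ q in 𝓝[>] (0 : ℝ) ×ˢ 𝓝 p, P q) ↔
      ∃ ρ > 0, ∀ ε ∈ Ioo 0 ρ, ∀ x ∈ Metric.ball p ρ, P (ε, x) := by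
  constructor
  · intro h
    obtain ⟨pa, ha, pb, hb, hab⟩ := eventually_prod_iff.1 h
    obtain ⟨u, hu, hua⟩ := mem_nhdsGT_iff_exists_Ioo_subset.1 ha
    obtain ⟨ρ, hρ, hρb⟩ := Metric.mem_nhds_iff.1 hb
    refine ⟨min u ρ, lt_min hu hρ, fun ε hε x hx => hab (hua ⟨hε.1, ?_⟩) (hρb ?_)⟩
    · exact hε.2.trans_le (min_le_left _ _)
    · exact Metric.ball_subset_ball (min_le_right _ _) hx
  · rintro ⟨ρ, hρ, h⟩
    have h1 : ∀ᶠ ε in 𝓝[>] (0 : ℝ), ε ∈ Ioo 0 ρ := Ioo_mem_nhdsGT hρ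
    filter_upwards [h1.prod_mk (Metric.ball_mem_nhds p hρ)] with q hq
    exact h q.1 hq.1 q.2 hq.2

theorem gronwallBound_le_mul_exp {δ K ε x : ℝ} (hK : 1 ≤ K) (hε : 0 ≤ ε) (hx : 0 ≤ x) :
    gronwallBound δ K ε x ≤ (δ + ε) * Real.exp (K * x) := by
  have hK0 : 0 < K := by linarith
  rw [gronwallBound_of_K_ne_0 hK0.ne']
  have h1 : 1 ≤ Real.exp (K * x) := Real.one_le_exp (by positivity)
  have h2 : ε / K ≤ ε := div_le_self hε hK
  have h3 : ε / K * (Real.exp (K * x) - 1) ≤ ε * Real.exp (K * x) :=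
    mul_le_mul h2 (by linarith) (by linarith) hε
  linarith

namespace IsFlow

variable {X : E → E} {Φ : ℝ → E → E} {W : ℝ → E → E →L[ℝ] E}

theorem norm_sub_le (hF : IsFlow X Φ W) {K : ℝ} (hK : ∀ x, ‖X x‖ ≤ K) (x : E) (s t : ℝ) :
    ‖Φ t x - Φ s x‖ ≤ K * |t - s| :=
  convex_univ.norm_image_sub_le_of_norm_hasDerivWithin_le
    (fun r _ => (hF.hasDerivAt r x).hasDerivWithinAt) (fun _ _ => hK _) trivial trivial

theorem flux_le (hF : IsFlow X Φ W) {h : E → ℝ} {B : Set E} {a : ℝ} {x : E} {s t : ℝ}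
    (hh : ∀ y ∈ B, DifferentiableAt ℝ h y) (ha : ∀ y ∈ B, a ≤ fderiv ℝ h y (X y)) (hst : s ≤ t)
    (hB : ∀ r ∈ Icc s t, Φ r x ∈ B) : a * (t - s) ≤ h (Φ t x) - h (Φ s x) := by
  have hd : ∀ r ∈ Icc s t, HasDerivAt (fun r => h (Φ r x)) (fderiv ℝ h (Φ r x) (X (Φ r x))) r :=
    fun r hr => (hh _ (hB r hr)).hasFDerivAt.comp_hasDerivAt r (hF.hasDerivAt r x)
  refine (convex_Icc s t).mul_sub_le_image_sub_of_le_deriv (f := fun r => h (Φ r x))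
    (HasDerivAt.continuousOn hd)
    (fun r hr => (hd r (interior_subset hr)).differentiableAt.differentiableWithinAt)
    (fun r hr => ?_) s ⟨le_rfl, hst⟩ t ⟨hst, le_rfl⟩ hst
  rw [(hd r (interior_subset hr)).deriv]
  exact ha _ (hB r (interior_subset hr))

/-- The variational equation along an orbit which crosses a thin layer `|h| ≲ ε` with positive
speed. -/
theorem norm_linear_sub_le (hF : IsFlow X Φ W) {h : E → ℝ} {B : Set E} {a ε κ K K₁ T : ℝ}
    {x v : E} (ha : 0 < a) (hε : 0 < ε) (hκ : 0 < κ) (hκ1 : κ ≤ 1) (hK : 0 ≤ K) (hK₁ : 0 ≤ K₁)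
    (hT : 0 ≤ T) (hh : ∀ y ∈ B, DifferentiableAt ℝ h y) (hflux : ∀ y ∈ B, a ≤ fderiv ℝ h y (X y))
    (hDX : ∀ y ∈ B, ‖fderiv ℝ X y‖ ≤ K + K₁ / ε / (1 + (h y / ε) ^ 2))
    (hDXv : ∀ y ∈ B, ‖fderiv ℝ X y v‖ ≤ (K + κ * (K₁ / ε / (1 + (h y / ε) ^ 2))) * ‖v‖)
    (hB : ∀ t ∈ Icc 0 T, Φ t x ∈ B) :
    ‖W T x v - v‖ ≤ κ * ‖v‖ * (Real.exp ((K / κ + 1) * T + K₁ / a * Real.pi) - 1) := by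
  rcases eq_or_ne v 0 with rfl | hv
  · simp
  have hv0 : 0 < ‖v‖ := norm_pos_iff.2 hv
  -- As `h` grows at rate at least `a`, the singular bound `K₁ / ε / (1 + (h / ε) ^ 2)` is at most
  -- the time derivative of `K₁ / a * arctan (h / ε)`, whose total increase is at most `K₁ / a * π`
  -- whatever `ε` is. The rate `K / κ` instead of `K` lets the source term `K * ‖v‖` be compared
  -- with the barrier scale `κ * ‖v‖`, and `+ 1` makes the inequality strict.
  set H : ℝ → ℝ := fun t =>
    (K / κ + 1) * t + K₁ / a * (Real.arctan (h (Φ t x) / ε) - Real.arctan (h (Φ 0 x) / ε)) with hH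
  set H' : ℝ → ℝ := fun t => (K / κ + 1) + K₁ / a *
    (1 / (1 + (h (Φ t x) / ε) ^ 2) * (fderiv ℝ h (Φ t x) (X (Φ t x)) / ε)) with hH'
  have hHd : ∀ t ∈ Icc 0 T, HasDerivAt H (H' t) t := fun t ht => by
    have h1 : HasDerivAt (fun r => h (Φ r x)) (fderiv ℝ h (Φ t x) (X (Φ t x))) t :=
      (hh _ (hB t ht)).hasFDerivAt.comp_hasDerivAt t (hF.hasDerivAt t x)
    have h2 := ((h1.div_const ε).arctan.sub_const (Real.arctan (h (Φ 0 x) / ε))).const_mul (K₁ / a)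
    have h3 := (hasDerivAt_id t).const_mul (K / κ + 1)
    rw [mul_one] at h3
    exact h3.add h2
  have hBd : ∀ t ∈ Icc 0 T, HasDerivAt (fun t => κ * ‖v‖ * (Real.exp (H t) - 1))
      (κ * ‖v‖ * (Real.exp (H t) * H' t)) t := fun t ht =>
    (((hHd t ht).exp).sub_const 1).const_mul _
  have hf : ∀ t, HasDerivAt (fun t => W t x v - v) (fderiv ℝ X (Φ t x) (W t x v)) t := fun t => by
    have := ((hF.hasDerivAt_linear t x).clm_apply (hasDerivAt_const t v)).sub_const v
    simpa using this
  have key := image_norm_le_of_norm_deriv_right_lt_deriv_boundary' (f := fun t => W t x v - v)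
    (f' := fun t => fderiv ℝ X (Φ t x) (W t x v)) (a := 0) (b := T)
    (HasDerivAt.continuousOn fun t _ => hf t) (fun t _ => (hf t).hasDerivWithinAt)
    (B := fun t => κ * ‖v‖ * (Real.exp (H t) - 1)) (B' := fun t => κ * ‖v‖ * (Real.exp (H t) * H' t))
    (by simp [hF.linear_zero, hH]) (HasDerivAt.continuousOn hBd)
    (fun t ht => (hBd t (Ico_subset_Icc_self ht)).hasDerivWithinAt) (fun t ht heq => ?_)
    (show T ∈ Icc 0 T from ⟨hT, le_rfl⟩)
  · refine key.trans ?_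
    have h1 := Real.arctan_lt_pi_div_two (h (Φ T x) / ε)
    have h2 := Real.neg_pi_div_two_lt_arctan (h (Φ 0 x) / ε)
    have h3 : K₁ / a * (Real.arctan (h (Φ T x) / ε) - Real.arctan (h (Φ 0 x) / ε)) ≤
        K₁ / a * Real.pi := mul_le_mul_of_nonneg_left (by linarith) (by positivity)
    gcongr
    simp only [hH]
    linarith
  · have hmem := hB t (Ico_subset_Icc_self ht)
    set y := Φ t x
    set Λ := K₁ / ε / (1 + (h y / ε) ^ 2) with hΛ
    have hΛ0 : 0 ≤ Λ := by positivity
    have hKκ : K ≤ K / κ := le_div_self hK hκ hκ1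
    have hH'le : K / κ + Λ + 1 ≤ H' t := by
      have h1 : Λ ≤ K₁ / a * (1 / (1 + (h y / ε) ^ 2) * (fderiv ℝ h y (X y) / ε)) := by
        have h2 : K₁ / a * (1 / (1 + (h y / ε) ^ 2) * (a / ε)) = Λ := by
          rw [hΛ]; field_simp
        rw [← h2]
        have := hflux y hmem
        gcongr
      simp only [hH']
      linarith
    have e : fderiv ℝ X y (W t x v) = fderiv ℝ X y (W t x v - v) + fderiv ℝ X y v := by
      rw [map_sub]; abel
    have hle : ‖fderiv ℝ X y (W t x v)‖ ≤
        (K + Λ) * (κ * ‖v‖ * (Real.exp (H t) - 1)) + (K + κ * Λ) * ‖v‖ := by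
      rw [e]
      refine (norm_add_le _ _).trans (add_le_add ?_ (hDXv y hmem))
      rw [← heq]
      exact ((fderiv ℝ X y).le_opNorm _).trans (mul_le_mul_of_nonneg_right (hDX y hmem) (norm_nonneg _))
    refine hle.trans_lt ?_
    have hexp : 0 < Real.exp (H t) := Real.exp_pos _
    have hB0 : 0 ≤ κ * ‖v‖ * (Real.exp (H t) - 1) := by rw [← heq]; exact norm_nonneg _
    have h1 : (K + Λ) * (κ * ‖v‖ * (Real.exp (H t) - 1)) ≤
        (K / κ + Λ) * (κ * ‖v‖ * (Real.exp (H t) - 1)) :=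
      mul_le_mul_of_nonneg_right (by linarith) hB0
    have h2 : (K + κ * Λ) * ‖v‖ = (K / κ + Λ) * (κ * ‖v‖) := by field_simp
    have h3 : κ * ‖v‖ * (Real.exp (H t) * (K / κ + Λ + 1)) ≤ κ * ‖v‖ * (Real.exp (H t) * H' t) := by
      gcongr
    have h4 : 0 < κ * ‖v‖ * Real.exp (H t) := by positivity
    rw [h2]
    linarith

end IsFlow

/-- Points reached at all times before `τ` determine the point reached at time `τ`. -/
theorem c0Reach_of_forall_lt {ι : Type*} {l : Filter ι} {X : ι → E → E} {Φ : ι → ℝ → E → E}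
    {W : ι → ℝ → E → E →L[ℝ] E} (hF : ∀ i, IsFlow (X i) (Φ i) (W i)) {K : ℝ}
    (hK : ∀ i x, ‖X i x‖ ≤ K) {x : E} {τ : ℝ} {c : ℝ → E}
    (hc : ContinuousWithinAt c (Iio τ) τ) (hτ : 0 < τ)
    (h : ∀ s, 0 < s → s < τ → C0Reach l Φ x s (c s)) : C0Reach l Φ x τ (c τ) := by
  refine Metric.tendsto_nhds.2 fun η hη => ?_
  have h1 : ∀ᶠ s in 𝓝[<] τ, dist (c s) (c τ) < η / 3 := hc (Metric.ball_mem_nhds _ (by positivity))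
  have h2 : ∀ᶠ s in 𝓝[<] τ, K * |τ - s| < η / 3 := by
    have : Tendsto (fun s => K * |τ - s|) (𝓝[<] τ) (𝓝 0) := by
      have : Continuous fun s => K * |τ - s| := by fun_prop
      simpa using (this.tendsto τ).mono_left nhdsWithin_le_nhds
    exact this.eventually_lt_const (by positivity)
  have h3 : ∀ᶠ s in 𝓝[<] τ, s ∈ Ioo 0 τ := Ioo_mem_nhdsLT hτ
  obtain ⟨s, hs1, hs2, hs3⟩ := (h1.and (h2.and h3)).exists
  filter_upwards [Metric.tendsto_nhds.1 (h s hs3.1 hs3.2) (η / 3) (by positivity)] with q hq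
  have h4 := (hF q.1).norm_sub_le (hK q.1) q.2 s τ
  rw [← dist_eq_norm] at h4
  linarith [dist_triangle4 (Φ q.1 τ q.2) (Φ q.1 s q.2) (c s) (c τ)]

end Basic

/-! ### Crossing a discontinuity: leaving it, and the saltation matrix. -/

section Crossing

variable {E : Type*} [NormedAddCommGroup E] [NormedSpace ℝ E]

/-- The jump of the linearized flow at a discontinuity with tangent space `ker ν`, across which the
vector field jumps from `a` to `b`. -/
noncomputable def saltation (ν : E →L[ℝ] ℝ) (a b : E) : E →L[ℝ] E :=
  1 + (((ν a)⁻¹ • ν).smulRight (b - a))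

theorem saltation_apply_of_mem_ker {ν : E →L[ℝ] ℝ} (a b : E) {v : E} (hv : ν v = 0) :
    saltation ν a b v = v := by
  simp [saltation, hv]

theorem saltation_apply_self {ν : E →L[ℝ] ℝ} {a : E} (b : E) (ha : ν a ≠ 0) :
    saltation ν a b a = b := by
  simp [saltation, ha]

/-- A linear map is determined by its restriction to `ker ν` and its value at one vector `a` off the
kernel; the constants are the norms of the corresponding decomposition `w = v + α • a`. -/
theorem norm_sub_saltation_le {ν : E →L[ℝ] ℝ} {a b : E} (ha : ν a ≠ 0) {A : E →L[ℝ] E} {η₁ η₂ : ℝ}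
    (hη₁ : 0 ≤ η₁) (hη₂ : 0 ≤ η₂)
    (h₁ : ∀ v, ν v = 0 → ‖A v - v‖ ≤ η₁ * ‖v‖) (h₂ : ‖A a - b‖ ≤ η₂) :
    ‖A - saltation ν a b‖ ≤ η₁ * (1 + |(ν a)⁻¹| * ‖ν‖ * ‖a‖) + |(ν a)⁻¹| * ‖ν‖ * η₂ := by
  refine ContinuousLinearMap.opNorm_le_bound _ (by positivity) fun w => ?_
  set α := (ν a)⁻¹ * ν w
  set v := w - α • a with hv
  have hνv : ν v = 0 := by
    simp only [hv, map_sub, map_smul, smul_eq_mul, α]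
    field_simp; ring
  have hw : w = v + α • a := by simp [hv]
  have hα : |α| ≤ |(ν a)⁻¹| * ‖ν‖ * ‖w‖ := by
    rw [abs_mul, mul_assoc]
    exact mul_le_mul_of_nonneg_left (ν.le_opNorm w) (abs_nonneg _)
  have hvn : ‖v‖ ≤ (1 + |(ν a)⁻¹| * ‖ν‖ * ‖a‖) * ‖w‖ := by
    refine (norm_sub_le _ _).trans ?_
    rw [norm_smul, Real.norm_eq_abs]
    nlinarith [mul_le_mul_of_nonneg_right hα (norm_nonneg a)]
  have e : (A - saltation ν a b) w = (A v - v) + α • (A a - b) := by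
    conv_lhs => rw [hw]
    simp only [sub_apply, map_add, map_smul, saltation_apply_of_mem_ker a b hνv,
      saltation_apply_self b ha, smul_sub]
  rw [e]
  refine (norm_add_le _ _).trans ?_
  rw [norm_smul, Real.norm_eq_abs, add_mul]
  refine add_le_add ((h₁ v hνv).trans ?_) ?_
  · rw [mul_assoc]
    exact mul_le_mul_of_nonneg_left hvn hη₁
  · calc |α| * ‖A a - b‖ ≤ (|(ν a)⁻¹| * ‖ν‖ * ‖w‖) * η₂ := by gcongr
      _ = _ := by ring

/-- Bounds on the regularizations `X ε` near a point `p` of the discontinuity `{h = 0}`, which is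
crossed from `{h < 0}` to `{h > 0}` by the vector fields. -/
structure CrossingField (X : ℝ → E → E) (h : E → ℝ) (ν : E →L[ℝ] ℝ) (p : E) (Y : E → E)
    (K C a : ℝ) : Prop where
  a_pos : 0 < a
  K_pos : 0 < K
  C_nonneg : 0 ≤ C
  apply_eq_zero : h p = 0
  differentiableAt : ∀ᶠ x in 𝓝 p, DifferentiableAt ℝ h x
  norm_le : ∀ ε x, ‖X ε x‖ ≤ K
  flux : ∀ᶠ q : ℝ × E in 𝓝[>] 0 ×ˢ 𝓝 p, a ≤ fderiv ℝ h q.2 (X q.1 q.2)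
  fderiv_le : ∀ᶠ q : ℝ × E in 𝓝[>] 0 ×ˢ 𝓝 p, ‖fderiv ℝ (X q.1) q.2‖ ≤ K / q.1
  fderiv_le_off : ∀ᶠ q : ℝ × E in 𝓝[>] 0 ×ˢ 𝓝 p, C * q.1 ≤ |h q.2| → ‖fderiv ℝ (X q.1) q.2‖ ≤ K
  fderiv_tangent_le : ∀ η > 0, ∀ᶠ q : ℝ × E in 𝓝[>] 0 ×ˢ 𝓝 p, ∀ v, ν v = 0 →
    ‖fderiv ℝ (X q.1) q.2 v‖ ≤ η / q.1 * ‖v‖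
  tendsto_off : ∃ ρ > 0, ∀ η > 0, ∀ᶠ ε : ℝ in 𝓝[>] 0, ∀ x ∈ Metric.ball p ρ, C * ε ≤ h x →
    ‖X ε x - Y x‖ ≤ η

namespace CrossingField

variable {X : ℝ → E → E} {h : E → ℝ} {ν : E →L[ℝ] ℝ} {p : E} {Y : E → E} {K C a : ℝ}
  {Φ : ℝ → ℝ → E → E} {W : ℝ → ℝ → E → E →L[ℝ] E}

theorem mem_ball_of_lt (hX : CrossingField X h ν p Y K C a)
    (hF : ∀ ε, IsFlow (X ε) (Φ ε) (W ε)) {ρ T : ℝ} {ε : ℝ} {x : E} (hx : dist x p + K * T < ρ) :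
    ∀ t ∈ Icc 0 T, Φ ε t x ∈ Metric.ball p ρ := fun t ht => by
  have h1 := (hF ε).norm_sub_le (hX.norm_le ε) x 0 t
  rw [(hF ε).zero, ← dist_eq_norm, sub_zero, abs_of_nonneg ht.1] at h1
  have h2 : K * t ≤ K * T := mul_le_mul_of_nonneg_left ht.2 hX.K_pos.le
  rw [Metric.mem_ball]
  linarith [dist_triangle (Φ ε t x) x p]

/-- Orbits that start near the discontinuity leave it along the flow on the far side. -/
theorem exit (hX : CrossingField X h ν p Y K C a) (hF : ∀ ε, IsFlow (X ε) (Φ ε) (W ε))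
    {φ : ℝ → E → E} {w : ℝ → E → E →L[ℝ] E} (hY : IsFlow Y φ w) :
    ∃ r₀ > 0, ∀ r ∈ Ioc 0 r₀, C0Reach (𝓝[>] 0) Φ p r (φ r p) := by
  have hdiff : ∀ᶠ q : ℝ × E in 𝓝[>] 0 ×ˢ 𝓝 p, DifferentiableAt ℝ h q.2 :=
    tendsto_snd.eventually hX.differentiableAt
  obtain ⟨ρ₁, hρ₁, hball⟩ := eventually_nhdsGT_prod_nhds_iff.1 (hX.flux.and hdiff)
  obtain ⟨ρ₂, hρ₂, hoff⟩ := hX.tendsto_off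
  set ρ := min ρ₁ ρ₂
  have hρ : 0 < ρ := lt_min hρ₁ hρ₂
  have hK := hX.K_pos
  have ha := hX.a_pos
  have hC := hX.C_nonneg
  refine ⟨ρ / (4 * K), by positivity, fun r hr => Metric.tendsto_nhds.2 fun η hη => ?_⟩
  have hKr : K * r ≤ ρ / 4 := by
    have := mul_le_mul_of_nonneg_left hr.2 hK.le
    have e : K * (ρ / (4 * K)) = ρ / 4 := by field_simp
    linarith
  obtain ⟨L₀, hL₀⟩ := hY.lipschitz
  set L : ℝ≥0 := L₀ + 1
  have hL : LipschitzWith L Y := hL₀.weaken (by simp [L])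
  have hL1 : (1 : ℝ) ≤ L := by simp [L]
  -- Of the five units, three bound the distance at time `r'`, one the error of the field, and one
  -- keeps the final inequality strict.
  set θ := η / (5 * Real.exp (L * r)) with hθ
  have hθ0 : 0 < θ := by positivity
  have hφ : ∀ᶠ r' in 𝓝[>] (0 : ℝ), dist (φ r' p) p < θ := by
    have : Tendsto (fun t => φ t p) (𝓝[>] 0) (𝓝 p) := by
      have := (hY.continuous_time p).tendsto 0
      rw [hY.zero] at this
      exact this.mono_left nhdsWithin_le_nhds
    exact this (Metric.ball_mem_nhds _ hθ0)
  have hKr' : ∀ᶠ r' in 𝓝[>] (0 : ℝ), r' ∈ Ioo 0 (min r (θ / K)) :=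
    Ioo_mem_nhdsGT (lt_min hr.1 (by positivity))
  -- Before time `r'` only the speed bound is used. After it the flux forces `h ≥ a * r' / 2 ≥ C *
  -- ε`, so the orbit has left the layer, the field is within `θ` of `Y`, and Grönwall applies.
  obtain ⟨r', hr'1, hr'2⟩ := (hφ.and hKr').exists
  have hr'0 : 0 < r' := hr'2.1
  have hr'r : r' < r := hr'2.2.trans_le (min_le_left _ _)
  have hKr'θ : K * r' < θ := by
    have := (lt_div_iff₀ hK).1 (hr'2.2.trans_le (min_le_right _ _))
    linarith
  have hcont : ContinuousAt h p := hX.differentiableAt.self_of_nhds.continuousAt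
  have hh0 : ∀ᶠ x in 𝓝 p, |h x| < a * r' / 2 := by
    have := hcont.abs.tendsto
    rw [hX.apply_eq_zero, abs_zero] at this
    exact this.eventually_lt_const (show 0 < a * r' / 2 by positivity)
  have hε : ∀ᶠ ε in 𝓝[>] (0 : ℝ), ε ∈ Ioo 0 (min ρ (a * r' / 2 / (C + 1))) :=
    Ioo_mem_nhdsGT (lt_min hρ (by positivity))
  have hxs : ∀ᶠ x in 𝓝 p, dist x p < min (ρ / 2) θ :=
    Metric.ball_mem_nhds p (lt_min (by positivity) hθ0)
  filter_upwards [(hε.and (hoff θ hθ0)).prod_mk (hh0.and hxs)] with q hq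
  obtain ⟨ε, x⟩ := q
  obtain ⟨⟨⟨hε0, hε1⟩, hεoff⟩, hx1, hx2⟩ := hq
  simp only at hε0 hε1 hεoff hx1 hx2 ⊢
  have hερ : ε < ρ := hε1.trans_le (min_le_left _ _)
  have hCε : C * ε ≤ a * r' / 2 := by
    have := (lt_div_iff₀ (by linarith)).1 (hε1.trans_le (min_le_right _ _))
    nlinarith
  have hmem : ∀ t ∈ Icc 0 r, Φ ε t x ∈ Metric.ball p ρ :=
    hX.mem_ball_of_lt hF (by linarith [hx2.trans_le (min_le_left _ _)])
  have hflux : ∀ t ∈ Icc 0 r, a * t ≤ h (Φ ε t x) - h x := fun t ht => by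
    have := (hF ε).flux_le (h := h) (B := Metric.ball p ρ) (a := a) (x := x) (s := 0) (t := t)
      (fun y hy => (hball ε ⟨hε0, hερ.trans_le (min_le_left _ _)⟩ y
        (Metric.ball_subset_ball (min_le_left _ _) hy)).2)
      (fun y hy => (hball ε ⟨hε0, hερ.trans_le (min_le_left _ _)⟩ y
        (Metric.ball_subset_ball (min_le_left _ _) hy)).1) ht.1
      (fun s hs => hmem s ⟨hs.1, hs.2.trans ht.2⟩)
    rwa [sub_zero, (hF ε).zero] at this
  have hclose : ∀ t ∈ Icc r' r, ‖X ε (Φ ε t x) - Y (Φ ε t x)‖ ≤ θ := fun t ht => by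
    have ht0 : t ∈ Icc 0 r := ⟨hr'0.le.trans ht.1, ht.2⟩
    refine hεoff _ (Metric.ball_subset_ball (min_le_right _ _) (hmem t ht0)) ?_
    have h1 := hflux t ht0
    have h2 := mul_le_mul_of_nonneg_left ht.1 ha.le
    linarith [(abs_lt.1 hx1).1]
  have h0 : dist (Φ ε r' x) (φ r' p) ≤ 3 * θ := by
    have h1 := (hF ε).norm_sub_le (hX.norm_le ε) x 0 r'
    rw [(hF ε).zero, ← dist_eq_norm, sub_zero, abs_of_pos hr'0] at h1
    have h2 := hx2.trans_le (min_le_right _ _)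
    rw [dist_comm] at hr'1
    linarith [dist_triangle4 (Φ ε r' x) x p (φ r' p)]
  have := dist_le_of_approx_trajectories_ODE (v := fun _ => Y) (K := L) (a := r') (b := r)
    (f := fun t => Φ ε t x) (g := fun t => φ t p) (f' := fun t => X ε (Φ ε t x))
    (g' := fun t => Y (φ t p)) (εf := θ) (εg := 0) (δ := 3 * θ) (fun _ => hL)
    ((hF ε).continuous_time x).continuousOn (fun t _ => ((hF ε).hasDerivAt t x).hasDerivWithinAt)
    (fun t ht => by rw [dist_eq_norm]; exact hclose t (Ico_subset_Icc_self ht))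
    (hY.continuous_time p).continuousOn (fun t _ => (hY.hasDerivAt t p).hasDerivWithinAt)
    (fun t _ => by rw [dist_self]) h0 r ⟨hr'r.le, le_rfl⟩
  refine this.trans_lt ((gronwallBound_le_mul_exp hL1 (by linarith) (by linarith)).trans_lt ?_)
  have h1 : Real.exp (L * (r - r')) ≤ Real.exp (L * r) :=
    Real.exp_le_exp.2 (mul_le_mul_of_nonneg_left (by linarith) L.2)
  calc (3 * θ + (θ + 0)) * Real.exp (L * (r - r')) ≤ 4 * θ * Real.exp (L * r) := by
        rw [show 3 * θ + (θ + 0) = 4 * θ by ring]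
        gcongr
    _ < 5 * θ * Real.exp (L * r) := by gcongr; norm_num
    _ = η := by rw [hθ]; field_simp

/-- The linearized flow through the discontinuity is close to the saltation matrix. -/
theorem window (hX : CrossingField X h ν p Y K C a) (hF : ∀ ε, IsFlow (X ε) (Φ ε) (W ε))
    {Z : E → E} (hZ : ContinuousAt Z p) (hY : ContinuousAt Y p) (hν : ν (Z p) ≠ 0)
    {φ c : ℝ → E} (hc : Tendsto c (𝓝[>] 0) (𝓝 p)) (hφ : Tendsto φ (𝓝[>] 0) (𝓝 p))
    (hcZ : ∀ᶠ r in 𝓝[>] 0, Tendsto (fun q : ℝ × E => X q.1 q.2) (𝓝[>] 0 ×ˢ 𝓝 (c r)) (𝓝 (Z (c r))))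
    (hφY : ∀ᶠ r in 𝓝[>] 0, Tendsto (fun q : ℝ × E => X q.1 q.2) (𝓝[>] 0 ×ˢ 𝓝 (φ r)) (𝓝 (Y (φ r))))
    (hreach : ∀ᶠ r in 𝓝[>] 0, C0Reach (𝓝[>] 0) Φ (c r) (2 * r) (φ r)) {η : ℝ} (hη : 0 < η) :
    ∀ᶠ r in 𝓝[>] 0, ∀ᶠ q : ℝ × E in 𝓝[>] 0 ×ˢ 𝓝 (c r),
      ‖W q.1 (2 * r) q.2 - saltation ν (Z p) (Y p)‖ ≤ η := by
  have hK := hX.K_pos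
  have ha := hX.a_pos
  have hC := hX.C_nonneg
  -- In the layer `|h| < C * ε` one has `1 + (h / ε) ^ 2 ≤ 1 + C ^ 2`, so this constant turns the
  -- bound `K / ε` into the integrable profile required by `norm_linear_sub_le`.
  set K₁ := K * (1 + C ^ 2) with hK₁
  have hK₁0 : 0 ≤ K₁ := by positivity
  set H := 1 + K₁ / a * Real.pi with hH
  set Q := Real.exp (K + H) with hQ
  set M := 1 + |(ν (Z p))⁻¹| * ‖ν‖ * (1 + ‖Z p‖) with hM
  have hM1 : 1 ≤ M := by
    have : 0 ≤ |(ν (Z p))⁻¹| * ‖ν‖ * (1 + ‖Z p‖) := by positivity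
    linarith
  set η₁ := η / (2 * M) with hη₁
  have hη₁0 : 0 < η₁ := by positivity
  -- `norm_linear_sub_le` moves tangent vectors by at most `κ * exp H` times their norm. The
  -- constant `H` does not involve `κ`, provided that the time `2 * r` is small compared with `1 /
  -- (K / κ + 1)`.
  set κ := min 1 (η₁ / Real.exp H) with hκdef
  have hκ : 0 < κ := lt_min one_pos (by positivity)
  have hκ1 : κ ≤ 1 := min_le_left _ _
  set η₂ := η₁ / (2 * (Q + 1)) with hη₂
  have hQ0 : 0 < Q := Real.exp_pos _
  have hη₂0 : 0 < η₂ := by positivity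
  have hdiff : ∀ᶠ q : ℝ × E in 𝓝[>] 0 ×ˢ 𝓝 p, DifferentiableAt ℝ h q.2 :=
    tendsto_snd.eventually hX.differentiableAt
  obtain ⟨ρ, hρ, hball⟩ := eventually_nhdsGT_prod_nhds_iff.1
    (hX.flux.and (hdiff.and (hX.fderiv_le.and (hX.fderiv_le_off.and
      (hX.fderiv_tangent_le (κ * K) (by positivity))))))
  have hr : ∀ᶠ r in 𝓝[>] (0 : ℝ), r ∈ Ioo 0 (min (1 / (2 * (K / κ + 1))) (ρ / (8 * K))) :=
    Ioo_mem_nhdsGT (by positivity)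
  have hcρ : ∀ᶠ r in 𝓝[>] (0 : ℝ), dist (c r) p < ρ / 4 := hc (Metric.ball_mem_nhds _ (by positivity))
  have hZc : ∀ᶠ r in 𝓝[>] (0 : ℝ), dist (Z (c r)) (Z p) < η₂ :=
    (hZ.tendsto.comp hc) (Metric.ball_mem_nhds _ hη₂0)
  have hYc : ∀ᶠ r in 𝓝[>] (0 : ℝ), dist (Y (φ r)) (Y p) < η₂ :=
    (hY.tendsto.comp hφ) (Metric.ball_mem_nhds _ hη₂0)
  filter_upwards [hr, hcρ, hZc, hYc, hcZ, hφY, hreach] with r hr hcρ hZc hYc hcZ hφY hreach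
  have hr0 : 0 < r := hr.1
  have hr1 : (K / κ + 1) * (2 * r) ≤ 1 := by
    have := (lt_div_iff₀ (by positivity)).1 (hr.2.trans_le (min_le_left _ _))
    linarith
  have hr2 : K * (2 * r) ≤ ρ / 4 := by
    have := (lt_div_iff₀ (by positivity)).1 (hr.2.trans_le (min_le_right _ _))
    linarith
  have hε : ∀ᶠ ε in 𝓝[>] (0 : ℝ), ε ∈ Ioo 0 ρ := Ioo_mem_nhdsGT hρ
  have hxs : ∀ᶠ x in 𝓝 (c r), dist x (c r) < ρ / 4 := Metric.ball_mem_nhds _ (by positivity)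
  have hX0 : ∀ᶠ q : ℝ × E in 𝓝[>] 0 ×ˢ 𝓝 (c r), dist (X q.1 q.2) (Z (c r)) < η₂ :=
    hcZ (Metric.ball_mem_nhds _ hη₂0)
  have hX1 : ∀ᶠ q : ℝ × E in 𝓝[>] 0 ×ˢ 𝓝 (c r), dist (X q.1 (Φ q.1 (2 * r) q.2)) (Y (φ r)) < η₂ :=
    (hφY.comp hreach.prod) (Metric.ball_mem_nhds _ hη₂0)
  filter_upwards [hε.prod_mk hxs, hX0, hX1] with q hq hX0 hX1
  obtain ⟨ε, x⟩ := q
  obtain ⟨hε, hx⟩ := hq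
  simp only at hε hx hX0 hX1 ⊢
  have hε0 : 0 < ε := hε.1
  have hmem : ∀ t ∈ Icc 0 (2 * r), Φ ε t x ∈ Metric.ball p ρ :=
    hX.mem_ball_of_lt hF (by linarith [dist_triangle x (c r) p])
  have hlayer : ∀ y, ¬ C * ε ≤ |h y| → 1 / ε ≤ (1 + C ^ 2) / ε / (1 + (h y / ε) ^ 2) := fun y hy => by
    have h1 : (h y / ε) ^ 2 ≤ C ^ 2 := by
      rw [div_pow, div_le_iff₀ (by positivity), ← mul_pow, ← sq_abs]
      exact pow_le_pow_left₀ (abs_nonneg _) (not_le.1 hy).le 2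
    rw [div_right_comm]
    gcongr
    rw [one_le_div (by positivity)]
    linarith
  have hDX : ∀ y ∈ Metric.ball p ρ, ‖fderiv ℝ (X ε) y‖ ≤ K + K₁ / ε / (1 + (h y / ε) ^ 2) :=
    fun y hy => by
      obtain ⟨-, -, h3, h4, -⟩ := hball ε hε y hy
      by_cases hy' : C * ε ≤ |h y|
      · have : 0 ≤ K₁ / ε / (1 + (h y / ε) ^ 2) := by positivity
        linarith [h4 hy']
      · have := mul_le_mul_of_nonneg_left (hlayer y hy') hK.le
        have e1 : K * (1 / ε) = K / ε := by ring
        have e2 : K * ((1 + C ^ 2) / ε / (1 + (h y / ε) ^ 2)) = K₁ / ε / (1 + (h y / ε) ^ 2) := by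
          rw [hK₁]; ring
        rw [e1, e2] at this
        simp only at h3
        linarith
  have hDXv : ∀ v, ν v = 0 → ∀ y ∈ Metric.ball p ρ,
      ‖fderiv ℝ (X ε) y v‖ ≤ (K + κ * (K₁ / ε / (1 + (h y / ε) ^ 2))) * ‖v‖ := fun v hv y hy => by
    obtain ⟨-, -, -, h4, h5⟩ := hball ε hε y hy
    by_cases hy' : C * ε ≤ |h y|
    · refine ((fderiv ℝ (X ε) y).le_opNorm v).trans ?_
      have : 0 ≤ κ * (K₁ / ε / (1 + (h y / ε) ^ 2)) := by positivity
      have h4' := h4 hy'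
      simp only at h4'
      gcongr
      linarith
    · refine (h5 v hv).trans (mul_le_mul_of_nonneg_right ?_ (norm_nonneg v))
      have := mul_le_mul_of_nonneg_left (hlayer y hy') (show 0 ≤ κ * K by positivity)
      have e1 : κ * K * (1 / ε) = κ * K / ε := by ring
      have e2 : κ * K * ((1 + C ^ 2) / ε / (1 + (h y / ε) ^ 2)) =
          κ * (K₁ / ε / (1 + (h y / ε) ^ 2)) := by rw [hK₁]; ring
      rw [e1, e2] at this
      simp only
      linarith
  have hker : ∀ v, ν v = 0 → ‖W ε (2 * r) x v - v‖ ≤ η₁ * ‖v‖ := fun v hv => by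
    refine ((hF ε).norm_linear_sub_le (B := Metric.ball p ρ) ha hε0 hκ hκ1 hK.le hK₁0 (by positivity)
      (fun y hy => (hball ε hε y hy).2.1) (fun y hy => (hball ε hε y hy).1) hDX (hDXv v hv)
      hmem).trans ?_
    have h1 : Real.exp ((K / κ + 1) * (2 * r) + K₁ / a * Real.pi) - 1 ≤ Real.exp H := by
      have : Real.exp ((K / κ + 1) * (2 * r) + K₁ / a * Real.pi) ≤ Real.exp H :=
        Real.exp_le_exp.2 (by linarith)
      linarith
    have h2 : κ * Real.exp H ≤ η₁ := (le_div_iff₀ (Real.exp_pos _)).1 (min_le_right _ _)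
    calc _ ≤ κ * ‖v‖ * Real.exp H := by gcongr
      _ = κ * Real.exp H * ‖v‖ := by ring
      _ ≤ _ := by gcongr
  -- For arbitrary directions the same estimate with parameter `1` in place of `κ` still gives
  -- boundedness.
  have hWn : ∀ v, ‖W ε (2 * r) x v‖ ≤ Q * ‖v‖ := fun v => by
    have h1 := (hF ε).norm_linear_sub_le (B := Metric.ball p ρ) (v := v) ha hε0 one_pos le_rfl hK.le
      hK₁0 (T := 2 * r) (by positivity)
      (fun y hy => (hball ε hε y hy).2.1) (fun y hy => (hball ε hε y hy).1) hDX
      (fun y hy => ((fderiv ℝ (X ε) y).le_opNorm v).trans (mul_le_mul_of_nonneg_right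
        ((hDX y hy).trans_eq (by ring)) (norm_nonneg v))) hmem
    have h2 : Real.exp ((K / 1 + 1) * (2 * r) + K₁ / a * Real.pi) ≤ Q := by
      refine Real.exp_le_exp.2 ?_
      have : K ≤ K / κ := le_div_self hK.le hκ hκ1
      have : (K / 1 + 1) * (2 * r) ≤ (K / κ + 1) * (2 * r) := by
        rw [div_one]; gcongr
      linarith
    have h3 := norm_le_norm_add_norm_sub' (W ε (2 * r) x v) v
    nlinarith [norm_nonneg v]
  -- The linearized flow carries the field at the entrance, close to `Z p`, to the field at the
  -- exit, close to `Y p`.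
  have hfield : ‖W ε (2 * r) x (Z p) - Y p‖ ≤ η₁ := by
    have e : W ε (2 * r) x (Z p) - Y p = W ε (2 * r) x (Z p - X ε x) +
        (X ε (Φ ε (2 * r) x) - Y p) := by
      rw [map_sub, (hF ε).linear_field]; abel
    have h1 : ‖Z p - X ε x‖ ≤ 2 * η₂ := by
      rw [← dist_eq_norm, dist_comm]
      linarith [dist_triangle (X ε x) (Z (c r)) (Z p)]
    have h2 : ‖X ε (Φ ε (2 * r) x) - Y p‖ ≤ 2 * η₂ := by
      rw [← dist_eq_norm]
      linarith [dist_triangle (X ε (Φ ε (2 * r) x)) (Y (φ r)) (Y p)]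
    rw [e]
    refine (norm_add_le _ _).trans ((add_le_add (hWn _) h2).trans ?_)
    have h3 : Q * ‖Z p - X ε x‖ ≤ Q * (2 * η₂) := by gcongr
    have h4 : Q * (2 * η₂) + 2 * η₂ = η₁ := by rw [hη₂]; field_simp
    linarith
  refine (norm_sub_saltation_le hν hη₁0.le hη₁0.le hker hfield).trans ?_
  have h1 : η₁ * (1 + |(ν (Z p))⁻¹| * ‖ν‖ * ‖Z p‖) + |(ν (Z p))⁻¹| * ‖ν‖ * η₁ = η₁ * M := by
    rw [hM]; ring
  rw [h1, hη₁]
  have : η / (2 * M) * M = η / 2 := by field_simp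
  linarith

end CrossingField

end Crossing

/-! ### Convergence of the flows, with derivatives, through a crossing. -/

section CrossingReach

variable {E : Type*} [NormedAddCommGroup E] [NormedSpace ℝ E]

theorem IsFlow.exists_norm_linear_le {X : E → E} {Φ : ℝ → E → E} {W : ℝ → E → E →L[ℝ] E}
    (hF : IsFlow X Φ W) (T : ℝ) : ∃ b ≥ 0, ∀ t ∈ Icc 0 T, ∀ x, ‖W t x‖ ≤ b := by
  obtain ⟨K, hK⟩ := hF.lipschitz
  refine ⟨Real.exp (K * T), (Real.exp_pos _).le, fun t ht x => ?_⟩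
  have := norm_le_gronwallBound_of_norm_deriv_right_le (f := fun t => W t x) (a := 0) (b := T)
    (f' := fun t => (fderiv ℝ X (Φ t x)) ∘L (W t x)) (δ := 1) (K := K) (ε := 0)
    (HasDerivAt.continuousOn fun s _ => hF.hasDerivAt_linear s x)
    (fun s _ => (hF.hasDerivAt_linear s x).hasDerivWithinAt)
    (by rw [hF.linear_zero]; exact ContinuousLinearMap.norm_id_le)
    (fun s _ => by
      rw [add_zero]
      exact (ContinuousLinearMap.opNorm_comp_le _ _).trans
        (mul_le_mul_of_nonneg_right (norm_fderiv_le_of_lipschitz ℝ hK) (norm_nonneg _))) t ht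
  rw [gronwallBound_ε0, one_mul, sub_zero] at this
  exact this.trans (Real.exp_le_exp.2 (mul_le_mul_of_nonneg_left ht.2 K.2))

theorem norm_comp_comp_sub_le {P T Q B V A : E →L[ℝ] E} {θ b s a : ℝ} (hθ : 0 ≤ θ) (hb : 0 ≤ b)
    (hs : 0 ≤ s) (h₁ : ‖P - B‖ ≤ θ) (h₂ : ‖T - V‖ ≤ θ)
    (h₃ : ‖Q - A‖ ≤ θ) (hB : ‖B‖ ≤ b) (hT : ‖T‖ ≤ s) (hV : ‖V‖ ≤ s) (hQ : ‖Q‖ ≤ a) :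
    ‖P ∘L (T ∘L Q) - B ∘L (V ∘L A)‖ ≤ θ * (s * a + b * a + b * s) := by
  have ha : 0 ≤ a := (norm_nonneg _).trans hQ
  have e : P ∘L (T ∘L Q) - B ∘L (V ∘L A) =
      (P - B) ∘L (T ∘L Q) + B ∘L ((T - V) ∘L Q) + B ∘L (V ∘L (Q - A)) := by
    ext v
    simp only [sub_apply, ContinuousLinearMap.comp_apply, add_apply, map_sub]
    abel
  have hcomp : ∀ (R S : E →L[ℝ] E) {r t : ℝ}, 0 ≤ r → ‖R‖ ≤ r → ‖S‖ ≤ t → ‖R ∘L S‖ ≤ r * t :=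
    fun R S r t hr hR hS => (ContinuousLinearMap.opNorm_comp_le R S).trans
      (mul_le_mul hR hS (norm_nonneg _) hr)
  rw [e]
  refine (norm_add₃_le).trans ?_
  have h4 := hcomp _ _ hθ h₁ (hcomp _ _ hs hT hQ)
  have h5 := hcomp _ _ hb hB (hcomp _ _ hθ h₂ hQ)
  have h6 := hcomp _ _ hb hB (hcomp _ _ hs hV h₃)
  linarith

namespace CrossingField

variable [FiniteDimensional ℝ E] {X : ℝ → E → E} {h : E → ℝ} {ν : E →L[ℝ] ℝ} {p : E} {Y Z : E → E}
  {K C a : ℝ} {Φ : ℝ → ℝ → E → E} {W : ℝ → ℝ → E → E →L[ℝ] E} {φ ψ : ℝ → E → E}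
  {w z : ℝ → E → E →L[ℝ] E} {x₀ : E} {δ δ' : ℝ} {U V : Set E}

theorem c0Reach_exit (hX : CrossingField X h ν p Y K C a)
    (hF : ∀ ε, IsFlow (X ε) (Φ ε) (W ε)) (hY : IsFlow Y φ w) (hV : IsOpen V)
    (hVX : ∀ y ∈ V, FieldTendsto (𝓝[>] 0) X Y y) (hV' : ∀ t ∈ Ioc 0 δ', φ t p ∈ V) :
    ∀ t ∈ Icc 0 δ', C0Reach (𝓝[>] 0) Φ p t (φ t p) := by
  intro t ht
  rcases ht.1.eq_or_lt with rfl | ht0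
  · rw [hY.zero]; exact c0Reach_zero hF p
  obtain ⟨r₀, hr₀, hexit⟩ := hX.exit hF hY
  have hr : min r₀ t ∈ Ioc 0 r₀ := ⟨lt_min hr₀ ht0, min_le_left _ _⟩
  have h1 := hexit _ hr
  have h2 := (c1Reach_of_fieldTendsto hF hY hV hVX (x₀ := φ (min r₀ t) p) (τ := t - min r₀ t)
    (sub_nonneg.2 (min_le_right _ _)) fun s hs => by
      rw [← hY.add]
      exact hV' _ ⟨by linarith [hs.1, hr.1], by linarith [hs.2, ht.2]⟩).1
  have := h1.trans hF h2
  rwa [← hY.add, sub_add_cancel, add_sub_cancel] at this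

/-- Convergence holds up to every earlier time, where the limit orbit stays in `U`; the uniform
speed bound extends it to the time of impact. -/
theorem c0Reach_enter (hX : CrossingField X h ν p Y K C a)
    (hF : ∀ ε, IsFlow (X ε) (Φ ε) (W ε)) (hZ : IsFlow Z ψ z) (hU : IsOpen U)
    (hUX : ∀ y ∈ U, FieldTendsto (𝓝[>] 0) X Z y) (hU' : ∀ t ∈ Ico 0 δ, ψ t x₀ ∈ U)
    (hδ : 0 < δ) (hp : ψ δ x₀ = p) : C0Reach (𝓝[>] 0) Φ x₀ δ p := by
  rw [← hp]
  refine c0Reach_of_forall_lt hF hX.norm_le (c := fun t => ψ t x₀)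
    (hZ.continuous_time x₀).continuousWithinAt hδ fun s hs0 hs => ?_
  exact (c1Reach_of_fieldTendsto hF hZ hU hUX hs0.le fun t ht =>
    hU' t ⟨ht.1, ht.2.trans_lt hs⟩).1

/-- Convergence, with first derivatives, of the flows of the regularizations through a point of
transverse discontinuity. -/
theorem c1Reach (hX : CrossingField X h ν p Y K C a)
    (hF : ∀ ε, IsFlow (X ε) (Φ ε) (W ε)) (hY : IsFlow Y φ w) (hZ : IsFlow Z ψ z)
    (hν : ν (Z p) ≠ 0) (hV : IsOpen V)
    (hVX : ∀ y ∈ V, FieldTendsto (𝓝[>] 0) X Y y) (hV' : ∀ t ∈ Ioc 0 δ', φ t p ∈ V) (hU : IsOpen U)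
    (hUX : ∀ y ∈ U, FieldTendsto (𝓝[>] 0) X Z y) (hU' : ∀ t ∈ Ico 0 δ, ψ t x₀ ∈ U)
    (hδ : 0 < δ) (hδ' : 0 < δ') (hp : ψ δ x₀ = p) :
    C1Reach (𝓝[>] 0) Φ W x₀ (δ + δ') (φ δ' p)
      (w δ' p ∘L (saltation ν (Z p) (Y p) ∘L z δ x₀)) := by
  refine ⟨(hX.c0Reach_enter hF hZ hU hUX hU' hδ hp).trans hF
    (hX.c0Reach_exit hF hY hV hVX hV' δ' ⟨hδ'.le, le_rfl⟩), ?_⟩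
  set S := saltation ν (Z p) (Y p)
  set A := z δ x₀
  obtain ⟨b, hb0, hb⟩ := hY.exists_norm_linear_le δ'
  set M := (‖S‖ + 1) * (‖A‖ + 2) + b * (‖A‖ + 2) + b * (‖S‖ + 1) with hM
  have hM0 : 0 ≤ M := by positivity
  have hsmall : ∀ᶠ r in 𝓝[>] (0 : ℝ), r ∈ Ioo 0 (min δ δ') := Ioo_mem_nhdsGT (lt_min hδ hδ')
  have hψr : ∀ r, Tendsto (fun r => ψ (δ - r) x₀) (𝓝[>] r) (𝓝 (ψ (δ - r) x₀)) := fun r => by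
    have : Continuous fun r => ψ (δ - r) x₀ := (hZ.continuous_time x₀).comp (by fun_prop)
    exact (this.tendsto r).mono_left nhdsWithin_le_nhds
  have hφr : Tendsto (fun r => φ r p) (𝓝[>] 0) (𝓝 p) := by
    have := (hY.continuous_time p).tendsto 0
    rw [hY.zero] at this
    exact this.mono_left nhdsWithin_le_nhds
  refine Metric.tendsto_nhds.2 fun η hη => ?_
  set θ := min 1 (η / (2 * (M + 1))) with hθ
  have hθ0 : 0 < θ := lt_min one_pos (by positivity)
  have hwindow := hX.window hF (Z := Z) hZ.smooth.continuous.continuousAt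
    hY.smooth.continuous.continuousAt hν (c := fun r => ψ (δ - r) x₀) (φ := fun r => φ r p)
    (by simpa [hp] using hψr 0) hφr
    (by
      filter_upwards [hsmall] with r hr
      exact (hUX _ (hU' _ ⟨by linarith [hr.2.trans_le (min_le_left _ _)], by linarith [hr.1]⟩)).1)
    (by
      filter_upwards [hsmall] with r hr
      exact (hVX _ (hV' _ ⟨hr.1, (hr.2.trans_le (min_le_right _ _)).le⟩)).1)
    (by
      filter_upwards [hsmall] with r hr
      have hrδ := hr.2.trans_le (min_le_left _ _)
      have h1 : C0Reach (𝓝[>] 0) Φ (ψ (δ - r) x₀) r p := by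
        refine hX.c0Reach_enter hF hZ hU hUX (fun t ht => ?_) hr.1 ?_
        · rw [← hZ.add]
          exact hU' _ ⟨by linarith [ht.1], by linarith [ht.2]⟩
        · rw [← hZ.add, add_sub_cancel, hp]
      have := h1.trans hF (hX.c0Reach_exit hF hY hV hVX hV' r
        ⟨hr.1.le, (hr.2.trans_le (min_le_right _ _)).le⟩)
      rwa [← two_mul] at this) (half_pos hθ0)
  have hA : ∀ᶠ r in 𝓝[>] (0 : ℝ), dist (z (δ - r) x₀) A < θ / 2 := by
    have hc : Continuous fun r => z (δ - r) x₀ := by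
      have : Continuous fun t => z t x₀ :=
        continuous_iff_continuousAt.2 fun t => (hZ.hasDerivAt_linear t x₀).continuousAt
      exact this.comp (by fun_prop)
    have : Tendsto (fun r => z (δ - r) x₀) (𝓝[>] 0) (𝓝 A) := by
      simpa using (hc.tendsto 0).mono_left nhdsWithin_le_nhds
    exact this (Metric.ball_mem_nhds _ (by positivity))
  have hwS : ∀ᶠ r in 𝓝[>] (0 : ℝ), dist (w r p ∘L S) S < θ / 2 := by
    have hc : Continuous fun r => w r p ∘L S := by
      have : Continuous fun t => w t p :=
        continuous_iff_continuousAt.2 fun t => (hY.hasDerivAt_linear t p).continuousAt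
      exact this.clm_comp continuous_const
    have : Tendsto (fun r => w r p ∘L S) (𝓝[>] 0) (𝓝 S) := by
      have := (hc.tendsto 0).mono_left (nhdsWithin_le_nhds (s := Ioi 0))
      rw [hY.linear_zero] at this
      exact this
    exact this (Metric.ball_mem_nhds _ (by positivity))
  obtain ⟨r, hr, hwin, hA, hwS⟩ := (hsmall.and (hwindow.and (hA.and hwS))).exists
  have hrδ := hr.2.trans_le (min_le_left _ _)
  have hrδ' := hr.2.trans_le (min_le_right _ _)
  have hr0 := hr.1
  have R1 : C1Reach (𝓝[>] 0) Φ W x₀ (δ - r) (ψ (δ - r) x₀) (z (δ - r) x₀) :=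
    c1Reach_of_fieldTendsto hF hZ hU hUX (by linarith) fun t ht =>
      hU' t ⟨ht.1, by linarith [ht.2]⟩
  have R2 : C0Reach (𝓝[>] 0) Φ x₀ (δ + r) (φ r p) :=
    (hX.c0Reach_enter hF hZ hU hUX hU' hδ hp).trans hF
      (hX.c0Reach_exit hF hY hV hVX hV' r ⟨hr0.le, hrδ'.le⟩)
  have R3 : C1Reach (𝓝[>] 0) Φ W (φ r p) (δ' - r) (φ (δ' - r) (φ r p)) (w (δ' - r) (φ r p)) :=
    c1Reach_of_fieldTendsto hF hY hV hVX (by linarith) fun t ht => by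
      rw [← hY.add]
      exact hV' _ ⟨by linarith [ht.1], by linarith [ht.2]⟩
  have e1 := R1.2 (Metric.ball_mem_nhds _ (half_pos hθ0))
  have e2 := R1.1.prod.eventually hwin
  have e3 := (R3.2.comp R2.prod) (Metric.ball_mem_nhds _ hθ0)
  filter_upwards [e1, e2, e3] with q e1 e2 e3
  simp only [mem_preimage, Function.comp, Metric.mem_ball] at e1 e2 e3
  -- The passage is cut at the times `δ - r` and `δ + r`. The outer parts are governed by convergent
  -- fields and the middle one by `window`; `r` is fixed in terms of `θ` before `ε` tends to zero.
  have hsplit : W q.1 (δ + δ') q.2 = W q.1 (δ' - r) (Φ q.1 (δ + r) q.2) ∘L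
      (W q.1 (2 * r) (Φ q.1 (δ - r) q.2) ∘L W q.1 (δ - r) q.2) := by
    rw [← (hF q.1).linear_add, show 2 * r + (δ - r) = δ + r by ring, ← (hF q.1).linear_add]
    congr 1; ring
  have hlim : w δ' p ∘L (S ∘L A) = w (δ' - r) (φ r p) ∘L ((w r p ∘L S) ∘L A) := by
    have hw : w δ' p = w (δ' - r) (φ r p) ∘L w r p := by rw [← hY.linear_add, sub_add_cancel]
    rw [hw]
    rfl
  rw [dist_eq_norm] at e1 e3 hA hwS ⊢
  have hθ1 : θ ≤ 1 := min_le_left _ _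
  rw [hsplit, hlim]
  have hT : ‖W q.1 (2 * r) (Φ q.1 (δ - r) q.2) - w r p ∘L S‖ ≤ θ := by
    have := norm_sub_le_norm_sub_add_norm_sub (W q.1 (2 * r) (Φ q.1 (δ - r) q.2)) S (w r p ∘L S)
    rw [norm_sub_rev S] at this
    linarith
  refine (norm_comp_comp_sub_le hθ0.le hb0 (s := ‖S‖ + 1) (a := ‖A‖ + 2) (by positivity) e3.le hT
    (A := A) ?_ (hb _ ⟨by linarith, by linarith⟩ _) ?_ ?_ ?_).trans_lt ?_
  · have := norm_sub_le_norm_sub_add_norm_sub (W q.1 (δ - r) q.2) (z (δ - r) x₀) A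
    linarith
  · have := norm_le_norm_add_norm_sub' (W q.1 (2 * r) (Φ q.1 (δ - r) q.2)) S
    linarith
  · have := norm_le_norm_add_norm_sub' (w r p ∘L S) S
    linarith
  · have h1 := norm_sub_le_norm_sub_add_norm_sub (W q.1 (δ - r) q.2) (z (δ - r) x₀) A
    have := norm_le_norm_add_norm_sub' (W q.1 (δ - r) q.2) A
    linarith
  · have h1 : θ * (M + 1) ≤ η / 2 := by
      have : θ ≤ η / (2 * (M + 1)) := min_le_right _ _
      calc θ * (M + 1) ≤ η / (2 * (M + 1)) * (M + 1) := by gcongr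
        _ = η / 2 := by field_simp
    nlinarith

end CrossingField

end CrossingReach

/-! ### Characteristic polynomials of block triangular maps. -/

section CharpolyBlock

-- In a basis adapted to `V ⊕ K ∙ y` the matrix of `A` is block lower triangular with diagonal
-- blocks `B` and `r`.
open Polynomial in
theorem LinearMap.charpoly_eq_mul_of_sub_mem_span {K E : Type*} [Field K] [AddCommGroup E]
    [Module K E] [FiniteDimensional K E] {V : Submodule K E} {y : E}
    (hV : IsCompl V (K ∙ y)) (hy : y ≠ 0) {A : E →ₗ[K] E} {B : V →ₗ[K] V} {r : K}
    (hAy : A y = r • y) (hAB : ∀ v : V, A v - B v ∈ K ∙ y) :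
    A.charpoly = (X - C r) * B.charpoly := by
  classical
  let bV := Module.finBasis K V
  let bY : Module.Basis Unit K (K ∙ y) := (Module.Basis.singleton Unit K).map
    (LinearEquiv.toSpanNonzeroSingleton K E y hy)
  let e := Submodule.prodEquivOfIsCompl V (K ∙ y) hV
  let b := (bV.prod bY).map e
  have hbl : ∀ i, b (Sum.inl i) = bV i := fun i => by simp [b, e]
  have hbr : ∀ i, b (Sum.inr i) = y := fun i => by simp [b, e, bY]
  choose c hc using fun v => Submodule.mem_span_singleton.1 (hAB v)
  have hAv : ∀ v : V, A v = e (B v, LinearEquiv.toSpanNonzeroSingleton K E y hy (c v)) := fun v => by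
    rw [Submodule.coe_prodEquivOfIsCompl']
    simp [hc v]
  have hM : LinearMap.toMatrix b b A = Matrix.fromBlocks (LinearMap.toMatrix bV bV B) 0
      (Matrix.of fun _ j => c (bV j)) (Matrix.of fun _ _ : Unit => r) := by
    have hA2 : A y = e (0, LinearEquiv.toSpanNonzeroSingleton K E y hy r) := by
      rw [Submodule.coe_prodEquivOfIsCompl', hAy]; simp
    have hsymm : ∀ (c : K) (h : c • y ∈ K ∙ y),
        (LinearEquiv.toSpanNonzeroSingleton K E y hy).symm ⟨c • y, h⟩ = c := fun c h =>
      (LinearEquiv.toSpanNonzeroSingleton K E y hy).symm_apply_eq.2 rfl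
    ext (i | i) (j | j)
    · rw [LinearMap.toMatrix_apply, hbl, hAv, Matrix.fromBlocks_apply₁₁, LinearMap.toMatrix_apply]
      simp [b]
    · rw [LinearMap.toMatrix_apply, hbr, hA2, Matrix.fromBlocks_apply₁₂]
      simp [b]
    · rw [LinearMap.toMatrix_apply, hbl, hAv, Matrix.fromBlocks_apply₂₁]
      simpa [b, bY] using hsymm _ _
    · rw [LinearMap.toMatrix_apply, hbr, hA2, Matrix.fromBlocks_apply₂₂]
      simpa [b, bY] using hsymm _ _
  rw [← LinearMap.charpoly_toMatrix A b, hM, Matrix.charpoly_fromBlocks_zero₁₂,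
    LinearMap.charpoly_toMatrix, mul_comm]
  congr 1
  simp [Matrix.charpoly, Matrix.charmatrix]

theorem LinearMap.charpoly_comp_comm {K E : Type*} [Field K] [AddCommGroup E] [Module K E]
    [FiniteDimensional K E] (A B : E →ₗ[K] E) : (A ∘ₗ B).charpoly = (B ∘ₗ A).charpoly := by
  classical
  let b := Module.finBasis K E
  rw [← LinearMap.charpoly_toMatrix _ b, ← LinearMap.charpoly_toMatrix (B ∘ₗ A) b,
    LinearMap.toMatrix_comp b b b, LinearMap.toMatrix_comp b b b, Matrix.charpoly_mul_comm]

end CharpolyBlock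

/-! ### Approximate orbits of a hyperbolic linear map. -/

section SummedBound

/-- Approximate orbits of a linear map without eigenvalues on the unit circle are controlled by
their errors and their end points. -/
theorem Module.End.exists_sum_norm_le {F : Type*} [NormedAddCommGroup F] [NormedSpace ℂ F]
    [FiniteDimensional ℂ F] (A : Module.End ℂ F)
    (hA : ∀ z, A.HasEigenvalue z → ‖z‖ ≠ 1) :
    ∃ C : ℝ, 0 ≤ C ∧ ∀ (N : ℕ) (w : ℕ → F), ∑ j ∈ Finset.range N, ‖w j‖ ≤
      C * (∑ j ∈ Finset.range N, ‖w (j + 1) - A (w j)‖ + (‖w 0‖ + ‖w N‖)) := by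
  induction hd : Module.finrank ℂ F generalizing F with
  | zero =>
    have := Module.finrank_zero_iff.1 hd
    refine ⟨0, le_rfl, fun N w => ?_⟩
    simp [Subsingleton.elim _ (0 : F)]
  | succ d ih =>
    have : Nontrivial F := Module.nontrivial_of_finrank_pos (R := ℂ) (by omega)
    obtain ⟨z, hz⟩ := Module.End.exists_eigenvalue A
    -- A functional vanishing on the range of `A - z` is a left eigenvector. Its values along the
    -- sequence obey a scalar recursion, and its kernel is an invariant hyperplane to which
    -- induction applies.
    have hnt : LinearMap.range (A - algebraMap ℂ (Module.End ℂ F) z) < ⊤ := by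
      refine lt_of_le_of_ne le_top fun h => ?_
      have hinj := LinearMap.ker_eq_bot_iff_range_eq_top.2 h
      obtain ⟨v, hv⟩ := hz.exists_hasEigenvector
      have : v ∈ LinearMap.ker (A - algebraMap ℂ (Module.End ℂ F) z) := by
        simp [hv.apply_eq_smul]
      rw [hinj] at this
      exact hv.2 (by simpa using this)
    obtain ⟨ℓ', hℓ0, hℓ⟩ := Submodule.exists_le_ker_of_lt_top _ hnt
    obtain ⟨e, he⟩ : ∃ e, ℓ' e = 1 := by
      obtain ⟨x, hx⟩ : ∃ x, ℓ' x ≠ 0 := by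
        by_contra! h
        exact hℓ0 (LinearMap.ext h)
      exact ⟨(ℓ' x)⁻¹ • x, by simp [hx]⟩
    let ℓ : F →L[ℂ] ℂ := LinearMap.toContinuousLinearMap ℓ'
    have hℓA : ∀ x, ℓ (A x) = z * ℓ x := fun x => by
      have : ℓ' (A x - z • x) = 0 := hℓ ⟨x, by simp⟩
      rw [map_sub, map_smul, sub_eq_zero] at this
      exact this
    let H := LinearMap.ker ℓ'
    have hmaps : ∀ x ∈ H, A x ∈ H := fun x hx => by
      have := hℓA x
      rw [show ℓ x = 0 from hx, mul_zero] at this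
      exact this
    have hHd : Module.finrank ℂ H = d := by
      have h1 := LinearMap.finrank_range_add_finrank_ker ℓ'
      have h2 : LinearMap.range ℓ' = ⊤ := LinearMap.range_eq_top.2 fun c => ⟨c • e, by simp [he]⟩
      rw [h2, finrank_top, Module.finrank_self, hd] at h1
      change 1 + Module.finrank ℂ H = d + 1 at h1
      omega
    obtain ⟨C, hC0, hC⟩ := ih (A.restrict hmaps) (fun μ hμ => hA μ (by
      obtain ⟨v, hv⟩ := hμ.exists_hasEigenvector
      refine Module.End.hasEigenvalue_of_hasEigenvector (x := (v : F)) ⟨?_, ?_⟩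
      · rw [Module.End.mem_eigenspace_iff]
        exact congrArg Subtype.val hv.apply_eq_smul
      · simpa using hv.2)) hHd
    have hz1 := hA z hz
    set D := |‖z‖ - 1|⁻¹ * ‖ℓ‖ with hD
    have hD0 : 0 ≤ D := by positivity
    -- Summing `‖ℓ (w (j + 1))‖ - ‖z‖ * ‖ℓ (w j)‖` gives `(1 - ‖z‖) * Q` up to end terms, which
    -- controls `Q` whether `‖z‖` is below or above one.
    have hscalar : ∀ (N : ℕ) (w : ℕ → F), ∑ j ∈ Finset.range N, ‖ℓ (w j)‖ ≤
        D * (∑ j ∈ Finset.range N, ‖w (j + 1) - A (w j)‖ + (‖w 0‖ + ‖w N‖)) := by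
      intro N w
      set Q := ∑ j ∈ Finset.range N, ‖ℓ (w j)‖ with hQdef
      have hshift : ∑ j ∈ Finset.range N, ‖ℓ (w (j + 1))‖ = Q + ‖ℓ (w N)‖ - ‖ℓ (w 0)‖ := by
        have h1 := Finset.sum_range_succ (fun j => ‖ℓ (w j)‖) N
        have h2 := Finset.sum_range_succ' (fun j => ‖ℓ (w j)‖) N
        linarith
      have hdiff : ∀ j, |‖ℓ (w (j + 1))‖ - ‖z‖ * ‖ℓ (w j)‖| ≤ ‖ℓ‖ * ‖w (j + 1) - A (w j)‖ := by
        intro j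
        rw [← norm_mul]
        refine (abs_norm_sub_norm_le _ _).trans ?_
        rw [← hℓA, ← map_sub]
        exact ℓ.le_opNorm _
      have hsum : |∑ j ∈ Finset.range N, (‖ℓ (w (j + 1))‖ - ‖z‖ * ‖ℓ (w j)‖)| ≤
          ‖ℓ‖ * ∑ j ∈ Finset.range N, ‖w (j + 1) - A (w j)‖ := by
        refine (Finset.abs_sum_le_sum_abs _ _).trans ?_
        rw [Finset.mul_sum]
        exact Finset.sum_le_sum fun j _ => hdiff j
      rw [Finset.sum_sub_distrib, hshift, ← Finset.mul_sum, ← hQdef] at hsum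
      have hQ : 0 ≤ Q := Finset.sum_nonneg fun _ _ => norm_nonneg _
      have h0 := ℓ.le_opNorm (w 0)
      have hN := ℓ.le_opNorm (w N)
      have : |‖z‖ - 1| * Q ≤
          ‖ℓ‖ * (∑ j ∈ Finset.range N, ‖w (j + 1) - A (w j)‖ + (‖w 0‖ + ‖w N‖)) := by
        rw [← abs_of_nonneg hQ, ← abs_mul]
        rw [abs_le] at hsum ⊢
        constructor <;> nlinarith [norm_nonneg (ℓ (w 0)), norm_nonneg (ℓ (w N))]
      rw [hD, mul_assoc]
      exact (le_inv_mul_iff₀ (abs_pos.2 (sub_ne_zero.2 hz1))).2 this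
    -- In the recursion projected to the kernel along `e`, the scalar component appears only as an
    -- additional error `ℓ (w j) • (A e - z • e)`, whose sum is already bounded.
    let π : F →L[ℂ] F := ContinuousLinearMap.id ℂ F - ℓ.smulRight e
    have hπ : ∀ x, π x = x - ℓ x • e := fun x => by simp [π]
    have hπH : ∀ x, π x ∈ H := fun x => by
      change ℓ' (π x) = 0
      rw [hπ, map_sub, map_smul, he]
      simp [ℓ]
    set G := ‖A e - z • e‖ with hG
    refine ⟨C * (‖π‖ + D * G) + D * ‖e‖, by positivity, fun N w => ?_⟩
    set S := ∑ j ∈ Finset.range N, ‖w (j + 1) - A (w j)‖ + (‖w 0‖ + ‖w N‖) with hS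
    have h1 := hscalar N w
    have h2 := hC N (fun j => ⟨π (w j), hπH _⟩)
    have h3 : ∀ j, ‖(⟨π (w (j + 1)), hπH _⟩ : H) - A.restrict hmaps ⟨π (w j), hπH _⟩‖ ≤
        ‖π‖ * ‖w (j + 1) - A (w j)‖ + ‖ℓ (w j)‖ * G := by
      intro j
      have : ((⟨π (w (j + 1)), hπH _⟩ : H) - A.restrict hmaps ⟨π (w j), hπH _⟩ : F) =
          π (w (j + 1) - A (w j)) + ℓ (w j) • (A e - z • e) := by
        change π (w (j + 1)) - A (π (w j)) = _
        rw [hπ, hπ, hπ]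
        simp only [map_sub, map_smul, hℓA, smul_sub, sub_smul, mul_smul]
        rw [smul_comm z]
        abel
      refine (le_of_eq (congrArg norm this)).trans ?_
      refine (norm_add_le _ _).trans (add_le_add (π.le_opNorm _) ?_)
      rw [norm_smul]
    have h4 : ∑ j ∈ Finset.range N, ‖π (w j)‖ ≤ C * (‖π‖ * S + D * S * G) := by
      refine h2.trans (mul_le_mul_of_nonneg_left ?_ hC0)
      have h5 := Finset.sum_le_sum fun j (_ : j ∈ Finset.range N) => h3 j
      rw [Finset.sum_add_distrib, ← Finset.mul_sum, ← Finset.sum_mul] at h5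
      have h6 := π.le_opNorm (w 0)
      have h7 := π.le_opNorm (w N)
      have h8 := mul_le_mul_of_nonneg_right h1 (norm_nonneg (A e - z • e))
      rw [← hS, ← hG] at h8
      have h9 : ‖π‖ * S = ‖π‖ * ∑ j ∈ Finset.range N, ‖w (j + 1) - A (w j)‖ +
          (‖π‖ * ‖w 0‖ + ‖π‖ * ‖w N‖) := by rw [hS]; ring
      rw [h9]
      change _ + (‖π (w 0)‖ + ‖π (w N)‖) ≤ _
      linarith
    calc ∑ j ∈ Finset.range N, ‖w j‖
        ≤ ∑ j ∈ Finset.range N, (‖π (w j)‖ + ‖ℓ (w j)‖ * ‖e‖) := by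
          refine Finset.sum_le_sum fun j _ => ?_
          rw [← norm_smul]
          refine le_trans (le_of_eq ?_) (norm_add_le _ _)
          rw [hπ, sub_add_cancel]
      _ ≤ C * (‖π‖ * S + D * S * G) + D * S * ‖e‖ := by
          rw [Finset.sum_add_distrib, ← Finset.sum_mul]
          gcongr
      _ = _ := by ring

end SummedBound

/-! ### Semicontinuity of eigenvalue counts. -/

section RootCount

open Polynomial in
/-- Lower semicontinuity of the number of eigenvalues in an open set. -/
theorem eventually_card_filter_roots_charpoly_le {ι F : Type*} [NormedAddCommGroup F]
    [NormedSpace ℂ F] [FiniteDimensional ℂ F] {l : Filter ι} {A : ι → F →L[ℂ] F} {B : F →L[ℂ] F}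
    (hA : Tendsto A l (𝓝 B)) {O : ℂ → Prop} [DecidablePred O]
    (hO : IsOpen {z | O z}) :
    ∀ᶠ i in l, ((B : F →ₗ[ℂ] F).charpoly.roots.filter O).card ≤
      ((A i : F →ₗ[ℂ] F).charpoly.roots.filter O).card := by
  classical
  set d := Module.finrank ℂ F with hd
  have hroots : ∀ L : F →L[ℂ] F, ∃ r : Fin d → ℂ,
      (L : F →ₗ[ℂ] F).charpoly.roots = Finset.univ.val.map r := by
    intro L
    have hcard : (L : F →ₗ[ℂ] F).charpoly.roots.card = d := by
      rw [← (IsAlgClosed.splits _).natDegree_eq_card_roots, LinearMap.charpoly_natDegree]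
    obtain ⟨m, hm⟩ := Quot.exists_rep (L : F →ₗ[ℂ] F).charpoly.roots
    have hm' : (m : Multiset ℂ) = (L : F →ₗ[ℂ] F).charpoly.roots := hm
    have hlen : m.length = d := by rw [← hcard, ← hm', Multiset.coe_card]
    refine ⟨fun k => m.get (k.cast hlen.symm), ?_⟩
    rw [← hm', Fin.univ_val_map]
    congr 1
    exact List.ext_get (by simp [hlen]) (by simp)
  have hprod : ∀ (L : F →L[ℂ] F) (r : Fin d → ℂ),
      (L : F →ₗ[ℂ] F).charpoly.roots = Finset.univ.val.map r →
      (L : F →ₗ[ℂ] F).charpoly = ∏ k, (X - C (r k)) := by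
    intro L r hr
    rw [(IsAlgClosed.splits (L : F →ₗ[ℂ] F).charpoly).eq_prod_roots_of_monic
      (LinearMap.charpoly_monic _), hr, Multiset.map_map]
    rfl
  have heval : ∀ (L : F →L[ℂ] F) (z : ℂ), (L : F →ₗ[ℂ] F).charpoly.eval z =
      (algebraMap ℂ (F →L[ℂ] F) z - L).det := by
    intro L z
    rw [LinearMap.eval_charpoly]
    rfl
  have hcount : ∀ r : Fin d → ℂ, (((Finset.univ.val.map r).filter O).card) =
      (Finset.univ.filter fun k => O (r k)).card := by
    intro r
    rw [Multiset.filter_map, Multiset.card_map]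
    rfl
  choose r hr using fun i => hroots (A i)
  -- Along an ultrafilter the roots, which are bounded by operator norms, converge in some
  -- enumeration. Comparing values of characteristic polynomials shows that the limits are the roots
  -- of `B` with multiplicity, and membership in an open set passes from a limit to nearby terms.
  refine Filter.mem_iff_ultrafilter.2 fun g hg => ?_
  have hbound : ∀ᶠ i in (g : Filter ι), r i ∈ Metric.closedBall (0 : Fin d → ℂ) (‖B‖ + 1) := by
    have : ∀ᶠ i in (g : Filter ι), ‖A i‖ < ‖B‖ + 1 :=
      (hA.norm.mono_left hg).eventually (gt_mem_nhds (lt_add_one _))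
    filter_upwards [this] with i hi
    rw [mem_closedBall_zero_iff]
    refine (pi_norm_le_iff_of_nonneg (by positivity)).2 fun k => ?_
    have hmem : r i k ∈ (A i : F →ₗ[ℂ] F).charpoly.roots := by
      rw [hr]; exact Multiset.mem_map_of_mem _ (Finset.mem_univ k)
    have heig : Module.End.HasEigenvalue (A i : F →ₗ[ℂ] F) (r i k) :=
      (Module.End.hasEigenvalue_iff_isRoot_charpoly _ _).2 (isRoot_of_mem_roots hmem)
    obtain ⟨v, hv⟩ := heig.exists_hasEigenvector
    have h1 := (A i).le_opNorm v
    rw [show A i v = r i k • v from hv.apply_eq_smul, norm_smul] at h1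
    exact (le_of_mul_le_mul_right h1 (norm_pos_iff.2 hv.2)).trans hi.le
  obtain ⟨q, -, hq⟩ := (isCompact_closedBall (0 : Fin d → ℂ) (‖B‖ + 1)).ultrafilter_le_nhds
    (g.map r) (le_principal_iff.2 hbound)
  have hq' : Tendsto r g (𝓝 q) := hq
  have hB : (B : F →ₗ[ℂ] F).charpoly = ∏ k, (X - C (q k)) := by
    refine Polynomial.funext fun z => ?_
    have h1 : Tendsto (fun i => (A i : F →ₗ[ℂ] F).charpoly.eval z) g
        (𝓝 ((B : F →ₗ[ℂ] F).charpoly.eval z)) := by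
      simp only [heval]
      exact (ContinuousLinearMap.continuous_det.tendsto _).comp
        (tendsto_const_nhds.sub (hA.mono_left hg))
    have h2 : Tendsto (fun i => (A i : F →ₗ[ℂ] F).charpoly.eval z) g
        (𝓝 ((∏ k, (X - C (q k))).eval z)) := by
      simp only [hprod _ _ (hr _), eval_prod, eval_sub, eval_X, eval_C]
      exact tendsto_finsetProd _ fun k _ =>
        tendsto_const_nhds.sub (((continuous_apply k).tendsto q).comp hq')
    exact tendsto_nhds_unique h1 h2
  have hBr : (B : F →ₗ[ℂ] F).charpoly.roots = Finset.univ.val.map q := by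
    rw [hB, Polynomial.roots_prod]
    · simp
    · exact Finset.prod_ne_zero_iff.2 fun k _ => X_sub_C_ne_zero _
  have : ∀ᶠ i in (g : Filter ι), ∀ k, O (q k) → O (r i k) := by
    refine eventually_all.2 fun k => ?_
    by_cases hk : O (q k)
    · exact ((((continuous_apply k).tendsto q).comp hq').eventually (hO.mem_nhds hk)).mono
        fun i hi _ => hi
    · exact Eventually.of_forall fun i h => (hk h).elim
  filter_upwards [this] with i hi
  rw [hBr, hr, hcount, hcount]
  exact Finset.card_le_card fun k => by
    simpa using hi k

end RootCount

/-! ### Transfer of these facts to real endomorphisms. -/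

section Complexify

variable {E : Type*} [NormedAddCommGroup E] [NormedSpace ℝ E] [FiniteDimensional ℝ E]

/-- The endomorphism of `ℂⁿ` with the same matrix as a given endomorphism of a real space. -/
noncomputable def complexify (L : E →L[ℝ] E) :
    (Fin (Module.finrank ℝ E) → ℂ) →L[ℂ] (Fin (Module.finrank ℝ E) → ℂ) :=
  LinearMap.toContinuousLinearMap (Matrix.toLin' ((LinearMap.toMatrix (Module.finBasis ℝ E)
    (Module.finBasis ℝ E) (L : E →ₗ[ℝ] E)).map (algebraMap ℝ ℂ)))

/-- The complex coordinates of a real vector. -/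
noncomputable def complexCoord : E →L[ℝ] (Fin (Module.finrank ℝ E) → ℂ) :=
  LinearMap.toContinuousLinearMap
    (LinearMap.pi fun i => Complex.ofRealCLM.toLinearMap ∘ₗ (Module.finBasis ℝ E).coord i)

theorem complexCoord_apply (x : E) (i) :
    complexCoord x i = ((Module.finBasis ℝ E).repr x i : ℂ) := rfl

theorem complexCoord_injective : Function.Injective (complexCoord : E → _) := fun x y h => by
  refine (Module.finBasis ℝ E).repr.injective (Finsupp.ext fun i => ?_)
  have := congrFun h i
  rwa [complexCoord_apply, complexCoord_apply, Complex.ofReal_inj] at this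

theorem complexify_complexCoord (L : E →L[ℝ] E) (x : E) :
    complexify L (complexCoord x) = complexCoord (L x) := by
  ext i
  have h1 := congrFun (LinearMap.toMatrix_mulVec_repr (Module.finBasis ℝ E) (Module.finBasis ℝ E)
    (L : E →ₗ[ℝ] E) x) i
  rw [complexCoord_apply]
  rw [show L x = (L : E →ₗ[ℝ] E) x from rfl, ← h1]
  simp [complexify, Matrix.mulVec, dotProduct, complexCoord_apply]

theorem charpoly_complexify (L : E →L[ℝ] E) :
    (complexify L : (Fin (Module.finrank ℝ E) → ℂ) →ₗ[ℂ] _).charpoly =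
      (L : E →ₗ[ℝ] E).charpoly.map (algebraMap ℝ ℂ) := by
  rw [complexify, LinearMap.coe_toContinuousLinearMap, Matrix.charpoly_toLin', Matrix.charpoly_map,
    LinearMap.charpoly_toMatrix]

theorem continuous_complexify : Continuous (complexify : (E →L[ℝ] E) → _) := by
  let f : (E →L[ℝ] E) →ₗ[ℝ] Matrix (Fin (Module.finrank ℝ E)) (Fin (Module.finrank ℝ E)) ℝ :=
    (LinearMap.toMatrix (Module.finBasis ℝ E) (Module.finBasis ℝ E)).toLinearMap ∘ₗ
      (ContinuousLinearMap.coeLM ℝ)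
  have hf : Continuous f := f.continuous_of_finiteDimensional
  let g : Matrix (Fin (Module.finrank ℝ E)) (Fin (Module.finrank ℝ E)) ℂ →ₗ[ℂ]
      ((Fin (Module.finrank ℝ E) → ℂ) →L[ℂ] (Fin (Module.finrank ℝ E) → ℂ)) :=
    LinearMap.toContinuousLinearMap.toLinearMap ∘ₗ Matrix.toLin'.toLinearMap
  have hg : Continuous g := g.continuous_of_finiteDimensional
  exact hg.comp (hf.matrix_map Complex.continuous_ofReal)

theorem ContinuousLinearMap.eventually_card_filter_roots_charpoly_le {ι : Type*} {l : Filter ι}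
    {A : ι → E →L[ℝ] E} {B : E →L[ℝ] E} (hA : Tendsto A l (𝓝 B)) {O : ℂ → Prop} [DecidablePred O]
    (hO : IsOpen {z | O z}) :
    ∀ᶠ i in l, (((B : E →ₗ[ℝ] E).charpoly.map (algebraMap ℝ ℂ)).roots.filter O).card ≤
      (((A i : E →ₗ[ℝ] E).charpoly.map (algebraMap ℝ ℂ)).roots.filter O).card := by
  simp only [← charpoly_complexify]
  exact _root_.eventually_card_filter_roots_charpoly_le
    ((continuous_complexify.tendsto B).comp hA) hO

theorem ContinuousLinearMap.exists_sum_norm_le (A : E →L[ℝ] E)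
    (hA : ∀ z ∈ ((A : E →ₗ[ℝ] E).charpoly.map (algebraMap ℝ ℂ)).roots, ‖z‖ ≠ 1) :
    ∃ C : ℝ, 0 ≤ C ∧ ∀ (N : ℕ) (w : ℕ → E), ∑ j ∈ Finset.range N, ‖w j‖ ≤
      C * (∑ j ∈ Finset.range N, ‖w (j + 1) - A (w j)‖ + (‖w 0‖ + ‖w N‖)) := by
  have hA' : ∀ z, Module.End.HasEigenvalue (complexify A).toLinearMap z → ‖z‖ ≠ 1 :=
    fun z hz => by
      refine hA z ?_
      rw [← charpoly_complexify, Polynomial.mem_roots (LinearMap.charpoly_monic _).ne_zero]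
      exact (Module.End.hasEigenvalue_iff_isRoot_charpoly _ _).1 hz
  obtain ⟨C, hC0, hC⟩ := Module.End.exists_sum_norm_le (complexify A).toLinearMap hA'
  obtain ⟨K, -, hK⟩ := (complexCoord : E →L[ℝ] _).toLinearMap.exists_antilipschitzWith
    (LinearMap.ker_eq_bot.2 complexCoord_injective)
  have hK' : ∀ x : E, ‖x‖ ≤ K * ‖complexCoord x‖ := fun x => by
    simpa using hK.le_mul_norm_sub x 0
  obtain ⟨D, hD0, hD⟩ : ∃ D : ℝ, 0 ≤ D ∧ ∀ x : E, ‖complexCoord x‖ ≤ D * ‖x‖ :=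
    ⟨_, norm_nonneg _, (complexCoord : E →L[ℝ] _).le_opNorm⟩
  refine ⟨K * (C * D), mul_nonneg K.2 (mul_nonneg hC0 hD0), fun N w => ?_⟩
  have h1 := hC N (fun j => complexCoord (w j))
  have h2 : ∑ j ∈ Finset.range N, ‖w j‖ ≤ K * ∑ j ∈ Finset.range N, ‖complexCoord (w j)‖ := by
    rw [Finset.mul_sum]
    exact Finset.sum_le_sum fun j _ => hK' _
  have h3 : ∑ j ∈ Finset.range N, ‖complexCoord (w (j + 1)) - complexify A (complexCoord (w j))‖ +
      (‖complexCoord (w 0)‖ + ‖complexCoord (w N)‖) ≤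
      D * (∑ j ∈ Finset.range N, ‖w (j + 1) - A (w j)‖ + (‖w 0‖ + ‖w N‖)) := by
    rw [mul_add, mul_add, Finset.mul_sum]
    refine add_le_add ?_ (add_le_add (hD _) (hD _))
    refine Finset.sum_le_sum fun j _ => ?_
    rw [complexify_complexCoord, ← map_sub]
    exact hD _
  refine h2.trans ?_
  rw [mul_assoc, mul_assoc]
  exact mul_le_mul_of_nonneg_left (h1.trans (mul_le_mul_of_nonneg_left h3 hC0)) K.2

end Complexify

/-! ### Hyperbolic type of a return map and spectrum of the monodromy. -/

section FlowType

variable {E : Type*} [NormedAddCommGroup E] [NormedSpace ℝ E] [FiniteDimensional ℝ E]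

/-- One eigenvalue is left on the unit circle when those of absolute value less than one and
greater than one are counted. -/
structure HasFlowType (A : E →L[ℝ] E) (s u : ℕ) : Prop where
  finrank : s + u + 1 = Module.finrank ℝ E
  card_lt : (((A : E →ₗ[ℝ] E).charpoly.map (algebraMap ℝ ℂ)).roots.filter fun z => ‖z‖ < 1).card = s
  card_gt : (((A : E →ₗ[ℝ] E).charpoly.map (algebraMap ℝ ℂ)).roots.filter fun z => 1 < ‖z‖).card = u

theorem HasFlowType.congr_charpoly {A B : E →L[ℝ] E} {s u : ℕ}
    (h : (A : E →ₗ[ℝ] E).charpoly = (B : E →ₗ[ℝ] E).charpoly) (hA : HasFlowType A s u) :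
    HasFlowType B s u :=
  ⟨hA.finrank, by rw [← h]; exact hA.card_lt, by rw [← h]; exact hA.card_gt⟩

theorem HasFlowType.comp_comm {A B : E →L[ℝ] E} {s u : ℕ} (hA : HasFlowType (A ∘L B) s u) :
    HasFlowType (B ∘L A) s u :=
  hA.congr_charpoly (by
    rw [ContinuousLinearMap.toLinearMap_comp, ContinuousLinearMap.toLinearMap_comp,
      LinearMap.charpoly_comp_comm])

open Polynomial in
theorem LinearMap.roots_map_charpoly_of_sub_mem_span {V : Submodule ℝ E} {y : E}
    (hV : IsCompl V (ℝ ∙ y)) (hy : y ≠ 0) {A : E →ₗ[ℝ] E} {B : V →ₗ[ℝ] V} {r : ℝ}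
    (hAy : A y = r • y) (hAB : ∀ v : V, A v - B v ∈ ℝ ∙ y) :
    (A.charpoly.map (algebraMap ℝ ℂ)).roots =
      (r : ℂ) ::ₘ (B.charpoly.map (algebraMap ℝ ℂ)).roots := by
  have hB : B.charpoly.map (algebraMap ℝ ℂ) ≠ 0 := (B.charpoly_monic.map _).ne_zero
  rw [LinearMap.charpoly_eq_mul_of_sub_mem_span hV hy hAy hAB, Polynomial.map_mul,
    Polynomial.map_sub, map_X, map_C, roots_mul (mul_ne_zero (X_sub_C_ne_zero _) hB),
    roots_X_sub_C]
  rfl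

theorem finrank_add_one_of_isCompl {V : Submodule ℝ E} {y : E} (hV : IsCompl V (ℝ ∙ y))
    (hy : y ≠ 0) : Module.finrank ℝ V + 1 = Module.finrank ℝ E := by
  rw [← Submodule.finrank_add_eq_of_isCompl hV, finrank_span_singleton hy]

/-- `B` is what `A` induces modulo the fixed direction `y`, so `A` has the eigenvalues of `B` and
one further eigenvalue `1`, which neither count sees. -/
theorem hasHyperbolicType_iff_hasFlowType {V : Submodule ℝ E} {y : E}
    (hV : IsCompl V (ℝ ∙ y)) (hy : y ≠ 0) {A : E →L[ℝ] E} {B : V →ₗ[ℝ] V} {s u : ℕ}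
    (hAy : A y = y) (hAB : ∀ v : V, A v - B v ∈ ℝ ∙ y) :
    HasHyperbolicType B s u ↔ HasFlowType A s u := by
  have hr := LinearMap.roots_map_charpoly_of_sub_mem_span (A := (A : E →ₗ[ℝ] E)) (r := 1) hV hy
    (by simpa using hAy) hAB
  have hfr := finrank_add_one_of_isCompl hV hy
  have h1 : (((A : E →ₗ[ℝ] E).charpoly.map (algebraMap ℝ ℂ)).roots.filter
      fun z => ‖z‖ < 1).card =
      ((B.charpoly.map (algebraMap ℝ ℂ)).roots.filter fun z => ‖z‖ < 1).card := by
    rw [hr, Multiset.filter_cons_of_neg _ (by simp)]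
  have h2 : (((A : E →ₗ[ℝ] E).charpoly.map (algebraMap ℝ ℂ)).roots.filter
      fun z => 1 < ‖z‖).card =
      ((B.charpoly.map (algebraMap ℝ ℂ)).roots.filter fun z => 1 < ‖z‖).card := by
    rw [hr, Multiset.filter_cons_of_neg _ (by simp)]
  constructor
  · rintro ⟨h3, h4, h5⟩
    exact ⟨by omega, h1.trans h4, h2.trans h5⟩
  · rintro ⟨h3, h4, h5⟩
    exact ⟨by omega, h1.symm.trans h4, h2.symm.trans h5⟩

theorem card_roots_map_charpoly {F : Type*} [AddCommGroup F] [Module ℝ F] [FiniteDimensional ℝ F]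
    (A : F →ₗ[ℝ] F) :
    (A.charpoly.map (algebraMap ℝ ℂ)).roots.card = Module.finrank ℝ F := by
  rw [← (IsAlgClosed.splits _).natDegree_eq_card_roots, Polynomial.natDegree_map,
    LinearMap.charpoly_natDegree]

theorem card_filter_norm_add (m : Multiset ℂ) :
    (m.filter fun z => ‖z‖ < 1).card + (m.filter fun z => 1 < ‖z‖).card +
      (m.filter fun z => ‖z‖ = 1).card = m.card := by
  induction m using Multiset.induction with
  | empty => simp
  | cons a m ih =>
    rcases lt_trichotomy ‖a‖ 1 with h | h | h
    · simp only [Multiset.filter_cons, h, h.le.not_gt, h.ne, if_true, if_false, Multiset.card_add,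
        Multiset.card_cons, Multiset.card_singleton, Multiset.card_zero]
      omega
    · simp only [Multiset.filter_cons, h, lt_irrefl, if_true, if_false, Multiset.card_add,
        Multiset.card_cons, Multiset.card_singleton, Multiset.card_zero]
      omega
    · simp only [Multiset.filter_cons, h, h.le.not_gt, h.ne', if_true, if_false, Multiset.card_add,
        Multiset.card_cons, Multiset.card_singleton, Multiset.card_zero]
      omega

/-- By semicontinuity the counts inside and outside the unit circle are eventually at least `s` and
`u`. A fixed vector provides an eigenvalue on the circle, so they sum to at most the dimension minus
one, which is `s + u`. -/
theorem HasFlowType.eventually {ι : Type*} {l : Filter ι} {A : ι → E →L[ℝ] E} {B : E →L[ℝ] E}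
    {s u : ℕ} (hB : HasFlowType B s u) (hA : Tendsto A l (𝓝 B))
    (hfix : ∀ᶠ i in l, ∃ y, y ≠ 0 ∧ A i y = y) : ∀ᶠ i in l, HasFlowType (A i) s u := by
  filter_upwards [hfix, ContinuousLinearMap.eventually_card_filter_roots_charpoly_le hA
    (O := fun z => ‖z‖ < 1) (isOpen_lt continuous_norm continuous_const),
    ContinuousLinearMap.eventually_card_filter_roots_charpoly_le hA
    (O := fun z => 1 < ‖z‖) (isOpen_lt continuous_const continuous_norm)]
    with i ⟨y, hy, hAy⟩ h1 h2
  rw [hB.card_lt] at h1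
  rw [hB.card_gt] at h2
  have h3 := card_filter_norm_add ((A i : E →ₗ[ℝ] E).charpoly.map (algebraMap ℝ ℂ)).roots
  rw [card_roots_map_charpoly] at h3
  have hmem : (1 : ℂ) ∈ (((A i : E →ₗ[ℝ] E).charpoly.map (algebraMap ℝ ℂ)).roots.filter
      fun z => ‖z‖ = 1) := by
    refine Multiset.mem_filter.2 ⟨?_, by simp⟩
    have h4 : (A i : E →ₗ[ℝ] E).charpoly.IsRoot 1 :=
      (Module.End.hasEigenvalue_iff_isRoot_charpoly _ _).1
        (Module.End.hasEigenvalue_of_hasEigenvector (x := y)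
          ⟨Module.End.mem_eigenspace_iff.2 (by simpa using hAy), hy⟩)
    rw [Polynomial.mem_roots ((LinearMap.charpoly_monic _).map _).ne_zero]
    simpa using h4.map (f := algebraMap ℝ ℂ)
  have h5 := Multiset.card_pos_iff_exists_mem.2 ⟨_, hmem⟩
  have := hB.finrank
  exact ⟨this, by omega, by omega⟩

/-- The projection along `v` onto the kernel of `ℓ`, composed with `L`. -/
noncomputable def transversePart (ℓ : E →L[ℝ] ℝ) (v : E) (L : E →L[ℝ] E) : E →L[ℝ] E :=
  L - (ℓ ∘L L).smulRight v

theorem transversePart_apply (ℓ : E →L[ℝ] ℝ) (v : E) (L : E →L[ℝ] E) (x : E) :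
    transversePart ℓ v L x = L x - ℓ (L x) • v := rfl

theorem isCompl_ker_span {ℓ : E →L[ℝ] ℝ} {v : E} (hv : ℓ v ≠ 0) :
    IsCompl (LinearMap.ker (ℓ : E →ₗ[ℝ] ℝ)) (ℝ ∙ v) := by
  refine ⟨Submodule.disjoint_def.2 fun x hx hx' => ?_, codisjoint_iff.2 (eq_top_iff.2 fun x _ => ?_)⟩
  · obtain ⟨c, rfl⟩ := Submodule.mem_span_singleton.1 hx'
    have : c * ℓ v = 0 := by simpa using hx
    rw [(mul_eq_zero.1 this).resolve_right hv, zero_smul]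
  · refine Submodule.mem_sup.2 ⟨x - (ℓ x / ℓ v) • v, ?_, (ℓ x / ℓ v) • v,
      Submodule.smul_mem _ _ (Submodule.mem_span_singleton_self v), sub_add_cancel _ _⟩
    simp [hv]

/-- The map kills `v` and acts on `ker ℓ` as `L` does modulo `v`, so its eigenvalues are `0` and
those of the corresponding return map. -/
theorem HasFlowType.norm_ne_one_of_mem_roots {ℓ : E →L[ℝ] ℝ} {v : E} {L : E →L[ℝ] E} {s u : ℕ}
    (hL : HasFlowType L s u) (hv : ℓ v = 1) (hLv : L v = v) :
    ∀ z ∈ ((transversePart ℓ v L : E →ₗ[ℝ] E).charpoly.map (algebraMap ℝ ℂ)).roots, ‖z‖ ≠ 1 := by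
  have hv0 : v ≠ 0 := by rintro rfl; simp at hv
  have hV := isCompl_ker_span (ℓ := ℓ) (v := v) (by simp [hv])
  have hmaps : ∀ x ∈ LinearMap.ker (ℓ : E →ₗ[ℝ] ℝ),
      (transversePart ℓ v L : E →ₗ[ℝ] E) x ∈ LinearMap.ker (ℓ : E →ₗ[ℝ] ℝ) := fun x _ => by
    simp [transversePart_apply, hv]
  set B := (transversePart ℓ v L : E →ₗ[ℝ] E).restrict hmaps
  have h1 := (hasHyperbolicType_iff_hasFlowType (A := L) (B := B) (s := s) (u := u) hV hv0 hLv
    fun x => by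
      have : L x - B x = ℓ (L x) • v := by
        rw [LinearMap.coe_restrict_apply]
        simp [transversePart_apply]
      rw [this]
      exact Submodule.smul_mem _ _ (Submodule.mem_span_singleton_self v)).2 hL
  have h2 := LinearMap.roots_map_charpoly_of_sub_mem_span
    (A := (transversePart ℓ v L : E →ₗ[ℝ] E)) (B := B) (r := 0) hV hv0
    (by simp [transversePart_apply, hLv, hv]) (fun x => by simp [B])
  intro z hz
  rw [h2, Multiset.mem_cons] at hz
  rcases hz with rfl | hz
  · simp
  intro hz1
  have h3 := card_filter_norm_add (B.charpoly.map (algebraMap ℝ ℂ)).roots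
  rw [card_roots_map_charpoly, h1.2.1, h1.2.2, h1.1] at h3
  have : z ∈ ((B.charpoly.map (algebraMap ℝ ℂ)).roots.filter fun z => ‖z‖ = 1) :=
    Multiset.mem_filter.2 ⟨hz, hz1⟩
  rw [Multiset.card_eq_zero.1 (by omega : ((B.charpoly.map (algebraMap ℝ ℂ)).roots.filter
    fun z => ‖z‖ = 1).card = 0)] at this
  simp at this

end FlowType

/-! ### Joint differentiability in time and space, and differentials of hitting maps. -/

section JointDerivative

variable {E : Type*} [NormedAddCommGroup E] [NormedSpace ℝ E]

theorem IsFlow.neg {X : E → E} {Φ : ℝ → E → E} {W : ℝ → E → E →L[ℝ] E} (h : IsFlow X Φ W) :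
    IsFlow (fun x => -X x) (fun t => Φ (-t)) (fun t => W (-t)) where
  smooth := h.smooth.neg
  lipschitz := by
    obtain ⟨K, hK⟩ := h.lipschitz
    exact ⟨K, hK.neg⟩
  zero x := by simp [h.zero]
  hasDerivAt t x := by
    exact hasDerivAt_comp_neg_time (fun t => h.hasDerivAt t x) t
  linear_zero x := by simp [h.linear_zero]
  hasDerivAt_linear t x := by
    have := hasDerivAt_comp_neg_time (fun t => h.hasDerivAt_linear t x) t
    have e : fderiv ℝ (fun x => -X x) (Φ (-t) x) = -fderiv ℝ X (Φ (-t) x) := fderiv_fun_neg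
    rw [e, ContinuousLinearMap.neg_comp]
    exact this
  hasFDerivAt t x := h.hasFDerivAt (-t) x

theorem FieldTendsto.neg {ι : Type*} {l : Filter ι} {X : ι → E → E} {Y : E → E} {y : E}
    (h : FieldTendsto l X Y y) : FieldTendsto l (fun i x => -X i x) (fun x => -Y x) y := by
  refine ⟨h.1.neg, ?_⟩
  have e : ∀ (Z : E → E) (x : E), fderiv ℝ (fun x => -Z x) x = -fderiv ℝ Z x :=
    fun Z x => fderiv_fun_neg
  simp only [e]
  exact h.2.neg

variable [FiniteDimensional ℝ E] {ι : Type*} {l : Filter ι} {X : ι → E → E} {Φ : ι → ℝ → E → E}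
  {W : ι → ℝ → E → E →L[ℝ] E}

theorem eventually_flow_close_nonneg (hF : ∀ i, IsFlow (X i) (Φ i) (W i))
    {Y : E → E} {φ : ℝ → E → E} {w : ℝ → E → E →L[ℝ] E} (hY : IsFlow Y φ w) {U : Set E}
    (hU : IsOpen U) (hconv : ∀ y ∈ U, FieldTendsto l X Y y) {a : E} (ha : a ∈ U) {η : ℝ}
    (hη : 0 < η) :
    ∃ r > 0, ∀ᶠ q in l ×ˢ 𝓝 a, ∀ t ∈ Icc 0 r, ‖(Φ q.1 t q.2, W q.1 t q.2) - (a, 1)‖ ≤ η := by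
  have hc : Continuous fun t => (φ t a, w t a) :=
    continuous_iff_continuousAt.2 fun t => (hY.hasDerivAt_prod a t).continuousAt
  have h1 : ∀ᶠ t in 𝓝 (0 : ℝ), φ t a ∈ U ∧ ‖(φ t a, w t a) - (a, 1)‖ < η / 2 := by
    have e : (φ 0 a, w 0 a) = (a, 1) := by rw [hY.zero, hY.linear_zero]
    refine ((continuous_fst.comp hc).continuousAt.eventually_mem
      (hU.mem_nhds (by simpa [hY.zero] using ha))).and ?_
    have := hc.tendsto 0 (Metric.ball_mem_nhds _ (half_pos hη))
    filter_upwards [this] with t ht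
    rw [mem_preimage, Metric.mem_ball, dist_eq_norm, e] at ht
    exact ht
  obtain ⟨r, hr, h2⟩ := Metric.eventually_nhds_iff_ball.1 h1
  have h3 : ∀ t ∈ Icc 0 (r / 2), t ∈ Metric.ball (0 : ℝ) r := fun t ht => by
    rw [Metric.mem_ball, dist_zero_right, Real.norm_eq_abs, abs_of_nonneg ht.1]
    linarith [ht.2]
  refine ⟨r / 2, half_pos hr, ?_⟩
  filter_upwards [eventually_flow_close hF hY hU hconv (x₀ := a) (τ := r / 2)
    (fun t ht => (h2 t (h3 t ht)).1) (half_pos hη)] with q hq t ht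
  have h4 := norm_sub_le_norm_sub_add_norm_sub (Φ q.1 t q.2, W q.1 t q.2) (φ t a, w t a) (a, 1)
  linarith [hq t ht, (h2 t (h3 t ht)).2]

/-- The flows and their derivatives for short times. -/
theorem tendsto_flow_zero (hF : ∀ i, IsFlow (X i) (Φ i) (W i))
    {Y : E → E} {φ : ℝ → E → E} {w : ℝ → E → E →L[ℝ] E} (hY : IsFlow Y φ w) {U : Set E}
    (hU : IsOpen U) (hconv : ∀ y ∈ U, FieldTendsto l X Y y) {a : E} (ha : a ∈ U) :
    Tendsto (fun q : ι × (ℝ × E) => (Φ q.1 q.2.1 q.2.2, W q.1 q.2.1 q.2.2)) (l ×ˢ 𝓝 ((0 : ℝ), a))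
      (𝓝 (a, 1)) := by
  refine Metric.nhds_basis_closedBall.tendsto_right_iff.2 fun η hη => ?_
  obtain ⟨r, hr, h1⟩ := eventually_flow_close_nonneg hF hY hU hconv ha hη
  obtain ⟨r', hr', h2⟩ := eventually_flow_close_nonneg (fun i => (hF i).neg) hY.neg hU
    (fun y hy => (hconv y hy).neg) ha hη
  have hproj : Tendsto (fun q : ι × (ℝ × E) => (q.1, q.2.2)) (l ×ˢ 𝓝 ((0 : ℝ), a)) (l ×ˢ 𝓝 a) :=
    tendsto_fst.prodMk (((continuous_snd.tendsto ((0 : ℝ), a))).comp tendsto_snd)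
  have htime : Tendsto (fun q : ι × (ℝ × E) => q.2.1) (l ×ˢ 𝓝 ((0 : ℝ), a)) (𝓝 0) :=
    ((continuous_fst.tendsto ((0 : ℝ), a))).comp tendsto_snd
  filter_upwards [hproj.eventually h1, hproj.eventually h2, htime.eventually (gt_mem_nhds hr),
    htime.eventually (lt_mem_nhds (neg_lt_zero.2 hr'))] with q h1 h2 h3 h4
  rw [Metric.mem_closedBall, dist_eq_norm]
  rcases le_total 0 q.2.1 with h | h
  · exact h1 _ ⟨h, h3.le⟩
  · simpa using h2 (-q.2.1) ⟨by linarith, by linarith⟩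

/-- The flows and their derivatives near a given time. -/
theorem C1Reach.tendsto_flow (hF : ∀ i, IsFlow (X i) (Φ i) (W i))
    {Y : E → E} {φ : ℝ → E → E} {w : ℝ → E → E →L[ℝ] E} (hY : IsFlow Y φ w) {U : Set E}
    (hU : IsOpen U) (hconv : ∀ y ∈ U, FieldTendsto l X Y y) {x a : E} {T : ℝ} {L : E →L[ℝ] E}
    (hT : C1Reach l Φ W x T a L) (ha : a ∈ U) :
    Tendsto (fun q : ι × (ℝ × E) => (Φ q.1 (T + q.2.1) q.2.2, W q.1 (T + q.2.1) q.2.2))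
      (l ×ˢ 𝓝 ((0 : ℝ), x)) (𝓝 (a, L)) := by
  have h0 := tendsto_flow_zero hF hY hU hconv ha
  have hproj : Tendsto (fun q : ι × (ℝ × E) => (q.1, q.2.2)) (l ×ˢ 𝓝 ((0 : ℝ), x)) (l ×ˢ 𝓝 x) :=
    tendsto_fst.prodMk (((continuous_snd.tendsto ((0 : ℝ), x))).comp tendsto_snd)
  have htime : Tendsto (fun q : ι × (ℝ × E) => q.2.1) (l ×ˢ 𝓝 ((0 : ℝ), x)) (𝓝 0) :=
    ((continuous_fst.tendsto ((0 : ℝ), x))).comp tendsto_snd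
  have h1 : Tendsto (fun q : ι × (ℝ × E) => (q.1, (q.2.1, Φ q.1 T q.2.2))) (l ×ˢ 𝓝 ((0 : ℝ), x))
      (l ×ˢ 𝓝 ((0 : ℝ), a)) :=
    tendsto_fst.prodMk (htime.prodMk_nhds (hT.1.comp hproj))
  have h2 := h0.comp h1
  have h3 := hT.2.comp hproj
  have hcomp : Tendsto (fun p : (E →L[ℝ] E) × (E →L[ℝ] E) => p.1 ∘L p.2) (𝓝 (1, L))
      (𝓝 (1 ∘L L)) :=
    (isBoundedBilinearMap_comp (𝕜 := ℝ) (E := E) (F := E) (G := E)).continuous.tendsto _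
  have h4 := hcomp.comp (((continuous_snd.tendsto _).comp h2).prodMk_nhds h3)
  refine (((continuous_fst.tendsto _).comp h2).prodMk_nhds h4).congr fun q => ?_
  simp only [Function.comp_apply]
  rw [add_comm T, (hF q.1).add, (hF q.1).linear_add]

/-- Both partial derivatives exist everywhere and are jointly continuous at the point; the
continuity is `C1Reach.tendsto_flow` for a constant family. -/
theorem IsFlow.hasStrictFDerivAt {X : E → E} {Φ : ℝ → E → E} {W : ℝ → E → E →L[ℝ] E}
    (h : IsFlow X Φ W) {t : ℝ} (ht : 0 ≤ t) (x : E) :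
    HasStrictFDerivAt (fun z : ℝ × E => Φ z.1 z.2)
      ((ContinuousLinearMap.toSpanSingleton ℝ (X (Φ t x))).coprod (W t x)) (t, x) := by
  have hconv : ∀ y ∈ (univ : Set E), FieldTendsto (pure ()) (fun _ : Unit => X) X y :=
    fun y _ => fieldTendsto_const _ h.smooth y
  have h1 := C1Reach.tendsto_flow (l := pure ()) (fun _ : Unit => h) h isOpen_univ hconv
    (h.c1Reach _ x ht) trivial
  have h2 : Tendsto (fun z : ℝ × E => (Φ z.1 z.2, W z.1 z.2)) (𝓝 (t, x)) (𝓝 (Φ t x, W t x)) := by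
    have h3 : Tendsto (fun z : ℝ × E => ((), (z.1 - t, z.2))) (𝓝 (t, x))
        (pure () ×ˢ 𝓝 ((0 : ℝ), x)) := by
      refine Tendsto.prodMk (tendsto_pure.2 (Eventually.of_forall fun _ => rfl)) ?_
      have : Continuous fun z : ℝ × E => (z.1 - t, z.2) := by fun_prop
      simpa using this.tendsto (t, x)
    refine (h1.comp h3).congr fun z => ?_
    simp
  refine hasStrictFDerivAt_uncurry_coprod (f := Φ)
    (f₁ := fun t x => ContinuousLinearMap.toSpanSingleton ℝ (X (Φ t x))) (f₂ := W) (u := (t, x))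
    (Eventually.of_forall fun v => (h.hasDerivAt v.1 v.2).hasFDerivAt)
    (Eventually.of_forall fun v => h.hasFDerivAt v.1 v.2) ?_ ((continuous_snd.tendsto _).comp h2)
  have h4 : Continuous fun y : E => ContinuousLinearMap.toSpanSingleton ℝ (X y) :=
    ContinuousLinearMap.toSpanSingletonCLE.continuous.comp h.smooth.continuous
  exact (h4.tendsto _).comp ((continuous_fst.tendsto _).comp h2)

/-- The derivative of a map into a hypersurface given by following a flow. -/
theorem IsFlow.hasFDerivWithinAt_of_hit {X : E → E} {Φ : ℝ → E → E} {W : ℝ → E → E →L[ℝ] E}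
    (hF : IsFlow X Φ W) {T : ℝ} (hT : 0 ≤ T) {p : E} {S : Set E} {τ : E → ℝ}
    (hτ : ContinuousWithinAt τ S p) (hτp : τ p = T) {h : E → ℝ} {ν : E →L[ℝ] ℝ}
    (hh : HasFDerivAt h ν (Φ T p)) (h0 : h (Φ T p) = 0)
    (hit : ∀ᶠ x in 𝓝[S] p, h (Φ (τ x) x) = 0) (hν : ν (X (Φ T p)) ≠ 0) :
    HasFDerivWithinAt (fun x => Φ (τ x) x)
      (W T p - (ν (X (Φ T p)))⁻¹ • (ν ∘L W T p).smulRight (X (Φ T p))) S p := by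
  set b := ν (X (Φ T p)) with hb
  set J := W T p with hJ
  have hΦ := (hF.hasStrictFDerivAt hT p).hasFDerivAt
  have hcomp : HasFDerivAt (fun z : ℝ × E => h (Φ z.1 z.2)) (ν ∘L
      ((ContinuousLinearMap.toSpanSingleton ℝ (X (Φ T p))).coprod (W T p))) (T, p) :=
    HasFDerivAt.comp (g := h) (T, p) hh hΦ
  have hpair : Tendsto (fun x => (τ x, x)) (𝓝[S] p) (𝓝 (T, p)) := by
    rw [← hτp]
    exact Tendsto.prodMk_nhds hτ (tendsto_id.mono_left nhdsWithin_le_nhds)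
  have hsmall := (hasFDerivAt_iff_isLittleO.1 hcomp).comp_tendsto hpair
  -- The hitting time is only known to be continuous. Since `h` vanishes at the hits, the expansion
  -- of `h ∘ Φ` becomes an approximate linear equation for `τ x - T`.
  have hsmall' : (fun x => b * (τ x - T) + ν (J (x - p))) =o[𝓝[S] p]
      fun x => ((τ x, x) - (T, p) : ℝ × E) := by
    rw [← Asymptotics.isLittleO_neg_left]
    refine hsmall.congr' ?_ EventuallyEq.rfl
    filter_upwards [hit] with x hx
    simp [hx, h0, ← hJ, hb]
    ring
  -- The remainder involves `τ x - T` with coefficient at most `|b| / 2`, which is absorbed on the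
  -- left; this turns continuity into a linear bound.
  have hO : (fun x => τ x - T) =O[𝓝[S] p] fun x => x - p := by
    have hb0 : 0 < |b| := abs_pos.2 hν
    have := (Asymptotics.isLittleO_iff.1 hsmall') (half_pos hb0)
    refine Asymptotics.IsBigO.of_bound (2 * (‖ν‖ * ‖J‖) / |b| + 1) ?_
    filter_upwards [this] with x hx
    have h1 : ‖((τ x, x) - (T, p) : ℝ × E)‖ ≤ ‖τ x - T‖ + ‖x - p‖ := by
      rw [Prod.mk_sub_mk, Prod.norm_mk]
      exact max_le (le_add_of_nonneg_right (norm_nonneg _)) (le_add_of_nonneg_left (norm_nonneg _))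
    have h2 : ‖ν (J (x - p))‖ ≤ ‖ν‖ * ‖J‖ * ‖x - p‖ := by
      rw [mul_assoc]
      exact (ν.le_opNorm _).trans (mul_le_mul_of_nonneg_left (J.le_opNorm _) (norm_nonneg _))
    have h3 : |b| * ‖τ x - T‖ ≤ ‖b * (τ x - T) + ν (J (x - p))‖ + ‖ν (J (x - p))‖ := by
      rw [← Real.norm_eq_abs, ← norm_mul]
      exact norm_le_add_norm_add _ _
    have h4 : |b| / 2 * ‖((τ x, x) - (T, p) : ℝ × E)‖ ≤ |b| / 2 * (‖τ x - T‖ + ‖x - p‖) := by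
      gcongr
    have h5 : |b| / 2 * ‖τ x - T‖ ≤ (‖ν‖ * ‖J‖ + |b| / 2) * ‖x - p‖ := by nlinarith
    have h6 : ‖τ x - T‖ ≤ ((‖ν‖ * ‖J‖ + |b| / 2) * ‖x - p‖) / (|b| / 2) := by
      rw [le_div_iff₀ (by positivity)]
      linarith
    refine h6.trans (le_of_eq ?_)
    field_simp
  have hpairO : (fun x => ((τ x, x) - (T, p) : ℝ × E)) =O[𝓝[S] p] fun x => x - p :=
    hO.prod_left (Asymptotics.isBigO_refl _ _)
  have hτ' : HasFDerivWithinAt τ (-(b⁻¹ • (ν ∘L J))) S p := by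
    refine HasFDerivWithinAt.of_isLittleO ?_
    refine ((hsmall'.trans_isBigO hpairO).const_mul_left b⁻¹).congr_left fun x => ?_
    simp only [hτp]
    rw [mul_add, inv_mul_cancel_left₀ hν]
    simp
  have hfin := HasFDerivAt.comp_hasFDerivWithinAt (g := fun z : ℝ × E => Φ z.1 z.2) p
    (by rw [hτp]; exact hΦ) (hτ'.prodMk (hasFDerivWithinAt_id p S))
  refine hfin.congr_fderiv ?_
  ext v
  simp [hJ, hb, sub_eq_neg_add, smul_smul]

end JointDerivative

/-! ### Limit cycles of families of flows: local estimates. -/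

section LimitCycle

/-- The radius does not depend on the index. This is what allows one fixed neighbourhood to serve
all small parameters. -/
theorem IsCompact.exists_ball_eventually_forall {ι F : Type*} [PseudoMetricSpace F] {l : Filter ι}
    {G : Set F} (hG : IsCompact G) {P : ι → F → Prop}
    (h : ∀ z ∈ G, ∀ᶠ q in l ×ˢ 𝓝 z, P q.1 q.2) :
    ∃ r > 0, ∀ᶠ i in l, ∀ z ∈ G, ∀ y ∈ Metric.ball z r, P i y := by
  have h1 : ∀ᶠ q in l ×ˢ 𝓝ˢ G, P q.1 q.2 := by
    rw [hG.prod_nhdsSet_eq_biSup]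
    simpa only [eventually_iSup] using h
  obtain ⟨p, hp, q, hq, hpq⟩ := eventually_prod_iff.1 h1
  obtain ⟨V, hV, hGV, hVq⟩ := mem_nhdsSet_iff_exists.1 hq
  obtain ⟨r, hr, hrV⟩ := hG.exists_thickening_subset_open hV hGV
  refine ⟨r, hr, ?_⟩
  filter_upwards [hp] with i hi z hz y hy
  exact hpq hi (hVq (hrV (Metric.mem_thickening_iff.2 ⟨z, hz, hy⟩)))

theorem exists_ball_eventually_forall {ι F : Type*} [PseudoMetricSpace F] {l : Filter ι}
    {z : F} {P : ι → F → Prop} (h : ∀ᶠ q in l ×ˢ 𝓝 z, P q.1 q.2) :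
    ∃ r > 0, ∀ᶠ i in l, ∀ y ∈ Metric.ball z r, P i y := by
  simpa using isCompact_singleton.exists_ball_eventually_forall (G := {z}) (by simpa using h)

theorem norm_toSpanSingleton_coprod_sub_le {E : Type*} [NormedAddCommGroup E] [NormedSpace ℝ E]
    (x y : E) (A B : E →L[ℝ] E) : ‖(ContinuousLinearMap.toSpanSingleton ℝ x).coprod A -
      (ContinuousLinearMap.toSpanSingleton ℝ y).coprod B‖ ≤ ‖x - y‖ + ‖A - B‖ := by
  refine ContinuousLinearMap.opNorm_le_bound _ (by positivity) fun z => ?_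
  have e : ((ContinuousLinearMap.toSpanSingleton ℝ x).coprod A -
      (ContinuousLinearMap.toSpanSingleton ℝ y).coprod B) z = z.1 • (x - y) + (A - B) z.2 := by
    simp [smul_sub]
    abel
  rw [e]
  have h1 := (A - B).le_opNorm z.2
  have h2 := mul_le_mul_of_nonneg_left (norm_snd_le z) (norm_nonneg (A - B))
  have h3 := mul_le_mul_of_nonneg_left (norm_fst_le z) (norm_nonneg (x - y))
  refine (norm_add_le _ _).trans ?_
  rw [norm_smul]
  linarith

theorem IsFlow.hasFDerivAt_add_time {E : Type*} [NormedAddCommGroup E] [NormedSpace ℝ E]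
    [FiniteDimensional ℝ E] {X : E → E} {Φ : ℝ → E → E} {W : ℝ → E → E →L[ℝ] E}
    (hF : IsFlow X Φ W) {T : ℝ} {z : ℝ × E} (hz : 0 ≤ T + z.1) :
    HasFDerivAt (fun z : ℝ × E => Φ (T + z.1) z.2) ((ContinuousLinearMap.toSpanSingleton ℝ
      (X (Φ (T + z.1) z.2))).coprod (W (T + z.1) z.2)) z := by
  have h1 := (hF.hasStrictFDerivAt hz z.2).hasFDerivAt
  have h2 : HasFDerivAt (fun z : ℝ × E => (T + z.1, z.2)) (ContinuousLinearMap.id ℝ (ℝ × E)) z :=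
    (((ContinuousLinearMap.fst ℝ ℝ E).hasFDerivAt).const_add T).prodMk
      (ContinuousLinearMap.snd ℝ ℝ E).hasFDerivAt
  have h3 := HasFDerivAt.comp (g := fun z : ℝ × E => Φ z.1 z.2) z h1 h2
  rwa [ContinuousLinearMap.comp_id] at h3

/-- A closed curve `c`, of period `T`, which is approximated by orbits of the vector fields `X i`.
Near `c 0` the fields converge to `v`, and the time `T` maps converge to `L` to first order. -/
structure LimitCycle {E ι : Type*} [NormedAddCommGroup E] [NormedSpace ℝ E] (l : Filter ι)
    (X : ι → E → E) (Φ : ι → ℝ → E → E) (W : ι → ℝ → E → E →L[ℝ] E) (c : ℝ → E) (T K : ℝ) (v : E)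
    (L : E →L[ℝ] E) : Prop where
  isFlow : ∀ i, IsFlow (X i) (Φ i) (W i)
  norm_le : ∀ i x, ‖X i x‖ ≤ K
  period_pos : 0 < T
  field : Tendsto (fun q : ι × E => X q.1 q.2) (l ×ˢ 𝓝 (c 0)) (𝓝 v)
  field_ne : v ≠ 0
  tendsto_flow : Tendsto (fun q : ι × (ℝ × E) => (Φ q.1 (T + q.2.1) q.2.2, W q.1 (T + q.2.1) q.2.2))
    (l ×ˢ 𝓝 ((0 : ℝ), c 0)) (𝓝 (c 0, L))
  reach : ∀ t ∈ Icc 0 T, C0Reach l Φ (c 0) t (c t)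
  reach_end : ∀ t ∈ Icc 0 T, C0Reach l Φ (c t) (T - t) (c 0)
  simple : ∀ t ∈ Ioo 0 T, c t ≠ c 0

namespace LimitCycle

variable {E ι : Type*} [NormedAddCommGroup E] [NormedSpace ℝ E] {l : Filter ι} [l.NeBot]
  {X : ι → E → E} {Φ : ι → ℝ → E → E} {W : ι → ℝ → E → E →L[ℝ] E} {c : ℝ → E} {T K : ℝ} {v : E}
  {L : E →L[ℝ] E}

theorem norm_flow_sub_le (hc : LimitCycle l X Φ W c T K v L) (i : ι) (x : E) (s t : ℝ) :
    ‖Φ i t x - Φ i s x‖ ≤ K * |t - s| :=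
  (hc.isFlow i).norm_sub_le (hc.norm_le i) x s t

theorem speed_nonneg (hc : LimitCycle l X Φ W c T K v L) : 0 ≤ K := by
  obtain ⟨i⟩ := l.nonempty_of_neBot
  exact (norm_nonneg _).trans (hc.norm_le i 0)

theorem tendsto_orbit (hc : LimitCycle l X Φ W c T K v L) {t : ℝ} (ht : t ∈ Icc 0 T) :
    Tendsto (fun i => Φ i t (c 0)) l (𝓝 (c t)) :=
  (hc.reach t ht).comp (tendsto_id.prodMk tendsto_const_nhds)

theorem norm_sub_le (hc : LimitCycle l X Φ W c T K v L) {s t : ℝ} (hs : s ∈ Icc 0 T)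
    (ht : t ∈ Icc 0 T) : ‖c t - c s‖ ≤ K * |t - s| :=
  le_of_tendsto ((hc.tendsto_orbit ht).sub (hc.tendsto_orbit hs)).norm
    (Eventually.of_forall fun i => hc.norm_flow_sub_le i _ s t)

theorem continuousOn (hc : LimitCycle l X Φ W c T K v L) : ContinuousOn c (Icc 0 T) :=
  LipschitzOnWith.continuousOn (K := K.toNNReal) <| LipschitzOnWith.of_dist_le_mul fun t ht s hs => by
    rw [dist_eq_norm, Real.coe_toNNReal _ hc.speed_nonneg]
    exact hc.norm_sub_le hs ht

theorem zero_mem (hc : LimitCycle l X Φ W c T K v L) : (0 : ℝ) ∈ Icc 0 T := ⟨le_rfl, hc.period_pos.le⟩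

theorem period_mem (hc : LimitCycle l X Φ W c T K v L) : T ∈ Icc 0 T := ⟨hc.period_pos.le, le_rfl⟩

theorem apply_period (hc : LimitCycle l X Φ W c T K v L) : c T = c 0 := by
  have h1 := hc.reach_end 0 hc.zero_mem
  rw [sub_zero] at h1
  exact tendsto_nhds_unique (hc.tendsto_orbit hc.period_mem)
    (h1.comp (tendsto_id.prodMk tendsto_const_nhds))

theorem tendsto_flow_prod (hc : LimitCycle l X Φ W c T K v L) :
    Tendsto (fun q : ι × (ℝ × E) => (q.1, Φ q.1 (T + q.2.1) q.2.2))
      (l ×ˢ 𝓝 ((0 : ℝ), c 0)) (l ×ˢ 𝓝 (c 0)) :=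
  tendsto_fst.prodMk ((continuous_fst.tendsto _).comp hc.tendsto_flow)

/-- The identity `W X = X ∘ Φ` passes to the limit, and the field has the same limit at both ends of
the cycle. -/
theorem linear_field (hc : LimitCycle l X Φ W c T K v L) : L v = v := by
  have h0 : Tendsto (fun i : ι => (i, ((0 : ℝ), c 0))) l (l ×ˢ 𝓝 ((0 : ℝ), c 0)) :=
    tendsto_id.prodMk tendsto_const_nhds
  have h1 : Tendsto (fun i => X i (c 0)) l (𝓝 v) :=
    hc.field.comp (tendsto_id.prodMk tendsto_const_nhds)
  have h2 : Tendsto (fun i => W i (T + 0) (c 0)) l (𝓝 L) :=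
    ((continuous_snd.tendsto _).comp hc.tendsto_flow).comp h0
  have h3 : Tendsto (fun i => W i (T + 0) (c 0) (X i (c 0))) l (𝓝 (L v)) :=
    ((isBoundedBilinearMap_apply (𝕜 := ℝ) (E := E) (F := E)).continuous.tendsto (L, v)).comp
      (h2.prodMk_nhds h1)
  have h4 : Tendsto (fun i => X i (Φ i (T + 0) (c 0))) l (𝓝 v) :=
    hc.field.comp (hc.tendsto_flow_prod.comp h0)
  refine tendsto_nhds_unique h3 (h4.congr fun i => ?_)
  rw [(hc.isFlow i).linear_field]

/-- Orbits that start close to `c 0` follow `c`. -/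
theorem exists_forall_norm_sub_lt (hc : LimitCycle l X Φ W c T K v L) {η : ℝ} (hη : 0 < η) :
    ∃ r > 0, ∀ᶠ i in l, ∀ x ∈ Metric.ball (c 0) r, ∀ t ∈ Icc 0 T, ‖Φ i t x - c t‖ < η := by
  have hK := hc.speed_nonneg
  obtain ⟨r, hr, h⟩ := (isCompact_Icc.prod isCompact_singleton :
    IsCompact (Icc 0 T ×ˢ {c 0})).exists_ball_eventually_forall (l := l)
    (P := fun i z => z.1 ∈ Icc 0 T → ‖Φ i z.1 z.2 - c z.1‖ < η) (by
      rintro ⟨t, x⟩ ⟨ht, rfl : x = c 0⟩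
      have hproj : Tendsto (fun q : ι × (ℝ × E) => (q.1, q.2.2)) (l ×ˢ 𝓝 (t, c 0))
          (l ×ˢ 𝓝 (c 0)) :=
        tendsto_fst.prodMk ((continuous_snd.tendsto (t, c 0)).comp tendsto_snd)
      have htime : Tendsto (fun q : ι × (ℝ × E) => 2 * (K * |q.2.1 - t|)) (l ×ˢ 𝓝 (t, c 0))
          (𝓝 0) := by
        have : Continuous fun q : ℝ × E => 2 * (K * |q.1 - t|) := by fun_prop
        have := (this.tendsto (t, c 0)).comp (tendsto_snd (f := l))
        simpa [Function.comp_def] using this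
      filter_upwards [((hc.reach t ht).comp hproj) (Metric.ball_mem_nhds _ (half_pos hη)),
        htime.eventually (gt_mem_nhds (half_pos hη))] with q h1 h2 h3
      have h4 := hc.norm_flow_sub_le q.1 q.2.2 t q.2.1
      have h5 := hc.norm_sub_le h3 ht
      rw [abs_sub_comm] at h5
      simp only [mem_preimage, Function.comp_apply, mem_ball_iff_norm] at h1
      have : Φ q.1 q.2.1 q.2.2 - c q.2.1 = (Φ q.1 q.2.1 q.2.2 - Φ q.1 t q.2.2) +
        (Φ q.1 t q.2.2 - c t) + (c t - c q.2.1) := by abel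
      rw [this]
      refine norm_add₃_le.trans_lt ?_
      linarith)
  refine ⟨r, hr, h.mono fun i hi x hx t ht => hi (t, c 0) ⟨ht, rfl⟩ (t, x) ?_ ht⟩
  rw [Metric.mem_ball, Prod.dist_eq]
  exact max_lt (by simpa using hr) hx

/-- Points close to `c` flow to `c 0`. -/
theorem exists_forall_norm_flow_sub_lt (hc : LimitCycle l X Φ W c T K v L) {η : ℝ} (hη : 0 < η) :
    ∃ r > 0, ∀ᶠ i in l, ∀ t ∈ Icc 0 T, ∀ y ∈ Metric.ball (c t) r, ‖Φ i (T - t) y - c 0‖ < η := by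
  have hK := hc.speed_nonneg
  obtain ⟨r, hr, h⟩ := (isCompact_Icc.image_of_continuousOn
    (continuousOn_id.prodMk hc.continuousOn)).exists_ball_eventually_forall (l := l)
    (P := fun i z => ‖Φ i (T - z.1) z.2 - c 0‖ < η) (by
      rintro _ ⟨t, ht, rfl⟩
      have hproj : Tendsto (fun q : ι × (ℝ × E) => (q.1, q.2.2)) (l ×ˢ 𝓝 (t, c t))
          (l ×ˢ 𝓝 (c t)) :=
        tendsto_fst.prodMk ((continuous_snd.tendsto (t, c t)).comp tendsto_snd)
      have htime : Tendsto (fun q : ι × (ℝ × E) => K * |(T - q.2.1) - (T - t)|) (l ×ˢ 𝓝 (t, c t))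
          (𝓝 0) := by
        have : Continuous fun q : ℝ × E => K * |(T - q.1) - (T - t)| := by fun_prop
        have := (this.tendsto (t, c t)).comp (tendsto_snd (f := l))
        simpa [Function.comp_def] using this
      filter_upwards [((hc.reach_end t ht).comp hproj) (Metric.ball_mem_nhds _ (half_pos hη)),
        htime.eventually (gt_mem_nhds (half_pos hη))] with q h1 h2
      have h4 := hc.norm_flow_sub_le q.1 q.2.2 (T - t) (T - q.2.1)
      simp only [mem_preimage, Function.comp_apply, mem_ball_iff_norm] at h1
      have := norm_sub_le_norm_sub_add_norm_sub (Φ q.1 (T - q.2.1) q.2.2) (Φ q.1 (T - t) q.2.2) (c 0)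
      linarith)
  refine ⟨r, hr, h.mono fun i hi t ht y hy => hi (t, c t) ⟨t, ht, rfl⟩ (t, y) ?_⟩
  rw [Metric.mem_ball, Prod.dist_eq]
  exact max_lt (by simpa using hr) hy

/-- The fields are close to the constant `v` near `c 0`, so short orbits there are nearly straight.
-/
theorem exists_norm_flow_sub_sub_le (hc : LimitCycle l X Φ W c T K v L) {η : ℝ} (hη : 0 < η) :
    ∃ r > 0, ∀ᶠ i in l, ∀ x ∈ Metric.ball (c 0) r, ∀ s ∈ Icc (-r) r, ∀ t ∈ Icc (-r) r,
      ‖Φ i t x - Φ i s x - (t - s) • v‖ ≤ η * |t - s| := by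
  have hK := hc.speed_nonneg
  obtain ⟨ρ, hρ, h⟩ := exists_ball_eventually_forall
    (P := fun i x => X i x ∈ Metric.closedBall v η) (hc.field.eventually (Metric.closedBall_mem_nhds v hη))
  refine ⟨ρ / (2 * (K + 1)), by positivity, h.mono fun i hi x hx s hs t ht => ?_⟩
  set r := ρ / (2 * (K + 1)) with hr
  have hr' : r * (K + 1) = ρ / 2 := by rw [hr]; field_simp
  have hr0 : 0 < r := by positivity
  have hmem : ∀ s ∈ Icc (-r) r, Φ i s x ∈ Metric.ball (c 0) ρ := fun s hs => by
    have h1 := hc.norm_flow_sub_le i x 0 s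
    rw [(hc.isFlow i).zero, sub_zero] at h1
    rw [mem_ball_iff_norm] at hx ⊢
    have h2 := norm_sub_le_norm_sub_add_norm_sub (Φ i s x) x (c 0)
    have h3 := mul_le_mul_of_nonneg_left (abs_le.2 hs) hK
    linarith
  have hd : ∀ s ∈ Icc (-r) r, HasDerivWithinAt (fun s => Φ i s x - s • v) (X i (Φ i s x) - v)
      (Icc (-r) r) s := fun s _ => by
    have := (((hc.isFlow i).hasDerivAt s x).sub ((hasDerivAt_id s).smul_const v)).hasDerivWithinAt
      (s := Icc (-r) r)
    rw [one_smul] at this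
    exact this
  have := (convex_Icc (-r) r).norm_image_sub_le_of_norm_hasDerivWithin_le hd
    (fun s hs => by
      have := hi _ (hmem s hs)
      rwa [mem_closedBall_iff_norm] at this) hs ht
  rw [Real.norm_eq_abs] at this
  refine le_trans (le_of_eq ?_) this
  rw [sub_smul]
  congr 1
  abel

variable [FiniteDimensional ℝ E]

/-- Uniform differentiability of the flows at times close to the period. -/
theorem exists_approximates (hc : LimitCycle l X Φ W c T K v L) {η : ℝ} (hη : 0 < η) :
    ∃ r > 0, ∀ᶠ i in l, ∀ z ∈ Metric.ball ((0 : ℝ), c 0) r, ∀ z' ∈ Metric.ball ((0 : ℝ), c 0) r,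
      ‖Φ i (T + z.1) z.2 - Φ i (T + z'.1) z'.2 - (L (z.2 - z'.2) + (z.1 - z'.1) • v)‖ ≤
        η * ‖z - z'‖ := by
  let Λ : (ℝ × E) →L[ℝ] E := (ContinuousLinearMap.toSpanSingleton ℝ v).coprod L
  have h1 : Tendsto (fun q : ι × (ℝ × E) => X q.1 (Φ q.1 (T + q.2.1) q.2.2))
    (l ×ˢ 𝓝 ((0 : ℝ), c 0)) (𝓝 v) := hc.field.comp hc.tendsto_flow_prod
  have h2 := (continuous_snd.tendsto _).comp hc.tendsto_flow
  obtain ⟨r, hr, h⟩ := exists_ball_eventually_forall (P := fun i (z : ℝ × E) =>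
    X i (Φ i (T + z.1) z.2) ∈ Metric.closedBall v (η / 2) ∧
      W i (T + z.1) z.2 ∈ Metric.closedBall L (η / 2))
    ((h1.eventually (Metric.closedBall_mem_nhds v (half_pos hη))).and
      (h2.eventually (Metric.closedBall_mem_nhds L (half_pos hη))))
  refine ⟨min r T, lt_min hr hc.period_pos, h.mono fun i hi z hz z' hz' => ?_⟩
  have hd : ∀ z ∈ Metric.ball ((0 : ℝ), c 0) (min r T),
      HasFDerivWithinAt (fun z : ℝ × E => Φ i (T + z.1) z.2) ((ContinuousLinearMap.toSpanSingleton ℝ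
      (X i (Φ i (T + z.1) z.2))).coprod (W i (T + z.1) z.2))
      (Metric.ball ((0 : ℝ), c 0) (min r T)) z := fun z hz => by
    have hpos : 0 ≤ T + z.1 := by
      have h1 : |z.1| < min r T := by
        have := (le_max_left (dist z.1 0) (dist z.2 (c 0))).trans_lt hz
        simpa using this
      linarith [(abs_lt.1 (h1.trans_le (min_le_right _ _))).1]
    exact ((hc.isFlow i).hasFDerivAt_add_time hpos).hasFDerivWithinAt
  have := (convex_ball ((0 : ℝ), c 0) (min r T)).norm_image_sub_le_of_norm_hasFDerivWithin_le'
    (φ := Λ) (C := η) hd (fun y hy => by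
      have := hi y (Metric.ball_subset_ball (min_le_left _ _) hy)
      rw [mem_closedBall_iff_norm, mem_closedBall_iff_norm] at this
      exact (norm_toSpanSingleton_coprod_sub_le _ _ _ _).trans (by linarith [this.1, this.2]))
      hz' hz
  refine le_trans (le_of_eq ?_) this
  congr 2
  simp [Λ, add_comm]

/-- Points close to `c 0` flow in a short time to the hyperplane through `c 0`. -/
theorem exists_hit (hc : LimitCycle l X Φ W c T K v L) {ℓ : E →L[ℝ] ℝ} (hℓ : ℓ v = 1) :
    ∃ r > 0, ∀ᶠ i in l, ∀ y ∈ Metric.ball (c 0) r,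
      ∃ t, |t| ≤ 2 * ‖ℓ‖ * ‖y - c 0‖ ∧ ℓ (Φ i t y - c 0) = 0 := by
  obtain ⟨ρ, hρ, h⟩ := hc.exists_norm_flow_sub_sub_le (η := (2 * (‖ℓ‖ + 1))⁻¹) (by positivity)
  refine ⟨min ρ (ρ / (2 * (‖ℓ‖ + 1))), by positivity, h.mono fun i hi y hy => ?_⟩
  have hy1 := Metric.ball_subset_ball (min_le_left _ _) hy
  have hy2 : ‖y - c 0‖ * (2 * (‖ℓ‖ + 1)) < ρ := by
    have := Metric.ball_subset_ball (min_le_right _ _) hy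
    rw [mem_ball_iff_norm] at this
    exact (lt_div_iff₀ (by positivity)).1 this
  set f : ℝ → ℝ := fun t => ℓ (Φ i t y - c 0) with hf
  have hfc : Continuous f :=
    ℓ.continuous.comp (((hc.isFlow i).continuous_time y).sub continuous_const)
  have hest : ∀ t ∈ Icc (-ρ) ρ, |f t - f 0 - t| ≤ |t| / 2 := fun t ht => by
    have h1 := hi y hy1 0 ⟨by linarith, hρ.le⟩ t ht
    have e : f t - f 0 - t = ℓ (Φ i t y - Φ i 0 y - (t - 0) • v) := by
      simp [hf, hℓ]
    rw [e, ← Real.norm_eq_abs]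
    refine (ℓ.le_opNorm _).trans ((mul_le_mul_of_nonneg_left h1 (norm_nonneg _)).trans ?_)
    rw [sub_zero, inv_mul_eq_div, mul_div_assoc', div_le_div_iff₀ (by positivity) (by positivity)]
    nlinarith [abs_nonneg t, norm_nonneg ℓ]
  -- Along the orbit `ℓ` starts within `b` of zero and changes by at least half the elapsed time, so
  -- times `-2 b` and `2 b` give opposite signs.
  set b := ‖ℓ‖ * ‖y - c 0‖ with hb
  have hb0 : 0 ≤ b := by positivity
  have hf0 : |f 0| ≤ b := by
    rw [hf]
    simp only [(hc.isFlow i).zero]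
    exact ℓ.le_opNorm _
  have hbρ : 2 * b ≤ ρ := by nlinarith [norm_nonneg (y - c 0)]
  have h1 := hest (2 * b) ⟨by linarith, hbρ⟩
  have h2 := hest (-(2 * b)) ⟨by linarith, by linarith⟩
  rw [abs_of_nonneg (by linarith : 0 ≤ 2 * b)] at h1
  rw [abs_neg, abs_of_nonneg (by linarith : 0 ≤ 2 * b)] at h2
  rw [abs_le] at h1 h2 hf0
  obtain ⟨t, ht, ht'⟩ := intermediate_value_Icc (by linarith : -(2 * b) ≤ 2 * b) hfc.continuousOn
    (⟨by linarith, by linarith⟩ : (0 : ℝ) ∈ Icc (f (-(2 * b))) (f (2 * b)))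
  exact ⟨t, by rw [mul_assoc]; exact abs_le.2 ht, ht'⟩

/-- Near both ends of the period the curve is transverse to the hyperplane, by estimates inherited
from the flows; at the remaining times simplicity and compactness keep it away from `c 0`. -/
theorem exists_dist_le_of_mem_hyperplane (hc : LimitCycle l X Φ W c T K v L) {ℓ : E →L[ℝ] ℝ}
    (hℓ : ℓ v = 1) : ∃ r > 0, ∀ t ∈ Icc 0 T, ‖c t - c 0‖ ≤ r → ℓ (c t - c 0) = 0 → c t = c 0 := by
  have hη : 0 < (2 * (‖ℓ‖ + 1))⁻¹ := by positivity
  have hη' : ‖ℓ‖ * (2 * (‖ℓ‖ + 1))⁻¹ ≤ 1 / 2 := by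
    rw [← div_eq_mul_inv, div_le_div_iff₀ (by positivity) (by positivity)]
    linarith
  have key : ∀ (w : E) (s : ℝ), 0 ≤ s → ‖w - s • v‖ ≤ (2 * (‖ℓ‖ + 1))⁻¹ * |s| → ℓ w = 0 → s = 0 := by
    intro w s hs h1 h2
    have h3 := ℓ.le_opNorm (w - s • v)
    rw [map_sub, map_smul, h2, hℓ, smul_eq_mul, mul_one, zero_sub, norm_neg, Real.norm_eq_abs,
      abs_of_nonneg hs] at h3
    rw [abs_of_nonneg hs] at h1
    have := h3.trans (mul_le_mul_of_nonneg_left h1 (norm_nonneg _))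
    rw [← mul_assoc] at this
    nlinarith
  obtain ⟨r₁, hr₁, h₁⟩ := hc.exists_norm_flow_sub_sub_le hη
  obtain ⟨r₂, hr₂, h₂⟩ := hc.exists_approximates hη
  set r := min r₁ r₂ / 2 with hr
  have hr0 : 0 < r := by positivity
  have hr1 : r < r₁ := by rw [hr]; linarith [min_le_left r₁ r₂, lt_min hr₁ hr₂]
  have hr2 : r < r₂ := by rw [hr]; linarith [min_le_right r₁ r₂, lt_min hr₁ hr₂]
  have hstart : ∀ t ∈ Icc 0 T, t ≤ r → ℓ (c t - c 0) = 0 → c t = c 0 := by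
    intro t ht htr h0
    have h3 : ‖c t - c 0 - t • v‖ ≤ (2 * (‖ℓ‖ + 1))⁻¹ * |t| := by
      refine le_of_tendsto (((hc.tendsto_orbit ht).sub_const (c 0)).sub_const (t • v)).norm
        (h₁.mono fun i hi => ?_)
      have := hi (c 0) (Metric.mem_ball_self hr₁) 0 ⟨by linarith, hr₁.le⟩ t
        ⟨by linarith [ht.1], by linarith⟩
      rwa [(hc.isFlow i).zero, sub_zero] at this
    rw [key _ _ ht.1 h3 h0]
  have hend : ∀ t ∈ Icc 0 T, T - r ≤ t → ℓ (c t - c 0) = 0 → c t = c 0 := by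
    intro t ht htr h0
    have h3 : ‖c 0 - c t - (T - t) • v‖ ≤ (2 * (‖ℓ‖ + 1))⁻¹ * |T - t| := by
      have hlim := hc.tendsto_orbit hc.period_mem
      rw [hc.apply_period] at hlim
      refine le_of_tendsto ((hlim.sub (hc.tendsto_orbit ht)).sub_const ((T - t) • v)).norm
        (h₂.mono fun i hi => ?_)
      have := hi ((0 : ℝ), c 0) (Metric.mem_ball_self hr₂) (t - T, c 0) (by
        rw [Metric.mem_ball, Prod.dist_eq]
        simp only [dist_self, Real.dist_eq, sub_zero]
        rw [max_eq_left (abs_nonneg _), abs_sub_comm, abs_of_nonneg (by linarith [ht.2])]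
        linarith)
      simpa [Prod.norm_def, abs_sub_comm] using this
    have := key (c 0 - c t) (T - t) (by linarith [ht.2]) h3 (by rw [← neg_sub, map_neg, h0, neg_zero])
    rw [← sub_eq_zero.1 this, hc.apply_period]
  rcases lt_or_ge (T - r) r with hTr | hTr
  · refine ⟨1, one_pos, fun t ht _ h0 => ?_⟩
    rcases le_total t r with h | h
    · exact hstart t ht h h0
    · exact hend t ht (hTr.le.trans h) h0
  · have hsub : Icc r (T - r) ⊆ Icc 0 T := Icc_subset_Icc hr0.le (by linarith)
    obtain ⟨t₀, ht₀, hmin⟩ := isCompact_Icc.exists_isMinOn (nonempty_Icc.2 hTr)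
      ((hc.continuousOn.mono hsub).sub continuousOn_const).norm (f := fun t => ‖c t - c 0‖)
    have hpos : 0 < ‖c t₀ - c 0‖ := norm_pos_iff.2 (sub_ne_zero.2
      (hc.simple t₀ ⟨by linarith [ht₀.1], by linarith [ht₀.2]⟩))
    refine ⟨‖c t₀ - c 0‖ / 2, by positivity, fun t ht h1 h0 => ?_⟩
    rcases le_total t r with h | h
    · exact hstart t ht h h0
    rcases le_total (T - r) t with h' | h'
    · exact hend t ht h' h0
    have : ‖c t₀ - c 0‖ ≤ ‖c t - c 0‖ := hmin ⟨h, h'⟩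
    linarith

end LimitCycle

end LimitCycle

/-! ### Existence, uniqueness and minimal period of nearby closed orbits. -/

section PeriodicOrbits

namespace LimitCycle

variable {E ι : Type*} [NormedAddCommGroup E] [NormedSpace ℝ E] {l : Filter ι} [l.NeBot]
  {X : ι → E → E} {Φ : ι → ℝ → E → E} {W : ι → ℝ → E → E →L[ℝ] E} {c : ℝ → E} {T K : ℝ} {v : E}
  {L : E →L[ℝ] E} [FiniteDimensional ℝ E] {ℓ : E →L[ℝ] ℝ}

/-- For a constant sequence the summed bound reads `N * ‖x‖ ≤ 2 * C * ‖x‖` for all `N`. -/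
theorem _root_.HasFlowType.eq_zero_of_transversePart_eq {s u : ℕ} (hL : HasFlowType L s u)
    (hv : ℓ v = 1) (hLv : L v = v) {x : E} (hx : transversePart ℓ v L x = x) : x = 0 := by
  obtain ⟨C, hC0, hC⟩ := (transversePart ℓ v L).exists_sum_norm_le
    (hL.norm_ne_one_of_mem_roots hv hLv)
  by_contra h
  have hx0 : 0 < ‖x‖ := norm_pos_iff.2 h
  obtain ⟨N, hN⟩ := exists_nat_gt (C * 2)
  have := hC N (fun _ => x)
  simp only [hx, sub_self, norm_zero, Finset.sum_const_zero, zero_add, Finset.sum_const,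
    Finset.card_range, nsmul_eq_mul] at this
  nlinarith

/-- The equations `Φ (T + t) x = x` and `ℓ (x - c 0) = 0` have linearization `Λ`, which is injective
because a kernel vector is fixed by the transverse part of `L`. They are uniformly close to `Λ` on a
fixed ball, while the defect at `(0, c 0)` tends to zero, so a quantitative inverse function theorem
yields a solution at a distance controlled by the defect. -/
theorem exists_periodic_points (hc : LimitCycle l X Φ W c T K v L) (hℓ : ℓ v = 1) {s u : ℕ}
    (hL : HasFlowType L s u) :
    ∃ (t : ι → ℝ) (x : ι → E), Tendsto t l (𝓝 0) ∧ Tendsto x l (𝓝 (c 0)) ∧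
      ∀ᶠ i in l, Φ i (T + t i) (x i) = x i ∧ ℓ (x i - c 0) = 0 := by
  let Λ : (ℝ × E) →ₗ[ℝ] (E × ℝ) :=
    (LinearMap.fst ℝ ℝ E).smulRight v + L.toLinearMap ∘ₗ LinearMap.snd ℝ ℝ E - LinearMap.snd ℝ ℝ E |>.prod
      (ℓ.toLinearMap ∘ₗ LinearMap.snd ℝ ℝ E)
  have hΛ : ∀ z, Λ z = (z.1 • v + L z.2 - z.2, ℓ z.2) := fun z => rfl
  have hinj : Function.Injective Λ := by
    refine (injective_iff_map_eq_zero Λ).2 fun z hz => ?_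
    rw [hΛ, Prod.mk_eq_zero] at hz
    have h1 : L z.2 = z.2 - z.1 • v := by
      rw [eq_sub_iff_add_eq, add_comm]; exact sub_eq_zero.1 hz.1
    have h2 : z.2 = 0 := hL.eq_zero_of_transversePart_eq hℓ hc.linear_field (by
      rw [transversePart_apply, h1]
      simp [hz.2, hℓ])
    have h3 : z.1 • v = 0 := by simpa [h2] using hz.1
    exact Prod.ext ((smul_eq_zero.1 h3).resolve_right hc.field_ne) h2
  let e := (Λ.linearEquivOfInjective hinj (by simp [add_comm])).toContinuousLinearEquiv
  have he : ∀ z, e z = (z.1 • v + L z.2 - z.2, ℓ z.2) := fun z => hΛ z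
  set R := e.toNonlinearRightInverse with hR
  have hN : 0 < (R.nnnorm : ℝ) := by
    refine lt_of_le_of_ne R.nnnorm.2 fun h => ?_
    have h1 := R.bound (0, 1)
    rw [← h, zero_mul] at h1
    have h2 := R.right_inv (0, 1)
    rw [norm_le_zero_iff.1 h1, map_zero] at h2
    simpa using congrArg Prod.snd h2
  -- With half the admissible error, the surjectivity radius per unit, `R.nnnorm⁻¹ - η`, is again
  -- `η`; hence the ball of radius `ρ i` below is mapped onto one that contains `0`.
  set η : ℝ≥0 := R.nnnorm⁻¹ / 2 with hη
  have hη0 : (0 : ℝ) < η := by rw [hη]; push_cast; positivity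
  obtain ⟨r, hr, hap⟩ := hc.exists_approximates hη0
  let F : ι → ℝ × E → E × ℝ := fun i z => (Φ i (T + z.1) z.2 - z.2, ℓ (z.2 - c 0))
  set z₀ : ℝ × E := (0, c 0) with hz₀
  set ρ : ι → ℝ := fun i => ‖F i z₀‖ / η with hρ
  have hρ0 : Tendsto ρ l (𝓝 0) := by
    have h1 := hc.tendsto_orbit hc.period_mem
    rw [hc.apply_period] at h1
    have h2 : Tendsto (fun i => F i z₀) l (𝓝 0) := by
      have h3 : Tendsto (fun i => (Φ i T (c 0) - c 0, (0 : ℝ))) l (𝓝 (c 0 - c 0, 0)) :=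
        (h1.sub_const _).prodMk_nhds tendsto_const_nhds
      rw [sub_self] at h3
      refine h3.congr fun i => ?_
      simp [F, hz₀]
    simpa using h2.norm.div_const (η : ℝ)
  have hex : ∀ i, ∃ z : ℝ × E, (∀ z ∈ Metric.ball z₀ r, ∀ z' ∈ Metric.ball z₀ r,
      ‖Φ i (T + z.1) z.2 - Φ i (T + z'.1) z'.2 - (L (z.2 - z'.2) + (z.1 - z'.1) • v)‖ ≤
        η * ‖z - z'‖) → ρ i < r → z ∈ Metric.closedBall z₀ (ρ i) ∧ F i z = 0 := by
    intro i
    by_cases h : (∀ z ∈ Metric.ball z₀ r, ∀ z' ∈ Metric.ball z₀ r,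
      ‖Φ i (T + z.1) z.2 - Φ i (T + z'.1) z'.2 - (L (z.2 - z'.2) + (z.1 - z'.1) • v)‖ ≤
        η * ‖z - z'‖) ∧ ρ i < r
    swap
    · exact ⟨0, fun h1 h2 => (h ⟨h1, h2⟩).elim⟩
    obtain ⟨h1, h2⟩ := h
    have happ : ApproximatesLinearOn (F i) (e : (ℝ × E) →L[ℝ] (E × ℝ)) (Metric.ball z₀ r) η := by
      intro z hz z' hz'
      have := h1 z hz z' hz'
      have e1 : F i z - F i z' - e (z - z') = (Φ i (T + z.1) z.2 - Φ i (T + z'.1) z'.2 -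
          (L (z.2 - z'.2) + (z.1 - z'.1) • v), 0) := by
        rw [he]
        refine Prod.ext ?_ ?_
        · simp only [F, Prod.fst_sub, Prod.snd_sub]
          abel
        · simp [F]
      change ‖F i z - F i z' - e (z - z')‖ ≤ _
      rw [e1, Prod.norm_mk, norm_zero, max_eq_left (norm_nonneg _)]
      exact this
    have hsurj := happ.surjOn_closedBall_of_nonlinearRightInverse R (ε := ρ i) (b := z₀)
      (by positivity) (Metric.closedBall_subset_ball h2)
    obtain ⟨z, hz, hz0⟩ := hsurj (show (0 : E × ℝ) ∈ _ by
      rw [Metric.mem_closedBall, dist_zero_left]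
      have : ((R.nnnorm : ℝ)⁻¹ - η) = η := by rw [hη]; push_cast; ring
      rw [this, hρ]
      exact le_of_eq (by field_simp))
    exact ⟨z, fun _ _ => ⟨hz, hz0⟩⟩
  choose z hz using hex
  have hz' : ∀ᶠ i in l, z i ∈ Metric.closedBall z₀ (ρ i) ∧ F i (z i) = 0 := by
    filter_upwards [hap, hρ0.eventually (gt_mem_nhds hr)] with i h1 h2 using hz i h1 h2
  have hzt : Tendsto z l (𝓝 z₀) := tendsto_iff_dist_tendsto_zero.2 <|
    squeeze_zero' (Eventually.of_forall fun _ => dist_nonneg) (hz'.mono fun i hi => hi.1) hρ0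
  refine ⟨fun i => (z i).1, fun i => (z i).2, (continuous_fst.tendsto _).comp hzt,
    (continuous_snd.tendsto _).comp hzt, hz'.mono fun i hi => ?_⟩
  have h1 := Prod.mk_eq_zero.1 hi.2
  exact ⟨sub_eq_zero.1 h1.1, h1.2⟩

/-- Two orbit segments which end in the hyperplane. -/
theorem exists_return_estimate (hc : LimitCycle l X Φ W c T K v L) (hℓ : ℓ v = 1) {κ : ℝ}
    (hκ : 0 < κ) :
    ∃ r > 0, ∀ᶠ i in l, ∀ z ∈ Metric.ball ((0 : ℝ), c 0) r, ∀ z' ∈ Metric.ball ((0 : ℝ), c 0) r,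
      ℓ (Φ i (T + z.1) z.2 - c 0) = 0 → ℓ (Φ i (T + z'.1) z'.2 - c 0) = 0 →
      |z.1 - z'.1| ≤ (2 * ‖ℓ‖ * ‖L‖ + 1) * ‖z.2 - z'.2‖ ∧
      ‖Φ i (T + z.1) z.2 - Φ i (T + z'.1) z'.2 - transversePart ℓ v L (z.2 - z'.2)‖ ≤
        κ * ‖z.2 - z'.2‖ := by
  set B := 2 * ‖ℓ‖ * ‖L‖ + 1 with hB
  have hB0 : 0 < B := by positivity
  set D := (1 + ‖ℓ‖ * ‖v‖) * (1 + B) with hD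
  have hD0 : 0 < D := by positivity
  obtain ⟨r, hr, hap⟩ := hc.exists_approximates (η := min (2 * (‖ℓ‖ + 1))⁻¹ (κ / D))
    (lt_min (by positivity) (by positivity))
  refine ⟨r, hr, hap.mono fun i hi z hz z' hz' h0 h0' => ?_⟩
  set η := min (2 * (‖ℓ‖ + 1))⁻¹ (κ / D)
  have hη0 : 0 < η := lt_min (by positivity) (by positivity)
  have hη1 : ‖ℓ‖ * η ≤ 1 / 2 := by
    calc ‖ℓ‖ * η ≤ ‖ℓ‖ * (2 * (‖ℓ‖ + 1))⁻¹ := by gcongr; exact min_le_left _ _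
      _ ≤ 1 / 2 := by
        rw [← div_eq_mul_inv, div_le_div_iff₀ (by positivity) (by positivity)]
        linarith [norm_nonneg ℓ]
  have hη2 : D * η ≤ κ := by
    calc D * η ≤ D * (κ / D) := by gcongr; exact min_le_right _ _
      _ = κ := by field_simp
  have h1 := hi z hz z' hz'
  set e := Φ i (T + z.1) z.2 - Φ i (T + z'.1) z'.2 - (L (z.2 - z'.2) + (z.1 - z'.1) • v) with he
  set w := z.2 - z'.2
  set β := z.1 - z'.1
  have hzn : ‖z - z'‖ ≤ |β| + ‖w‖ := by
    rw [Prod.norm_def]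
    exact max_le (le_add_of_nonneg_right (norm_nonneg _)) (le_add_of_nonneg_left (abs_nonneg _))
  have h1' : ‖e‖ ≤ η * (|β| + ‖w‖) := h1.trans (mul_le_mul_of_nonneg_left hzn hη0.le)
  -- As both end points lie in the hyperplane, applying `ℓ` eliminates them, and the time difference
  -- `β` is `-ℓ (L w)` up to the error. Substituting this back leaves the transverse part of `L`.
  have hℓe : ℓ e = -ℓ (L w) - β := by
    have : e = (Φ i (T + z.1) z.2 - c 0) - (Φ i (T + z'.1) z'.2 - c 0) - (L w + β • v) := by
      rw [he]; abel
    rw [this, map_sub, map_sub, h0, h0', map_add, map_smul, hℓ]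
    simp
    ring
  have hβ : |β| ≤ B * ‖w‖ := by
    have h2 : |β| ≤ ‖ℓ e‖ + ‖ℓ (L w)‖ := by
      rw [← Real.norm_eq_abs, show β = -(ℓ e + ℓ (L w)) by rw [hℓe]; ring, norm_neg]
      exact norm_add_le _ _
    have h3 : ‖ℓ e‖ ≤ 1 / 2 * (|β| + ‖w‖) := by
      calc ‖ℓ e‖ ≤ ‖ℓ‖ * ‖e‖ := ℓ.le_opNorm _
        _ ≤ ‖ℓ‖ * (η * (|β| + ‖w‖)) := by gcongr
        _ = ‖ℓ‖ * η * (|β| + ‖w‖) := by ring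
        _ ≤ _ := by gcongr
    have h4 : ‖ℓ (L w)‖ ≤ ‖ℓ‖ * ‖L‖ * ‖w‖ := by
      rw [mul_assoc]
      exact (ℓ.le_opNorm _).trans (mul_le_mul_of_nonneg_left (L.le_opNorm _) (norm_nonneg _))
    rw [hB]
    nlinarith
  refine ⟨hβ, ?_⟩
  have e2 : Φ i (T + z.1) z.2 - Φ i (T + z'.1) z'.2 - transversePart ℓ v L w = e - ℓ e • v := by
    rw [hℓe, he, transversePart_apply]
    module
  rw [e2]
  calc ‖e - ℓ e • v‖ ≤ ‖e‖ + ‖ℓ‖ * ‖e‖ * ‖v‖ := by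
        refine (_root_.norm_sub_le _ _).trans (add_le_add le_rfl ?_)
        rw [norm_smul]
        exact mul_le_mul_of_nonneg_right (ℓ.le_opNorm e) (norm_nonneg v)
    _ = (1 + ‖ℓ‖ * ‖v‖) * ‖e‖ := by ring
    _ ≤ (1 + ‖ℓ‖ * ‖v‖) * (η * (B * ‖w‖ + ‖w‖)) := by gcongr; exact h1'.trans (by gcongr)
    _ = D * η * ‖w‖ := by rw [hD]; ring
    _ ≤ κ * ‖w‖ := by gcongr

/-- Closed orbits that stay close to the limit cycle pass through the periodic points. -/
theorem exists_thickening_mem_range (hc : LimitCycle l X Φ W c T K v L) (hℓ : ℓ v = 1) {s u : ℕ}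
    (hL : HasFlowType L s u) {t : ι → ℝ} {x : ι → E} (ht : Tendsto t l (𝓝 0))
    (hx : Tendsto x l (𝓝 (c 0)))
    (hper : ∀ᶠ i in l, Φ i (T + t i) (x i) = x i ∧ ℓ (x i - c 0) = 0) :
    ∃ r > 0, ∀ᶠ i in l, ∀ y, IsClosed (range fun τ => Φ i τ y) →
      (range fun τ => Φ i τ y) ⊆ Metric.thickening r (c '' Icc 0 T) →
      x i ∈ range fun τ => Φ i τ y := by
  have hK := hc.speed_nonneg
  obtain ⟨C, hC0, hC⟩ := (transversePart ℓ v L).exists_sum_norm_le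
    (hL.norm_ne_one_of_mem_roots hℓ hc.linear_field)
  -- With this `κ` one has `C * κ ≤ 1 / 2`, so the errors in the summed bound are absorbed by its
  -- left side.
  obtain ⟨r₁, hr₁, h₁⟩ := hc.exists_return_estimate hℓ (κ := (2 * (C + 1))⁻¹) (by positivity)
  obtain ⟨r₂, hr₂, h₂⟩ := hc.exists_hit hℓ
  obtain ⟨r₃, hr₃, h₃⟩ := hc.exists_dist_le_of_mem_hyperplane hℓ
  set Q := 1 + 2 * ‖ℓ‖ * K with hQ
  have hQ0 : 0 < Q := by positivity
  set θ := min r₂ (min (r₃ / Q) (r₁ / (2 * ‖ℓ‖ + 1)) / 2) with hθ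
  have hθ0 : 0 < θ := by positivity
  have hθ3 : Q * θ ≤ r₃ := by
    have : θ ≤ r₃ / Q := ((min_le_right _ _).trans (by
      have h1 : 0 < min (r₃ / Q) (r₁ / (2 * ‖ℓ‖ + 1)) := by positivity
      linarith)).trans (min_le_left (r₃ / Q) (r₁ / (2 * ‖ℓ‖ + 1)))
    rw [mul_comm]
    exact (le_div_iff₀ hQ0).1 this
  have hθ1 : 2 * ‖ℓ‖ * θ < r₁ := by
    have : θ ≤ r₁ / (2 * ‖ℓ‖ + 1) := ((min_le_right _ _).trans (by
      have h1 : 0 < min (r₃ / Q) (r₁ / (2 * ‖ℓ‖ + 1)) := by positivity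
      linarith)).trans (min_le_right (r₃ / Q) (r₁ / (2 * ‖ℓ‖ + 1)))
    have := (le_div_iff₀ (by positivity)).1 this
    nlinarith
  obtain ⟨r₄, hr₄, h₄⟩ := hc.exists_forall_norm_sub_lt hθ0
  obtain ⟨r₅, hr₅, h₅⟩ := hc.exists_forall_norm_flow_sub_lt hθ0
  set ρ := min r₁ r₄ with hρ
  have hρ0 : 0 < ρ := lt_min hr₁ hr₄
  -- Near `c 0` the curve meets the hyperplane only in `c 0`. By compactness, hits of a sufficiently
  -- thin neighbourhood of the curve are therefore arbitrarily close to `c 0`, and an orbit confined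
  -- to it can be followed through any number of returns.
  obtain ⟨r₆, hr₆, h₆⟩ : ∃ r > 0, ∀ y ∈ Metric.thickening r (c '' Icc 0 T), ‖y - c 0‖ ≤ r₃ →
      ℓ (y - c 0) = 0 → ‖y - c 0‖ < ρ := by
    have hZ : IsCompact (Metric.closedBall (c 0) r₃ ∩ {y | ℓ (y - c 0) = 0 ∧ ρ ≤ ‖y - c 0‖}) := by
      have : ProperSpace E := FiniteDimensional.proper ℝ E
      refine (isCompact_closedBall _ _).inter_right ?_
      exact (isClosed_eq (f := fun y => ℓ (y - c 0)) (by fun_prop) continuous_const).inter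
        (isClosed_le (g := fun y => ‖y - c 0‖) continuous_const (by fun_prop))
    have hdisj : Disjoint (Metric.closedBall (c 0) r₃ ∩ {y | ℓ (y - c 0) = 0 ∧ ρ ≤ ‖y - c 0‖})
        (c '' Icc 0 T) := by
      rw [Set.disjoint_left]
      rintro y ⟨hy1, hy2, hy3⟩ ⟨t, ht, rfl⟩
      have := h₃ t ht (by simpa [dist_eq_norm] using hy1) hy2
      rw [this, sub_self, norm_zero] at hy3
      linarith
    obtain ⟨δ, hδ, hd⟩ := hdisj.exists_thickenings hZ
      (isCompact_Icc.image_of_continuousOn hc.continuousOn).isClosed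
    refine ⟨δ, hδ, fun y hy hy1 hy2 => ?_⟩
    by_contra! hy3
    exact Set.disjoint_left.1 hd (Metric.self_subset_thickening hδ _
      ⟨by simpa [dist_eq_norm] using hy1, hy2, hy3⟩) hy
  have hti : ∀ᶠ i in l, |t i| < r₁ := by
    have := ht.abs
    rw [abs_zero] at this
    exact this.eventually (gt_mem_nhds hr₁)
  have hxi : ∀ᶠ i in l, ‖x i - c 0‖ < ρ := by
    have := hx (Metric.ball_mem_nhds _ hρ0)
    filter_upwards [this] with i hi
    exact mem_ball_iff_norm.1 hi
  refine ⟨min r₅ r₆, lt_min hr₅ hr₆, ?_⟩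
  filter_upwards [hper, h₁, h₂, h₄, h₅, hti, hxi] with i hper h₁ h₂ h₄ h₅ hti hxi y hcl hsub
  set Γ := range fun τ => Φ i τ y with hΓ
  have hΓflow : ∀ z ∈ Γ, ∀ τ, Φ i τ z ∈ Γ := by
    rintro _ ⟨τ', rfl⟩ τ
    exact ⟨τ + τ', (hc.isFlow i).add _ _ _⟩
  have hhit : ∀ z ∈ Γ, ‖z - c 0‖ < θ →
      ∃ σ, |σ| < r₁ ∧ ℓ (Φ i σ z - c 0) = 0 ∧ ‖Φ i σ z - c 0‖ < ρ := by
    intro z hz hzθ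
    obtain ⟨σ, hσ, hσ0⟩ := h₂ z (mem_ball_iff_norm.2 (hzθ.trans_le (min_le_left _ _)))
    refine ⟨σ, ?_, hσ0, h₆ _ (Metric.thickening_mono (min_le_right _ _) _
      (hsub (hΓflow z hz σ))) ?_ hσ0⟩
    · refine hσ.trans_lt (lt_of_le_of_lt ?_ hθ1)
      gcongr
    · have h7 := hc.norm_flow_sub_le i z 0 σ
      rw [(hc.isFlow i).zero, sub_zero] at h7
      have h8 := norm_sub_le_norm_sub_add_norm_sub (Φ i σ z) z (c 0)
      have h9 : K * |σ| ≤ K * (2 * ‖ℓ‖ * ‖z - c 0‖) := mul_le_mul_of_nonneg_left hσ hK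
      have h10 : Q * ‖z - c 0‖ ≤ Q * θ := mul_le_mul_of_nonneg_left hzθ.le hQ0.le
      have h11 : Q * ‖z - c 0‖ = ‖z - c 0‖ + K * (2 * ‖ℓ‖ * ‖z - c 0‖) := by rw [hQ]; ring
      linarith
  -- The hits of the orbit close to `c 0` are mapped to one another by flowing for about the period.
  -- The closed orbit may wind around many times, so no fixed point of this step is presupposed.
  let A := {z : E // z ∈ Γ ∧ ℓ (z - c 0) = 0 ∧ ‖z - c 0‖ < ρ}
  have hstep : ∀ z : A, ∃ z' : A, ∃ σ, |σ| < r₁ ∧ (z' : E) = Φ i (T + σ) z := by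
    rintro ⟨z, hz, hz0, hzρ⟩
    have h7 := h₄ z (mem_ball_iff_norm.2 (hzρ.trans_le (min_le_right _ _))) T hc.period_mem
    rw [hc.apply_period] at h7
    obtain ⟨σ, hσ, h8, h9⟩ := hhit _ (hΓflow z hz T) h7
    rw [← (hc.isFlow i).add, add_comm] at h8 h9
    exact ⟨⟨Φ i (T + σ) z, hΓflow z hz _, h8, h9⟩, σ, hσ, rfl⟩
  choose f σ hσ hf using hstep
  obtain ⟨z₀⟩ : Nonempty A := by
    have hy : y ∈ Γ := ⟨0, (hc.isFlow i).zero y⟩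
    obtain ⟨_, ⟨τ, hτ, rfl⟩, hyτ⟩ := Metric.mem_thickening_iff.1
      (Metric.thickening_mono (min_le_left _ _) _ (hsub hy))
    have h7 := h₅ τ hτ y hyτ
    obtain ⟨σ, -, h8, h9⟩ := hhit _ (hΓflow y hy (T - τ)) h7
    exact ⟨⟨_, hΓflow _ (hΓflow y hy _) σ, h8, h9⟩⟩
  let a : ℕ → A := fun n => f^[n] z₀
  have ha : ∀ n, a (n + 1) = f (a n) := fun n => Function.iterate_succ_apply' f n z₀
  let w : ℕ → E := fun n => a n - x i
  have hw : ∀ n, ‖w (n + 1) - transversePart ℓ v L (w n)‖ ≤ (2 * (C + 1))⁻¹ * ‖w n‖ := by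
    intro n
    have hmem : ∀ (τ : ℝ) (z : E), |τ| < r₁ → ‖z - c 0‖ < ρ → (τ, z) ∈ Metric.ball ((0 : ℝ), c 0) r₁ :=
      fun τ z h1 h2 => by
        rw [Metric.mem_ball, Prod.dist_eq]
        exact max_lt (by simpa [Real.dist_eq] using h1)
          (by rw [dist_eq_norm]; exact h2.trans_le (min_le_left _ _))
    have h7 := (h₁ (σ (a n), a n) (hmem _ _ (hσ _) (a n).2.2.2) (t i, x i) (hmem _ _ hti hxi)
      (by
        simp only
        rw [← hf]
        exact (f (a n)).2.2.1)
      (by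
        simp only
        rw [hper.1]
        exact hper.2)).2
    simp only at h7
    rw [← hf, hper.1, ← ha] at h7
    exact h7
  have hwb : ∀ n, ‖w n‖ ≤ 2 * ρ := fun n => by
    have h7 := norm_sub_le_norm_sub_add_norm_sub (a n : E) (c 0) (x i)
    rw [norm_sub_rev (c 0)] at h7
    linarith [(a n).2.2.2]
  have hsum : ∀ N, ∑ j ∈ Finset.range N, ‖w j‖ ≤ 8 * C * ρ := fun N => by
    have h7 := hC N w
    have h8 : ∑ j ∈ Finset.range N, ‖w (j + 1) - transversePart ℓ v L (w j)‖ ≤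
        (2 * (C + 1))⁻¹ * ∑ j ∈ Finset.range N, ‖w j‖ := by
      rw [Finset.mul_sum]
      exact Finset.sum_le_sum fun j _ => hw j
    have h9 : C * (2 * (C + 1))⁻¹ ≤ 1 / 2 := by
      rw [← div_eq_mul_inv, div_le_div_iff₀ (by positivity) (by positivity)]
      linarith
    have h10 : 0 ≤ ∑ j ∈ Finset.range N, ‖w j‖ := Finset.sum_nonneg fun _ _ => norm_nonneg _
    have h11 := mul_le_mul_of_nonneg_left h8 hC0
    have h12 := mul_le_mul_of_nonneg_right h9 h10
    have h13 : C * (‖w 0‖ + ‖w N‖) ≤ C * (4 * ρ) :=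
      mul_le_mul_of_nonneg_left (by linarith [hwb 0, hwb N]) hC0
    rw [mul_assoc] at h12
    rw [mul_add] at h7
    linarith
  -- Bounded partial sums force the hits to converge to the periodic point, which then lies on the
  -- closed orbit.
  have hw0 : Tendsto w atTop (𝓝 0) := tendsto_zero_iff_norm_tendsto_zero.2
    (summable_of_sum_range_le (fun _ => norm_nonneg _) hsum).tendsto_atTop_zero
  have hax : Tendsto (fun n => (a n : E)) atTop (𝓝 (x i)) := by
    simpa [w] using hw0.add_const (x i)
  exact hcl.mem_of_tendsto hax (Eventually.of_forall fun n => (a n).2.1)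

/-- The period is minimal. -/
theorem eventually_flow_ne (hc : LimitCycle l X Φ W c T K v L) {t : ι → ℝ} {x : ι → E}
    (ht : Tendsto t l (𝓝 0)) (hx : Tendsto x l (𝓝 (c 0)))
    (hper : ∀ᶠ i in l, Φ i (T + t i) (x i) = x i) :
    ∀ᶠ i in l, 0 < T + t i ∧ ∀ σ ∈ Ioo 0 (T + t i), Φ i σ (x i) ≠ x i := by
  have hv : 0 < ‖v‖ := norm_pos_iff.2 hc.field_ne
  obtain ⟨r₁, hr₁, h₁⟩ := hc.exists_norm_flow_sub_sub_le (half_pos hv)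
  set r := min r₁ (T / 2) with hr
  have hT := hc.period_pos
  have hr0 : 0 < r := by positivity
  have hrT : r ≤ T / 2 := min_le_right _ _
  have hsub : Icc r (T - r / 2) ⊆ Icc 0 T := Icc_subset_Icc hr0.le (by linarith)
  obtain ⟨t₀, ht₀, hmin⟩ := isCompact_Icc.exists_isMinOn
    (nonempty_Icc.2 (by linarith : r ≤ T - r / 2))
    ((hc.continuousOn.mono hsub).sub continuousOn_const).norm (f := fun t => ‖c t - c 0‖)
  have hδ : 0 < ‖c t₀ - c 0‖ := norm_pos_iff.2 (sub_ne_zero.2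
    (hc.simple t₀ ⟨by linarith [ht₀.1], by linarith [ht₀.2]⟩))
  obtain ⟨r₂, hr₂, h₂⟩ := hc.exists_forall_norm_sub_lt (half_pos hδ)
  have hti : ∀ᶠ i in l, |t i| < r / 2 := by
    have := ht.abs
    rw [abs_zero] at this
    exact this.eventually (gt_mem_nhds (half_pos hr0))
  have hxi : ∀ ρ > 0, ∀ᶠ i in l, x i ∈ Metric.ball (c 0) ρ := fun ρ hρ =>
    hx (Metric.ball_mem_nhds _ hρ)
  filter_upwards [hper, h₁, h₂, hti, hxi r₁ hr₁, hxi r₂ hr₂, hxi _ (half_pos hδ)] with i hper h₁ h₂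
    hti hx1 hx2 hx3
  rw [abs_lt] at hti
  refine ⟨by linarith, fun σ hσ heq => ?_⟩
  have hshort : ∀ τ, 0 < τ → τ ≤ r → Φ i τ (x i) ≠ x i := by
    intro τ hτ hτr h
    have h3 := h₁ (x i) hx1 0 ⟨by linarith, hr₁.le⟩ τ ⟨by linarith, hτr.trans (min_le_left _ _)⟩
    rw [(hc.isFlow i).zero, h, sub_self, zero_sub, norm_neg, norm_smul, sub_zero,
      Real.norm_eq_abs, abs_of_pos hτ] at h3
    nlinarith
  rcases le_total σ r with h | h
  · exact hshort σ hσ.1 h heq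
  rcases le_total (T - r / 2) σ with h' | h'
  -- A return shortly before the full period makes the complementary time a short period, which is
  -- excluded as well. Intermediate times are excluded by simplicity of the limit curve.
  · refine hshort (T + t i - σ) (by linarith [hσ.2]) (by linarith) ?_
    rw [← heq, ← (hc.isFlow i).add, sub_add_cancel, heq, hper]
  · have h3 := h₂ (x i) hx2 σ (hsub ⟨h, h'⟩)
    rw [heq] at h3
    have h4 : ‖c t₀ - c 0‖ ≤ ‖c σ - c 0‖ := hmin ⟨h, h'⟩
    have h5 := norm_sub_le_norm_sub_add_norm_sub (c σ) (x i) (c 0)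
    rw [norm_sub_rev (c σ) (x i)] at h5
    linarith [mem_ball_iff_norm.1 hx3]

theorem eventually_orbit_close (hc : LimitCycle l X Φ W c T K v L) {t : ι → ℝ} {x : ι → E}
    (ht : Tendsto t l (𝓝 0)) (hx : Tendsto x l (𝓝 (c 0)))
    (hper : ∀ᶠ i in l, Φ i (T + t i) (x i) = x i) {η : ℝ} (hη : 0 < η) :
    ∀ᶠ i in l, (∀ τ, ∃ σ ∈ Icc 0 T, ‖Φ i τ (x i) - c σ‖ < η) ∧
      ∀ σ ∈ Icc 0 T, ‖Φ i σ (x i) - c σ‖ < η := by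
  have hK := hc.speed_nonneg
  obtain ⟨r, hr, h⟩ := hc.exists_forall_norm_sub_lt (half_pos hη)
  have hti : ∀ᶠ i in l, K * |t i| < η / 2 ∧ |t i| < T := by
    have := ht.abs
    rw [abs_zero] at this
    refine Eventually.and ?_ (this.eventually (gt_mem_nhds hc.period_pos))
    have := this.const_mul K
    rw [mul_zero] at this
    exact this.eventually (gt_mem_nhds (half_pos hη))
  filter_upwards [h, hx (Metric.ball_mem_nhds _ hr), hti, hper] with i h hx hti hper
  have h1 := h (x i) hx
  refine ⟨fun τ => ?_, fun σ hσ => (h1 σ hσ).trans (half_lt_self hη)⟩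
  have hp : Function.Periodic (fun τ => Φ i τ (x i)) (T + t i) := fun τ => by
    simp only
    rw [(hc.isFlow i).add, hper]
  obtain ⟨τ', hτ', heq⟩ := hp.exists_mem_Ico₀ (by linarith [(abs_lt.1 hti.2).1]) τ
  rw [heq]
  rcases le_total τ' T with h2 | h2
  · exact ⟨τ', ⟨hτ'.1, h2⟩, (h1 τ' ⟨hτ'.1, h2⟩).trans (half_lt_self hη)⟩
  · refine ⟨T, hc.period_mem, ?_⟩
    have h3 := hc.norm_flow_sub_le i (x i) T τ'
    have h4 : K * |τ' - T| ≤ K * |t i| := by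
      refine mul_le_mul_of_nonneg_left ?_ hK
      rw [abs_of_nonneg (by linarith)]
      exact (by linarith [hτ'.2] : τ' - T ≤ t i).trans (le_abs_self _)
    have h5 := norm_sub_le_norm_sub_add_norm_sub (Φ i τ' (x i)) (Φ i T (x i)) (c T)
    linarith [h1 T hc.period_mem]

theorem tendsto_hausdorffEDist (hc : LimitCycle l X Φ W c T K v L) {t : ι → ℝ} {x : ι → E}
    (ht : Tendsto t l (𝓝 0)) (hx : Tendsto x l (𝓝 (c 0)))
    (hper : ∀ᶠ i in l, Φ i (T + t i) (x i) = x i) :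
    Tendsto (fun i => Metric.hausdorffEDist (range fun τ => Φ i τ (x i)) (c '' Icc 0 T)) l (𝓝 0) := by
  refine ENNReal.tendsto_nhds_zero.2 fun η hη => ?_
  obtain ⟨δ, hδ, hδη⟩ : ∃ δ : ℝ, 0 < δ ∧ ENNReal.ofReal δ ≤ η := by
    rcases eq_or_ne η ⊤ with rfl | h
    · exact ⟨1, one_pos, le_top⟩
    · exact ⟨η.toReal, ENNReal.toReal_pos hη.ne' h, ENNReal.ofReal_toReal_le⟩
  filter_upwards [hc.eventually_orbit_close ht hx hper hδ] with i hi
  refine le_trans (Metric.hausdorffEDist_le_of_mem_edist ?_ ?_) hδη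
  · rintro _ ⟨τ, rfl⟩
    obtain ⟨σ, hσ, h⟩ := hi.1 τ
    refine ⟨_, ⟨σ, hσ, rfl⟩, ?_⟩
    rw [edist_dist, dist_eq_norm]
    exact ENNReal.ofReal_le_ofReal h.le
  · rintro _ ⟨σ, hσ, rfl⟩
    refine ⟨_, ⟨σ, rfl⟩, ?_⟩
    rw [edist_comm, edist_dist, dist_eq_norm]
    exact ENNReal.ofReal_le_ofReal (hi.2 σ hσ).le

/-- The return times to the hyperplane. -/
theorem eventually_exists_return_time (hc : LimitCycle l X Φ W c T K v L) (hℓ : ℓ v = 1)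
    {t : ι → ℝ} {x : ι → E} (ht : Tendsto t l (𝓝 0)) (hx : Tendsto x l (𝓝 (c 0)))
    (hper : ∀ᶠ i in l, Φ i (T + t i) (x i) = x i ∧ ℓ (x i - c 0) = 0) :
    ∀ᶠ i in l, ∃ τ : E → ℝ, τ (x i) = T + t i ∧ ContinuousAt τ (x i) ∧
      ∀ᶠ y in 𝓝 (x i), ℓ (Φ i (τ y) y - c 0) = 0 := by
  obtain ⟨r₁, hr₁, h₁⟩ := hc.exists_return_estimate hℓ one_pos
  obtain ⟨r₂, hr₂, h₂⟩ := hc.exists_hit hℓ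
  set θ := min r₂ (r₁ / (2 * (2 * ‖ℓ‖ + 1))) with hθ
  have hθ0 : 0 < θ := by positivity
  have hθ1 : 2 * ‖ℓ‖ * θ < r₁ / 2 := by
    have : θ ≤ r₁ / (2 * (2 * ‖ℓ‖ + 1)) := min_le_right _ _
    have := (le_div_iff₀ (by positivity)).1 this
    nlinarith
  have hti : ∀ᶠ i in l, |t i| < r₁ / 2 := by
    have := ht.abs
    rw [abs_zero] at this
    exact this.eventually (gt_mem_nhds (half_pos hr₁))
  have hxi : ∀ᶠ i in l, x i ∈ Metric.ball (c 0) (min θ r₁) :=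
    hx (Metric.ball_mem_nhds _ (lt_min hθ0 hr₁))
  filter_upwards [h₁, h₂, hti, hxi, hper] with i h₁ h₂ hti hxi hper
  have hmem : ∀ (τ : ℝ) (z : E), |τ| < r₁ → z ∈ Metric.ball (c 0) (min θ r₁) →
      (τ, z) ∈ Metric.ball ((0 : ℝ), c 0) r₁ :=
    fun τ z h1 h2 => by
      rw [Metric.mem_ball, Prod.dist_eq]
      exact max_lt (by simpa [Real.dist_eq] using h1) (h2.trans_le (min_le_right _ _))
  have hcont : ContinuousAt (fun y => Φ i (T + t i) y) (x i) :=
    ((hc.isFlow i).hasFDerivAt (T + t i) (x i)).continuousAt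
  have hnear : ∀ᶠ y in 𝓝 (x i), y ∈ Metric.ball (c 0) (min θ r₁) ∧
      Φ i (T + t i) y ∈ Metric.ball (c 0) θ := by
    refine (Metric.isOpen_ball.mem_nhds hxi |> Filter.Eventually.and) ?_
    refine hcont.eventually_mem (Metric.isOpen_ball.mem_nhds ?_)
    simp only [hper.1]
    exact Metric.ball_subset_ball (min_le_left _ _) hxi
  -- The correction is found by `exists_hit`; its linear bound from `exists_return_estimate` makes
  -- the return time continuous at `x i`, however the correction is chosen. Away from the relevant
  -- neighbourhood `0` is a default.
  have hex : ∀ y, ∃ σ : ℝ, y ∈ Metric.ball (c 0) (min θ r₁) ∧ Φ i (T + t i) y ∈ Metric.ball (c 0) θ →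
      ℓ (Φ i (T + (t i + σ)) y - c 0) = 0 ∧ |t i + σ - t i| ≤ (2 * ‖ℓ‖ * ‖L‖ + 1) * ‖y - x i‖ := by
    intro y
    by_cases hy : y ∈ Metric.ball (c 0) (min θ r₁) ∧ Φ i (T + t i) y ∈ Metric.ball (c 0) θ
    swap
    · exact ⟨0, fun h => (hy h).elim⟩
    obtain ⟨σ, hσ, hσ0⟩ := h₂ _ (Metric.ball_subset_ball (min_le_left _ _) hy.2)
    rw [← (hc.isFlow i).add, show σ + (T + t i) = T + (t i + σ) by ring] at hσ0
    have hσ1 : |σ| < r₁ / 2 := hσ.trans_lt (lt_of_le_of_lt (by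
      gcongr
      exact (mem_ball_iff_norm.1 hy.2).le) hθ1)
    refine ⟨σ, fun _ => ⟨hσ0, ?_⟩⟩
    refine (h₁ (t i + σ, y) (hmem _ _ ?_ hy.1) (t i, x i) (hmem _ _ (by linarith) hxi) hσ0 ?_).1
    · exact (abs_add_le _ _).trans_lt (by linarith)
    · simp only [hper.1, hper.2]
  choose σ hσ using hex
  refine ⟨fun y => T + (t i + σ y), ?_, ?_, ?_⟩
  · have h3 := (hσ (x i) hnear.self_of_nhds).2
    rw [sub_self, norm_zero, mul_zero] at h3
    have h4 : t i + σ (x i) - t i = 0 := abs_eq_zero.1 (le_antisymm h3 (abs_nonneg _))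
    linarith
  · have h3 := (hσ (x i) hnear.self_of_nhds).2
    rw [sub_self, norm_zero, mul_zero] at h3
    have h4 : t i + σ (x i) - t i = 0 := abs_eq_zero.1 (le_antisymm h3 (abs_nonneg _))
    have h5 : Tendsto (fun y => t i + σ y) (𝓝 (x i)) (𝓝 (t i)) := by
      refine tendsto_iff_norm_sub_tendsto_zero.2 (squeeze_zero' (Eventually.of_forall fun _ =>
        norm_nonneg _) (hnear.mono fun y hy => (hσ y hy).2) ?_)
      have : Continuous fun y => (2 * ‖ℓ‖ * ‖L‖ + 1) * ‖y - x i‖ := by fun_prop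
      simpa using this.tendsto (x i)
    have h6 := h5.const_add T
    change Tendsto _ _ (𝓝 (T + (t i + σ (x i))))
    rwa [show t i + σ (x i) = t i by linarith]
  · exact hnear.mono fun y hy => (hσ y hy).1

theorem tendsto_linear (hc : LimitCycle l X Φ W c T K v L) {t : ι → ℝ} {x : ι → E}
    (ht : Tendsto t l (𝓝 0)) (hx : Tendsto x l (𝓝 (c 0))) :
    Tendsto (fun i => W i (T + t i) (x i)) l (𝓝 L) :=
  ((continuous_snd.tendsto _).comp hc.tendsto_flow).comp
    (tendsto_id.prodMk (ht.prodMk_nhds hx))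

end LimitCycle

end PeriodicOrbits

/-! ### Charts and tangent spaces of hypersurfaces. -/

section Hypersurface

variable {n : ℕ}

/-- A smooth chart centred at `p` in which `S` is a coordinate hyperplane. -/
structure HypersurfaceChart (S : Set (Space n)) (p : Space n)
    (φ : OpenPartialHomeomorph (Space n) (Space n)) (i : Fin n) : Prop where
  mem_source : p ∈ φ.source
  map_eq_zero : φ p = 0
  contDiffOn : ContDiffOn ℝ ∞ φ φ.source
  contDiffOn_symm : ContDiffOn ℝ ∞ φ.symm φ.target
  mem_iff : ∀ x ∈ φ.source, (x ∈ S ↔ φ x i = 0)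

theorem HasLocalComponents.exists_chart {S : Set (Space n)} {p : Space n}
    (h : HasLocalComponents S p 1) : ∃ φ i, HypersurfaceChart S p φ i := by
  obtain ⟨hn, φ, h1, h2, h3, h4, h5⟩ := h
  refine ⟨φ, ⟨0, hn⟩, h1, h2, h3, h4, fun x hx => (h5 x hx).trans ⟨?_, fun h => ⟨_, one_pos, h⟩⟩⟩
  rintro ⟨i, hi, h⟩
  rwa [show (⟨0, hn⟩ : Fin n) = i from Fin.ext (Nat.lt_one_iff.1 hi).symm]

namespace HypersurfaceChart

variable {S : Set (Space n)} {p : Space n} {φ : OpenPartialHomeomorph (Space n) (Space n)}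
  {i : Fin n}

/-- The differential of the defining function. -/
noncomputable def normal (_ : HypersurfaceChart S p φ i) : Space n →L[ℝ] ℝ :=
  EuclideanSpace.proj i ∘L fderiv ℝ φ p

variable (hφ : HypersurfaceChart S p φ i)

include hφ

theorem hasStrictFDerivAt_chart : HasStrictFDerivAt φ (fderiv ℝ φ p) p :=
  (hφ.contDiffOn.contDiffAt (φ.open_source.mem_nhds hφ.mem_source)).hasStrictFDerivAt (by simp)

theorem zero_mem_target : (0 : Space n) ∈ φ.target := by
  rw [← hφ.map_eq_zero]
  exact φ.map_source hφ.mem_source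

theorem symm_zero : φ.symm 0 = p := by
  rw [← hφ.map_eq_zero, φ.left_inv hφ.mem_source]

theorem hasStrictFDerivAt_symm : HasStrictFDerivAt φ.symm (fderiv ℝ φ.symm 0) 0 :=
  (hφ.contDiffOn_symm.contDiffAt (φ.open_target.mem_nhds hφ.zero_mem_target)).hasStrictFDerivAt
    (by simp)

theorem hasStrictFDerivAt : HasStrictFDerivAt (fun x => φ x i) hφ.normal p :=
  (EuclideanSpace.proj (𝕜 := ℝ) i).hasStrictFDerivAt.comp p hφ.hasStrictFDerivAt_chart

theorem fderiv_symm_fderiv (v : Space n) : fderiv ℝ φ.symm 0 (fderiv ℝ φ p v) = v := by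
  have h1 : HasFDerivAt φ.symm (fderiv ℝ φ.symm 0) (φ p) := by
    rw [hφ.map_eq_zero]; exact hφ.hasStrictFDerivAt_symm.hasFDerivAt
  have h2 := h1.comp p hφ.hasStrictFDerivAt_chart.hasFDerivAt
  have h3 : HasFDerivAt (φ.symm ∘ φ) (ContinuousLinearMap.id ℝ (Space n)) p :=
    (hasFDerivAt_id p).congr_of_eventuallyEq <| by
      filter_upwards [φ.open_source.mem_nhds hφ.mem_source] with x hx using φ.left_inv hx
  exact DFunLike.congr_fun (h2.unique h3) v

/-- Within `S` the defining function has derivative zero as well as `normal`, so they agree on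
tangent vectors. Conversely a kernel vector is the image, under the inverse chart, of the direction
of a segment in the coordinate hyperplane. -/
theorem tangentSubspace_eq : tangentSubspace S p = LinearMap.ker (hφ.normal : Space n →ₗ[ℝ] ℝ) := by
  refine le_antisymm (Submodule.span_le.2 fun v hv => ?_) fun v hv => Submodule.subset_span ?_
  · have h1 : HasFDerivWithinAt (fun x => φ x i) hφ.normal S p :=
      hφ.hasStrictFDerivAt.hasFDerivAt.hasFDerivWithinAt
    have h2 : HasFDerivWithinAt (fun x => φ x i) (0 : Space n →L[ℝ] ℝ) S p := by
      refine (hasFDerivWithinAt_const (0 : ℝ) p S).congr_of_eventuallyEq ?_ ?_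
      · filter_upwards [mem_nhdsWithin_of_mem_nhds (φ.open_source.mem_nhds hφ.mem_source),
          self_mem_nhdsWithin] with x hx hxS using (hφ.mem_iff x hx).1 hxS
      · rw [hφ.map_eq_zero]; rfl
    exact h1.unique_on h2 hv
  · have hv' : (fderiv ℝ φ p v) i = 0 := hv
    set H : Set (Space n) := {y | y i = 0}
    have h1 : fderiv ℝ φ p v ∈ tangentConeAt ℝ (H ∩ φ.target) 0 := by
      have h2 : fderiv ℝ φ p v ∈ tangentConeAt ℝ H 0 := by
        have := mem_tangentConeAt_of_segment_subset (s := H) (x := 0)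
          (y := fderiv ℝ φ p v) (by
            intro y hy
            rw [segment_eq_image] at hy
            obtain ⟨t, -, rfl⟩ := hy
            simp [H, hv'])
        simpa using this
      rwa [tangentConeAt_inter_nhds (φ.open_target.mem_nhds hφ.zero_mem_target)]
    have h3 := (hφ.hasStrictFDerivAt_symm.hasFDerivAt.hasFDerivWithinAt
      (s := H ∩ φ.target)).mapsTo_tangent_cone h1
    rw [hφ.fderiv_symm_fderiv, hφ.symm_zero] at h3
    refine tangentConeAt_mono ?_ h3
    rintro _ ⟨y, ⟨hyH, hy⟩, rfl⟩
    refine (hφ.mem_iff _ (φ.map_target hy)).2 ?_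
    rw [φ.right_inv hy]
    exact hyH

end HypersurfaceChart

theorem hypersurfaceChart_hyperplane (A : Space n ≃L[ℝ] Space n) {a p : Space n} {i : Fin n}
    (hp : A (p - a) i = 0) : HypersurfaceChart {x | A (x - a) i = 0} p
      (((Homeomorph.addRight (-p)).trans A.toHomeomorph).toOpenPartialHomeomorph) i := by
  have h1 : ∀ x, ((Homeomorph.addRight (-p)).trans A.toHomeomorph).toOpenPartialHomeomorph x =
      A (x - p) := fun x => by simp [sub_eq_add_neg]
  have h2 : ∀ x, ((Homeomorph.addRight (-p)).trans A.toHomeomorph).toOpenPartialHomeomorph.symm x =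
      A.symm x + p := fun x => by
        change A.symm x + (- -p) = _
        rw [neg_neg]
  refine ⟨trivial, by rw [h1]; simp, ?_, ?_, fun x _ => ?_⟩
  · refine ContDiff.contDiffOn ?_
    rw [funext h1]
    exact A.contDiff.comp (contDiff_id.sub contDiff_const)
  · refine ContDiff.contDiffOn ?_
    rw [funext h2]
    exact A.symm.contDiff.add contDiff_const
  · have h3 : A (x - a) i = A (x - p) i := by
      rw [show x - a = (x - p) + (p - a) by abel, map_add, PiLp.add_apply, hp, add_zero]
    rw [h1, ← h3]
    rfl

theorem HypersurfaceChart.hasLocalComponents {S : Set (Space n)} {p : Space n}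
    {φ : OpenPartialHomeomorph (Space n) (Space n)} {i : Fin n} (h : HypersurfaceChart S p φ i)
    (hi : (i : ℕ) = 0) : HasLocalComponents S p 1 := by
  refine ⟨i.pos, φ, h.mem_source, h.map_eq_zero, h.contDiffOn, h.contDiffOn_symm, fun x hx =>
    (h.mem_iff x hx).trans ⟨fun hx => ⟨i, by omega, hx⟩, ?_⟩⟩
  rintro ⟨j, hj, hx⟩
  rwa [show i = j from Fin.ext (by omega)]

theorem normal_hyperplane (A : Space n ≃L[ℝ] Space n) {a p : Space n} {i : Fin n}
    (hp : A (p - a) i = 0) (v : Space n) :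
    (hypersurfaceChart_hyperplane A hp).normal v = A v i := by
  have h1 := (hypersurfaceChart_hyperplane A hp).hasStrictFDerivAt_chart.hasFDerivAt
  have h2 : HasFDerivAt (((Homeomorph.addRight (-p)).trans A.toHomeomorph).toOpenPartialHomeomorph)
      (A : Space n →L[ℝ] Space n) p := by
    have : HasFDerivAt (fun x => A (x - p)) (A : Space n →L[ℝ] Space n) p := by
      have := HasFDerivAt.comp (g := A) (f := fun x => x - p) p A.hasFDerivAt
        ((hasFDerivAt_id p).sub_const p)
      exact this
    refine this.congr_of_eventuallyEq (Eventually.of_forall fun x => ?_)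
    simp [sub_eq_add_neg]
  have h3 := DFunLike.congr_fun (h1.unique h2) v
  exact congrArg (fun w : Space n => w i) h3

end Hypersurface

/-! ### Persistence of a hyperbolic limit cycle. -/

section HyperbolicOrbits

variable {n : ℕ} {ι : Type*} {l : Filter ι} [l.NeBot]
  {X : ι → Space n → Space n} {Φ : ι → ℝ → Space n → Space n}
  {W : ι → ℝ → Space n → Space n →L[ℝ] Space n} {c : ℝ → Space n} {T K : ℝ} {v : Space n}
  {L : Space n →L[ℝ] Space n}

theorem IsFlow.eventually_forall_mem {X : Space n → Space n} {Φ : ℝ → Space n → Space n}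
    {W : ℝ → Space n → Space n →L[ℝ] Space n} (hF : IsFlow X Φ W) {O : Set (Space n)} (hO : IsOpen O)
    {T : ℝ} {p : Space n} (h : ∀ t ∈ Icc 0 T, Φ t p ∈ O) :
    ∀ᶠ x in 𝓝 p, ∀ t ∈ Icc 0 T, Φ t x ∈ O := by
  refine isCompact_Icc.eventually_forall_of_forall_eventually fun t ht => ?_
  have h1 := (hF.hasStrictFDerivAt ht.1 p).hasFDerivAt.continuousAt
  have h2 : Tendsto (fun z : Space n × ℝ => (z.2, z.1)) (𝓝 (p, t)) (𝓝 (t, p)) :=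
    continuous_swap.tendsto _
  exact (h1.tendsto.comp h2) (hO.mem_nhds (h t ht))

/-- Near a hyperbolic limit cycle there is exactly one hyperbolic periodic orbit. -/
theorem LimitCycle.exists_hyperbolic_orbits (hc : LimitCycle l X Φ W c T K v L) {s u : ℕ}
    (hL : HasFlowType L s u) {O : Set (Space n)} (hO : IsOpen O) (hcO : c '' Icc 0 T ⊆ O)
    {Z : ι → Space n → Space n} (hZ : ∀ᶠ i in l, EqOn (Z i) (X i) O) :
    ∃ U : Set (Space n), IsOpen U ∧ c '' Icc 0 T ⊆ U ∧ U ⊆ O ∧ ∃ Γ : ι → Set (Space n),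
      (∀ᶠ i in l, (IsHyperbolicPeriodicOrbit (Z i) s u (Γ i) ∧ Γ i ⊆ U) ∧
        ∀ γ', IsHyperbolicPeriodicOrbit (Z i) s u γ' → γ' ⊆ U → γ' = Γ i) ∧
      Tendsto (fun i => Metric.hausdorffEDist (Γ i) (c '' Icc 0 T)) l (𝓝 0) := by
  have hn : 0 < n := by
    have := hL.finrank
    rw [finrank_euclideanSpace_fin] at this
    omega
  set i₀ : Fin n := ⟨0, hn⟩
  -- Linear coordinates sending `v` to a basis vector provide both the functional `ℓ` and a chart in
  -- which the transverse hyperplane is a coordinate hyperplane.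
  obtain ⟨A, hA⟩ := SeparatingDual.exists_continuousLinearEquiv_apply_eq (R := ℝ) hc.field_ne
    (show EuclideanSpace.single i₀ (1 : ℝ) ≠ 0 by simp)
  set ℓ : Space n →L[ℝ] ℝ := EuclideanSpace.proj i₀ ∘L (A : Space n →L[ℝ] Space n) with hℓdef
  have hℓ : ℓ v = 1 := by simp [hℓdef, hA]
  obtain ⟨t, x, ht, hx, hper⟩ := hc.exists_periodic_points hℓ hL
  have hper1 := hper.mono fun i hi => hi.1
  obtain ⟨r, hr, huniq⟩ := hc.exists_thickening_mem_range hℓ hL ht hx hper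
  obtain ⟨δ, hδ, hδO⟩ := (isCompact_Icc.image_of_continuousOn
    hc.continuousOn).exists_thickening_subset_open hO hcO
  have hη : 0 < min r δ := lt_min hr hδ
  refine ⟨Metric.thickening (min r δ) (c '' Icc 0 T), Metric.isOpen_thickening,
    Metric.self_subset_thickening hη _, (Metric.thickening_mono (min_le_right _ _) _).trans hδO,
    fun i => range fun τ => Φ i τ (x i), ?_, hc.tendsto_hausdorffEDist ht hx hper1⟩
  have hField : ∀ᶠ i in l, ℓ (X i (x i)) ≠ 0 := by
    have h1 : Tendsto (fun i => X i (x i)) l (𝓝 v) := hc.field.comp (tendsto_id.prodMk hx)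
    have h2 := (ℓ.continuous.tendsto v).comp h1
    rw [hℓ] at h2
    exact h2.eventually_ne one_ne_zero
  have hType : ∀ᶠ i in l, HasFlowType (W i (T + t i) (x i)) s u := by
    refine hL.eventually (hc.tendsto_linear ht hx) ?_
    filter_upwards [hper, hField] with i h1 h2
    refine ⟨X i (x i), fun h => h2 (by rw [h, map_zero]), ?_⟩
    rw [(hc.isFlow i).linear_field, h1.1]
  filter_upwards [hper, hField, hType, hc.eventually_flow_ne ht hx hper1,
    hc.eventually_orbit_close ht hx hper1 hη, huniq, hZ,
    hc.eventually_exists_return_time hℓ ht hx hper] with i hper hField hType hne hclose huniq hZ hτ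
  have hF := hc.isFlow i
  have hΓU : (range fun τ => Φ i τ (x i)) ⊆ Metric.thickening (min r δ) (c '' Icc 0 T) := by
    rintro _ ⟨τ, rfl⟩
    obtain ⟨σ, hσ, h⟩ := hclose.1 τ
    exact Metric.mem_thickening_iff.2 ⟨_, ⟨σ, hσ, rfl⟩, by rwa [dist_eq_norm]⟩
  have hUO := (Metric.thickening_mono (min_le_right r δ) (c '' Icc 0 T)).trans hδO
  refine ⟨⟨?_, hΓU⟩, fun γ' hγ' hγ'U => ?_⟩
  · refine ⟨fun τ => Φ i τ (x i), T + t i, ⟨hne.1, fun τ => ?_, fun τ => ?_, ?_⟩, rfl, ?_⟩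
    · rw [hZ (hUO (hΓU ⟨τ, rfl⟩))]
      exact hF.hasDerivAt τ _
    · rw [hF.add, hper.1]
    · have key : ∀ a ∈ Ico 0 (T + t i), ∀ b ∈ Ico 0 (T + t i), a < b →
          Φ i a (x i) ≠ Φ i b (x i) := by
        intro a ha b hb hab h
        refine hne.2 (b - a) ⟨by linarith, by linarith [ha.1, hb.2]⟩ (hF.injective a ?_)
        rw [← hF.add, add_sub_cancel, h]
      intro a ha b hb h
      rcases lt_trichotomy a b with hab | hab | hab
      · exact (key a ha b hb hab h).elim
      · exact hab
      · exact (key b hb a ha hab h.symm).elim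
    · simp only [hF.zero]
      have hxS : A (x i - c 0) i₀ = 0 := hper.2
      have hch := hypersurfaceChart_hyperplane A hxS
      have hV : tangentSubspace {y | A (y - c 0) i₀ = 0} (x i) =
          LinearMap.ker (ℓ : Space n →ₗ[ℝ] ℝ) := by
        rw [hch.tangentSubspace_eq]
        congr 1
        ext w
        exact normal_hyperplane A hxS w
      obtain ⟨τ, hτx, hτc, hτ0⟩ := hτ
      have hret : Φ i (T + t i) (x i) = x i := hper.1
      refine ⟨{y | A (y - c 0) i₀ = 0}, hxS, hch.hasLocalComponents rfl, ?_,
        fun y => Φ i (τ y) y, ⟨τ, hτx, hτc.continuousWithinAt, ?_⟩, ?_⟩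
      · rw [hV, hZ (hUO (hΓU ⟨0, hF.zero _⟩))]
        exact hField
      · have hmem := hF.eventually_forall_mem hO (T := T + t i + 1) (p := x i)
          fun σ _ => hUO (hΓU ⟨σ, rfl⟩)
        have hτb : ∀ᶠ y in 𝓝 (x i), τ y ∈ Ioo 0 (T + t i + 1) :=
          hτc.eventually_mem (Ioo_mem_nhds (by rw [hτx]; exact hne.1) (by rw [hτx]; linarith))
        filter_upwards [mem_nhdsWithin_of_mem_nhds hτ0, mem_nhdsWithin_of_mem_nhds hmem,
          mem_nhdsWithin_of_mem_nhds hτb] with y h1 h2 h3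
        refine ⟨h1, fun σ => Φ i σ y, ⟨h3.1, fun σ hσ => ?_⟩, hF.zero y, rfl⟩
        rw [hZ (h2 σ ⟨hσ.1, hσ.2.trans h3.2.le⟩)]
        exact (hF.hasDerivAt σ y).hasDerivWithinAt
      · refine ⟨by simp only [hτx, hret], ?_⟩
        have hℓd : HasFDerivAt (fun y => ℓ (y - c 0)) ℓ (Φ i (T + t i) (x i)) := by
          have := HasFDerivAt.comp (g := ℓ) (f := fun y => y - c 0) (Φ i (T + t i) (x i))
            ℓ.hasFDerivAt ((hasFDerivAt_id (Φ i (T + t i) (x i))).sub_const (c 0))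
          rwa [ContinuousLinearMap.comp_id] at this
        have hD := hF.hasFDerivWithinAt_of_hit hne.1.le (S := {y | A (y - c 0) i₀ = 0})
          hτc.continuousWithinAt hτx (h := fun y => ℓ (y - c 0)) (ν := ℓ)
          hℓd
          (by rw [hret]; exact hper.2)
          (mem_nhdsWithin_of_mem_nhds hτ0) (by rw [hret]; exact hField)
        rw [hret] at hD
        set y := X i (x i) with hy
        set B := W i (T + t i) (x i) with hB
        set L' := B - (ℓ y)⁻¹ • (ℓ ∘L B).smulRight y with hL'
        have hL'B : ∀ w, L' w = B w - ((ℓ y)⁻¹ * ℓ (B w)) • y := fun w => by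
          simp [hL', smul_smul]
        have hmaps : ∀ w ∈ tangentSubspace {y | A (y - c 0) i₀ = 0} (x i),
            (L' : Space n →ₗ[ℝ] Space n) w ∈ tangentSubspace {y | A (y - c 0) i₀ = 0} (x i) := by
          intro w _
          rw [hV]
          change ℓ (L' w) = 0
          rw [hL'B, map_sub, map_smul, smul_eq_mul]
          field_simp
          ring
        refine ⟨L', hmaps, hD, ?_⟩
        have hcompl : IsCompl (tangentSubspace {y | A (y - c 0) i₀ = 0} (x i)) (ℝ ∙ y) := by
          rw [hV]
          exact isCompl_ker_span hField
        refine (hasHyperbolicType_iff_hasFlowType (A := B) hcompl ?_ ?_ fun w => ?_).2 hType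
        · rintro h
          exact hField (by rw [h, map_zero])
        · rw [hB, hy, hF.linear_field, hret]
        · rw [LinearMap.coe_restrict_apply]
          change B w - L' w ∈ _
          rw [hL'B, sub_sub_cancel]
          exact Submodule.smul_mem _ _ (Submodule.mem_span_singleton_self _)
  · obtain ⟨c', T', hc', rfl, -⟩ := hγ'
    have hflow : ∀ τ, c' τ = Φ i τ (c' 0) := hF.eq_of_hasDerivAt fun τ => by
      rw [← hZ (hUO (hγ'U ⟨τ, rfl⟩))]
      exact hc'.hasDerivAt τ
    have hrange : range c' = range fun τ => Φ i τ (c' 0) := congrArg range (funext hflow)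
    have hclosed : IsClosed (range c') :=
      (hc'.periodic.compact_of_continuous hc'.period_pos.ne' (continuous_iff_continuousAt.2
        fun τ => (hc'.hasDerivAt τ).continuousAt)).isClosed
    rw [hrange] at hclosed hγ'U ⊢
    -- The competing orbit lies where the two fields agree, so it is a closed orbit of `X i` and
    -- contains the periodic point; two orbits with a common point coincide.
    obtain ⟨τ, hτ'⟩ := huniq _ hclosed (hγ'U.trans (Metric.thickening_mono (min_le_left _ _) _))
    simp only at hτ'
    rw [← hτ']
    ext z
    constructor
    · rintro ⟨σ, rfl⟩
      refine ⟨σ - τ, ?_⟩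
      simp only
      rw [← hF.add, sub_add_cancel]
    · rintro ⟨σ, rfl⟩
      exact ⟨σ + τ, hF.add _ _ _⟩

end HyperbolicOrbits

/-! ### Measure and complement of the discontinuity locus, and smooth cut-offs. -/

section Locus

variable {n : ℕ} {M S V W A : Set (Space n)} {X : Space n → Space n}

theorem volume_coordinate_hyperplane (i : Fin n) : volume {y : Space n | y i = 0} = 0 := by
  have h := Measure.addHaar_submodule (volume : Measure (Space n))
    (LinearMap.ker ((EuclideanSpace.proj i : Space n →L[ℝ] ℝ) : Space n →ₗ[ℝ] ℝ)) (by
      intro h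
      have : EuclideanSpace.single i (1 : ℝ) ∈
        LinearMap.ker ((EuclideanSpace.proj i : Space n →L[ℝ] ℝ) : Space n →ₗ[ℝ] ℝ) := by
        rw [h]; trivial
      simp at this)
  exact h

theorem HypersurfaceChart.volume_eq_zero {p : Space n}
    {φ : OpenPartialHomeomorph (Space n) (Space n)} {i : Fin n} (hφ : HypersurfaceChart S p φ i) :
    volume (S ∩ φ.source) = 0 := by
  refine measure_mono_null (t := φ.symm '' ({y | y i = 0} ∩ φ.target)) ?_ ?_
  · rintro x ⟨hxS, hx⟩
    exact ⟨φ x, ⟨(hφ.mem_iff x hx).1 hxS, φ.map_source hx⟩, φ.left_inv hx⟩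
  · refine addHaar_image_eq_zero_of_differentiableOn_of_addHaar_eq_zero volume ?_
      (measure_mono_null inter_subset_left (volume_coordinate_hyperplane i))
    exact (hφ.contDiffOn_symm.differentiableOn (by simp)).mono inter_subset_right

/-- Charts map each hypersurface locally into a hyperplane and have differentiable inverses.
Convolutions are therefore insensitive to the values of the field on the locus. -/
theorem IsNormalCrossings.volume_eq_zero (hS : IsNormalCrossings M S) : volume S = 0 := by
  obtain ⟨⟨N, H, hH, rfl⟩, -⟩ := hS
  refine measure_iUnion_null fun j => measure_null_of_locally_null _ fun p hp => ?_
  obtain ⟨φ, i, hφ⟩ := ((hH j).2.2 p hp).exists_chart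
  exact ⟨_, inter_mem_nhdsWithin _ (φ.open_source.mem_nhds hφ.mem_source), hφ.volume_eq_zero⟩

theorem IsNormalCrossings.isOpen_diff (hS : IsNormalCrossings M S) (hM : IsOpen M) :
    IsOpen (M \ S) := by
  obtain ⟨⟨N, H, hH, rfl⟩, -⟩ := hS
  have : M \ ⋃ i, H i = M \ closure (⋃ i, H i) := by
    refine Subset.antisymm (fun x hx => ⟨hx.1, fun h => hx.2 ?_⟩)
      (sdiff_subset_sdiff_right subset_closure)
    rw [closure_iUnion_of_finite] at h
    obtain ⟨i, hi⟩ := mem_iUnion.1 h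
    exact mem_iUnion.2 ⟨i, (hH i).2.1 ⟨hi, hx.1⟩⟩
  rw [this]
  exact hM.sdiff isClosed_closure

theorem IsComponentOf.isOpen (hA : IsOpen A) (hW : IsComponentOf A W) : IsOpen W := by
  obtain ⟨x, -, rfl⟩ := hW
  exact hA.connectedComponentIn

theorem IsComponentOf.subset (hW : IsComponentOf A W) : W ⊆ A := by
  obtain ⟨x, -, rfl⟩ := hW
  exact connectedComponentIn_subset A x

theorem IsComponentOf.subset_of_isPreconnected (hW : IsComponentOf A W) {B : Set (Space n)}
    (hB : IsPreconnected B) (hBA : B ⊆ A) (h : (B ∩ W).Nonempty) : B ⊆ W := by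
  obtain ⟨x, -, rfl⟩ := hW
  obtain ⟨y, hyB, hyW⟩ := h
  rw [connectedComponentIn_eq hyW]
  exact hB.subset_connectedComponentIn hyB hBA

theorem IsPiecewiseSmooth.exists_eventuallyEq (hX : IsPiecewiseSmooth M S X)
    (hMS : IsOpen (M \ S)) {q : Space n} (hq : q ∈ M \ S) :
    ∃ Y, ContDiffOn ℝ ∞ Y M ∧ X =ᶠ[𝓝 q] Y := by
  have hW : IsComponentOf (M \ S) (connectedComponentIn (M \ S) q) := ⟨q, hq, rfl⟩
  obtain ⟨Y, hY, hYX⟩ := hX _ hW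
  refine ⟨Y, hY, ?_⟩
  filter_upwards [(hW.isOpen hMS).mem_nhds (mem_connectedComponentIn hq)] with y hy
    using (hYX hy).symm

theorem IsPiecewiseSmooth.continuousOn (hX : IsPiecewiseSmooth M S X) (hM : IsOpen M)
    (hMS : IsOpen (M \ S)) : ContinuousOn X (M \ S) := by
  intro q hq
  obtain ⟨Y, hY, hYX⟩ := hX.exists_eventuallyEq hMS hq
  exact ((hY.continuousOn.continuousAt (hM.mem_nhds hq.1)).congr hYX.symm).continuousWithinAt

theorem exists_contDiff_hasCompactSupport_eqOn (hM : IsOpen M) (hVc : IsCompact (closure V))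
    (hVM : closure V ⊆ M) {Y : Space n → Space n} (hY : ContDiffOn ℝ ∞ Y M) :
    ∃ Z : Space n → Space n, ContDiff ℝ ∞ Z ∧ HasCompactSupport Z ∧ EqOn Z Y V := by
  obtain ⟨V', hV', hVV', hV'M, hV'c⟩ := exists_open_between_and_isCompact_closure hVc hM hVM
  obtain ⟨f, hf1, hf0, -⟩ := exists_contMDiffMap_one_nhds_of_subset_interior
    (n := (⊤ : ℕ∞)) (modelWithCornersSelf ℝ (Space n)) (isClosed_closure (s := V)) (t := V')
    (by rwa [hV'.interior_eq])
  have hf : ContDiff ℝ ∞ f := f.contMDiff.contDiff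
  have h0 : ∀ x ∉ V', f x • Y x = 0 := fun x hx => by rw [hf0 x hx, zero_smul]
  refine ⟨fun x => f x • Y x, contDiff_iff_contDiffAt.2 fun x => ?_,
    HasCompactSupport.intro hV'c fun x hx => h0 x fun h => hx (subset_closure h), fun x hx => ?_⟩
  · by_cases hx : x ∈ M
    · exact hf.contDiffAt.smul (hY.contDiffAt (hM.mem_nhds hx))
    · refine contDiffAt_const (c := (0 : Space n)) |>.congr_of_eventuallyEq ?_
      filter_upwards [isClosed_closure.isOpen_compl.mem_nhds fun h => hx (hV'M h)] with y hy
        using h0 y fun h => hy (subset_closure h)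
  · have := hf1.self_of_nhdsSet x (subset_closure hx)
    simp only [this, one_smul]

end Locus

/-! ### Truncation near the orbit, and global flows of the regularizations. -/

section Truncation

variable {n : ℕ} {M S V γ : Set (Space n)} {X g : Space n → Space n} {C : ℝ} {m : Space n → ℝ}

/-- `g` is bounded with compact support, and agrees with `X` near `γ` off the locus `S`. -/
structure IsTruncation (M S : Set (Space n)) (X : Space n → Space n) (γ V : Set (Space n))
    (g : Space n → Space n) (C : ℝ) : Prop where
  isOpen : IsOpen V
  subset : γ ⊆ V
  isCompact_closure : IsCompact (closure V)
  closure_subset : closure V ⊆ M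
  aestronglyMeasurable : AEStronglyMeasurable g
  norm_le : ∀ x, ‖g x‖ ≤ C
  hasCompactSupport : HasCompactSupport g
  apply_eq : ∀ y ∈ V, y ∉ S → g y = X y

/-- Local bounds at points of `γ`, also at those on `S`, give a bound near `γ` by compactness; `X`
is then cut to zero outside a relatively compact neighbourhood. -/
theorem exists_isTruncation (hM : IsOpen M) (hMS : IsOpen (M \ S))
    (hX : IsPiecewiseSmooth M S X) (hγ : IsCompact γ) (hγM : γ ⊆ M)
    (hb : ∀ q ∈ γ, ∃ O ∈ 𝓝 q, ∃ C, ∀ y ∈ O \ S, ‖X y‖ ≤ C) :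
    ∃ V g C, IsTruncation M S X γ V g C := by
  obtain ⟨O, hO, hγO, C, hC⟩ : ∃ O, IsOpen O ∧ γ ⊆ O ∧ ∃ C, ∀ y ∈ O \ S, ‖X y‖ ≤ C := by
    refine hγ.induction_on (p := fun γ => ∃ O, IsOpen O ∧ γ ⊆ O ∧ ∃ C, ∀ y ∈ O \ S, ‖X y‖ ≤ C)
      ⟨∅, isOpen_empty, Subset.rfl, 0, by simp⟩ ?_ ?_ ?_
    · rintro s t hst ⟨O, h1, h2, h3⟩
      exact ⟨O, h1, hst.trans h2, h3⟩
    · rintro s t ⟨O, h1, h2, C, h3⟩ ⟨O', h1', h2', C', h3'⟩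
      refine ⟨O ∪ O', h1.union h1', union_subset_union h2 h2', max C C', ?_⟩
      rintro y ⟨hy | hy, hyS⟩
      · exact (h3 y ⟨hy, hyS⟩).trans (le_max_left _ _)
      · exact (h3' y ⟨hy, hyS⟩).trans (le_max_right _ _)
    · intro q hq
      obtain ⟨O, hO, C, hC⟩ := hb q hq
      obtain ⟨O', hO'O, hO', hqO'⟩ := mem_nhds_iff.1 hO
      exact ⟨O', mem_nhdsWithin_of_mem_nhds (hO'.mem_nhds hqO'), O', hO', Subset.rfl, C,
        fun y hy => hC y ⟨hO'O hy.1, hy.2⟩⟩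
  obtain ⟨V, hV, hγV, hVO, hVc⟩ := exists_open_between_and_isCompact_closure hγ (hM.inter hO)
    (subset_inter hγM hγO)
  have hVM : closure V ⊆ M := hVO.trans inter_subset_left
  have hV' : V ∩ (M \ S) = V \ S := by
    ext x
    exact ⟨fun h => ⟨h.1, h.2.2⟩, fun h => ⟨h.1, hVM (subset_closure h.1), h.2⟩⟩
  have hVS : IsOpen (V \ S) := hV' ▸ hV.inter hMS
  refine ⟨V, (V \ S).indicator X, max C 0, hV, hγV, hVc, hVM, ?_, fun x => ?_,
    HasCompactSupport.intro hVc fun x hx => indicator_of_notMem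
      (fun h : x ∈ V \ S => hx (subset_closure h.1)) _, fun y hy hyS =>
      indicator_of_mem (show y ∈ V \ S from ⟨hy, hyS⟩) _⟩
  · rw [aestronglyMeasurable_indicator_iff hVS.measurableSet]
    refine ContinuousOn.aestronglyMeasurable ?_ hVS.measurableSet
    exact (hX.continuousOn hM hMS).mono fun x hx => ⟨hVM (subset_closure hx.1), hx.2⟩
  · by_cases hx : x ∈ V \ S
    · rw [indicator_of_mem hx]
      exact (hC x ⟨(hVO (subset_closure hx.1)).2, hx.2⟩).trans (le_max_left _ _)
    · rw [indicator_of_notMem hx, norm_zero]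
      exact le_max_right _ _

namespace IsTruncation

variable (h : IsTruncation M S X γ V g C)
include h

theorem subset_domain : V ⊆ M := subset_closure.trans h.closure_subset

theorem locallyIntegrable : LocallyIntegrable g := fun x =>
  ⟨Metric.ball x 1, Metric.ball_mem_nhds x one_pos,
    Measure.integrableOn_of_bounded (M := C) measure_ball_lt_top.ne h.aestronglyMeasurable
      (Eventually.of_forall h.norm_le)⟩

theorem exists_extension (hM : IsOpen M) {Y : Space n → Space n} (hY : ContDiffOn ℝ ∞ Y M) :
    ∃ Z : Space n → Space n, ContDiff ℝ ∞ Z ∧ HasCompactSupport Z ∧ EqOn Z Y V :=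
  exists_contDiff_hasCompactSupport_eqOn hM h.isCompact_closure h.closure_subset hY

theorem ae_apply_eq (hS : volume S = 0) : ∀ᵐ y, y ∈ V → g y = X y := by
  filter_upwards [measure_eq_zero_iff_ae_notMem.1 hS] with y hy hyV using h.apply_eq y hyV hy

end IsTruncation

/-- The mollified field for positive `ε`, and zero otherwise. -/
noncomputable def mollField (m : Space n → ℝ) (g : Space n → Space n) (ε : ℝ) :
    Space n → Space n := if 0 < ε then moll m ε g else 0

theorem mollField_of_pos {ε : ℝ} (hε : 0 < ε) : mollField m g ε = moll m ε g := if_pos hε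

theorem FieldTendsto.mollField {Y : Space n → Space n} {x : Space n}
    (hF : FieldTendsto (𝓝[>] 0) (fun ε => moll m ε g) Y x) :
    FieldTendsto (𝓝[>] 0) (mollField m g) Y x := by
  have h : ∀ᶠ q : ℝ × Space n in 𝓝[>] 0 ×ˢ 𝓝 x, moll m q.1 g = _root_.mollField m g q.1 := by
    filter_upwards [tendsto_fst.eventually self_mem_nhdsWithin] with q hq
    exact (mollField_of_pos hq).symm
  exact ⟨hF.1.congr' (h.mono fun q hq => congrFun hq q.2),
    hF.2.congr' (h.mono fun q hq => congrArg (fun f => fderiv ℝ f q.2) hq)⟩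

theorem IsTruncation.norm_mollField_le (h : IsTruncation M S X γ V g C) (hm : IsMollifier m)
    (ε : ℝ) (x : Space n) : ‖mollField m g ε x‖ ≤ C := by
  by_cases hε : 0 < ε
  · rw [mollField_of_pos hε]
    exact hm.norm_moll_le hε h.aestronglyMeasurable h.norm_le x
  · rw [mollField, if_neg hε]
    simpa using (norm_nonneg _).trans (h.norm_le 0)

/-- `LimitCycle` requires a flow for every index, which is why the family is extended by the zero
field to non-positive parameters. -/
theorem IsTruncation.exists_isFlow (h : IsTruncation M S X γ V g C) (hm : IsMollifier m) :
    ∃ (Φ : ℝ → ℝ → Space n → Space n) (W : ℝ → ℝ → Space n → Space n →L[ℝ] Space n),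
      ∀ ε, IsFlow (mollField m g ε) (Φ ε) (W ε) := by
  have : ∀ ε, ∃ Φ W, IsFlow (mollField m g ε) Φ W := fun ε => by
    by_cases hε : 0 < ε
    · rw [mollField_of_pos hε]
      exact _root_.exists_isFlow (hm.contDiff_moll hε h.locallyIntegrable)
        (hm.hasCompactSupport_moll hε h.hasCompactSupport)
    · rw [mollField, if_neg hε]
      exact _root_.exists_isFlow contDiff_const HasCompactSupport.zero
  choose Φ W h using this
  exact ⟨Φ, W, h⟩

theorem IsTruncation.exists_open_eqOn_regularize (h : IsTruncation M S X γ V g C)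
    (hS : volume S = 0) (hm : IsMollifier m) (hγ : IsCompact γ) :
    ∃ O, IsOpen O ∧ γ ⊆ O ∧ O ⊆ V ∧
      ∀ᶠ ε : ℝ in 𝓝[>] 0, EqOn (regularize M m X ε) (mollField m g ε) O := by
  obtain ⟨R, hR0, hR⟩ := hm.exists_radius
  obtain ⟨δ, hδ, hδV⟩ := hγ.exists_thickening_subset_open h.isOpen h.subset
  refine ⟨Metric.thickening (δ / 2) γ, Metric.isOpen_thickening,
    Metric.self_subset_thickening (half_pos hδ) _,
    (Metric.thickening_mono (by linarith) _).trans hδV, ?_⟩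
  filter_upwards [Ioo_mem_nhdsGT (show 0 < δ / 2 / R by positivity)] with ε hε x hx
  rw [mollField_of_pos hε.1]
  refine moll_congr (g := M.indicator X) hR hε.1 ?_
  filter_upwards [h.ae_apply_eq hS] with y hy hyx
  have hyV : y ∈ V := by
    obtain ⟨z, hz, hzx⟩ := Metric.mem_thickening_iff.1 hx
    have h1 := (lt_div_iff₀ hR0).1 hε.2
    exact hδV (Metric.mem_thickening_iff.2 ⟨z, hz, (dist_triangle y x z).trans_lt (by linarith)⟩)
  rw [hy hyV, indicator_of_mem (h.subset_domain hyV)]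

/-- A limit cycle of the mollified fields with hyperbolic monodromy persists. -/
theorem IsTruncation.exists_hyperbolic_orbits (h : IsTruncation M S X γ V g C)
    (hS : volume S = 0) (hm : IsMollifier m) {Φ : ℝ → ℝ → Space n → Space n}
    {W : ℝ → ℝ → Space n → Space n →L[ℝ] Space n} {c : ℝ → Space n} {T K : ℝ} {v : Space n}
    {L : Space n →L[ℝ] Space n} (hc : LimitCycle (𝓝[>] 0) (mollField m g) Φ W c T K v L)
    (hγ : c '' Icc 0 T = γ) {s u : ℕ} (hL : HasFlowType L s u) :
    ∃ U : Set (Space n), IsOpen U ∧ γ ⊆ U ∧ U ⊆ M ∧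
    ∃ E : Set ℝ≥0, E ∈ 𝓝 (0 : ℝ≥0) ∧
    ∃ Γ : ℝ≥0 → Set (Space n),
      (∀ ε ∈ E, ε ≠ 0 →
        ContDiffOn ℝ ∞ (regularize M m X ε) U ∧
        (IsHyperbolicPeriodicOrbit (regularize M m X ε) s u (Γ ε) ∧ Γ ε ⊆ U) ∧
        ∀ γ' : Set (Space n),
          IsHyperbolicPeriodicOrbit (regularize M m X ε) s u γ' → γ' ⊆ U → γ' = Γ ε) ∧
      Tendsto (fun ε : ℝ≥0 => Metric.hausdorffEDist (Γ ε) γ) (𝓝[≠] 0) (𝓝 0) := by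
  have hγc : IsCompact γ := hγ ▸ isCompact_Icc.image_of_continuousOn hc.continuousOn
  obtain ⟨O, hO, hγO, hOV, hreg⟩ := h.exists_open_eqOn_regularize hS hm hγc
  obtain ⟨U, hU, hγU, hUO, Γ, hΓ, hlim⟩ := hc.exists_hyperbolic_orbits hL hO
    (hγ.symm ▸ hγO) hreg
  rw [hγ] at hγU hlim
  have hcoe : Tendsto (fun ε : ℝ≥0 => (ε : ℝ)) (𝓝[≠] 0) (𝓝[>] 0) := by
    refine tendsto_nhdsWithin_iff.2 ⟨?_, ?_⟩
    · exact (NNReal.continuous_coe.tendsto 0).mono_left nhdsWithin_le_nhds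
    · filter_upwards [self_mem_nhdsWithin] with ε hε
      exact NNReal.coe_pos.2 (pos_iff_ne_zero.2 hε)
  -- Here `E` is a full neighbourhood of `0` whose punctured part satisfies the eventual statements.
  refine ⟨U, hU, hγU, hUO.trans (hOV.trans h.subset_domain), _,
    mem_nhdsWithin_iff_exists_mem_nhds_inter.1 (hcoe.eventually (hΓ.and hreg)) |>.choose_spec.1,
    fun ε => Γ ε, fun ε hε hε0 => ?_, hlim.comp hcoe⟩
  have hε' := (mem_nhdsWithin_iff_exists_mem_nhds_inter.1
    (hcoe.eventually (hΓ.and hreg))).choose_spec.2 ⟨hε, hε0⟩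
  refine ⟨?_, hε'.1⟩
  have hpos : 0 < (ε : ℝ) := NNReal.coe_pos.2 (pos_iff_ne_zero.2 hε0)
  refine ContDiffOn.congr ?_ fun x hx => hε'.2 (hUO hx)
  rw [mollField_of_pos hpos]
  exact (hm.contDiff_moll hpos h.locallyIntegrable).contDiffOn

end Truncation

/-! ### Integral arcs, flows, and differentials on a section. -/

section Arcs

variable {n : ℕ} {X Z : Space n → Space n} {φ : ℝ → Space n → Space n}
  {w : ℝ → Space n → Space n →L[ℝ] Space n} {c : ℝ → Space n} {τ σ : ℝ}

theorem IsFlow.eq_of_hasDerivWithinAt (hF : IsFlow Z φ w) {a b : ℝ}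
    (hc : ContinuousOn c (Icc a b))
    (hd : ∀ t ∈ Ico a b, HasDerivWithinAt c (Z (c t)) (Ici t) t) :
    ∀ t ∈ Icc a b, c t = φ (t - a) (c a) := by
  obtain ⟨K, hK⟩ := hF.lipschitz
  have hφ : ∀ t, HasDerivAt (fun t => φ (t - a) (c a)) (Z (φ (t - a) (c a))) t := fun t => by
    have := (hF.hasDerivAt (t - a) (c a)).scomp t ((hasDerivAt_id t).sub_const a)
    rw [one_smul] at this
    exact this
  exact ODE_solution_unique_of_mem_Icc_right (v := fun _ => Z) (s := fun _ => univ) (K := K)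
    (fun _ _ => hK.lipschitzOnWith) hc hd (fun _ _ => trivial)
    (fun t _ => (hφ t).continuousAt.continuousWithinAt)
    (fun t _ => (hφ t).hasDerivWithinAt) (fun _ _ => trivial) (by simp [hF.zero])

theorem IsIntegralArc.continuousOn (hc : IsIntegralArc X c τ) : ContinuousOn c (Icc 0 τ) :=
  fun t ht => (hc.2 t ht).continuousWithinAt

theorem IsIntegralArc.hasDerivWithinAt_Ici (hc : IsIntegralArc X c τ) {t : ℝ} (ht : t ∈ Ico 0 τ) :
    HasDerivWithinAt c (X (c t)) (Ici t) t :=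
  (hc.2 t ⟨ht.1, ht.2.le⟩).mono_of_mem_nhdsWithin <| by
    filter_upwards [Icc_mem_nhdsGE ht.2] with s hs using ⟨ht.1.trans hs.1, hs.2⟩

/-- An integral arc follows the flow as long as the flow stays in the region where the fields
agree. -/
theorem IsIntegralArc.eq_flow (hc : IsIntegralArc X c τ) (hF : IsFlow Z φ w) {O : Set (Space n)}
    (hO : IsOpen O) (hXZ : EqOn X Z O) (hστ : σ ≤ τ) (h : ∀ t ∈ Icc 0 σ, φ t (c 0) ∈ O) :
    ∀ t ∈ Icc 0 σ, c t = φ t (c 0) := by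
  have hcc : ContinuousOn c (Icc 0 σ) := hc.continuousOn.mono (Icc_subset_Icc_right hστ)
  have hφc : ContinuousOn (fun t => φ t (c 0)) (Icc 0 σ) :=
    fun t _ => (hF.hasDerivAt t _).continuousAt.continuousWithinAt
  -- Continuation: the times at which arc and flow agree form a closed set, and at each of them the
  -- arc is still in `O`, so agreement extends to the right.
  refine fun t ht => IsClosed.Icc_subset_of_forall_mem_nhdsWithin
    (s := {t | c t = φ t (c 0)}) ?_ (hF.zero _).symm ?_ ht
  · have := (hcc.sub hφc).preimage_isClosed_of_isClosed isClosed_Icc (isClosed_singleton (x := 0))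
    convert this using 1
    ext t
    simp [sub_eq_zero, and_comm]
  · rintro a ⟨ha, ha0, haσ⟩
    have haO : c a ∈ O := by rw [show c a = _ from ha]; exact h a ⟨ha0, haσ.le⟩
    have hca : ContinuousWithinAt c (Icc a σ) a :=
      (hcc a ⟨ha0, haσ.le⟩).mono (Icc_subset_Icc_left ha0)
    have h1 : ∀ᶠ t in 𝓝[≥] a, c t ∈ O := by
      have := hca.eventually_mem (hO.mem_nhds haO)
      rwa [nhdsWithin_Icc_eq_nhdsGE haσ] at this
    obtain ⟨b, hab, hb⟩ := (mem_nhdsGE_iff_exists_Ico_subset' haσ).1 h1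
    have hab' : a < min b σ := lt_min hab haσ
    have key := hF.eq_of_hasDerivWithinAt (c := c) (a := a) (b := min b σ)
      (hcc.mono (Icc_subset_Icc ha0 (min_le_right _ _))) fun t ht => by
        rw [← hXZ (hb ⟨ht.1, ht.2.trans_le (min_le_left _ _)⟩)]
        exact hc.hasDerivWithinAt_Ici ⟨ha0.trans ht.1,
          ht.2.trans_le ((min_le_right _ _).trans hστ)⟩
    filter_upwards [Ioo_mem_nhdsGT hab'] with t ht
    have := key t ⟨ht.1.le, ht.2.le⟩
    rw [show c a = _ from ha, ← hF.add, sub_add_cancel] at this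
    exact this

theorem HasFDerivWithinAt.eqOn_tangentSubspace {S : Set (Space n)} {p : Space n}
    {P : Space n → Space n} {L L' : Space n →L[ℝ] Space n} (h : HasFDerivWithinAt P L S p)
    (h' : HasFDerivWithinAt P L' S p) : ∀ v ∈ tangentSubspace S p, L v = L' v := by
  intro v hv
  have := LinearMap.eqOn_span (f := (L : Space n →ₗ[ℝ] Space n))
    (g := (L' : Space n →ₗ[ℝ] Space n)) (h.unique_on h') hv
  exact this

/-- A hyperbolic fixed point of a map whose differential is induced by `A`. -/
theorem IsHyperbolicFixedPoint.hasFlowType {S : Set (Space n)} {p : Space n}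
    {P : Space n → Space n} {s u : ℕ} (h : IsHyperbolicFixedPoint S P p s u)
    {ν : Space n →L[ℝ] ℝ} (hν : tangentSubspace S p = LinearMap.ker (ν : Space n →ₗ[ℝ] ℝ))
    {A L : Space n →L[ℝ] Space n} {y : Space n} (hL : HasFDerivWithinAt P L S p)
    (hy : ν y ≠ 0) (hAy : A y = y)
    (hAL : ∀ v ∈ tangentSubspace S p, A v - L v ∈ ℝ ∙ y) : HasFlowType A s u := by
  obtain ⟨-, L₀, hmaps, hL₀, htype⟩ := h
  have hcompl : IsCompl (tangentSubspace S p) (ℝ ∙ y) := by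
    rw [hν]
    exact isCompl_ker_span hy
  refine (hasHyperbolicType_iff_hasFlowType (A := A) hcompl ?_ hAy fun v => ?_).1 htype
  · rintro rfl
    exact hy (map_zero _)
  · rw [LinearMap.coe_restrict_apply]
    have h1 := hL₀.eqOn_tangentSubspace hL v v.2
    change A v - L₀ v ∈ _
    rw [h1]
    exact hAL v v.2

end Arcs

/-! ### Periodic orbits that do not meet the locus. -/

section Regular

variable {n : ℕ} {M S V γ : Set (Space n)} {X g : Space n → Space n} {C : ℝ} {m : Space n → ℝ}

theorem IsPiecewiseSmooth.exists_norm_le_nhds (hX : IsPiecewiseSmooth M S X) (hM : IsOpen M)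
    (hMS : IsOpen (M \ S)) {q : Space n} (hq : q ∈ M \ S) :
    ∃ O ∈ 𝓝 q, ∃ C, ∀ y ∈ O \ S, ‖X y‖ ≤ C := by
  have h1 := ((hX.continuousOn hM hMS).continuousAt (hMS.mem_nhds hq)).norm.eventually_lt_const
    (lt_add_one ‖X q‖)
  exact ⟨_, h1, _, fun y hy => hy.1.le⟩

theorem IsTruncation.fieldTendsto (h : IsTruncation M S X γ V g C) (hS : volume S = 0)
    (hm : IsMollifier m) {Z : Space n → Space n} (hZ : ContDiff ℝ ∞ Z) (hZc : HasCompactSupport Z)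
    {O : Set (Space n)} (hO : IsOpen O) (hOV : O ⊆ V) (hXZ : EqOn X Z (O \ S)) {y : Space n}
    (hy : y ∈ O) : FieldTendsto (𝓝[>] 0) (mollField m g) Z y := by
  obtain ⟨r, hr, hrO⟩ := Metric.isOpen_iff.1 hO y hy
  refine (hm.fieldTendsto_of_ae hZ hZc hr ?_).mollField
  filter_upwards [h.ae_apply_eq hS, measure_eq_zero_iff_ae_notMem.1 hS] with x hx hxS hxy
  have hxO : x ∈ O := hrO hxy
  rw [hx (hOV hxO), hXZ ⟨hxO, hxS⟩]

/-- By connectedness the orbit lies in one component, so `X` agrees near it with a single smooth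
field `Z` and the regularizations converge with derivatives along the whole orbit. The monodromy is
the linearized flow of `Z` over one period. -/
theorem IsHyperbolicPeriodicOrbit.exists_of_regularize (hM : IsOpen M) (hS : IsNormalCrossings M S)
    (hX : IsPiecewiseSmooth M S X) (hm : IsMollifier m) {s u : ℕ}
    (hγ : IsHyperbolicPeriodicOrbit X s u γ) (hγM : γ ⊆ M \ S) :
    ∃ U : Set (Space n), IsOpen U ∧ γ ⊆ U ∧ U ⊆ M ∧
    ∃ E : Set ℝ≥0, E ∈ 𝓝 (0 : ℝ≥0) ∧
    ∃ Γ : ℝ≥0 → Set (Space n),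
      (∀ ε ∈ E, ε ≠ 0 →
        ContDiffOn ℝ ∞ (regularize M m X ε) U ∧
        (IsHyperbolicPeriodicOrbit (regularize M m X ε) s u (Γ ε) ∧ Γ ε ⊆ U) ∧
        ∀ γ' : Set (Space n),
          IsHyperbolicPeriodicOrbit (regularize M m X ε) s u γ' → γ' ⊆ U → γ' = Γ ε) ∧
      Tendsto (fun ε : ℝ≥0 => Metric.hausdorffEDist (Γ ε) γ) (𝓝[≠] 0) (𝓝 0) := by
  have hMS := hS.isOpen_diff hM
  obtain ⟨c, T, hc, rfl, S', hcS', hS', htrans, P, ⟨τ, hτ, hτc, hret⟩, hP⟩ := hγ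
  have hcont : Continuous c := continuous_iff_continuousAt.2 fun t => (hc.hasDerivAt t).continuousAt
  have hcompact : IsCompact (range c) :=
    hc.periodic.compact_of_continuous hc.period_pos.ne' hcont
  obtain ⟨V, g, C, hg⟩ := exists_isTruncation hM hMS hX hcompact (hγM.trans sdiff_subset)
    fun q hq => hX.exists_norm_le_nhds hM hMS (hγM hq)
  have hcomp : IsComponentOf (M \ S) (connectedComponentIn (M \ S) (c 0)) :=
    ⟨c 0, hγM ⟨0, rfl⟩, rfl⟩
  set Q := connectedComponentIn (M \ S) (c 0)
  have hcQ : range c ⊆ Q := hcomp.subset_of_isPreconnected (isPreconnected_range hcont) hγM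
    ⟨c 0, ⟨0, rfl⟩, mem_connectedComponentIn (hγM ⟨0, rfl⟩)⟩
  obtain ⟨Y, hY, hYX⟩ := hX Q hcomp
  obtain ⟨Z, hZ, hZc, hZY⟩ := hg.exists_extension hM hY
  obtain ⟨φ, w, hφ⟩ := exists_isFlow hZ hZc
  have hO : IsOpen (V ∩ Q) := hg.isOpen.inter (hcomp.isOpen hMS)
  have hXZ : EqOn X Z (V ∩ Q) := fun x hx => by rw [hZY hx.1, hYX hx.2]
  have hcO : ∀ t, c t ∈ V ∩ Q := fun t => ⟨hg.subset ⟨t, rfl⟩, hcQ ⟨t, rfl⟩⟩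
  have hflow : ∀ t, c t = φ t (c 0) := hφ.eq_of_hasDerivAt fun t => by
    rw [← hXZ (hcO t)]; exact hc.hasDerivAt t
  have hper : φ T (c 0) = c 0 := by rw [← hflow]; simpa using hc.periodic 0
  obtain ⟨Φ, W, hΦ⟩ := hg.exists_isFlow hm
  have hfield : ∀ y ∈ V ∩ Q, FieldTendsto (𝓝[>] 0) (mollField m g) Z y := fun y hy =>
    hg.fieldTendsto hS.volume_eq_zero hm hZ hZc hO inter_subset_left
      (hXZ.mono sdiff_subset) hy
  obtain ⟨ψ, i, hψ⟩ := hS'.exists_chart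
  have hν : hψ.normal (Z (c 0)) ≠ 0 := by
    rw [← hXZ (hcO 0)]
    rwa [hψ.tangentSubspace_eq] at htrans
  have hadd : ∀ a b, c (a + b) = φ a (c b) := fun a b => by
    rw [hflow (a + b), hφ.add, ← hflow b]
  have hreach : ∀ a, ∀ t ≥ 0, C1Reach (𝓝[>] 0) Φ W (c a) t (φ t (c a)) (w t (c a)) :=
    fun a t ht => c1Reach_of_fieldTendsto hΦ hφ hO hfield ht fun t _ => by
      rw [← hadd]; exact hcO _
  have hlimit : LimitCycle (𝓝[>] 0) (mollField m g) Φ W c T C (Z (c 0)) (w T (c 0)) := by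
    refine ⟨hΦ, hg.norm_mollField_le hm, hc.period_pos, (hfield _ (hcO 0)).1, ?_, ?_,
      fun t ht => ?_, fun t ht => ?_, fun t ht h => ?_⟩
    · intro h; exact hν (by rw [h, map_zero])
    · have := hreach 0 T hc.period_pos.le
      rw [hper] at this
      exact this.tendsto_flow hΦ hφ hO hfield (hcO 0)
    · have := (hreach 0 t ht.1).1
      rwa [← hflow] at this
    · have := (hreach t (T - t) (sub_nonneg.2 ht.2)).1
      rwa [← hadd, sub_add_cancel, hflow T, hper] at this
    · exact ht.1.ne' (hc.injOn ⟨ht.1.le, ht.2⟩ ⟨le_rfl, hc.period_pos⟩ h)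
  have himage : c '' Icc 0 T = range c := by
    refine Subset.antisymm (image_subset_range _ _) ?_
    have := hc.periodic.image_Icc hc.period_pos 0
    rw [zero_add] at this
    exact this.ge
  refine hg.exists_hyperbolic_orbits hS.volume_eq_zero hm hlimit himage
    (hP.hasFlowType hψ.tangentSubspace_eq (L := w T (c 0) - (hψ.normal (Z (c 0)))⁻¹ •
      (hψ.normal ∘L w T (c 0)).smulRight (Z (c 0))) ?_ hν ?_ fun v _ => ?_)
  · have hmem := hφ.eventually_forall_mem hO (T := T + 1) (p := c 0)
      fun t _ => by rw [← hflow]; exact hcO t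
    have hτb : ∀ᶠ x in 𝓝[S'] (c 0), τ x < T + 1 :=
      hτc.eventually_lt_const (by rw [hτ]; exact lt_add_one T)
    -- `P` is only assumed to follow some integral arcs of `X`; near the orbit these are orbits of
    -- the flow of `Z`, so the differential of `P` can be computed.
    have hPφ : ∀ᶠ x in 𝓝[S'] (c 0), P x ∈ S' ∧ P x = φ (τ x) x := by
      filter_upwards [hret, hτb, mem_nhdsWithin_of_mem_nhds hmem] with x ⟨hPS, e, he, he0, heP⟩ h2 h3
      refine ⟨hPS, ?_⟩
      rw [← heP, he.eq_flow hφ hO hXZ le_rfl (fun t ht => ?_) (τ x) ⟨he.1.le, le_rfl⟩, he0]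
      rw [he0]
      exact h3 t ⟨ht.1, ht.2.trans h2.le⟩
    have hlim : Tendsto (fun x => φ (τ x) x) (𝓝[S'] (c 0)) (𝓝 (c 0)) := by
      have h1 := (hφ.hasStrictFDerivAt hc.period_pos.le (c 0)).hasFDerivAt.continuousAt
      have h2 : Tendsto (fun x => (τ x, x)) (𝓝[S'] (c 0)) (𝓝 (T, c 0)) := by
        rw [← hτ]
        exact hτc.tendsto.prodMk_nhds (tendsto_id.mono_left nhdsWithin_le_nhds)
      have h3 := h1.tendsto.comp h2
      simp only [hper] at h3
      exact h3
    have hD := hφ.hasFDerivWithinAt_of_hit hc.period_pos.le hτc hτ (h := fun x => ψ x i)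
      (ν := hψ.normal) (by rw [hper]; exact hψ.hasStrictFDerivAt.hasFDerivAt)
      (by rw [hper, hψ.map_eq_zero]; rfl) (by
        filter_upwards [hPφ, hlim.eventually_mem (ψ.open_source.mem_nhds hψ.mem_source)]
          with x h1 h2
        rw [← hψ.mem_iff _ h2, ← h1.2]
        exact h1.1) (by rwa [hper])
    rw [hper] at hD
    refine hD.congr_of_eventuallyEq (hPφ.mono fun x hx => hx.2) ?_
    rw [hτ, hper, hP.1]
  · rw [hφ.linear_field, hper]
  · have : w T (c 0) v - (w T (c 0) - (hψ.normal (Z (c 0)))⁻¹ •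
      (hψ.normal ∘L w T (c 0)).smulRight (Z (c 0))) v =
      ((hψ.normal (Z (c 0)))⁻¹ * hψ.normal (w T (c 0) v)) • Z (c 0) := by
      simp [smul_smul]
    rw [this]
    exact Submodule.smul_mem _ _ (Submodule.mem_span_singleton_self _)

end Regular

/-! ### Two-sided neighbourhoods of smooth points, and the regularized field there. -/

section Gate

variable {n : ℕ} {M S B : Set (Space n)} {p : Space n} {h : Space n → ℝ} {ν : Space n →L[ℝ] ℝ}

/-- In the neighbourhood `B` of `p` the hypersurface `S` is the zero set of `h`, and it has two
connected sides. -/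
structure IsGate (S : Set (Space n)) (p : Space n) (h : Space n → ℝ) (ν : Space n →L[ℝ] ℝ)
    (B : Set (Space n)) : Prop where
  isOpen : IsOpen B
  mem : p ∈ B
  contDiffAt : ContDiffAt ℝ ∞ h p
  continuousOn : ContinuousOn h B
  hasStrictFDerivAt : HasStrictFDerivAt h ν p
  apply_eq_zero : h p = 0
  mem_iff : ∀ x ∈ B, (x ∈ S ↔ h x = 0)
  tangentSubspace_eq : tangentSubspace S p = LinearMap.ker (ν : Space n →ₗ[ℝ] ℝ)
  isPreconnected_pos : IsPreconnected (B ∩ {x | 0 < h x})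
  isPreconnected_neg : IsPreconnected (B ∩ {x | h x < 0})

theorem IsGate.neg (hB : IsGate S p h ν B) : IsGate S p (-h) (-ν) B where
  isOpen := hB.isOpen
  mem := hB.mem
  contDiffAt := hB.contDiffAt.neg
  continuousOn := hB.continuousOn.neg
  hasStrictFDerivAt := hB.hasStrictFDerivAt.neg
  apply_eq_zero := by simp [hB.apply_eq_zero]
  mem_iff x hx := by simp [hB.mem_iff x hx]
  tangentSubspace_eq := by
    rw [hB.tangentSubspace_eq]
    ext v
    simp
  isPreconnected_pos := by simpa using hB.isPreconnected_neg
  isPreconnected_neg := by simpa using hB.isPreconnected_pos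

/-- For `B` the image of a small ball under the inverse chart, the sides are images of half-balls
and hence connected. Each side therefore lies in a single component of `M \ S`. -/
theorem HypersurfaceChart.exists_isGate {φ : OpenPartialHomeomorph (Space n) (Space n)} {i : Fin n}
    (hφ : HypersurfaceChart S p φ i) (hM : M ∈ 𝓝 p) :
    ∃ B ⊆ M, IsGate S p (fun x => φ x i) hφ.normal B := by
  have h1 : ∀ᶠ y in 𝓝 (0 : Space n), y ∈ φ.target ∧ φ.symm y ∈ M := by
    refine Eventually.and (φ.open_target.mem_nhds hφ.zero_mem_target) ?_
    exact hφ.hasStrictFDerivAt_symm.hasFDerivAt.continuousAt.eventually_mem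
      (by rwa [hφ.symm_zero])
  obtain ⟨r, hr, hrb⟩ := Metric.eventually_nhds_iff_ball.1 h1
  have ht : Metric.ball 0 r ⊆ φ.target := fun y hy => (hrb y hy).1
  have hc : ContinuousOn φ.symm (Metric.ball 0 r) := φ.continuousOn_symm.mono ht
  have himage : ∀ Q : Set ℝ, φ.symm '' Metric.ball 0 r ∩ {x | φ x i ∈ Q} =
      φ.symm '' (Metric.ball 0 r ∩ {y | y i ∈ Q}) := fun Q => by
    ext x
    constructor
    · rintro ⟨⟨y, hy, rfl⟩, hx⟩
      refine ⟨y, ⟨hy, ?_⟩, rfl⟩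
      simpa [φ.right_inv (ht hy)] using hx
    · rintro ⟨y, ⟨hy, hyQ⟩, rfl⟩
      refine ⟨⟨y, hy, rfl⟩, ?_⟩
      simpa [φ.right_inv (ht hy)] using hyQ
  have hconn : ∀ Q : Set ℝ, Convex ℝ Q →
      IsPreconnected (φ.symm '' Metric.ball 0 r ∩ {x | φ x i ∈ Q}) := fun Q hQ => by
    rw [himage]
    refine IsPreconnected.image (Convex.isPreconnected ?_) _ (hc.mono inter_subset_left)
    exact (convex_ball 0 r).inter
      (hQ.linear_preimage ((EuclideanSpace.proj i : Space n →L[ℝ] ℝ) : Space n →ₗ[ℝ] ℝ))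
  refine ⟨φ.symm '' Metric.ball 0 r, ?_, ?_, ⟨0, Metric.mem_ball_self hr, hφ.symm_zero⟩, ?_,
    ?_, hφ.hasStrictFDerivAt, by simp [hφ.map_eq_zero], ?_, hφ.tangentSubspace_eq,
    hconn (Ioi 0) (convex_Ioi 0), hconn (Iio 0) (convex_Iio 0)⟩
  · rintro _ ⟨y, hy, rfl⟩
    exact (hrb y hy).2
  · exact φ.symm.isOpen_image_of_subset_source Metric.isOpen_ball ht
  · exact ((EuclideanSpace.proj i : Space n →L[ℝ] ℝ).contDiff.contDiffAt).comp p
      (hφ.contDiffOn.contDiffAt (φ.open_source.mem_nhds hφ.mem_source))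
  · refine ((EuclideanSpace.proj i : Space n →L[ℝ] ℝ).continuous.comp_continuousOn
      φ.continuousOn).mono ?_
    rintro _ ⟨y, hy, rfl⟩
    exact φ.map_target (ht hy)
  · rintro _ ⟨y, hy, rfl⟩
    exact hφ.mem_iff _ (φ.map_target (ht hy))

variable {V γ : Set (Space n)} {X g Y Z : Space n → Space n} {C : ℝ} {m : Space n → ℝ}

theorem exists_norm_fderiv_le_of_hasCompactSupport (hY : ContDiff ℝ ∞ Y)
    (hYc : HasCompactSupport Y) : ∃ K, ∀ x, ‖fderiv ℝ Y x‖ ≤ K :=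
  (hYc.fderiv ℝ).exists_bound_of_continuous (hY.continuous_fderiv (by simp))

theorem IsMollifier.norm_fderiv_moll_le (hm : IsMollifier m) (hY : ContDiff ℝ ∞ Y)
    (hYc : HasCompactSupport Y) {K : ℝ} (hK : ∀ x, ‖fderiv ℝ Y x‖ ≤ K) {ε : ℝ} (hε : 0 < ε)
    (x : Space n) : ‖fderiv ℝ (moll m ε Y) x‖ ≤ K := by
  rw [hm.fderiv_moll_of_contDiff (hY.of_le (by simp)) hYc]
  exact hm.norm_moll_le hε (hY.continuous_fderiv (by simp)).aestronglyMeasurable hK x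

theorem IsMollifier.eventually_norm_moll_sub_le (hm : IsMollifier m) (hY : Continuous Y)
    {K : Set (Space n)} (hK : IsCompact K) {η : ℝ} (hη : 0 < η) :
    ∀ᶠ ε : ℝ in 𝓝[>] 0, ∀ x ∈ K, ‖moll m ε Y x - Y x‖ ≤ η := by
  refine hK.eventually_forall_of_prod_nhds fun x _ => ?_
  have h1 : Tendsto (fun q : ℝ × Space n => ‖moll m q.1 Y q.2 - Y q.2‖) (𝓝[>] 0 ×ˢ 𝓝 x) (𝓝 0) := by
    have := ((hm.tendsto_moll hY x).sub ((hY.tendsto x).comp tendsto_snd)).norm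
    simpa using this
  exact (h1.eventually_lt_const hη).mono fun q hq => hq.le

/-- Near a point of transverse discontinuity the mollified fields form a crossing field. -/
theorem IsTruncation.exists_crossingField (hg : IsTruncation M S X γ V g C) (hS : volume S = 0)
    (hm : IsMollifier m) (hB : IsGate S p h ν B) (hpV : p ∈ V)
    (hZ : ContDiff ℝ ∞ Z) (hZc : HasCompactSupport Z) (hY : ContDiff ℝ ∞ Y)
    (hYc : HasCompactSupport Y) (hXZ : ∀ y ∈ V ∩ B, h y < 0 → X y = Z y)
    (hXY : ∀ y ∈ V ∩ B, 0 < h y → X y = Y y) (hνZ : 0 < ν (Z p)) (hνY : 0 < ν (Y p)) :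
    ∃ K C' a, CrossingField (mollField m g) h ν p Y K C' a := by
  obtain ⟨R, hR0, hR⟩ := hm.exists_radius
  obtain ⟨r, hr, hrVB⟩ := Metric.isOpen_iff.1 (hg.isOpen.inter hB.isOpen) p ⟨hpV, hB.mem⟩
  have hdiff : ∀ᶠ x in 𝓝 p, DifferentiableAt ℝ h x := by
    filter_upwards [(hB.contDiffAt.of_le (show (1 : WithTop ℕ∞) ≤ ∞ by simp)).eventually (by simp)]
      with x hx using hx.differentiableAt (by simp)
  have hgae : ∀ᵐ y, dist y p < r → g y = if 0 < h y then Y y else Z y := by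
    filter_upwards [hg.ae_apply_eq hS, measure_eq_zero_iff_ae_notMem.1 hS] with y hy hyS hyr
    have hyVB := hrVB hyr
    rw [hy hyVB.1]
    have h0 : h y ≠ 0 := fun h0 => hyS ((hB.mem_iff y hyVB.2).2 h0)
    split_ifs with hpos
    · exact hXY y hyVB hpos
    · exact hXZ y hyVB (lt_of_le_of_ne (not_lt.1 hpos) h0)
  obtain ⟨κ, t, ht, hκ⟩ := hB.hasStrictFDerivAt.exists_lipschitzOnWith
  obtain ⟨r', hr', hr't⟩ := Metric.mem_nhds_iff.1 ht
  set ρ := min r r' / 4 with hρ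
  have hρ0 : 0 < ρ := by positivity
  have hρr : 4 * ρ ≤ r := by rw [hρ]; linarith [min_le_left r r']
  have hρr' : 4 * ρ ≤ r' := by rw [hρ]; linarith [min_le_right r r']
  -- Over a distance `2 * R * ε` the function `h` varies by less than `C' * ε`, so from points with
  -- `|h| ≥ C' * ε` the mollifier sees one side only. The factor two leaves room for equality in a
  -- neighbourhood, as derivatives require.
  set C' : ℝ := 2 * R * κ + 1 with hC'
  have hC'0 : 0 ≤ C' := by positivity
  have hside : ∀ ε : ℝ, 0 < ε → 2 * R * ε ≤ ρ → ∀ x ∈ Metric.ball p ρ, ∀ y, dist y x < 2 * R * ε →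
      |h y - h x| < C' * ε ∧ dist y p < r := by
    intro ε hε hRε x hx y hy
    have hyp : dist y p < 2 * ρ := by
      have := dist_triangle y x p
      linarith [Metric.mem_ball.1 hx]
    refine ⟨?_, by linarith⟩
    have h1 := hκ.dist_le_mul y (hr't (Metric.mem_ball.2 (by linarith))) x
      (hr't (Metric.mem_ball.2 (by linarith [Metric.mem_ball.1 hx])))
    rw [Real.dist_eq] at h1
    have h2 : κ * dist y x ≤ κ * (2 * R * ε) := mul_le_mul_of_nonneg_left hy.le κ.2
    rw [hC']
    nlinarith
  have hpos : ∀ ε : ℝ, 0 < ε → 2 * R * ε ≤ ρ → ∀ x ∈ Metric.ball p ρ, C' * ε ≤ h x →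
      ∀ᵐ y, dist y x < 2 * R * ε → g y = Y y := by
    intro ε hε hRε x hx hhx
    filter_upwards [hgae] with y hy hyx
    obtain ⟨h1, h2⟩ := hside ε hε hRε x hx y hyx
    rw [hy h2, if_pos (by linarith [(abs_lt.1 h1).1])]
  have hneg : ∀ ε : ℝ, 0 < ε → 2 * R * ε ≤ ρ → ∀ x ∈ Metric.ball p ρ, h x ≤ -(C' * ε) →
      ∀ᵐ y, dist y x < 2 * R * ε → g y = Z y := by
    intro ε hε hRε x hx hhx
    filter_upwards [hgae] with y hy hyx
    obtain ⟨h1, h2⟩ := hside ε hε hRε x hx y hyx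
    rw [hy h2, if_neg (by linarith [(abs_lt.1 h1).2])]
  have hsmall : ∀ᶠ ε : ℝ in 𝓝[>] 0, 0 < ε ∧ 2 * R * ε ≤ ρ := by
    filter_upwards [Ioo_mem_nhdsGT (show 0 < ρ / (2 * R) by positivity)] with ε hε
    refine ⟨hε.1, ?_⟩
    have := (lt_div_iff₀ (by positivity)).1 hε.2
    linarith
  have hsmall' : ∀ᶠ q : ℝ × Space n in 𝓝[>] 0 ×ˢ 𝓝 p,
      (0 < q.1 ∧ 2 * R * q.1 ≤ ρ) ∧ q.2 ∈ Metric.ball p ρ :=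
    hsmall.prod_mk (Metric.ball_mem_nhds p hρ0)
  obtain ⟨K₁, hK₁0, hK₁⟩ := hm.exists_norm_fderiv_moll_le hg.locallyIntegrable hg.norm_le
  obtain ⟨K₂, hK₂⟩ := exists_norm_fderiv_le_of_hasCompactSupport hY hYc
  obtain ⟨K₃, hK₃⟩ := exists_norm_fderiv_le_of_hasCompactSupport hZ hZc
  have hK₂0 : 0 ≤ K₂ := (norm_nonneg _).trans (hK₂ 0)
  have hK₃0 : 0 ≤ K₃ := (norm_nonneg _).trans (hK₃ 0)
  have hC0 : 0 ≤ C := (norm_nonneg _).trans (hg.norm_le 0)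
  set a := min (ν (Y p)) (ν (Z p)) / 2 with ha
  have ha0 : 0 < a := half_pos (lt_min hνY hνZ)
  refine ⟨C + K₁ + K₂ + K₃ + 1, C', a, ha0, by positivity, hC'0, hB.apply_eq_zero, hdiff,
    fun ε x => (hg.norm_mollField_le hm ε x).trans (by linarith), ?_, ?_, ?_, ?_, ?_⟩
  · have hcont : ∀ {A : Space n → Space n}, ContDiff ℝ ∞ A → a < ν (A p) →
        ∀ᶠ z : Space n × Space n in 𝓝 (p, p), a < fderiv ℝ h z.1 (A z.2) := by
      intro A hA hAp
      have h1 : ContinuousAt (fderiv ℝ h) p := (hB.contDiffAt.fderiv_right (m := 0)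
        (by simp)).continuousAt
      have h2 : ContinuousAt (fun z : Space n × Space n => fderiv ℝ h z.1 (A z.2)) (p, p) :=
        ContinuousAt.clm_apply (h1.comp_of_eq continuousAt_fst rfl)
          (hA.continuous.continuousAt.comp_of_eq continuousAt_snd rfl)
      refine h2.eventually_const_lt ?_
      simp only
      rwa [hB.hasStrictFDerivAt.hasFDerivAt.fderiv]
    have h3 := (hcont hY (lt_of_lt_of_le (half_lt_self (lt_min hνY hνZ)) (min_le_left _ _))).and
      (hcont hZ (lt_of_lt_of_le (half_lt_self (lt_min hνY hνZ)) (min_le_right _ _)))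
    obtain ⟨δ, hδ, hδb⟩ := Metric.eventually_nhds_iff_ball.1 h3
    have hδ' : ∀ᶠ q : ℝ × Space n in 𝓝[>] 0 ×ˢ 𝓝 p,
        q.1 ∈ Ioo 0 (δ / 2 / R) ∧ q.2 ∈ Metric.ball p (δ / 2) :=
      Eventually.prod_mk (Ioo_mem_nhdsGT (show (0 : ℝ) < δ / 2 / R by positivity))
        (Metric.ball_mem_nhds p (half_pos hδ))
    filter_upwards [hδ', hsmall'] with q hq hq'
    rw [mollField_of_pos hq.1.1]
    refine hm.le_apply_moll hR hq.1.1 hg.locallyIntegrable _ ?_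
    filter_upwards [hgae] with y hy hyq
    have hRq := (lt_div_iff₀ hR0).1 hq.1.2
    have hyr : dist y p < r := (hside q.1 hq'.1.1 hq'.1.2 q.2 hq'.2 y (by nlinarith [hq.1.1])).2
    have hyδ : dist y p < δ := by
      have := dist_triangle y q.2 p
      linarith [Metric.mem_ball.1 hq.2]
    have h4 := hδb (q.2, y) (by
      rw [Metric.mem_ball, Prod.dist_eq]
      exact max_lt (by linarith [Metric.mem_ball.1 hq.2]) hyδ)
    rw [hy hyr]
    split_ifs
    · exact h4.1.le
    · exact h4.2.le
  · filter_upwards [hsmall'] with q hq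
    rw [mollField_of_pos hq.1.1]
    refine (hK₁ _ hq.1.1 _).trans ?_
    have := hq.1.1
    gcongr
    linarith
  · filter_upwards [hsmall'] with q hq hqh
    rw [mollField_of_pos hq.1.1]
    have hRε : R * q.1 < 2 * R * q.1 := by nlinarith [hq.1.1]
    rcases le_abs.1 hqh with hqh | hqh
    · rw [(moll_eventuallyEq hR hq.1.1 hRε (hpos _ hq.1.1 hq.1.2 _ hq.2 hqh)).fderiv_eq]
      exact (hm.norm_fderiv_moll_le hY hYc hK₂ hq.1.1 _).trans (by linarith)
    · rw [(moll_eventuallyEq hR hq.1.1 hRε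
        (hneg _ hq.1.1 hq.1.2 _ hq.2 (by linarith))).fderiv_eq]
      exact (hm.norm_fderiv_moll_le hZ hZc hK₃ hq.1.1 _).trans (by linarith)
  · intro η hη
    classical
    -- The tangential estimate needs the two-sided formula at every point, so `g` is altered on a
    -- null set, which does not affect its mollifications.
    set g' : Space n → Space n := fun y => if dist y p < r then
      (if 0 < h y then Y y else Z y) else g y with hg'
    have hgg' : g =ᵐ[volume] g' := by
      filter_upwards [hgae] with y hy
      simp only [hg']
      split_ifs with h1 h2
      · rw [hy h1, if_pos h2]
      · rw [hy h1, if_neg h2]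
      · rfl
    have hmoll : ∀ ε : ℝ, 0 < ε → moll m ε g = moll m ε g' := fun ε hε => by
      ext1 x
      exact moll_congr hR hε (hgg'.mono fun y hy _ => hy)
    have hν0 : ν ≠ 0 := by rintro rfl; simp at hνY
    filter_upwards [hsmall', hm.eventually_fderiv_moll_tangent_le
      (hg.locallyIntegrable.congr hgg') hB.hasStrictFDerivAt hν0
      hY.continuous.continuousAt hZ.continuous.continuousAt hr
      (fun y hy => if_pos hy) hη] with q hq h1
    rwa [mollField_of_pos hq.1.1, hmoll _ hq.1.1]
  · refine ⟨ρ, hρ0, fun η hη => ?_⟩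
    filter_upwards [hsmall, hm.eventually_norm_moll_sub_le hY.continuous
      (isCompact_closedBall p ρ) hη] with ε hε h1 x hx hhx
    rw [mollField_of_pos hε.1]
    have : moll m ε g x = moll m ε Y x := by
      refine moll_congr hR hε.1 ?_
      filter_upwards [hpos _ hε.1 hε.2 _ hx hhx] with y hy hyx
      exact hy (by nlinarith [hε.1])
    rw [this]
    exact h1 x (Metric.ball_subset_closedBall hx)

end Gate

/-! ### One-sided derivatives and the sides of a gate. -/

section OneSided

theorem HasDerivWithinAt.eventually_lt_right {f : ℝ → ℝ} {f' a : ℝ}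
    (hf : HasDerivWithinAt f f' (Ioi a) a) (h : 0 < f') : ∀ᶠ t in 𝓝[>] a, f a < f t := by
  have h1 := (hasDerivWithinAt_iff_tendsto_slope' self_notMem_Ioi).1 hf
  filter_upwards [h1.eventually_const_lt h, self_mem_nhdsWithin] with t ht hta
  exact (slope_pos_iff_of_le (le_of_lt hta)).1 ht

theorem HasDerivWithinAt.eventually_lt_left {f : ℝ → ℝ} {f' a : ℝ}
    (hf : HasDerivWithinAt f f' (Iio a) a) (h : 0 < f') : ∀ᶠ t in 𝓝[<] a, f t < f a := by
  have h1 := (hasDerivWithinAt_iff_tendsto_slope' self_notMem_Iio).1 hf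
  filter_upwards [h1.eventually_const_lt h, self_mem_nhdsWithin] with t ht hta
  rw [slope_comm] at ht
  exact (slope_pos_iff_of_le (le_of_lt hta)).1 ht

variable {n : ℕ} {S B : Set (Space n)} {p : Space n} {h : Space n → ℝ} {ν : Space n →L[ℝ] ℝ}
  {c : ℝ → Space n} {v : Space n} {a : ℝ}

theorem IsGate.eventually_pos (hB : IsGate S p h ν B) (hc : HasDerivWithinAt c v (Ioi a) a)
    (hca : c a = p) (hv : 0 < ν v) : ∀ᶠ t in 𝓝[>] a, c t ∈ B ∧ 0 < h (c t) := by
  have h1 : HasDerivWithinAt (h ∘ c) (ν v) (Ioi a) a :=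
    HasFDerivAt.comp_hasDerivWithinAt a
      (by rw [hca]; exact hB.hasStrictFDerivAt.hasFDerivAt) hc
  filter_upwards [h1.eventually_lt_right hv,
    hc.continuousWithinAt.eventually_mem (hB.isOpen.mem_nhds (by rw [hca]; exact hB.mem))] with t h2 h3
  refine ⟨h3, ?_⟩
  simpa [hca, hB.apply_eq_zero] using h2

theorem IsGate.eventually_neg (hB : IsGate S p h ν B) (hc : HasDerivWithinAt c v (Iio a) a)
    (hca : c a = p) (hv : 0 < ν v) : ∀ᶠ t in 𝓝[<] a, c t ∈ B ∧ h (c t) < 0 := by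
  have h1 : HasDerivWithinAt (h ∘ c) (ν v) (Iio a) a :=
    HasFDerivAt.comp_hasDerivWithinAt a
      (by rw [hca]; exact hB.hasStrictFDerivAt.hasFDerivAt) hc
  filter_upwards [h1.eventually_lt_left hv,
    hc.continuousWithinAt.eventually_mem (hB.isOpen.mem_nhds (by rw [hca]; exact hB.mem))] with t h2 h3
  refine ⟨h3, ?_⟩
  simpa [hca, hB.apply_eq_zero] using h2

theorem IsGate.subset_compl (hB : IsGate S p h ν B) {x : Space n} (hx : x ∈ B) (hhx : h x ≠ 0) :
    x ∉ S := fun hxS => hhx ((hB.mem_iff x hx).1 hxS)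

end OneSided

/-! ### Gates and model flows along a sewing orbit. -/

namespace SewingDecomposition

variable {n : ℕ} {M S V γ : Set (Space n)} {X : Space n → Space n}

/-- Gates at the crossing points of a sewing-type periodic orbit: the orbit passes the point `p i`
from the side `h i < 0` to the side `h i > 0`. -/
structure IsGates (D : SewingDecomposition M S X γ) (h : Fin (D.k + 1) → Space n → ℝ)
    (ν : Fin (D.k + 1) → Space n →L[ℝ] ℝ) (B : Fin (D.k + 1) → Set (Space n)) : Prop where
  gate : ∀ i, IsGate S (D.p i) (h i) (ν i) (B i)
  start_pos : ∀ i, 0 < ν i (D.Y i (D.p i))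
  start_subset : ∀ i, B i ∩ {x | 0 < h i x} ⊆ D.W i
  finish_pos : ∀ i, 0 < ν (i + 1) (D.Y i (D.p (i + 1)))
  finish_subset : ∀ i, B (i + 1) ∩ {x | h (i + 1) x < 0} ⊆ D.W i

variable (D : SewingDecomposition M S X γ)

theorem period_pos (i : Fin (D.k + 1)) : 0 < D.T i := (D.isIntegralArc i).1

theorem hasDerivWithinAt_start (i : Fin (D.k + 1)) :
    HasDerivWithinAt (D.c i) (D.Y i (D.p i)) (Ioi 0) 0 := by
  have := (D.isIntegralArc i).hasDerivWithinAt_Ici ⟨le_rfl, D.period_pos i⟩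
  rw [D.start] at this
  exact this.Ioi_of_Ici

theorem hasDerivWithinAt_finish (i : Fin (D.k + 1)) :
    HasDerivWithinAt (D.c i) (D.Y i (D.p (i + 1))) (Iio (D.T i)) (D.T i) := by
  have := (D.isIntegralArc i).2 (D.T i) ⟨(D.period_pos i).le, le_rfl⟩
  rw [D.finish] at this
  refine this.mono_of_mem_nhdsWithin ?_
  filter_upwards [Ioo_mem_nhdsLT (D.period_pos i)] with t ht using ⟨ht.1.le, ht.2.le⟩

theorem eventually_mem_start (i : Fin (D.k + 1)) : ∀ᶠ t in 𝓝[>] 0, D.c i t ∈ D.W i := by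
  filter_upwards [Ioo_mem_nhdsGT (D.period_pos i)] with t ht using D.mem_component i t ht

theorem eventually_mem_finish (i : Fin (D.k + 1)) : ∀ᶠ t in 𝓝[<] (D.T i), D.c i t ∈ D.W i := by
  filter_upwards [Ioo_mem_nhdsLT (D.period_pos i)] with t ht using D.mem_component i t ht

/-- The sign of each defining function is chosen so that the outgoing field increases it. The point
is that the incoming field then increases it too, so `γ` really passes from one side to the other.
-/
theorem exists_isGates (hM : IsOpen M) : ∃ h ν B, D.IsGates h ν B := by
  have h1 : ∀ i, ∃ h ν B, IsGate S (D.p i) h ν B ∧ B ⊆ M ∧ 0 < ν (D.Y i (D.p i)) := fun i => by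
    obtain ⟨φ, j, hφ⟩ := (D.regular i).exists_chart
    obtain ⟨B, hBM, hB⟩ := hφ.exists_isGate (hM.mem_nhds (D.mem_locus i).1)
    have h0 : hφ.normal (D.Y i (D.p i)) ≠ 0 := by
      have := D.transverse_start i
      rwa [hB.tangentSubspace_eq] at this
    rcases h0.lt_or_gt with h0 | h0
    · exact ⟨_, _, B, hB.neg, hBM, by simpa using h0⟩
    · exact ⟨_, _, B, hB, hBM, h0⟩
  choose h ν B hB hBM hpos using h1
  have hcompl : ∀ i, ∀ Q : Set ℝ, 0 ∉ Q → B i ∩ {x | h i x ∈ Q} ⊆ M \ S := fun i Q hQ x hx =>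
    ⟨hBM i hx.1, (hB i).subset_compl hx.1 fun h0 => hQ (h0 ▸ hx.2)⟩
  have hstart : ∀ i, B i ∩ {x | 0 < h i x} ⊆ D.W i := fun i => by
    refine (D.isComponent i).subset_of_isPreconnected (hB i).isPreconnected_pos
      (hcompl i (Ioi 0) (by simp)) ?_
    obtain ⟨t, h2, h3⟩ := (((hB i).eventually_pos (D.hasDerivWithinAt_start i) (D.start i)
      (hpos i)).and (D.eventually_mem_start i)).exists
    exact ⟨_, h2, h3⟩
  have hfin : ∀ i, 0 < ν (i + 1) (D.Y i (D.p (i + 1))) := fun i => by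
    have h0 : ν (i + 1) (D.Y i (D.p (i + 1))) ≠ 0 := by
      have := D.transverse_finish i
      rwa [(hB (i + 1)).tangentSubspace_eq] at this
    -- Otherwise the incoming arc would arrive through the positive side, which would then lie in
    -- both components `W i` and `W (i + 1)`. The two extensions would agree there and, by
    -- continuity, at the crossing point, where `ν` gives them opposite signs.
    by_contra! hneg
    have hneg := lt_of_le_of_ne hneg h0
    obtain ⟨t, h2, h3⟩ := (((hB (i + 1)).neg.eventually_neg (D.hasDerivWithinAt_finish i)
      (D.finish i) (by simpa using hneg)).and (D.eventually_mem_finish i)).exists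
    have h4 : B (i + 1) ∩ {x | 0 < h (i + 1) x} ⊆ D.W i :=
      (D.isComponent i).subset_of_isPreconnected (hB (i + 1)).isPreconnected_pos
        (hcompl (i + 1) (Ioi 0) (by simp)) ⟨_, ⟨h2.1, by simpa using h2.2⟩, h3⟩
    have h5 : ∀ᶠ t in 𝓝[>] 0, D.Y i (D.c (i + 1) t) = D.Y (i + 1) (D.c (i + 1) t) := by
      filter_upwards [(hB (i + 1)).eventually_pos (D.hasDerivWithinAt_start (i + 1))
        (D.start (i + 1)) (hpos (i + 1)), D.eventually_mem_start (i + 1)] with t ht ht'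
      rw [D.eqOn i (h4 ht), D.eqOn (i + 1) ht']
    have h6 : Tendsto (D.c (i + 1)) (𝓝[>] 0) (𝓝 (D.p (i + 1))) := by
      have := (D.hasDerivWithinAt_start (i + 1)).continuousWithinAt.tendsto
      rwa [D.start] at this
    have hcont : ∀ j, ContinuousAt (D.Y j) (D.p (i + 1)) := fun j =>
      (D.smooth j).continuousOn.continuousAt (hM.mem_nhds (D.mem_locus _).1)
    have h7 := tendsto_nhds_unique (((hcont i).tendsto.comp h6).congr' h5)
      ((hcont (i + 1)).tendsto.comp h6)
    rw [h7] at hneg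
    exact (hpos (i + 1)).not_gt hneg
  refine ⟨h, ν, B, hB, hpos, hstart, hfin, fun i => ?_⟩
  refine (D.isComponent i).subset_of_isPreconnected (hB (i + 1)).isPreconnected_neg
    (hcompl (i + 1) (Iio 0) (by simp)) ?_
  obtain ⟨t, h2, h3⟩ := (((hB (i + 1)).eventually_neg (D.hasDerivWithinAt_finish i)
    (D.finish i) (hfin i)).and (D.eventually_mem_finish i)).exists
  exact ⟨_, h2, h3⟩

theorem mem_or_eq {q : Space n} (hq : q ∈ γ) : q ∈ M \ S ∨ ∃ i, q = D.p (i + 1) := by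
  rw [D.eq_union] at hq
  obtain ⟨i, t, ht, rfl⟩ := mem_iUnion.1 hq
  rcases ht.1.eq_or_lt with rfl | h0
  · exact Or.inr ⟨i - 1, by rw [D.start, sub_add_cancel]⟩
  rcases ht.2.eq_or_lt with rfl | h1
  · exact Or.inr ⟨i, D.finish i⟩
  · exact Or.inl ((D.isComponent i).subset (D.mem_component i t ⟨h0, h1⟩))

include D in
theorem isCompact : IsCompact γ := by
  rw [D.eq_union]
  exact isCompact_iUnion fun i => isCompact_Icc.image_of_continuousOn (D.isIntegralArc i).continuousOn

include D in
theorem subset_domain : γ ⊆ M := fun q hq => by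
  rcases D.mem_or_eq hq with h | ⟨i, rfl⟩
  · exact h.1
  · exact (D.mem_locus _).1

variable {D} {h : Fin (D.k + 1) → Space n → ℝ} {ν : Fin (D.k + 1) → Space n →L[ℝ] ℝ}
  {B : Fin (D.k + 1) → Set (Space n)}

theorem IsGates.apply_eq_of_pos (hD : D.IsGates h ν B) {i : Fin (D.k + 1)} {x : Space n}
    (hx : x ∈ B i) (hhx : 0 < h i x) : X x = D.Y i x :=
  (D.eqOn i (hD.start_subset i ⟨hx, hhx⟩)).symm

theorem IsGates.apply_eq_of_neg (hD : D.IsGates h ν B) {i : Fin (D.k + 1)} {x : Space n}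
    (hx : x ∈ B (i + 1)) (hhx : h (i + 1) x < 0) : X x = D.Y i x :=
  (D.eqOn i (hD.finish_subset i ⟨hx, hhx⟩)).symm

theorem IsGates.exists_norm_le_nhds (hD : D.IsGates h ν B) (hM : IsOpen M) (i : Fin (D.k + 1)) :
    ∃ O ∈ 𝓝 (D.p (i + 1)), ∃ C, ∀ y ∈ O \ S, ‖X y‖ ≤ C := by
  have h1 : ∀ j, ∀ᶠ x in 𝓝 (D.p (i + 1)), ‖D.Y j x‖ < ‖D.Y j (D.p (i + 1))‖ + 1 := fun j =>
    ((D.smooth j).continuousOn.continuousAt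
      (hM.mem_nhds (D.mem_locus _).1)).norm.eventually_lt_const (lt_add_one _)
  refine ⟨_, Eventually.and ((hD.gate (i + 1)).isOpen.mem_nhds (hD.gate (i + 1)).mem)
    ((h1 i).and (h1 (i + 1))), max (‖D.Y i (D.p (i + 1))‖ + 1)
      (‖D.Y (i + 1) (D.p (i + 1))‖ + 1), ?_⟩
  rintro y ⟨⟨hyB, hy1, hy2⟩, hyS⟩
  have h0 : h (i + 1) y ≠ 0 := fun h0 => hyS (((hD.gate (i + 1)).mem_iff y hyB).2 h0)
  rcases h0.lt_or_gt with h0 | h0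
  · rw [hD.apply_eq_of_neg hyB h0]
    exact hy1.le.trans (le_max_left _ _)
  · rw [hD.apply_eq_of_pos hyB h0]
    exact hy2.le.trans (le_max_right _ _)

theorem IsGates.exists_isTruncation (hD : D.IsGates h ν B) (hM : IsOpen M)
    (hMS : IsOpen (M \ S)) (hX : IsPiecewiseSmooth M S X) :
    ∃ V g C, IsTruncation M S X γ V g C :=
  _root_.exists_isTruncation hM hMS hX D.isCompact D.subset_domain fun q hq => by
    rcases D.mem_or_eq hq with h | ⟨i, rfl⟩
    · exact hX.exists_norm_le_nhds hM hMS h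
    · exact hD.exists_norm_le_nhds hM i

/-- Global flows which extend the flows along the segments of a sewing-type periodic orbit. -/
structure IsModel (D : SewingDecomposition M S X γ) (V : Set (Space n))
    (h : Fin (D.k + 1) → Space n → ℝ) (ν : Fin (D.k + 1) → Space n →L[ℝ] ℝ)
    (B : Fin (D.k + 1) → Set (Space n)) (Z : Fin (D.k + 1) → Space n → Space n)
    (φ : Fin (D.k + 1) → ℝ → Space n → Space n)
    (w : Fin (D.k + 1) → ℝ → Space n → Space n →L[ℝ] Space n) : Prop where
  isGates : D.IsGates h ν B
  isOpen_domain : IsOpen V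
  subset : γ ⊆ V
  isOpen_component : ∀ i, IsOpen (D.W i)
  hasCompactSupport : ∀ i, HasCompactSupport (Z i)
  eqOn : ∀ i, EqOn (Z i) (D.Y i) V
  isFlow : ∀ i, IsFlow (Z i) (φ i) (w i)

theorem IsGates.exists_isModel (hD : D.IsGates h ν B) (hM : IsOpen M) (hMS : IsOpen (M \ S))
    {g : Space n → Space n} {C : ℝ} (hg : IsTruncation M S X γ V g C) :
    ∃ Z φ w, D.IsModel V h ν B Z φ w := by
  choose Z hZ hZc hZY using fun i => hg.exists_extension hM (D.smooth i)
  choose φ w hφ using fun i => exists_isFlow (hZ i) (hZc i)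
  exact ⟨Z, φ, w, hD, hg.isOpen, hg.subset, fun i => (D.isComponent i).isOpen hMS, hZc, hZY, hφ⟩

namespace IsModel

variable {Z : Fin (D.k + 1) → Space n → Space n}
  {φ : Fin (D.k + 1) → ℝ → Space n → Space n}
  {w : Fin (D.k + 1) → ℝ → Space n → Space n →L[ℝ] Space n}
  (hD : D.IsModel V h ν B Z φ w) (i : Fin (D.k + 1))
include hD

theorem arc_mem {t : ℝ} (ht : t ∈ Icc 0 (D.T i)) : D.c i t ∈ V := by
  refine hD.subset (D.eq_union.ge ?_)
  exact mem_iUnion.2 ⟨i, t, ht, rfl⟩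

theorem arc_eq {t : ℝ} (ht : t ∈ Icc 0 (D.T i)) : D.c i t = φ i t (D.p i) := by
  have := (hD.isFlow i).eq_of_hasDerivWithinAt (D.isIntegralArc i).continuousOn (fun t ht => by
    rw [hD.eqOn i (hD.arc_mem i ⟨ht.1, ht.2.le⟩)]
    exact (D.isIntegralArc i).hasDerivWithinAt_Ici ht) t ht
  rwa [sub_zero, D.start] at this

theorem flow_mem_domain {t : ℝ} (ht : t ∈ Icc 0 (D.T i)) : φ i t (D.p i) ∈ V := by
  rw [← hD.arc_eq i ht]; exact hD.arc_mem i ht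

theorem flow_mem {t : ℝ} (ht : t ∈ Ioo 0 (D.T i)) : φ i t (D.p i) ∈ D.W i := by
  rw [← hD.arc_eq i ⟨ht.1.le, ht.2.le⟩]; exact D.mem_component i t ht

theorem flow_finish : φ i (D.T i) (D.p i) = D.p (i + 1) := by
  rw [← hD.arc_eq i ⟨(D.period_pos i).le, le_rfl⟩]; exact D.finish i

theorem start_mem : D.p i ∈ V := by
  have := hD.flow_mem_domain i ⟨le_rfl, (D.period_pos i).le⟩
  rwa [(hD.isFlow i).zero] at this

theorem start_pos : 0 < ν i (Z i (D.p i)) := by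
  rw [hD.eqOn i (hD.start_mem i)]; exact hD.isGates.start_pos i

theorem finish_pos : 0 < ν (i + 1) (Z i (D.p (i + 1))) := by
  rw [hD.eqOn i (hD.start_mem (i + 1))]; exact hD.isGates.finish_pos i

end IsModel

end SewingDecomposition

theorem IsFlow.eventually_forall_mem_Icc {n : ℕ} {X : Space n → Space n}
    {Φ : ℝ → Space n → Space n} {W : ℝ → Space n → Space n →L[ℝ] Space n} (hF : IsFlow X Φ W)
    {O : Set (Space n)} (hO : IsOpen O) {a b : ℝ} (ha : 0 ≤ a) {p : Space n}
    (h : ∀ t ∈ Icc a b, Φ t p ∈ O) : ∀ᶠ x in 𝓝 p, ∀ t ∈ Icc a b, Φ t x ∈ O := by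
  refine isCompact_Icc.eventually_forall_of_forall_eventually fun t ht => ?_
  have h1 := (hF.hasStrictFDerivAt (ha.trans ht.1) p).hasFDerivAt.continuousAt
  have h2 : Tendsto (fun z : Space n × ℝ => (z.2, z.1)) (𝓝 (p, t)) (𝓝 (t, p)) :=
    continuous_swap.tendsto _
  exact (h1.tendsto.comp h2) (hO.mem_nhds (h t ht))

theorem IsFlow.continuousAt_flow {n : ℕ} {X : Space n → Space n} {Φ : ℝ → Space n → Space n}
    {W : ℝ → Space n → Space n →L[ℝ] Space n} (hF : IsFlow X Φ W) {t : ℝ} (ht : 0 ≤ t)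
    (x : Space n) : ContinuousAt (fun z : ℝ × Space n => Φ z.1 z.2) (t, x) :=
  (hF.hasStrictFDerivAt ht x).hasFDerivAt.continuousAt

/-- The cyclic enumeration of `Fin (k + 1)`. -/
def cyclicIndex (k : ℕ) : ℕ → Fin (k + 1)
  | 0 => 0
  | j + 1 => cyclicIndex k j + 1

theorem val_cyclicIndex {k : ℕ} : ∀ {j : ℕ}, j < k + 1 → (cyclicIndex k j : ℕ) = j
  | 0, _ => rfl
  | j + 1, hj => by
    have h := val_cyclicIndex (k := k) (j := j) (by omega)
    rw [cyclicIndex, Fin.val_add_one_of_lt' (by omega), h]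

theorem cyclicIndex_eq {k : ℕ} {j : ℕ} (hj : j < k + 1) : cyclicIndex k j = ⟨j, hj⟩ :=
  Fin.ext (val_cyclicIndex hj)

theorem cyclicIndex_succ_self (k : ℕ) : cyclicIndex k (k + 1) = 0 := by
  rw [cyclicIndex, cyclicIndex_eq (Nat.lt_succ_self k)]
  exact Fin.last_add_one k

theorem foldl_ofFn_comp {α : Type*} (P : ℕ → α → α) (hP : P 0 = id) :
    ∀ (m : ℕ) (f : Fin m → α → α), (∀ j : Fin m, P (j + 1) = f j ∘ P j) →
      (List.ofFn f).foldl (fun g f => f ∘ g) id = P m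
  | 0, f, _ => by simp [hP]
  | m + 1, f, hf => by
    rw [List.ofFn_succ', List.concat_eq_append, List.foldl_append,
      foldl_ofFn_comp P hP m (fun i => f i.castSucc) fun j => hf j.castSucc]
    exact (hf (Fin.last m)).symm

/-! ### Transition maps and their differentials; the monodromy of the sewing orbit. -/

namespace SewingDecomposition

variable {n : ℕ} {M S V γ : Set (Space n)} {X : Space n → Space n}
  {D : SewingDecomposition M S X γ} {h : Fin (D.k + 1) → Space n → ℝ}
  {ν : Fin (D.k + 1) → Space n →L[ℝ] ℝ} {B : Fin (D.k + 1) → Set (Space n)}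
  {Z : Fin (D.k + 1) → Space n → Space n} {φ : Fin (D.k + 1) → ℝ → Space n → Space n}
  {w : Fin (D.k + 1) → ℝ → Space n → Space n →L[ℝ] Space n}

namespace IsModel

variable (hD : D.IsModel V h ν B Z φ w) (i : Fin (D.k + 1))
include hD

/-- Just after departure the defining function increases strictly along orbits. This excludes
arbitrarily short transition times. -/
theorem exists_eventually_notMem :
    ∃ δ > 0, ∀ᶠ x in 𝓝[S] (D.p i), ∀ t ∈ Ioc 0 δ, φ i t x ∉ S := by
  have hB := hD.isGates.gate i
  have hF := hD.isFlow i
  have h1 : ∀ᶠ y in 𝓝 (D.p i), y ∈ B i ∧ DifferentiableAt ℝ (h i) y ∧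
      0 < fderiv ℝ (h i) y (Z i y) := by
    refine Eventually.and (hB.isOpen.mem_nhds hB.mem) (Eventually.and ?_ ?_)
    · filter_upwards [(hB.contDiffAt.of_le (show (1 : WithTop ℕ∞) ≤ ∞ by simp)).eventually (by simp)]
        with x hx using hx.differentiableAt (by simp)
    · have h2 : ContinuousAt (fderiv ℝ (h i)) (D.p i) :=
        (hB.contDiffAt.fderiv_right (m := 0) (by simp)).continuousAt
      refine (h2.clm_apply hF.smooth.continuous.continuousAt).eventually_const_lt ?_
      simp only
      rw [hB.hasStrictFDerivAt.hasFDerivAt.fderiv]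
      exact hD.start_pos i
  obtain ⟨O, hON, hO, hpO⟩ := mem_nhds_iff.1 h1
  have h3 : ∀ᶠ t in 𝓝 (0 : ℝ), φ i t (D.p i) ∈ O :=
    (hF.hasDerivAt 0 (D.p i)).continuousAt.eventually_mem (hO.mem_nhds (by rwa [hF.zero]))
  obtain ⟨δ, hδ, hδO⟩ := Metric.eventually_nhds_iff.1 h3
  refine ⟨δ / 2, half_pos hδ, ?_⟩
  have h4 := hF.eventually_forall_mem_Icc hO (a := 0) (b := δ / 2) le_rfl (p := D.p i)
    fun t ht => hδO (by rw [Real.dist_eq, sub_zero, abs_of_nonneg ht.1]; linarith [ht.2])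
  filter_upwards [mem_nhdsWithin_of_mem_nhds h4, self_mem_nhdsWithin] with x hx hxS t ht htS
  have hderiv : ∀ t ∈ Icc 0 (δ / 2), HasDerivAt (fun t => h i (φ i t x))
      (fderiv ℝ (h i) (φ i t x) (Z i (φ i t x))) t := fun t ht =>
    HasFDerivAt.comp_hasDerivAt t (hON (hx t ht)).2.1.hasFDerivAt (hF.hasDerivAt t x)
  have hmono : StrictMonoOn (fun t => h i (φ i t x)) (Icc 0 (δ / 2)) := by
    refine strictMonoOn_of_deriv_pos (convex_Icc _ _)
      (fun t ht => (hderiv t ht).continuousAt.continuousWithinAt) fun t ht => ?_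
    have ht' := interior_subset ht
    rw [(hderiv t ht').deriv]
    exact (hON (hx t ht')).2.2
  have h0 : (0 : ℝ) ∈ Icc 0 (δ / 2) := ⟨le_rfl, (half_pos hδ).le⟩
  have h5 := hmono h0 ⟨ht.1.le, ht.2⟩ ht.1
  have hx0 := hx 0 h0
  simp only at h5
  rw [hF.zero] at hx0 h5
  rw [(hB.mem_iff x (hON hx0).1).1 hxS,
    (hB.mem_iff _ (hON (hx t ⟨ht.1.le, ht.2⟩)).1).1 htS] at h5
  exact lt_irrefl _ h5

/-- `IsTransitionMap` leaves the travel time free. Times up to some `δ` are excluded by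
`exists_eventually_notMem`; between `δ` and `T - η'` the orbit is inside `W i`; and it changes side,
hence meets `S`, before `T + η'`. -/
theorem eventually_transition_time {η : ℝ} (hη : 0 < η) :
    ∀ᶠ x in 𝓝[S] (D.p i), ∀ (τ : ℝ) (c : ℝ → Space n), IsIntegralArc (D.Y i) c τ →
      (∀ t ∈ Ioo 0 τ, c t ∈ D.W i) → c 0 = x → c τ ∈ S →
      |τ - D.T i| < η ∧ c τ = φ i τ x := by
  have hB := hD.isGates.gate (i + 1)
  have hF := hD.isFlow i
  set T := D.T i with hT
  have hT0 : 0 < T := D.period_pos i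
  have hder : HasDerivAt (fun t => φ i t (D.p i)) (Z i (D.p (i + 1))) T := by
    have := hF.hasDerivAt T (D.p i)
    rwa [hD.flow_finish i] at this
  have hfin := hD.finish_pos i
  have e1 := hder.continuousAt.eventually_mem
    ((hB.isOpen.inter hD.isOpen_domain).mem_nhds
      (show φ i T (D.p i) ∈ B (i + 1) ∩ V by
        rw [hD.flow_finish i]; exact ⟨hB.mem, hD.start_mem (i + 1)⟩))
  have e2 := eventually_nhdsWithin_iff.1
    (hB.eventually_pos hder.hasDerivWithinAt (hD.flow_finish i) hfin)
  have e3 := eventually_nhdsWithin_iff.1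
    (hB.eventually_neg hder.hasDerivWithinAt (hD.flow_finish i) hfin)
  obtain ⟨r, hr, hrb⟩ := Metric.eventually_nhds_iff.1 (e1.and (e2.and e3))
  set η' := min (min η r) T / 2 with hη'
  have hm0 : 0 < min (min η r) T := lt_min (lt_min hη hr) hT0
  have hη0 : 0 < η' := half_pos hm0
  have hηη : η' < η := (half_lt_self hm0).trans_le ((min_le_left _ _).trans (min_le_left _ _))
  have hηr : η' < r := (half_lt_self hm0).trans_le ((min_le_left _ _).trans (min_le_right _ _))
  have hηT : η' < T := (half_lt_self hm0).trans_le (min_le_right _ _)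
  have hnear : ∀ t ∈ Icc (T - η') (T + η'), dist t T < r := fun t ht => by
    rw [Real.dist_eq]
    exact lt_of_le_of_lt (abs_le.2 ⟨by linarith [ht.1], by linarith [ht.2]⟩) hηr
  have hlow : T - η' ∈ Icc (T - η') (T + η') := ⟨le_rfl, by linarith⟩
  have hhigh : T + η' ∈ Icc (T - η') (T + η') := ⟨by linarith, le_rfl⟩
  have A1 := hF.eventually_forall_mem_Icc hD.isOpen_domain (a := 0) (b := T + η') le_rfl
    (p := D.p i) fun t ht => by
      rcases le_total t T with htT | htT
      · exact hD.flow_mem_domain i ⟨ht.1, htT⟩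
      · exact (hrb (hnear t ⟨by linarith, ht.2⟩)).1.2
  have A2 := hF.eventually_forall_mem_Icc hB.isOpen (a := T - η') (b := T + η')
    (by linarith) (p := D.p i) fun t ht => (hrb (hnear t ht)).1.1
  have hopen : ∀ Q : Set ℝ, IsOpen Q → IsOpen (B (i + 1) ∩ h (i + 1) ⁻¹' Q) := fun Q hQ =>
    hB.continuousOn.isOpen_inter_preimage hB.isOpen hQ
  have A3 := hF.eventually_forall_mem_Icc (hopen (Ioi 0) isOpen_Ioi) (a := T + η') (b := T + η')
    (by linarith) (p := D.p i) fun t ht => by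
      obtain rfl : t = T + η' := le_antisymm ht.2 ht.1
      exact (hrb (hnear _ hhigh)).2.1 (show T < T + η' by linarith)
  have A4 := hF.eventually_forall_mem_Icc (hopen (Iio 0) isOpen_Iio) (a := T - η') (b := T - η')
    (by linarith) (p := D.p i) fun t ht => by
      obtain rfl : t = T - η' := le_antisymm ht.2 ht.1
      exact (hrb (hnear _ hlow)).2.2 (show T - η' < T by linarith)
  obtain ⟨δ, hδ, A5⟩ := hD.exists_eventually_notMem i
  have A6 := hF.eventually_forall_mem_Icc (hD.isOpen_component i) (a := δ) (b := T - η')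
    hδ.le (p := D.p i) fun t ht => hD.flow_mem i ⟨by linarith [ht.1], by linarith [ht.2]⟩
  have hWS : ∀ y ∈ D.W i, y ∉ S := fun y hy => ((D.isComponent i).subset hy).2
  have hYZ : EqOn (D.Y i) (Z i) V := (hD.eqOn i).symm
  filter_upwards [mem_nhdsWithin_of_mem_nhds A1, mem_nhdsWithin_of_mem_nhds A2,
    mem_nhdsWithin_of_mem_nhds A3, mem_nhdsWithin_of_mem_nhds A4, A5,
    mem_nhdsWithin_of_mem_nhds A6] with x A1 A2 A3 A4 A5 A6 τ c hc hcW hcx hcS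
  have hup : τ < T + η' := by
    by_contra! hle
    have hcφ := hc.eq_flow hF hD.isOpen_domain hYZ hle (fun t ht => by rw [hcx]; exact A1 t ht)
    rw [hcx] at hcφ
    have hcont : ContinuousOn (fun t => h (i + 1) (φ i t x)) (Icc (T - η') (T + η')) :=
      hB.continuousOn.comp (fun t _ => (hF.hasDerivAt t x).continuousAt.continuousWithinAt) A2
    obtain ⟨t, ht, ht0⟩ := intermediate_value_Icc (show T - η' ≤ T + η' by linarith) hcont
      ⟨(A4 _ ⟨le_rfl, le_rfl⟩).2.le, (A3 _ ⟨le_rfl, le_rfl⟩).2.le⟩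
    have htlt : t < T + η' := by
      refine lt_of_le_of_ne ht.2 ?_
      rintro rfl
      exact (A3 _ ⟨le_rfl, le_rfl⟩).2.ne' ht0
    refine hWS (c t) (hcW t ⟨by linarith [ht.1], by linarith⟩) ?_
    rw [hcφ t ⟨by linarith [ht.1], ht.2⟩]
    exact (hB.mem_iff _ (A2 t ht)).2 ht0
  have hcφ := hc.eq_flow hF hD.isOpen_domain hYZ le_rfl (fun t ht => by
    rw [hcx]; exact A1 t ⟨ht.1, ht.2.trans hup.le⟩) τ ⟨hc.1.le, le_rfl⟩
  rw [hcx] at hcφ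
  refine ⟨(abs_lt.2 ⟨?_, by linarith⟩), hcφ⟩
  by_contra! hle
  rw [hcφ] at hcS
  rcases le_total τ δ with hτδ | hτδ
  · exact A5 τ ⟨hc.1, hτδ⟩ hcS
  · exact hWS _ (A6 τ ⟨hτδ, by linarith⟩) hcS

theorem exists_transition_time {Q : Space n → Space n} (hQ : D.IsTransitionMap i Q) :
    ∃ τ : Space n → ℝ, τ (D.p i) = D.T i ∧ ContinuousWithinAt τ S (D.p i) ∧
      ∀ᶠ x in 𝓝[S] (D.p i), Q x ∈ S ∧ Q x = φ i (τ x) x := by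
  classical
  set P : Space n → ℝ → Prop := fun x τ => ∃ c : ℝ → Space n, IsIntegralArc (D.Y i) c τ ∧
    (∀ t ∈ Ioo 0 τ, c t ∈ D.W i) ∧ c 0 = x ∧ c τ = Q x with hP
  -- The value at the base point is prescribed exactly; elsewhere any admissible time will do, since
  -- all of them are close to `D.T i`. The final `0` is a default.
  set τ : Space n → ℝ := fun x => if x = D.p i then D.T i else
    if hx : ∃ τ, P x τ then hx.choose else 0 with hτ
  have hτp : τ (D.p i) = D.T i := if_pos rfl
  have hspec : ∀ x, x ≠ D.p i → (∃ τ, P x τ) → P x (τ x) := fun x hx hex => by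
    simp only [hτ]
    rw [if_neg hx, dif_pos hex]
    exact hex.choose_spec
  refine ⟨τ, hτp, ?_, ?_⟩
  · refine Metric.tendsto_nhds.2 fun η hη => ?_
    filter_upwards [hQ.2, hD.eventually_transition_time i hη] with x ⟨hxS, hx⟩ h2
    rw [hτp, Real.dist_eq]
    by_cases hxp : x = D.p i
    · rw [hxp, hτp, sub_self, abs_zero]; exact hη
    · obtain ⟨c, h3, h4, h5, h6⟩ := hspec x hxp hx
      exact (h2 _ c h3 h4 h5 (h6 ▸ hxS)).1
  · filter_upwards [hQ.2, hD.eventually_transition_time i one_pos] with x ⟨hxS, hx⟩ h2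
    refine ⟨hxS, ?_⟩
    by_cases hxp : x = D.p i
    · rw [hxp, hτp, hD.flow_finish i, hQ.1]
    · obtain ⟨c, h3, h4, h5, h6⟩ := hspec x hxp hx
      rw [← h6]
      exact (h2 _ c h3 h4 h5 (h6 ▸ hxS)).2

theorem tendsto_transition {Q : Space n → Space n} (hQ : D.IsTransitionMap i Q) :
    Tendsto Q (𝓝[S] (D.p i)) (𝓝[S] (D.p (i + 1))) := by
  obtain ⟨τ, hτp, hτc, hτ⟩ := hD.exists_transition_time i hQ
  refine tendsto_nhdsWithin_iff.2 ⟨?_, hτ.mono fun x hx => hx.1⟩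
  have h2 : Tendsto (fun x => (τ x, x)) (𝓝[S] (D.p i)) (𝓝 (D.T i, D.p i)) := by
    rw [← hτp]
    exact hτc.tendsto.prodMk_nhds (tendsto_id.mono_left nhdsWithin_le_nhds)
  have h3 := ((hD.isFlow i).continuousAt_flow (D.period_pos i).le (D.p i)).tendsto.comp h2
  simp only [hD.flow_finish i] at h3
  exact h3.congr' (hτ.mono fun x hx => hx.2.symm)

/-- The differential of the transition map is induced by the linearized flow. -/
theorem hasFDerivWithinAt_transition {Q : Space n → Space n} (hQ : D.IsTransitionMap i Q) :
    HasFDerivWithinAt Q (w i (D.T i) (D.p i) - (ν (i + 1) (Z i (D.p (i + 1))))⁻¹ •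
      (ν (i + 1) ∘L w i (D.T i) (D.p i)).smulRight (Z i (D.p (i + 1)))) S (D.p i) := by
  obtain ⟨τ, hτp, hτc, hτ⟩ := hD.exists_transition_time i hQ
  have hB := hD.isGates.gate (i + 1)
  have hD' := (hD.isFlow i).hasFDerivWithinAt_of_hit (D.period_pos i).le hτc hτp
    (h := h (i + 1)) (ν := ν (i + 1))
    (by rw [hD.flow_finish i]; exact hB.hasStrictFDerivAt.hasFDerivAt)
    (by rw [hD.flow_finish i, hB.apply_eq_zero]) (by
      filter_upwards [hτ, (hD.tendsto_transition i hQ).eventually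
        (mem_nhdsWithin_of_mem_nhds (hB.isOpen.mem_nhds hB.mem))] with x h1 h2
      rw [← hB.mem_iff _ (h1.2 ▸ h2), ← h1.2]
      exact h1.1) (by rw [hD.flow_finish i]; exact (hD.finish_pos i).ne')
  rw [hD.flow_finish i] at hD'
  refine hD'.congr_of_eventuallyEq (hτ.mono fun x hx => hx.2) ?_
  rw [hτp, hD.flow_finish i, hQ.1]

end IsModel

/-- The linearization of the limit flow along the first `j` segments. -/
noncomputable def monodromy (D : SewingDecomposition M S X γ)
    (ν : Fin (D.k + 1) → Space n →L[ℝ] ℝ) (Z : Fin (D.k + 1) → Space n → Space n)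
    (w : Fin (D.k + 1) → ℝ → Space n → Space n →L[ℝ] Space n) : ℕ → Space n →L[ℝ] Space n
  | 0 => 1
  | j + 1 => (saltation (ν (cyclicIndex D.k j + 1))
      (Z (cyclicIndex D.k j) (D.p (cyclicIndex D.k j + 1)))
      (Z (cyclicIndex D.k j + 1) (D.p (cyclicIndex D.k j + 1))) ∘L
        w (cyclicIndex D.k j) (D.T (cyclicIndex D.k j)) (D.p (cyclicIndex D.k j))) ∘L
      D.monodromy ν Z w j

namespace IsModel

variable (hD : D.IsModel V h ν B Z φ w)
include hD

theorem saltation_linear_field (i : Fin (D.k + 1)) :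
    saltation (ν (i + 1)) (Z i (D.p (i + 1))) (Z (i + 1) (D.p (i + 1)))
      (w i (D.T i) (D.p i) (Z i (D.p i))) = Z (i + 1) (D.p (i + 1)) := by
  rw [(hD.isFlow i).linear_field, hD.flow_finish i]
  exact saltation_apply_self _ (hD.finish_pos i).ne'

theorem monodromy_field (j : ℕ) : D.monodromy ν Z w j (Z 0 (D.p 0)) =
    Z (cyclicIndex D.k j) (D.p (cyclicIndex D.k j)) := by
  induction j with
  | zero => rfl
  | succ j ih =>
    change (saltation _ _ _ ∘L w _ _ _) (D.monodromy ν Z w j (Z 0 (D.p 0))) = _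
    rw [ih]
    exact hD.saltation_linear_field _

/-- The differential of a transition map is the linearized flow projected to the tangent space along
the incoming field `a`. The saltation matrix replaces the component along `a` by the same multiple
of the outgoing field `b`, so both results differ by a multiple of `b`. As each step carries the
flow direction to the next one, induction shows that the monodromy and the differential of the
composition agree modulo the flow direction. -/
theorem hasFlowType_monodromy {Q : Fin (D.k + 1) → Space n → Space n}
    (hQ : ∀ i, D.IsTransitionMap i (Q i)) {s u : ℕ}
    (hP : IsHyperbolicFixedPoint S (composeAll Q) (D.p 0) s u) :
    HasFlowType (D.monodromy ν Z w (D.k + 1)) s u := by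
  set P : ℕ → Space n → Space n := fun j => Nat.rec id (fun j P => Q (cyclicIndex D.k j) ∘ P) j
    with hPdef
  have hPs : ∀ j, P (j + 1) = Q (cyclicIndex D.k j) ∘ P j := fun j => rfl
  have hPQ : composeAll Q = P (D.k + 1) := foldl_ofFn_comp P rfl _ _ fun j => by
    rw [hPs, cyclicIndex_eq j.2]
  have key : ∀ j, ∃ L : Space n →L[ℝ] Space n, HasFDerivWithinAt (P j) L S (D.p 0) ∧
      P j (D.p 0) = D.p (cyclicIndex D.k j) ∧
      Tendsto (P j) (𝓝[S] (D.p 0)) (𝓝[S] (D.p (cyclicIndex D.k j))) ∧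
      ∀ v, D.monodromy ν Z w j v - L v ∈
        ℝ ∙ Z (cyclicIndex D.k j) (D.p (cyclicIndex D.k j)) := by
    intro j
    induction j with
    | zero =>
      refine ⟨1, hasFDerivWithinAt_id _ _, rfl, tendsto_id, fun v => ?_⟩
      change v - v ∈ _
      rw [sub_self]
      exact Submodule.zero_mem _
    | succ j ih =>
      obtain ⟨L, hL, hPp, hPt, hmem⟩ := ih
      set i := cyclicIndex D.k j with hi
      have hQi := hQ i
      have hd := hD.hasFDerivWithinAt_transition i hQi
      rw [← hPp] at hd hPt
      refine ⟨_, hd.comp_of_tendsto (D.p 0) hL hPt, ?_, ?_, fun v => ?_⟩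
      · rw [hPs, Function.comp_apply, hPp]
        exact hQi.1
      · rw [hPp] at hPt
        exact (hD.tendsto_transition i hQi).comp hPt
      · rw [hPp]
        obtain ⟨a, ha⟩ := Submodule.mem_span_singleton.1 (hmem v)
        have h1 : D.monodromy ν Z w j v = L v + a • Z i (D.p i) := by rw [ha]; abel
        have h2 : D.monodromy ν Z w (j + 1) v =
          saltation (ν (i + 1)) (Z i (D.p (i + 1))) (Z (i + 1) (D.p (i + 1)))
            (w i (D.T i) (D.p i) (D.monodromy ν Z w j v)) := rfl
        rw [h2, h1, map_add, map_add, map_smul, map_smul, hD.saltation_linear_field i]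
        refine Submodule.mem_span_singleton.2 ⟨(ν (i + 1) (Z i (D.p (i + 1))))⁻¹ *
          ν (i + 1) (w i (D.T i) (D.p i) (L v)) + a, ?_⟩
        simp only [saltation, cyclicIndex, ← hi, ContinuousLinearMap.comp_apply, add_apply,
          sub_apply, ContinuousLinearMap.smulRight_apply, smul_apply,
          one_apply_eq_self, smul_eq_mul, smul_sub, smul_smul, add_smul]
        abel
  obtain ⟨L, hL, -, -, hmem⟩ := key (D.k + 1)
  have hfix := hD.monodromy_field (D.k + 1)
  rw [cyclicIndex_succ_self] at hmem hfix
  rw [hPQ] at hP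
  exact hP.hasFlowType (hD.isGates.gate 0).tangentSubspace_eq hL (hD.start_pos 0).ne' hfix
    fun v _ => hmem v

end IsModel

end SewingDecomposition

/-! ### Curves followed by the flows in the limit. -/

section Curves

variable {E ι : Type*} [NormedAddCommGroup E] [NormedSpace ℝ E] {l : Filter ι}
  {X : ι → E → E} {Φ : ι → ℝ → E → E} {W : ι → ℝ → E → E →L[ℝ] E} {C C' : ℝ → E} {a b c : ℝ}

/-- The flows follow, in the limit, the curve `C` on `[a, b]`. -/
def CurveReach (l : Filter ι) (Φ : ι → ℝ → E → E) (C : ℝ → E) (a b : ℝ) : Prop :=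
  ∀ s t, a ≤ s → s ≤ t → t ≤ b → C0Reach l Φ (C s) (t - s) (C t)

theorem CurveReach.glue (hF : ∀ i, IsFlow (X i) (Φ i) (W i)) (h : CurveReach l Φ C a b)
    (h' : CurveReach l Φ C' b c) (hCC' : C b = C' b) :
    CurveReach l Φ (fun t => if t ≤ b then C t else C' t) a c := by
  intro s t has hst htc
  simp only
  split_ifs with hs ht ht
  · exact h s t has hst ht
  · have h1 := h s b has hs le_rfl
    rw [hCC'] at h1
    have := h1.trans hF (h' b t le_rfl (not_le.1 ht).le htc)
    rwa [sub_add_sub_comm, add_comm b t, add_sub_add_right_eq_sub] at this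
  · exact (hs (hst.trans ht)).elim
  · exact h' s t (not_le.1 hs).le hst htc

omit [NormedSpace ℝ E] in
theorem CurveReach.shift (h : CurveReach l Φ C a b) (r : ℝ) :
    CurveReach l Φ (fun t => C (t - r)) (a + r) (b + r) := fun s t hs hst ht => by
  have := h (s - r) (t - r) (by linarith) (by linarith) (by linarith)
  rwa [sub_sub_sub_cancel_right] at this

end Curves

/-! ### The sewing orbit as a limit cycle of the regularizations. -/

namespace SewingDecomposition

variable {n : ℕ} {M S V γ : Set (Space n)} {X : Space n → Space n}

/-- The time at which the segment with cyclic index `j` starts. -/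
noncomputable def startTime (D : SewingDecomposition M S X γ) (j : ℕ) : ℝ :=
  ∑ l ∈ Finset.range j, D.T (cyclicIndex D.k l)

section StartTime

variable (D : SewingDecomposition M S X γ)

theorem startTime_zero : D.startTime 0 = 0 := Finset.sum_range_zero _

theorem startTime_succ (j : ℕ) :
    D.startTime (j + 1) = D.startTime j + D.T (cyclicIndex D.k j) := Finset.sum_range_succ _ _

theorem startTime_strictMono : StrictMono D.startTime := strictMono_nat_of_lt_succ fun j => by
  rw [startTime_succ]; linarith [D.period_pos (cyclicIndex D.k j)]

theorem exists_eq_startTime_add {θ : ℝ} : ∀ {j : ℕ}, θ ∈ Ico 0 (D.startTime j) →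
    ∃ l < j, ∃ s ∈ Ico 0 (D.T (cyclicIndex D.k l)), θ = D.startTime l + s
  | 0, h => by rw [startTime_zero] at h; exact absurd h.2 (not_lt.2 h.1)
  | j + 1, h => by
    rcases lt_or_ge θ (D.startTime j) with h1 | h1
    · obtain ⟨l, hl, h2⟩ := exists_eq_startTime_add (j := j) ⟨h.1, h1⟩
      exact ⟨l, by omega, h2⟩
    · have := h.2
      rw [startTime_succ] at this
      exact ⟨j, by omega, θ - D.startTime j, ⟨by linarith, by linarith⟩, by ring⟩

end StartTime

namespace IsModel

variable {D : SewingDecomposition M S X γ} {h : Fin (D.k + 1) → Space n → ℝ}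
  {ν : Fin (D.k + 1) → Space n →L[ℝ] ℝ} {B : Fin (D.k + 1) → Set (Space n)}
  {Z : Fin (D.k + 1) → Space n → Space n} {φ : Fin (D.k + 1) → ℝ → Space n → Space n}
  {w : Fin (D.k + 1) → ℝ → Space n → Space n →L[ℝ] Space n}
  {g : Space n → Space n} {K : ℝ} {m : Space n → ℝ} {Φ : ℝ → ℝ → Space n → Space n}
  {L : ℝ → ℝ → Space n → Space n →L[ℝ] Space n}
  (hD : D.IsModel V h ν B Z φ w) (hg : IsTruncation M S X γ V g K) (hS : volume S = 0)
  (hm : IsMollifier m) (i : Fin (D.k + 1))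
  (hΦ : ∀ ε, IsFlow (mollField m g ε) (Φ ε) (L ε))

include hD

theorem isOpen_region : IsOpen (V ∩ D.W i) := hD.isOpen_domain.inter (hD.isOpen_component i)

theorem flow_mem_region {t : ℝ} (ht : t ∈ Ioo 0 (D.T i)) : φ i t (D.p i) ∈ V ∩ D.W i :=
  ⟨hD.flow_mem_domain i ⟨ht.1.le, ht.2.le⟩, hD.flow_mem i ht⟩

include hg hS hm

theorem fieldTendsto {y : Space n} (hy : y ∈ V ∩ D.W i) :
    FieldTendsto (𝓝[>] 0) (mollField m g) (Z i) y :=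
  hg.fieldTendsto hS hm (hD.isFlow i).smooth (hD.hasCompactSupport i) (hD.isOpen_region i)
    inter_subset_left (fun x hx => by rw [hD.eqOn i hx.1.1, D.eqOn i hx.1.2]) hy

theorem exists_crossingField : ∃ K C a, CrossingField (mollField m g) (h (i + 1)) (ν (i + 1))
    (D.p (i + 1)) (Z (i + 1)) K C a :=
  hg.exists_crossingField hS hm (hD.isGates.gate (i + 1)) (hD.start_mem (i + 1))
    (hD.isFlow i).smooth (hD.hasCompactSupport i) (hD.isFlow (i + 1)).smooth
    (hD.hasCompactSupport (i + 1))
    (fun y hy hh => by rw [hD.eqOn i hy.1, hD.isGates.apply_eq_of_neg hy.2 hh])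
    (fun y hy hh => by rw [hD.eqOn (i + 1) hy.1, hD.isGates.apply_eq_of_pos hy.2 hh])
    (hD.finish_pos i) (hD.start_pos (i + 1))

include hΦ

/-- Departure from the locus is `c0Reach_exit` at the gate of `p i`, the interior is convergence of
fields, and arrival follows from the speed bound. -/
theorem curveReach : CurveReach (𝓝[>] 0) Φ (D.c i) 0 (D.T i) := by
  have hF := hD.isFlow i
  suffices hφ : CurveReach (𝓝[>] 0) Φ (fun t => φ i t (D.p i)) 0 (D.T i) by
    intro s t hs hst ht
    rw [hD.arc_eq i ⟨hs, hst.trans ht⟩, hD.arc_eq i ⟨hs.trans hst, ht⟩]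
    exact hφ s t hs hst ht
  have hinner : ∀ s t, 0 ≤ s → s ≤ t → t < D.T i →
      C0Reach (𝓝[>] 0) Φ (φ i s (D.p i)) (t - s) (φ i t (D.p i)) := by
    intro s t hs hst ht
    rcases hs.eq_or_lt with rfl | hs0
    · obtain ⟨K, C, a, hX⟩ := hD.exists_crossingField hg hS hm (i - 1)
      rw [sub_add_cancel] at hX
      rw [hF.zero, sub_zero]
      exact hX.c0Reach_exit hΦ hF (hD.isOpen_region i) (fun y => hD.fieldTendsto hg hS hm i)
        (fun r hr => hD.flow_mem_region i ⟨hr.1, hr.2.trans_lt ht⟩) t ⟨hst, le_rfl⟩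
    · have := (c1Reach_of_fieldTendsto hΦ hF (hD.isOpen_region i)
        (fun y => hD.fieldTendsto hg hS hm i) (x₀ := φ i s (D.p i)) (τ := t - s)
        (sub_nonneg.2 hst) fun r hr => by
          rw [← hF.add]
          exact hD.flow_mem_region i ⟨by linarith [hr.1], by linarith [hr.2]⟩).1
      rwa [← hF.add, sub_add_cancel] at this
  intro s t hs hst ht
  rcases ht.lt_or_eq with ht | rfl
  · exact hinner s t hs hst ht
  rcases hst.eq_or_lt with rfl | hst
  · rw [sub_self]; exact c0Reach_zero hΦ _
  have := c0Reach_of_forall_lt hΦ (hg.norm_mollField_le hm)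
    (c := fun r => φ i (r + s) (D.p i)) (x := φ i s (D.p i)) (τ := D.T i - s)
    ((hF.continuous_time _).comp (continuous_add_const s)).continuousWithinAt (sub_pos.2 hst)
    fun r hr0 hr => by
      have := hinner s (r + s) hs (by linarith) (by linarith)
      rwa [add_sub_cancel_right] at this
  rwa [sub_add_cancel] at this

/-- The limit curve, followed through the first `j + 1` segments. -/
theorem exists_curveReach (j : ℕ) : ∃ C : ℝ → Space n,
    CurveReach (𝓝[>] 0) Φ C 0 (D.startTime (j + 1)) ∧
    ∀ l ≤ j, ∀ s ∈ Icc 0 (D.T (cyclicIndex D.k l)),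
      C (D.startTime l + s) = D.c (cyclicIndex D.k l) s := by
  induction j with
  | zero =>
    refine ⟨D.c 0, ?_, fun l hl s _ => ?_⟩
    · rw [startTime_succ, startTime_zero, zero_add]
      exact hD.curveReach hg hS hm 0 hΦ
    · obtain rfl := Nat.le_zero.1 hl
      rw [startTime_zero, zero_add]
      rfl
  | succ j ih =>
    obtain ⟨C, hC, hCc⟩ := ih
    have h1 := (hD.curveReach hg hS hm (cyclicIndex D.k (j + 1)) hΦ).shift (D.startTime (j + 1))
    rw [zero_add, add_comm (D.T _), ← startTime_succ] at h1
    have hend : C (D.startTime (j + 1)) =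
        D.c (cyclicIndex D.k (j + 1)) (D.startTime (j + 1) - D.startTime (j + 1)) := by
      rw [sub_self, D.start, startTime_succ, hCc j le_rfl _ ⟨(D.period_pos _).le, le_rfl⟩, D.finish]
      rfl
    refine ⟨_, hC.glue hΦ h1 hend, fun l hl s hs => ?_⟩
    rcases hl.lt_or_eq with hl | rfl
    · have h2 : D.startTime l + s ≤ D.startTime (j + 1) := by
        have := D.startTime_strictMono.monotone (show l + 1 ≤ j + 1 by omega)
        rw [startTime_succ] at this
        linarith [hs.2]
      simp only [if_pos h2]
      exact hCc l (by omega) s hs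
    · rcases hs.1.eq_or_lt with rfl | hs0
      · simp only [add_zero, le_refl, if_true]
        rw [hend, sub_self]
      · have h2 : ¬ D.startTime (j + 1) + s ≤ D.startTime (j + 1) := by linarith
        simp only [if_neg h2, add_sub_cancel_left]

/-- Steps run between midpoints of consecutive segments, since derivatives of the flows converge
only at starting and end points off the locus. -/
theorem c1Reach_step : C1Reach (𝓝[>] 0) Φ L (φ i (D.T i / 2) (D.p i))
    (D.T i / 2 + D.T (i + 1) / 2) (φ (i + 1) (D.T (i + 1) / 2) (D.p (i + 1)))
    (w (i + 1) (D.T (i + 1) / 2) (D.p (i + 1)) ∘L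
      (saltation (ν (i + 1)) (Z i (D.p (i + 1))) (Z (i + 1) (D.p (i + 1))) ∘L
        w i (D.T i / 2) (φ i (D.T i / 2) (D.p i)))) := by
  obtain ⟨K, C, a, hX⟩ := hD.exists_crossingField hg hS hm i
  have hT := D.period_pos i
  have hT' := D.period_pos (i + 1)
  refine hX.c1Reach hΦ (hD.isFlow (i + 1)) (hD.isFlow i) (hD.finish_pos i).ne'
    (hD.isOpen_region (i + 1)) (fun y => hD.fieldTendsto hg hS hm (i + 1))
    (fun t ht => hD.flow_mem_region (i + 1) ⟨ht.1, by linarith [ht.2]⟩)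
    (hD.isOpen_region i) (fun y => hD.fieldTendsto hg hS hm i) (fun t ht => ?_)
    (half_pos hT) (half_pos hT') ?_
  · rw [← (hD.isFlow i).add]
    exact hD.flow_mem_region i ⟨by linarith [ht.1], by linarith [ht.2]⟩
  · rw [← (hD.isFlow i).add, add_halves, hD.flow_finish i]

/-- The limit is the monodromy conjugated to midpoints; the identity is multiplied by the linearized
flow along the first half segment to avoid an inverse. -/
theorem exists_c1Reach (j : ℕ) : ∃ A : Space n →L[ℝ] Space n,
    C1Reach (𝓝[>] 0) Φ L (φ 0 (D.T 0 / 2) (D.p 0))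
      (D.startTime j - D.T 0 / 2 + D.T (cyclicIndex D.k j) / 2)
      (φ (cyclicIndex D.k j) (D.T (cyclicIndex D.k j) / 2) (D.p (cyclicIndex D.k j))) A ∧
    A ∘L w 0 (D.T 0 / 2) (D.p 0) =
      w (cyclicIndex D.k j) (D.T (cyclicIndex D.k j) / 2) (D.p (cyclicIndex D.k j)) ∘L
        D.monodromy ν Z w j := by
  induction j with
  | zero =>
    refine ⟨1, ?_, ?_⟩
    · rw [startTime_zero]
      change C1Reach _ _ _ _ (0 - D.T 0 / 2 + D.T 0 / 2) (φ 0 (D.T 0 / 2) (D.p 0)) _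
      rw [sub_add_cancel]
      exact c1Reach_zero hΦ _
    · ext1 v; rfl
  | succ j ih =>
    obtain ⟨A, hA, hAw⟩ := ih
    set i := cyclicIndex D.k j with hi
    have h1 := hA.trans hΦ (hD.c1Reach_step hg hS hm i hΦ)
    have hlin := (hD.isFlow i).linear_add (D.T i / 2) (D.T i / 2) (D.p i)
    rw [add_halves] at hlin
    have e : D.startTime j - D.T 0 / 2 + D.T i / 2 + (D.T i / 2 + D.T (i + 1) / 2) =
        D.startTime (j + 1) - D.T 0 / 2 + D.T (cyclicIndex D.k (j + 1)) / 2 := by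
      rw [startTime_succ, ← hi, cyclicIndex, ← hi]
      ring
    rw [e] at h1
    refine ⟨_, h1, ?_⟩
    rw [ContinuousLinearMap.comp_assoc, hAw]
    change _ = w (i + 1) _ _ ∘L ((saltation _ _ _ ∘L w i (D.T i) (D.p i)) ∘L _)
    rw [hlin]
    simp only [ContinuousLinearMap.comp_assoc]
    rfl

/-- The limit cycle of the mollified fields given by a sewing-type periodic orbit. -/
theorem exists_limitCycle {s u : ℕ}
    (hmon : HasFlowType (D.monodromy ν Z w (D.k + 1)) s u) :
    ∃ (c : ℝ → Space n) (T : ℝ) (v : Space n) (A : Space n →L[ℝ] Space n),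
      LimitCycle (𝓝[>] 0) (mollField m g) Φ L c T K v A ∧ c '' Icc 0 T = γ ∧
        HasFlowType A s u := by
  -- The curve is followed through `k + 2` segments, the initial one twice, because the base point
  -- is moved to the midpoint of that segment, where the regularizations converge.
  obtain ⟨C, hC, hCc⟩ := hD.exists_curveReach hg hS hm hΦ (D.k + 1)
  obtain ⟨A, hA, hAw⟩ := hD.exists_c1Reach hg hS hm hΦ (D.k + 1)
  rw [startTime_succ, cyclicIndex_succ_self] at hC
  have hlast := hCc (D.k + 1) le_rfl
  rw [cyclicIndex_succ_self] at hA hAw hlast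
  set T := D.startTime (D.k + 1) with hT
  have hT0 := D.period_pos 0
  set δ := D.T 0 / 2 with hδ
  have hδ0 : 0 < δ := half_pos hT0
  have hδT : δ + δ = D.T 0 := add_halves _
  rw [sub_add_cancel] at hA
  have hF := hD.isFlow 0
  set b := φ 0 δ (D.p 0) with hb
  have hbc : D.c 0 δ = b := hD.arc_eq 0 ⟨hδ0.le, by linarith⟩
  have hbmem : b ∈ V ∩ D.W 0 := hD.flow_mem_region 0 ⟨hδ0, by linarith⟩
  have hTpos : 0 < T := by
    have := D.startTime_strictMono (Nat.succ_pos D.k)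
    rwa [startTime_zero] at this
  have hfirst : ∀ s ∈ Icc 0 (D.T 0), C s = D.c 0 s := fun s hs => by
    have := hCc 0 (Nat.zero_le _) s hs
    rwa [startTime_zero, zero_add] at this
  have hC0 : C δ = b := by rw [hfirst δ ⟨hδ0.le, by linarith⟩, hbc]
  have hCT : C (T + δ) = b := by rw [hlast δ ⟨hδ0.le, by linarith⟩, hbc]
  have hreach : ∀ s t, 0 ≤ s → s ≤ t → t ≤ T →
      C0Reach (𝓝[>] 0) Φ (C (s + δ)) (t - s) (C (t + δ)) := fun s t hs hst ht => by
    have := hC (s + δ) (t + δ) (by linarith) (by linarith) (by linarith)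
    rwa [add_sub_add_right_eq_sub] at this
  have hinv : w 0 (-δ) b ∘L w 0 δ (D.p 0) = 1 := by
    rw [← hF.linear_add, neg_add_cancel, hF.linear_zero]
  have hinv' : w 0 δ (D.p 0) ∘L w 0 (-δ) b = 1 := by
    have := hF.linear_add δ (-δ) b
    rwa [hb, hF.neg_apply, add_neg_cancel, hF.linear_zero, ← hb, eq_comm] at this
  have hcover : ∀ t ∈ Icc 0 T, ∃ l ≤ D.k + 1, ∃ s ∈ Ico 0 (D.T (cyclicIndex D.k l)),
      t + δ = D.startTime l + s := fun t ht => by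
    obtain ⟨l, hl, h1⟩ := D.exists_eq_startTime_add (θ := t + δ) (j := D.k + 2)
      ⟨by linarith [ht.1], by
        rw [startTime_succ, cyclicIndex_succ_self, ← hT]; linarith [ht.2]⟩
    exact ⟨l, by omega, h1⟩
  refine ⟨fun t => C (t + δ), T, Z 0 b, A, ⟨hΦ, hg.norm_mollField_le hm, hTpos, ?_, ?_, ?_, ?_, ?_,
    ?_⟩, ?_, ?_⟩
  · simp only [zero_add, hC0]
    exact (hD.fieldTendsto hg hS hm 0 hbmem).1
  · intro h0
    have h1 := hF.linear_field (-δ) b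
    rw [h0, map_zero, hb, hF.neg_apply] at h1
    have h2 := hD.start_pos 0
    rw [← h1, map_zero] at h2
    exact lt_irrefl _ h2
  · simp only [zero_add, hC0]
    exact hA.tendsto_flow hΦ hF (hD.isOpen_region 0) (fun y => hD.fieldTendsto hg hS hm 0) hbmem
  · intro t ht
    have := hreach 0 t le_rfl ht.1 ht.2
    rwa [sub_zero] at this
  · intro t ht
    have := hreach t T ht.1 ht.2 le_rfl
    rw [hCT] at this
    simpa only [zero_add, hC0] using this
  · intro t ht h0
    simp only [zero_add, hC0] at h0
    obtain ⟨l, hl, s, hs, hts⟩ := hcover t ⟨ht.1.le, ht.2.le⟩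
    rw [hts, hCc l hl s ⟨hs.1, hs.2.le⟩, ← hbc] at h0
    obtain ⟨h1, rfl⟩ := D.simple _ _ s hs δ ⟨hδ0.le, by linarith⟩ h0
    rcases hl.lt_or_eq with hl | rfl
    · have h2 := val_cyclicIndex hl
      rw [h1] at h2
      obtain rfl : 0 = l := h2
      rw [startTime_zero] at hts
      linarith [ht.1]
    · linarith [ht.2]
  · refine Subset.antisymm ?_ fun q hq => ?_
    · rintro _ ⟨t, ht, rfl⟩
      obtain ⟨l, hl, s, hs, hts⟩ := hcover t ht
      simp only [hts]
      rw [hCc l hl s ⟨hs.1, hs.2.le⟩]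
      exact D.eq_union.ge (mem_iUnion.2 ⟨_, s, ⟨hs.1, hs.2.le⟩, rfl⟩)
    · obtain ⟨i, s, hs, rfl⟩ := mem_iUnion.1 (D.eq_union.le hq)
      have hi : cyclicIndex D.k i = i := cyclicIndex_eq i.2
      have hval := hCc i i.2.le
      rw [hi] at hval
      have hle : D.startTime i + s ≤ T := by
        have := D.startTime_strictMono.monotone (show (i : ℕ) + 1 ≤ D.k + 1 from i.2)
        rw [startTime_succ, hi] at this
        linarith [hs.2]
      rcases le_or_gt δ (D.startTime i + s) with h1 | h1
      · refine ⟨D.startTime i + s - δ, ⟨by linarith, by linarith⟩, ?_⟩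
        simp only [sub_add_cancel]
        exact hval s hs
      -- Points before the base point lie on the first half of segment `0`, which is traversed at
      -- the end of the period, as segment `k + 1`.
      · have h0 : (i : ℕ) = 0 := by
          by_contra hne
          have := D.startTime_strictMono.monotone (show 1 ≤ (i : ℕ) by omega)
          rw [startTime_succ, startTime_zero] at this
          change 0 + D.T 0 ≤ _ at this
          linarith [hs.1]
        obtain rfl : i = 0 := Fin.ext h0
        change D.startTime 0 + s < δ at h1
        rw [startTime_zero] at h1
        refine ⟨T + s - δ, ⟨?_, by linarith⟩, ?_⟩
        · have := D.startTime_strictMono.monotone (show 1 ≤ D.k + 1 by omega)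
          rw [startTime_succ, startTime_zero] at this
          change 0 + D.T 0 ≤ _ at this
          linarith [hs.1]
        · simp only [sub_add_cancel]
          exact hlast s hs
  -- `A` is conjugate to the monodromy based at `p 0` by the linearized flow along the first half
  -- segment, so the type is the same.
  · have e : A = w 0 δ (D.p 0) ∘L (D.monodromy ν Z w (D.k + 1) ∘L w 0 (-δ) b) := by
      rw [← ContinuousLinearMap.comp_assoc, ← hAw, ContinuousLinearMap.comp_assoc, hinv']
      ext1 v; rfl
    rw [e]
    refine HasFlowType.comp_comm ?_
    rw [ContinuousLinearMap.comp_assoc, hinv]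
    exact hmon

end IsModel

end SewingDecomposition

theorem mainTheorem5 (n : ℕ) (M S : Set (Space n)) (hM : IsOpen M) (hS : IsNormalCrossings M S)
    (X : Space n → Space n) (hX : IsPiecewiseSmooth M S X)
    (m : Space n → ℝ) (hm : IsMollifier m)
    (s u : ℕ) (γ : Set (Space n)) (hγ : IsHyperbolicSewingOrbit M S X s u γ) :
    ∃ U : Set (Space n), IsOpen U ∧ γ ⊆ U ∧ U ⊆ M ∧
    ∃ E : Set ℝ≥0, E ∈ 𝓝 (0 : ℝ≥0) ∧
    ∃ Γ : ℝ≥0 → Set (Space n),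
      (∀ ε ∈ E, ε ≠ 0 →
        ContDiffOn ℝ ∞ (regularize M m X ε) U ∧
        (IsHyperbolicPeriodicOrbit (regularize M m X ε) s u (Γ ε) ∧ Γ ε ⊆ U) ∧
        ∀ γ' : Set (Space n),
          IsHyperbolicPeriodicOrbit (regularize M m X ε) s u γ' → γ' ⊆ U → γ' = Γ ε) ∧
      Tendsto (fun ε : ℝ≥0 => Metric.hausdorffEDist (Γ ε) γ) (𝓝[≠] 0) (𝓝 0) := by
  have hMS := hS.isOpen_diff hM
  rcases hγ with ⟨hγM, hγ⟩ | ⟨D, Q, hQ, hP⟩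
  · exact hγ.exists_of_regularize hM hS hX hm hγM
  · obtain ⟨h, ν, B, hB⟩ := D.exists_isGates hM
    obtain ⟨V, g, C, hg⟩ := hB.exists_isTruncation hM hMS hX
    obtain ⟨Z, φ, w, hD⟩ := hB.exists_isModel hM hMS hg
    obtain ⟨Φ, L, hΦ⟩ := hg.exists_isFlow hm
    obtain ⟨c, T, v, A, hc, hcγ, hA⟩ := hD.exists_limitCycle hg hS.volume_eq_zero hm hΦ
      (hD.hasFlowType_monodromy hQ hP)
    exact hg.exists_hyperbolic_orbits hS.volume_eq_zero hm hc hcγ hA
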